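/- **Setting.** Let $\mu$ be a $\sigma$-finite Borel measure on $\mathbb R$, $A=\inf\operatorname{supp}\mu$, $B=\sup\operatorname{supp}\mu$, let $\Theta^\circ$ be the interior of $\{\theta:\int e^{\theta x}\,d\mu(x)<\infty\}$, $\psi(\theta)=\log\int e^{\theta x}\,d\mu(x)$, and for $\theta\in\Theta^\circ$ let $\mu_\theta$ be the tilted probability measure $d\mu_\theta/d\mu(x)=e^{\theta x-\psi(\theta)}$, whose mean is $\psi'(\theta)$. For $\delta>0$ put $A_\delta=\max(A+\delta,-1/\delta)$ and $B_\delta=\min(B-\delta,1/\delta)$. An MLE for an $m\times n$ margin $(\mathbf r,\mathbf c)$ is a maximizer of $\langle\mathbf r,\boldsymbol\alpha\rangle+\langle\mathbf c,\boldsymbol\beta\rangle-\sum_{i,j}\psi(\boldsymbol\alpha(i)+\boldsymbol\beta(j))$ over all $(\boldsymbol\alpha,\boldsymbol\beta)$ with $\boldsymbol\alpha(i)+\boldsymbol\beta(j)\in\Theta^\circ$ for all $i,j$; the margin is $\delta$-tame if $A_\delta\le\psi'(\boldsymbol\alpha(i)+\boldsymbol\beta(j))\le B_\delta$ for all $i,j$.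 The typical table of $(\mathbf r,\mathbf c)$ is the minimizer, with finite value, of $\sum_{i,j}D(z_{ij})$ over real matrices $(z_{ij})$ with row sums $\mathbf r$ and column sums $\mathbf c$, where $D(z)=\theta z-\psi(\theta)$ if $z=\psi'(\theta)$ with $\theta\in\Theta^\circ$, and $D(z)=\infty$ if there is no such $\theta$. For an $m\times n$ margin $(\mathbf r,\mathbf c)$ let $\lambda_{\mathbf r,\mathbf c}$ be the law of $X\sim\mu^{\otimes(m\times n)}$ conditioned on having row sums exactly $\mathbf r$ and column sums exactly $\mathbf c$: if the set $\mathcal T(\mathbf r,\mathbf c)$ of matrices with this margin has $\mu^{\otimes(m\times n)}$-measure in $(0,\infty)$, it is the normalized restriction to $\mathcal T(\mathbf r,\mathbf c)$; if $\mu$ has a Lebesgue density $p$, it is the probability measure on $\mathcal T(\mathbf r,\mathbf c)$ whose density is proportional to $\prod_{i,j}p(x_{ij})$ with respect to Lebesgue measure in the coordinates $(x_{ij})_{i<m,\,j<n}$. Let $(\mathbf r_0,\mathbf c_0)$ be a fixed real $m_0\times n_0$ margin ($m_0,n_0\ge1$) with an MLE $(\boldsymbol\alpha_0,\boldsymbol\beta_0)$,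 and let $\delta>0$ be such that it is $\delta$-tame. Its $k$-cloning is the $km_0\times kn_0$ margin $(k\,\mathbf r_0\otimes\mathbf 1_k,\;k\,\mathbf c_0\otimes\mathbf 1_k)$; let $X\sim\lambda$ be the exactly conditioned matrix for this margin and let $\xi^{(k)}_{11}$ be the law of $X_{11}$. When $\mu$ lives on $\mathbb Z$, only those $k$ are considered for which $k\mathbf r_0$ and $k\mathbf c_0$ are integer vectors (all $k$, if $\mathbf r_0,\mathbf c_0$ are integer). **Theorem.** 0. If $\mu$ has a density with respect to counting measure on $\mathbb Z$ or Lebesgue measure on $\mathbb R$, then for all $m,n\ge1$ the family $(\lambda_{\mathbf r,\mathbf c})$ is a regular conditional distribution of $\mu^{\otimes(m\times n)}$ given the margin (a disintegration of $\mu^{\otimes(m\times n)}$ along the map $\mathbf x\mapsto$ margin of $\mathbf x$ into probability measures carried by the fibers, for almost every margin under the image of $\mu^{\otimes(m\times n)}$). 1. Suppose $\mu$ has a density with respect to $\zeta$, where $\zeta$ is counting measure on $\mathbb Z$ or Lebesgue measure on $\mathbb R$; that $\operatorname{supp}\mu=[A,B]\cap\operatorname{supp}\zeta$; and that the densities $d\mu_\theta/d\zeta$,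 for $\theta\in\Theta^\circ$ with $A_\delta\le\psi'(\theta)\le B_\delta$, are bounded by a common constant. Then, as $k\to\infty$, $\xi^{(k)}_{11}$ is eventually a well-defined probability measure, it converges in total variation to $\mu_{\boldsymbol\alpha_0(1)+\boldsymbol\beta_0(1)}$, and $$d_{TV}\big(\xi^{(k)}_{11},\,\mu_{\boldsymbol\alpha_0(1)+\boldsymbol\beta_0(1)}\big)=O\big(k^{-1/4}\log k\big).$$ 2. If $\mu$ is counting measure on $\{0,1,\dots,b\}$ with $b\in\{0,1,2,\dots\}\cup\{\infty\}$, or Lebesgue measure on $[0,\infty)$, the same holds with $O\big(k^{-1/2}\sqrt{\log k}\big)$ in place of $O(k^{-1/4}\log k)$. 3. (Barvinok's conjecture.) If $\mu$ is counting measure on $\{0,1\}$ (resp. on $\mathbb Z_{\ge0}$), then $(\mathbf r_0,\mathbf c_0)$ has exactly one typical table $Z$, and $\xi^{(k)}_{11}$ converges in total variation, with rate $O(k^{-1/2}\sqrt{\log k})$, to the Bernoulli law (resp. the geometric law on $\{0,1,2,\dots\}$) with mean $Z_{11}$. 4. (Chatterjee–Diaconis–Sly.) If $D^{(k)}$ is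 a uniformly random $k\times k$ doubly stochastic matrix, then the law of $kD^{(k)}_{11}$ converges in total variation to the exponential law with mean $1$, with rate $O(k^{-1/2}\sqrt{\log k})$. -/

import Mathlib

open MeasureTheory ProbabilityTheory Filter Topology Asymptotics
open scoped ENNReal NNReal

namespace MarginCond

noncomputable section

/-! ### Exponential tilting of a base measure on the line -/

/-- The interior of the set of tilt parameters `θ` with `∫ exp (θ x) dμ(x) < ∞`. -/
def tiltDomain (μ : Measure ℝ) : Set ℝ := interior (integrableExpSet id μ)

/-- The log-partition function `ψ(θ) = log ∫ exp (θ x) dμ(x)`. -/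
def logPartition (μ : Measure ℝ) : ℝ → ℝ := cgf id μ

/-- The mean `ψ'(θ)` of the tilted measure. -/
def tiltMean (μ : Measure ℝ) (θ : ℝ) : ℝ := deriv (logPartition μ) θ

/-- The exponential tilt `dμ_θ/dμ (x) = exp (θ x - ψ(θ))`. -/
def tilt (μ : Measure ℝ) (θ : ℝ) : Measure ℝ :=
  μ.tilted fun x => θ * x

/-- `A = inf supp μ`. -/
def lowerEnd (μ : Measure ℝ) : EReal := sInf ((fun x : ℝ => (x : EReal)) '' μ.support)

/-- `B = sup supp μ`. -/
def upperEnd (μ : Measure ℝ) : EReal := sSup ((fun x : ℝ => (x : EReal)) '' μ.support)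

/-- The mean value `z` lies in `[A_δ, B_δ]`, where
`A_δ = max (A + δ) (-1/δ)` and `B_δ = min (B - δ) (1/δ)`. -/
def InTameRange (μ : Measure ℝ) (δ z : ℝ) : Prop :=
  max (lowerEnd μ + (δ : EReal)) ((-(1 / δ) : ℝ) : EReal) ≤ (z : EReal) ∧
    (z : EReal) ≤ min (upperEnd μ - (δ : EReal)) ((1 / δ : ℝ) : EReal)

/-! ### Margins, maximum likelihood, typical tables, cloning -/

/-- The `m × n` matrices with row sums `r` and column sums `c`. -/
def marginFiber {m n : ℕ} (r : Fin m → ℝ) (c : Fin n → ℝ) : Set (Fin m → Fin n → ℝ) :=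
  {x | (∀ i, ∑ j, x i j = r i) ∧ ∀ j, ∑ i, x i j = c j}

/-- The margin (row sums, column sums) of a matrix. -/
def marginMap {m n : ℕ} (x : Fin m → Fin n → ℝ) : (Fin m → ℝ) × (Fin n → ℝ) :=
  (fun i => ∑ j, x i j, fun j => ∑ i, x i j)

/-- The log-likelihood `⟨r, α⟩ + ⟨c, β⟩ - ∑ ψ(α i + β j)`. -/
def logLikelihood (μ : Measure ℝ) {m n : ℕ} (r : Fin m → ℝ) (c : Fin n → ℝ)
    (α : Fin m → ℝ) (β : Fin n → ℝ) : ℝ :=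
  ∑ i, r i * α i + ∑ j, c j * β j - ∑ i, ∑ j, logPartition μ (α i + β j)

/-- `(α, β)` is an MLE for the margin `(r, c)`: it maximizes the log-likelihood among all
admissible parameters. -/
def IsMLE (μ : Measure ℝ) {m n : ℕ} (r : Fin m → ℝ) (c : Fin n → ℝ)
    (α : Fin m → ℝ) (β : Fin n → ℝ) : Prop :=
  (∀ i j, α i + β j ∈ tiltDomain μ) ∧
    ∀ (α' : Fin m → ℝ) (β' : Fin n → ℝ), (∀ i j, α' i + β' j ∈ tiltDomain μ) →
      logLikelihood μ r c α' β' ≤ logLikelihood μ r c α β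

/-- The relative entropy `D(μ_θ ‖ μ) = θ ψ'(θ) - ψ(θ)` of the tilt with mean `z`, that is, with
`ψ'(θ) = z`; it is `⊤` if no tilt parameter has mean `z`. -/
def meanEntropy (μ : Measure ℝ) (z : ℝ) : EReal :=
  ⨅ θ : {θ : ℝ // θ ∈ tiltDomain μ ∧ tiltMean μ θ = z},
    (((θ : ℝ) * z - logPartition μ θ : ℝ) : EReal)

/-- `Z` is a typical table for the margin `(r, c)`: a minimizer, with finite value, of the total
relative entropy over all matrices with margin `(r, c)`. -/
def IsTypicalTable (μ : Measure ℝ) {m n : ℕ} (r : Fin m → ℝ) (c : Fin n → ℝ)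
    (Z : Fin m → Fin n → ℝ) : Prop :=
  Z ∈ marginFiber r c ∧ ∑ i, ∑ j, meanEntropy μ (Z i j) ≠ ⊤ ∧
    ∀ Z' ∈ marginFiber r c,
      ∑ i, ∑ j, meanEntropy μ (Z i j) ≤ ∑ i, ∑ j, meanEntropy μ (Z' i j)

/-- The vector `k v ⊗ 1_k`: each entry of `k v` is repeated `k` times. The `k`-cloning of a
margin `(r, c)` is `(clone k r, clone k c)`. -/
def clone (k : ℕ) {m : ℕ} (v : Fin m → ℝ) : Fin (m * k) → ℝ := fun i => k * v i.divNat

/-! ### The margin-conditioned random matrix -/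

/-- The product measure `μ^{⊗ (m × n)}` on `m × n` matrices. -/
def baseModel (μ : Measure ℝ) (m n : ℕ) : Measure (Fin m → Fin n → ℝ) :=
  Measure.pi fun _ => Measure.pi fun _ => μ

/-- The completion map: the `m × n` matrix with margin `(r, c)` and with given entries outside of
the last row and the last column. -/
def completion {m n : ℕ} (r : Fin m → ℝ) (c : Fin n → ℝ)
    (y : Fin (m - 1) → Fin (n - 1) → ℝ) : Fin m → Fin n → ℝ := fun i j =>
  if hi : (i : ℕ) < m - 1 then
    if hj : (j : ℕ) < n - 1 then y ⟨i, hi⟩ ⟨j, hj⟩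
    else r i - ∑ j', y ⟨i, hi⟩ j'
  else
    if hj : (j : ℕ) < n - 1 then c j - ∑ i', y i' ⟨j, hj⟩
    else ∑ i', ∑ j', y i' j' - ∑ i' : Fin (m - 1), r (Fin.castLE (Nat.sub_le m 1) i') + c j

/-- For `μ` with Lebesgue density `p`: the measure `∏ p(x i j)` on the matrices `x` with margin
`(r, c)`, these being parametrized (through `completion`) by their entries outside of the last row
and the last column, with Lebesgue measure there. -/
def fiberMeasure (μ : Measure ℝ) {m n : ℕ} (r : Fin m → ℝ) (c : Fin n → ℝ) :
    Measure (Fin m → Fin n → ℝ) :=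
  ((volume : Measure (Fin (m - 1) → Fin (n - 1) → ℝ)).withDensity fun y =>
    ∏ i, ∏ j, μ.rnDeriv volume (completion r c y i j)).map (completion r c)

open Classical in
/-- The law of the random matrix `X ∼ μ^{⊗ (m × n)}` conditioned on having margin exactly `(r, c)`.
If the set of matrices with this margin has measure in `(0, ∞)`, it is the normalized restriction
to that set. Otherwise (as for `μ` with a Lebesgue density) it is the normalization of
`fiberMeasure`. -/
def condLaw (μ : Measure ℝ) {m n : ℕ} (r : Fin m → ℝ) (c : Fin n → ℝ) :
    Measure (Fin m → Fin n → ℝ) :=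
  if baseModel μ m n (marginFiber r c) ≠ 0 ∧ baseModel μ m n (marginFiber r c) ≠ ∞ then
    cond (baseModel μ m n) (marginFiber r c)
  else (fiberMeasure μ r c Set.univ)⁻¹ • fiberMeasure μ r c

/-- `Λ` disintegrates the base model along the margin map into probability measures: it is a
regular conditional distribution of the base model given the margin. -/
def IsMarginDisintegration (μ : Measure ℝ) (m n : ℕ)
    (Λ : (Fin m → ℝ) × (Fin n → ℝ) → Measure (Fin m → Fin n → ℝ)) : Prop :=
  (∀ᵐ t ∂(baseModel μ m n).map marginMap,
      IsProbabilityMeasure (Λ t) ∧ Λ t {x | marginMap x ≠ t} = 0) ∧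
    (∀ E : Set (Fin m → Fin n → ℝ), MeasurableSet E → Measurable fun t => Λ t E) ∧
    ∀ h : (Fin m → Fin n → ℝ) → ℝ≥0∞, Measurable h →
      ∫⁻ x, h x ∂baseModel μ m n = ∫⁻ t, ∫⁻ x, h x ∂Λ t ∂(baseModel μ m n).map marginMap

/-- The `(1,1)` entry of a matrix (`0` for an empty matrix). -/
def corner {m n : ℕ} (x : Fin m → Fin n → ℝ) : ℝ :=
  if h : 0 < m ∧ 0 < n then x ⟨0, h.1⟩ ⟨0, h.2⟩ else 0

/-- The law of the `(1,1)` entry of the exactly conditioned matrix for the `k`-cloning of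
`(r₀, c₀)`. -/
def cornerLaw (μ : Measure ℝ) {m₀ n₀ : ℕ} (r₀ : Fin m₀ → ℝ) (c₀ : Fin n₀ → ℝ) (k : ℕ) :
    Measure ℝ :=
  (condLaw μ (clone k r₀) (clone k c₀)).map corner

/-- Total variation distance between probability measures. -/
def tvDist (P Q : Measure ℝ) : ℝ :=
  ⨆ S : {S : Set ℝ // MeasurableSet S}, |P.real S - Q.real S|

/-! ### Base measures -/

/-- Counting measure on `ℤ`, as a measure on `ℝ`. -/
def intCount : Measure ℝ := Measure.map (fun z : ℤ => (z : ℝ)) Measure.count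

/-- Counting measure on `{0, 1, …, b}`, or on `ℕ` if `b = ⊤`, as a measure on `ℝ`. -/
def countUpTo (b : ℕ∞) : Measure ℝ :=
  Measure.map (fun j : ℕ => (j : ℝ)) (Measure.count.restrict {j : ℕ | (j : ℕ∞) ≤ b})

/-- Lebesgue measure on `[0, ∞)`. -/
def lebNonneg : Measure ℝ := volume.restrict (Set.Ici 0)

/-- `μ` has a density with respect to `ζ`, has full support `[A, B] ∩ supp ζ`, and the densities of
its tilts with means in `[A_δ, B_δ]` are uniformly bounded. -/
def HasTameDensity (μ ζ : Measure ℝ) (δ : ℝ) : Prop :=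
  μ ≪ ζ ∧
    μ.support = {x : ℝ | lowerEnd μ ≤ (x : EReal) ∧ (x : EReal) ≤ upperEnd μ} ∩ ζ.support ∧
    ∃ M : ℝ≥0, ∀ θ ∈ tiltDomain μ, InTameRange μ δ (tiltMean μ θ) →
      ∀ᵐ x ∂ζ, (tilt μ θ).rnDeriv ζ x ≤ M

/-- The filter `k → ∞` through those `k` for which the `k`-cloning of `(r₀, c₀)` is integral. -/
def atTopIntegral {m₀ n₀ : ℕ} (r₀ : Fin m₀ → ℝ) (c₀ : Fin n₀ → ℝ) : Filter ℕ :=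
  atTop ⊓ 𝓟 {k | (∀ i, ∃ z : ℤ, (k : ℝ) * r₀ i = z) ∧ ∀ j, ∃ z : ℤ, (k : ℝ) * c₀ j = z}

/-- Bernoulli law with mean `z`. -/
def bernoulliLaw (z : ℝ) : Measure ℝ :=
  ENNReal.ofReal (1 - z) • Measure.dirac 0 + ENNReal.ofReal z • Measure.dirac 1

/-- Geometric law on `{0, 1, 2, …}` with mean `z`. -/
def geometricLaw (z : ℝ) : Measure ℝ :=
  Measure.sum fun j : ℕ =>
    ENNReal.ofReal (1 / (1 + z) * (z / (1 + z)) ^ j) • Measure.dirac (j : ℝ)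

/-- The rate `k^{-1/4} log k`. -/
def slowRate (k : ℕ) : ℝ := (k : ℝ) ^ (-(1 / 4) : ℝ) * Real.log k

/-- The rate `k^{-1/2} √(log k)`. -/
def fastRate (k : ℕ) : ℝ := (k : ℝ) ^ (-(1 / 2) : ℝ) * √(Real.log k)

/-- Along `l`, the laws `P k` are eventually probability measures, they converge to `Q` in total
variation, and the total variation distance is `O(rate k)`. -/
def ConvergesTV (P : ℕ → Measure ℝ) (Q : Measure ℝ) (l : Filter ℕ) (rate : ℕ → ℝ) : Prop :=
  (∀ᶠ k in l, IsProbabilityMeasure (P k)) ∧ Tendsto (fun k => tvDist (P k) Q) l (𝓝 0) ∧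
    (fun k => tvDist (P k) Q) =O[l] rate

end

end MarginCond

open MarginCond

namespace MarginCond

/-! ### Finite products of measures -/

/-! On a fiber of the margin map, multiplying the density of the entry `(i, j)` by `exp ((α i + β j)
x - ψ)` changes the product density by a constant only (`prodWt_tiltDens`). So the conditioned
matrix may be taken to come from independent entries with the tilted laws, and by the likelihood
equations (`IsMLE.sum_row`, `IsMLE.sum_col`) the prescribed margin is the mean margin of that model.
Let `Φ` be the density of the margin of the tilted model at the cloned margin, that is, the integral
`fibInt` over the fiber, parametrized by the entries off the last row and column.

The comparison with independence is soft. The entries of the last row and column are functions of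
the others and have densities at most `M`, so an event about the other entries has conditional
probability at most `M ^ O(k) / Φ` times its probability under independence
(`IsLattice.fibInt_indicator_le`). This is applied to the event that the frequency of a set `S` in
the block of about `k ^ 2` cells containing the corner deviates by `t` from its tilted probability,
which under independence has probability `exp (-Ω(t ^ 2 k ^ 2))`. Under conditioning these cells are
exchangeable, so the mean frequency is the probability that the corner lies in `S`. Hence a lower
bound `Φ ≥ exp (-e)` with `e ≥ k` gives total variation distance `O(√e / k)`
(`IsLattice.tv_corner_le`), and everything reduces to lower bounds for `Φ`.

For general densities, `e` is of order `k ^ (3/2) log ^ 2 k` (`exists_slow_lower_bound`). All but a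
band of about `√k log k` rows and columns are sampled freely; with probability at least `1/2` their
line sums and total deviate by no more than the band can absorb, and the band is then filled
deterministically with values near a grid on which the densities are bounded below (`exists_fill`).
The band has `O(k ^ (3/2) log k)` cells, each costing a power of `k`. For a merely measurable
density on the line no interval with a lower bound need exist; there the grid consists of two
Lebesgue density points, and averaging over translations along the fiber by rank one matrices
repairs the missing points (`le_fibInt_rect`).

For the indicator of an interval, `e` is of order `k log k`. The volume of a fiber is then Schur
concave in the row sums and in the column sums: with all rows but two fixed, it is a convolution of
symmetric intervals, hence symmetric and unimodal (`SymmUnimodal.conv`,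
`IsLattice.fibInt_le_of_rows`). So an event given by block sums of the matrix has probability at
most the largest density at a block-averaged margin times the volume of the possible margins, which
is only `exp (O(k log k))` (`IsLattice.withDensity_le_of_blocks`). It remains to find such an event
of probability `exp (-O(k))`: on the integers, exact values of the block sums (`le_pi_block_sums`);
on the half-line, block sums within `O(k)` of their means, combined with a scaling argument
(`pow_mul_fibInt_le`).

The typical table is the matrix of tilted means by the equality case of the Fenchel–Young inequality
(`IsMLE.isTypicalTable`), and doubly stochastic matrices are a rescaled cloning of the `1 × 1`
margin `(1)`. -/

theorem lintegral_fin_prod {n : ℕ} (μ : Fin n → Measure ℝ) [∀ i, SigmaFinite (μ i)]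
    (f : Fin n → ℝ → ℝ≥0∞) (hf : ∀ i, Measurable (f i)) :
    ∫⁻ x, ∏ i, f i (x i) ∂Measure.pi μ = ∏ i, ∫⁻ t, f i t ∂μ i := by
  induction n with
  | zero => simp
  | succ n ih =>
    rw [← ((measurePreserving_piFinSuccAbove μ 0).symm).lintegral_comp_emb
      (MeasurableEquiv.measurableEmbedding _)]
    simp only [MeasurableEquiv.piFinSuccAbove_symm_apply, Fin.insertNthEquiv, Fin.prod_univ_succ,
      Fin.insertNth_zero, Equiv.coe_fn_mk, Fin.cons_zero, Fin.cons_succ, Fin.zero_succAbove, cast_eq]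
    rw [lintegral_prod_mul (f := f 0)
      (g := fun x : Fin n → ℝ => ∏ i, f i.succ (x i)) (hf 0).aemeasurable
      (Finset.measurable_prod _ fun i _ => (hf i.succ).comp (measurable_pi_apply i)).aemeasurable,
      ih _ _ fun i => hf i.succ]

theorem lintegral_pi_prod {ι : Type*} [Fintype ι] (μ : ι → Measure ℝ) [∀ i, SigmaFinite (μ i)]
    (f : ι → ℝ → ℝ≥0∞) (hf : ∀ i, Measurable (f i)) :
    ∫⁻ x, ∏ i, f i (x i) ∂Measure.pi μ = ∏ i, ∫⁻ t, f i t ∂μ i := by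
  let e := (Fintype.equivFin ι).symm
  rw [← (measurePreserving_piCongrLeft μ e).lintegral_comp_emb
    (MeasurableEquiv.measurableEmbedding _), ← e.prod_comp,
    ← lintegral_fin_prod (fun i => μ (e i)) (fun i => f (e i)) fun i => hf _]
  refine lintegral_congr fun x => ?_
  rw [← e.prod_comp]
  refine Finset.prod_congr rfl fun i _ => ?_
  congr 1
  exact Equiv.piCongrLeft_apply_apply (P := fun _ : ι => ℝ) e x i

theorem pi_withDensity {ι : Type*} [Fintype ι] (μ : ι → Measure ℝ) [∀ i, SigmaFinite (μ i)]
    (f : ι → ℝ → ℝ≥0∞) (hf : ∀ i, Measurable (f i))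
    [∀ i, SigmaFinite ((μ i).withDensity (f i))] :
    Measure.pi (fun i => (μ i).withDensity (f i)) =
      (Measure.pi μ).withDensity fun x => ∏ i, f i (x i) := by
  refine Measure.pi_eq fun s hs => ?_
  rw [withDensity_apply _ (MeasurableSet.univ_pi hs), ← lintegral_indicator
    (MeasurableSet.univ_pi hs)]
  have : ∀ x : ι → ℝ, (Set.univ.pi s).indicator (fun x => ∏ i, f i (x i)) x =
      ∏ i, (s i).indicator (f i) (x i) := by
    intro x
    by_cases hx : x ∈ Set.univ.pi s
    · rw [Set.indicator_of_mem hx]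
      exact Finset.prod_congr rfl fun i _ => (Set.indicator_of_mem (hx i trivial) _).symm
    · rw [Set.indicator_of_notMem hx]
      simp only [Set.mem_pi, Set.mem_univ, forall_const, not_forall] at hx
      obtain ⟨i, hi⟩ := hx
      exact (Finset.prod_eq_zero (Finset.mem_univ i) (Set.indicator_of_notMem hi _)).symm
  simp_rw [this]
  rw [lintegral_pi_prod μ _ fun i => (hf i).indicator (hs i)]
  refine Finset.prod_congr rfl fun i _ => ?_
  rw [lintegral_indicator (hs i), withDensity_apply _ (hs i)]

/-- Concentration bounds treat the cells of a matrix as one independent family indexed by pairs,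
whereas matrices are curried functions; this passes between the two. Boxes whose sides are
themselves boxes generate the iterated product, so it suffices to compare the measures on them. -/
theorem measurePreserving_curry {ι κ : Type*} [Fintype ι] [Fintype κ]
    (μ : ι → κ → Measure ℝ) [∀ i j, SigmaFinite (μ i j)] :
    MeasurePreserving (MeasurableEquiv.curry ι κ ℝ)
      (Measure.pi fun e : ι × κ => μ e.1 e.2)
      (Measure.pi fun i => Measure.pi fun j => μ i j) := by
  refine ⟨(MeasurableEquiv.curry ι κ ℝ).measurable, ?_⟩
  symm
  refine Measure.pi_eq_generateFrom
    (C := fun _ => Set.univ.pi '' Set.univ.pi fun _ => {s : Set ℝ | MeasurableSet s})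
    (fun i => generateFrom_pi) (fun i => isPiSystem_pi)
    (fun i => Measure.FiniteSpanningSetsIn.pi fun j => (μ i j).toFiniteSpanningSetsIn) ?_
  intro s hs
  choose t ht hts using hs
  rw [MeasurableEquiv.map_apply]
  have h1 : (MeasurableEquiv.curry ι κ ℝ) ⁻¹' Set.univ.pi s =
      Set.univ.pi fun e : ι × κ => t e.1 e.2 := by
    ext x
    simp only [Set.mem_preimage, Set.mem_pi, Set.mem_univ, forall_const, ← hts]
    constructor
    · intro h e
      exact h e.1 e.2
    · intro h i j
      exact h (i, j)
  rw [h1, Measure.pi_pi, Fintype.prod_prod_type]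
  refine Finset.prod_congr rfl fun i _ => ?_
  rw [← hts i, Measure.pi_pi]

/-- Correction: for independent coordinates, the probability that the coordinates in `N` lie in `W`
and all the others are close to prescribed functions of those. -/
theorem pi_correction {ι : Type*} [Fintype ι] (p : ι → Prop) [DecidablePred p]
    (ν : ι → Measure ℝ) [∀ i, SigmaFinite (ν i)]
    (W : Set ({i // p i} → ℝ)) (hW : MeasurableSet W)
    (g : ({i // p i} → ℝ) → {i // ¬ p i} → ℝ) (ρ : ℝ) (q : ℝ≥0∞)
    (hq : ∀ w ∈ W, ∀ e : {i // ¬ p i}, q ≤ ν e (Metric.closedBall (g w e) ρ))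
    (A : Set (ι → ℝ)) (hA : MeasurableSet A)
    (hWA : ∀ x : ι → ℝ, (fun i : {i // p i} => x i) ∈ W →
      (∀ e : {i // ¬ p i}, |x e - g (fun i => x i) e| ≤ ρ) → x ∈ A) :
    Measure.pi (fun i : {i // p i} => ν i) W * q ^ (Fintype.card {i // ¬ p i}) ≤
      Measure.pi ν A := by
  have hmp := (measurePreserving_piEquivPiSubtypeProd ν p).symm
  rw [← hmp.measure_preimage hA.nullMeasurableSet,
    Measure.prod_apply (hmp.measurable hA)]
  -- Fubini: for `w ∈ W` the section of `A` contains the box of half-side `ρ` around `g w`, whose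
  -- measure is at least `q` to the number of remaining coordinates.
  calc Measure.pi (fun i : {i // p i} => ν i) W * q ^ (Fintype.card {i // ¬ p i})
      = ∫⁻ _ in W, q ^ (Fintype.card {i // ¬ p i}) ∂Measure.pi (fun i : {i // p i} => ν i) := by
        rw [setLIntegral_const, mul_comm]
    _ ≤ ∫⁻ w in W, Measure.pi (fun i : {i // ¬ p i} => ν i) (Prod.mk w ⁻¹'
          ((MeasurableEquiv.piEquivPiSubtypeProd (fun _ => ℝ) p).symm ⁻¹' A))
          ∂Measure.pi (fun i : {i // p i} => ν i) := by
        refine setLIntegral_mono' hW fun w hw => ?_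
        calc q ^ (Fintype.card {i // ¬ p i}) = ∏ _e : {i // ¬ p i}, q := by simp
          _ ≤ ∏ e : {i // ¬ p i}, ν e (Metric.closedBall (g w e) ρ) :=
            Finset.prod_le_prod' fun e _ => hq w hw e
          _ = Measure.pi (fun i : {i // ¬ p i} => ν i)
              (Set.univ.pi fun e => Metric.closedBall (g w e) ρ) := by rw [Measure.pi_pi]
          _ ≤ _ := by
            refine measure_mono fun z hz => ?_
            have h1 : (fun i : {i // p i} =>
                (MeasurableEquiv.piEquivPiSubtypeProd (fun _ => ℝ) p).symm (w, z) i) = w := by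
              ext i
              simp [MeasurableEquiv.piEquivPiSubtypeProd, Equiv.piEquivPiSubtypeProd, i.2]
            refine hWA _ (by rw [h1]; exact hw) fun e => ?_
            rw [h1]
            have h2 : (MeasurableEquiv.piEquivPiSubtypeProd (fun _ => ℝ) p).symm (w, z) e = z e := by
              simp [MeasurableEquiv.piEquivPiSubtypeProd, Equiv.piEquivPiSubtypeProd, e.2]
            rw [h2]
            exact hz e trivial
    _ ≤ _ := setLIntegral_le_lintegral _ _

/-- Exponential Markov inequality for sums of functions of independent coordinates. -/
theorem pi_chernoff {ι : Type*} [Fintype ι] (ν : ι → Measure ℝ) [∀ i, IsProbabilityMeasure (ν i)]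
    (K : Finset ι) (g : ι → ℝ → ℝ) (hg : ∀ i, Measurable (g i)) (s C τ : ℝ)
    (h : ∀ i ∈ K, ∫⁻ x, ENNReal.ofReal (Real.exp (s * g i x)) ∂ν i ≤
      ENNReal.ofReal (Real.exp (C * s ^ 2))) :
    Measure.pi ν {x | τ ≤ s * ∑ i ∈ K, g i (x i)} ≤
      ENNReal.ofReal (Real.exp (C * s ^ 2 * K.card - τ)) := by
  classical
  have hm : Measurable fun x : ι → ℝ => ∏ i, (if i ∈ K then
      ENNReal.ofReal (Real.exp (s * g i (x i))) else 1) := by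
    refine Finset.measurable_prod _ fun i _ => ?_
    split_ifs
    · have := hg i
      fun_prop
    · exact measurable_const
  have h1 := mul_meas_ge_le_lintegral₀ (μ := Measure.pi ν) hm.aemeasurable
    (ENNReal.ofReal (Real.exp τ))
  have h2 : ∀ x : ι → ℝ, ∏ i, (if i ∈ K then
      ENNReal.ofReal (Real.exp (s * g i (x i))) else 1) =
      ENNReal.ofReal (Real.exp (s * ∑ i ∈ K, g i (x i))) := by
    intro x
    rw [Finset.mul_sum, Real.exp_sum, ENNReal.ofReal_prod_of_nonneg fun i _ => (Real.exp_pos _).le]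
    simp [Finset.prod_ite_mem]
  have h3 : ∫⁻ x, ∏ i, (if i ∈ K then
      ENNReal.ofReal (Real.exp (s * g i (x i))) else 1) ∂Measure.pi ν ≤
      ENNReal.ofReal (Real.exp (C * s ^ 2 * K.card)) := by
    rw [lintegral_pi_prod ν (fun i y => if i ∈ K then
      ENNReal.ofReal (Real.exp (s * g i y)) else 1) (fun i => by
        split_ifs
        · have := hg i
          fun_prop
        · exact measurable_const)]
    calc _ = ∏ i ∈ K, ∫⁻ t, ENNReal.ofReal (Real.exp (s * g i t)) ∂ν i := by
          rw [← Finset.prod_subset (Finset.subset_univ K)]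
          · exact Finset.prod_congr rfl fun i hi => by simp [hi]
          · intro i _ hi
            simp [hi]
      _ ≤ ∏ _i ∈ K, ENNReal.ofReal (Real.exp (C * s ^ 2)) := Finset.prod_le_prod' h
      _ = _ := by
          rw [Finset.prod_const, ← ENNReal.ofReal_pow (Real.exp_pos _).le, ← Real.exp_nat_mul]
          ring_nf
  simp_rw [h2] at h1 h3
  have h4 : {x : ι → ℝ | ENNReal.ofReal (Real.exp τ) ≤
      ENNReal.ofReal (Real.exp (s * ∑ i ∈ K, g i (x i)))} =
      {x | τ ≤ s * ∑ i ∈ K, g i (x i)} := by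
    ext x
    simp [ENNReal.ofReal_le_ofReal_iff (Real.exp_pos _).le]
  rw [h4] at h1
  have h5 := h1.trans h3
  rw [Real.exp_sub, ENNReal.ofReal_div_of_pos (Real.exp_pos _), ENNReal.le_div_iff_mul_le (by simp [Real.exp_pos]) (by simp)]
  rwa [mul_comm] at h5

/-! ### Base measures invariant under reflections -/

/-- `ζ` is carried by the subgroup `Γ` and invariant under the reflections `x ↦ a - x`, `a ∈ Γ`. -/
structure IsLattice (ζ : Measure ℝ) (Γ : AddSubgroup ℝ) : Prop where
  mp : ∀ a ∈ Γ, MeasurePreserving (fun x => a - x) ζ ζ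
  ae_mem : ∀ᵐ x ∂ζ, x ∈ Γ

theorem isLattice_volume : IsLattice volume ⊤ where
  mp a _ := Measure.measurePreserving_sub_left volume a
  ae_mem := by simp

theorem measurableEmbedding_intCast : MeasurableEmbedding (fun z : ℤ => (z : ℝ)) :=
  Int.isClosedEmbedding_coe_real.measurableEmbedding

instance : SigmaFinite intCount := by
  unfold intCount
  exact measurableEmbedding_intCast.sigmaFinite_map

theorem lintegral_intCount (f : ℝ → ℝ≥0∞) : ∫⁻ x, f x ∂intCount = ∑' z : ℤ, f z := by
  rw [intCount, measurableEmbedding_intCast.lintegral_map, lintegral_count]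

theorem intCount_apply (s : Set ℝ) :
    intCount s = Measure.count ((fun z : ℤ => (z : ℝ)) ⁻¹' s) :=
  measurableEmbedding_intCast.map_apply _ _

theorem intCount_singleton (z : ℤ) : intCount {(z : ℝ)} = 1 := by
  rw [intCount_apply]
  have : (fun z : ℤ => (z : ℝ)) ⁻¹' {(z : ℝ)} = {z} := by
    ext w
    simp
  rw [this, Measure.count_singleton]

/-- The integers inside the reals. -/
def intSubgroup : AddSubgroup ℝ := (Int.castAddHom ℝ).range

theorem mem_intSubgroup {x : ℝ} : x ∈ intSubgroup ↔ ∃ z : ℤ, (z : ℝ) = x := Iff.rfl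

theorem isLattice_intCount : IsLattice intCount intSubgroup where
  mp := by
    rintro a ⟨w, rfl⟩
    refine ⟨by fun_prop, ?_⟩
    simp only [Int.coe_castAddHom]
    ext s hs
    rw [Measure.map_apply (by fun_prop) hs, intCount_apply, intCount_apply]
    have : (fun z : ℤ => (z : ℝ)) ⁻¹' ((fun x : ℝ => (w : ℝ) - x) ⁻¹' s) =
        (Equiv.subLeft w) ⁻¹' ((fun z : ℤ => (z : ℝ)) ⁻¹' s) := by
      ext z
      simp
    rw [this]
    exact (Measure.measurePreserving_sub_left Measure.count w).measure_preimage
      (MeasurableSet.of_discrete).nullMeasurableSet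
  ae_mem := by
    rw [ae_iff, intCount_apply]
    have : (fun z : ℤ => (z : ℝ)) ⁻¹' {x | x ∉ intSubgroup} = ∅ := by
      ext z
      simp [mem_intSubgroup]
    rw [this, measure_empty]

/-- A translation is a composition of two reflections. Reflections are the primitive notion because
the unimodality argument needs them. -/
theorem IsLattice.mp_add {ζ : Measure ℝ} {Γ : AddSubgroup ℝ} (h : IsLattice ζ Γ) {a : ℝ}
    (ha : a ∈ Γ) : MeasurePreserving (fun x => x + a) ζ ζ := by
  have := (h.mp a ha).comp (h.mp 0 Γ.zero_mem)
  convert this using 1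
  ext x
  simp [add_comm]

/-! ### The completion chart -/

section completion
variable {m n : ℕ} (r : Fin (m + 1) → ℝ) (c : Fin (n + 1) → ℝ) (y : Fin m → Fin n → ℝ)

theorem completion_castSucc_castSucc (i : Fin m) (j : Fin n) :
    completion r c y i.castSucc j.castSucc = y i j := by
  simp [completion]

theorem completion_castSucc_last (i : Fin m) :
    completion r c y i.castSucc (Fin.last n) = r i.castSucc - ∑ j, y i j := by
  simp [completion]

theorem completion_last_castSucc (j : Fin n) :
    completion r c y (Fin.last m) j.castSucc = c j.castSucc - ∑ i, y i j := by
  simp [completion]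

theorem completion_last_last :
    completion r c y (Fin.last m) (Fin.last n) =
      ∑ i, ∑ j, y i j - ∑ i : Fin m, r i.castSucc + c (Fin.last n) := by
  simp [completion]
  rfl

theorem sum_completion_col (j : Fin (n + 1)) : ∑ i, completion r c y i j = c j := by
  rw [Fin.sum_univ_castSucc]
  refine Fin.lastCases ?_ (fun j => ?_) j
  · simp only [completion_castSucc_last, completion_last_last, Finset.sum_sub_distrib]
    ring
  · simp only [completion_castSucc_castSucc, completion_last_castSucc]
    ring

theorem sum_completion_row (h : ∑ i, r i = ∑ j, c j) (i : Fin (m + 1)) :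
    ∑ j, completion r c y i j = r i := by
  rw [Fin.sum_univ_castSucc]
  refine Fin.lastCases ?_ (fun i => ?_) i
  · simp only [completion_last_castSucc, completion_last_last, Finset.sum_sub_distrib]
    rw [Fin.sum_univ_castSucc, Fin.sum_univ_castSucc (f := c)] at h
    rw [Finset.sum_comm]
    linarith
  · simp only [completion_castSucc_castSucc, completion_castSucc_last]
    ring

/-- Every matrix is the completion of its restriction. -/
theorem completion_restrict (x : Fin (m + 1) → Fin (n + 1) → ℝ)
    (hr : ∀ i, ∑ j, x i j = r i) (hc : ∀ j, ∑ i, x i j = c j) :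
    completion r c (fun i j => x i.castSucc j.castSucc) = x := by
  ext i j
  refine Fin.lastCases ?_ (fun i => ?_) i <;> refine Fin.lastCases ?_ (fun j => ?_) j
  · rw [completion_last_last, ← hc, Fin.sum_univ_castSucc]
    simp only [← hr, Fin.sum_univ_castSucc, Finset.sum_add_distrib]
    ring
  · rw [completion_last_castSucc, ← hc, Fin.sum_univ_castSucc]
    ring
  · rw [completion_castSucc_last, ← hr, Fin.sum_univ_castSucc]
    ring
  · rw [completion_castSucc_castSucc]

end completion

theorem completion_mem {Γ : AddSubgroup ℝ} {m n : ℕ} {r : Fin (m + 1) → ℝ}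
    {c : Fin (n + 1) → ℝ} (hr : ∀ i, r i ∈ Γ) (hc : ∀ j, c j ∈ Γ) {y : Fin m → Fin n → ℝ}
    (hy : ∀ i j, y i j ∈ Γ) (i : Fin (m + 1)) (j : Fin (n + 1)) : completion r c y i j ∈ Γ := by
  refine Fin.lastCases ?_ (fun i => ?_) i <;> refine Fin.lastCases ?_ (fun j => ?_) j
  · rw [completion_last_last]
    exact Γ.add_mem (Γ.sub_mem (Γ.sum_mem fun i _ => Γ.sum_mem fun j _ => hy i j)
      (Γ.sum_mem fun i _ => hr _)) (hc _)
  · rw [completion_last_castSucc]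
    exact Γ.sub_mem (hc _) (Γ.sum_mem fun i _ => hy i j)
  · rw [completion_castSucc_last]
    exact Γ.sub_mem (hr _) (Γ.sum_mem fun j _ => hy i j)
  · rw [completion_castSucc_castSucc]
    exact hy i j

theorem measurable_completion {m n : ℕ} :
    Measurable fun p : ((Fin m → ℝ) × (Fin n → ℝ)) × (Fin (m - 1) → Fin (n - 1) → ℝ) =>
      completion p.1.1 p.1.2 p.2 := by
  have hr : ∀ i, Measurable fun p : ((Fin m → ℝ) × (Fin n → ℝ)) ×
      (Fin (m - 1) → Fin (n - 1) → ℝ) => p.1.1 i := fun i => by fun_prop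
  have hc : ∀ j, Measurable fun p : ((Fin m → ℝ) × (Fin n → ℝ)) ×
      (Fin (m - 1) → Fin (n - 1) → ℝ) => p.1.2 j := fun j => by fun_prop
  have hy : ∀ i j, Measurable fun p : ((Fin m → ℝ) × (Fin n → ℝ)) ×
      (Fin (m - 1) → Fin (n - 1) → ℝ) => p.2 i j := fun i j => by fun_prop
  refine measurable_pi_iff.2 fun i => measurable_pi_iff.2 fun j => ?_
  unfold completion
  by_cases hi : (i : ℕ) < m - 1
  · by_cases hj : (j : ℕ) < n - 1
    · simpa only [dif_pos hi, dif_pos hj] using hy ⟨i, hi⟩ ⟨j, hj⟩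
    · simp only [dif_pos hi, dif_neg hj]
      exact (hr i).sub (Finset.measurable_sum _ fun j' _ => hy ⟨i, hi⟩ j')
  · by_cases hj : (j : ℕ) < n - 1
    · simp only [dif_neg hi, dif_pos hj]
      exact (hc j).sub (Finset.measurable_sum _ fun i' _ => hy i' ⟨j, hj⟩)
    · simp only [dif_neg hi, dif_neg hj]
      exact ((Finset.measurable_sum _ fun i' _ => Finset.measurable_sum _ fun j' _ => hy i' j').sub
          (Finset.measurable_sum _ fun i' _ => hr (Fin.castLE (Nat.sub_le m 1) i'))).add (hc j)

theorem measurable_completion_right {m n : ℕ} (r : Fin m → ℝ) (c : Fin n → ℝ) :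
    Measurable (completion r c) := by
  have h := (measurable_completion (m := m) (n := n)).comp (measurable_prodMk_left (x := (r, c)))
  have e : (fun p : ((Fin m → ℝ) × (Fin n → ℝ)) × (Fin (m - 1) → Fin (n - 1) → ℝ) =>
      completion p.1.1 p.1.2 p.2) ∘ Prod.mk (r, c) = completion r c := by
    funext y
    rfl
  rwa [e] at h

theorem measurable_marginMap {m n : ℕ} : Measurable (marginMap (m := m) (n := n)) := by
  unfold marginMap
  fun_prop

instance {ζ : Measure ℝ} [SigmaFinite ζ] {m n : ℕ} : SigmaFinite (baseModel ζ m n) := by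
  unfold baseModel
  infer_instance

theorem ae_pi_mem {ζ : Measure ℝ} [SigmaFinite ζ] {P : ℝ → Prop} (h : ∀ᵐ x ∂ζ, P x) (n : ℕ) :
    ∀ᵐ y ∂(Measure.pi fun _ : Fin n => ζ), ∀ j, P (y j) := by
  rw [eventually_all]
  intro j
  exact (Measure.tendsto_eval_ae_ae (μ := fun _ : Fin n => ζ) (i := j)).eventually h

theorem ae_baseModel_mem {ζ : Measure ℝ} [SigmaFinite ζ] {P : ℝ → Prop} (h : ∀ᵐ x ∂ζ, P x)
    (m n : ℕ) : ∀ᵐ y ∂(baseModel ζ m n), ∀ i j, P (y i j) := by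
  rw [eventually_all]
  intro i
  exact (Measure.tendsto_eval_ae_ae (μ := fun _ : Fin m => Measure.pi fun _ : Fin n => ζ)
    (i := i)).eventually (ae_pi_mem h n)

variable {ζ : Measure ℝ} [SigmaFinite ζ] {Γ : AddSubgroup ℝ}

/-- Trading the last entry of a row for the row sum is a shear: for almost every choice of the other
entries it is a translation by an element of `Γ`, which preserves `ζ`. -/
theorem IsLattice.mp_snoc (h : IsLattice ζ Γ) (n : ℕ) :
    MeasurePreserving
      (fun p : (Fin n → ℝ) × ℝ => (Fin.snoc p.1 (p.2 - ∑ j, p.1 j) : Fin (n + 1) → ℝ))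
      ((Measure.pi fun _ => ζ).prod ζ) (Measure.pi fun _ => ζ) := by
  have h1 : MeasurePreserving (fun p : (Fin n → ℝ) × ℝ => (p.1, p.2 - ∑ j, p.1 j))
      ((Measure.pi fun _ => ζ).prod ζ) ((Measure.pi fun _ => ζ).prod ζ) := by
    refine (MeasurePreserving.id _).skew_product (g := fun (y : Fin n → ℝ) (r : ℝ) => r - ∑ j, y j)
      (by unfold Function.uncurry; fun_prop) ?_
    filter_upwards [ae_pi_mem h.ae_mem n] with y hy
    have := (h.mp_add (Γ.neg_mem (Γ.sum_mem fun j (_ : j ∈ Finset.univ) => hy j))).map_eq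
    simpa [sub_eq_add_neg] using this
  have h2 := (measurePreserving_piFinSuccAbove (fun _ : Fin (n + 1) => ζ) (Fin.last n)).symm
  have h3 := (h2.comp Measure.measurePreserving_swap).comp h1
  convert h3 using 1
  ext p j
  simp [MeasurableEquiv.piFinSuccAbove_symm_apply, Fin.insertNthEquiv, Fin.insertNth_last']

/-- The row sums determined by all but the last one and by the column sums. -/
def rowExt {m n : ℕ} (ρ : Fin m → ℝ) (c : Fin n → ℝ) : Fin (m + 1) → ℝ :=
  Fin.snoc ρ (∑ j, c j - ∑ i, ρ i)

theorem sum_rowExt {m n : ℕ} (ρ : Fin m → ℝ) (c : Fin n → ℝ) :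
    ∑ i, rowExt ρ c i = ∑ j, c j := by
  rw [Fin.sum_univ_castSucc]
  simp [rowExt]

theorem rowExt_eq {m n : ℕ} (r : Fin (m + 1) → ℝ) (c : Fin n → ℝ) (h : ∑ i, r i = ∑ j, c j) :
    rowExt (fun i => r i.castSucc) c = r := by
  ext i
  refine Fin.lastCases ?_ (fun i => ?_) i
  · rw [Fin.sum_univ_castSucc] at h
    simp [rowExt, ← h]
  · simp [rowExt]

/-- The chart: a matrix as the completion of its restriction with given margins. -/
theorem IsLattice.mp_chart (h : IsLattice ζ Γ) (m n : ℕ) :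
    MeasurePreserving
      (fun p : ((Fin m → Fin n → ℝ) × (Fin m → ℝ)) × (Fin (n + 1) → ℝ) =>
        completion (rowExt p.1.2 p.2) p.2 p.1.1)
      (((baseModel ζ m n).prod (Measure.pi fun _ => ζ)).prod (Measure.pi fun _ => ζ))
      (baseModel ζ (m + 1) (n + 1)) := by
  -- Two shears: in every row but the last, the last entry is traded for the row sum (`h1`–`h3`);
  -- then the whole last row is traded for the column sums (`h4`).
  have h1 := measurePreserving_pi (fun _ : Fin m => (Measure.pi fun _ : Fin n => ζ).prod ζ)
    (fun _ => Measure.pi fun _ : Fin (n + 1) => ζ) fun _ => h.mp_snoc n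
  have h2 := (measurePreserving_arrowProdEquivProdArrow (Fin n → ℝ) ℝ (Fin m)
    (fun _ => Measure.pi fun _ : Fin n => ζ) (fun _ => ζ)).symm
  have h3 := (h1.comp h2).prod (MeasurePreserving.id (Measure.pi fun _ : Fin (n + 1) => ζ))
  have h4 : MeasurePreserving
      (fun p : (Fin m → Fin (n + 1) → ℝ) × (Fin (n + 1) → ℝ) =>
        (p.1, fun j => p.2 j - ∑ i, p.1 i j))
      ((baseModel ζ m (n + 1)).prod (Measure.pi fun _ => ζ))
      ((baseModel ζ m (n + 1)).prod (Measure.pi fun _ => ζ)) := by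
    refine (MeasurePreserving.id _).skew_product (g := fun (X : Fin m → Fin (n + 1) → ℝ)
      (c : Fin (n + 1) → ℝ) j => c j - ∑ i, X i j)
      (by unfold Function.uncurry; fun_prop) ?_
    filter_upwards [ae_baseModel_mem h.ae_mem m (n + 1)] with X hX
    refine (measurePreserving_pi (fun _ : Fin (n + 1) => ζ) (fun _ => ζ)
      (f := fun j t => t - ∑ i, X i j) fun j => ?_).map_eq
    have := h.mp_add (Γ.neg_mem (Γ.sum_mem fun i (_ : i ∈ Finset.univ) => hX i j))
    simpa [sub_eq_add_neg] using this
  have h5 := (measurePreserving_piFinSuccAbove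
    (fun _ : Fin (m + 1) => Measure.pi fun _ : Fin (n + 1) => ζ) (Fin.last m)).symm
  have h6 := ((h5.comp Measure.measurePreserving_swap).comp h4).comp h3
  have e : (fun p : ((Fin m → Fin n → ℝ) × (Fin m → ℝ)) × (Fin (n + 1) → ℝ) =>
        completion (rowExt p.1.2 p.2) p.2 p.1.1) =
      fun p => Fin.snoc (fun i => (Fin.snoc (p.1.1 i) (p.1.2 i - ∑ j, p.1.1 i j) :
        Fin (n + 1) → ℝ)) (fun j => p.2 j - ∑ i, (Fin.snoc (p.1.1 i)
          (p.1.2 i - ∑ j, p.1.1 i j) : Fin (n + 1) → ℝ) j) := by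
    ext p i j
    refine Fin.lastCases ?_ (fun i => ?_) i <;> refine Fin.lastCases ?_ (fun j => ?_) j
    · rw [completion_last_last]
      simp [rowExt, Finset.sum_sub_distrib]
      ring
    · rw [completion_last_castSucc]
      simp
    · rw [completion_castSucc_last]
      simp [rowExt]
    · rw [completion_castSucc_castSucc]
      simp
  rw [e]
  convert h6 using 1
  swap
  · rfl
  swap
  · rfl
  ext p i j
  simp [MeasurableEquiv.piFinSuccAbove_symm_apply, Fin.insertNthEquiv, Fin.insertNth_last',
    MeasurableEquiv.arrowProdEquivProdArrow, Equiv.arrowProdEquivProdArrow]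

theorem marginMap_completion {m n : ℕ} (ρ : Fin m → ℝ) (c : Fin (n + 1) → ℝ)
    (y : Fin m → Fin n → ℝ) : marginMap (completion (rowExt ρ c) c y) = (rowExt ρ c, c) := by
  unfold marginMap
  congr 1
  · ext i
    exact sum_completion_row _ _ _ (sum_rowExt ρ c) i
  · ext j
    exact sum_completion_col _ _ _ j

/-! ### Fiber integrals and disintegration -/

attribute [local irreducible] completion

/-- The integral of `F` over the matrices with margin `(r, c)`, in the completion chart. -/
noncomputable def fibInt (ζ : Measure ℝ) {m n : ℕ} (F : (Fin m → Fin n → ℝ) → ℝ≥0∞)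
    (r : Fin m → ℝ) (c : Fin n → ℝ) : ℝ≥0∞ :=
  ∫⁻ y, F (completion r c y) ∂baseModel ζ (m - 1) (n - 1)

/-- The measure with density `F` on the matrices with margin `(r, c)`, in the completion chart. -/
noncomputable def fib (ζ : Measure ℝ) {m n : ℕ} (F : (Fin m → Fin n → ℝ) → ℝ≥0∞)
    (r : Fin m → ℝ) (c : Fin n → ℝ) : Measure (Fin m → Fin n → ℝ) :=
  ((baseModel ζ (m - 1) (n - 1)).withDensity fun y => F (completion r c y)).map (completion r c)

/-- The product weight of a matrix. -/
noncomputable def prodWt {m n : ℕ} (p : Fin m → Fin n → ℝ → ℝ≥0∞) (x : Fin m → Fin n → ℝ) :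
    ℝ≥0∞ := ∏ i, ∏ j, p i j (x i j)

theorem measurable_prodWt {m n : ℕ} {p : Fin m → Fin n → ℝ → ℝ≥0∞}
    (hp : ∀ i j, Measurable (p i j)) : Measurable (prodWt p) := by
  refine Finset.measurable_prod _ fun i _ => Finset.measurable_prod _ fun j _ => ?_
  exact (hp i j).comp (by fun_prop)

theorem fiberMeasure_eq_fib (μ : Measure ℝ) {m n : ℕ} (r : Fin m → ℝ) (c : Fin n → ℝ) :
    fiberMeasure μ r c = fib volume (prodWt fun _ _ => μ.rnDeriv volume) r c := rfl

variable {ζ : Measure ℝ} [SigmaFinite ζ] {Γ : AddSubgroup ℝ} {m n : ℕ}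

omit [SigmaFinite ζ] in
theorem lintegral_fib {F h : (Fin m → Fin n → ℝ) → ℝ≥0∞} (hF : Measurable F) (hh : Measurable h)
    (r : Fin m → ℝ) (c : Fin n → ℝ) :
    ∫⁻ x, h x ∂fib ζ F r c = fibInt ζ (fun x => F x * h x) r c := by
  have hm := measurable_completion_right r c
  have h1 : Measurable fun y => F (completion r c y) := hF.comp hm
  have h2 : Measurable fun y => h (completion r c y) := hh.comp hm
  rw [fib, lintegral_map hh hm, lintegral_withDensity_eq_lintegral_mul _ h1 h2]
  rfl

omit [SigmaFinite ζ] in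
theorem fib_apply {F : (Fin m → Fin n → ℝ) → ℝ≥0∞} (hF : Measurable F)
    {E : Set (Fin m → Fin n → ℝ)} (hE : MeasurableSet E) (r : Fin m → ℝ) (c : Fin n → ℝ) :
    fib ζ F r c E = fibInt ζ (fun x => F x * E.indicator 1 x) r c := by
  rw [← lintegral_indicator_one hE, lintegral_fib hF (measurable_one.indicator hE)]

omit [SigmaFinite ζ] in
theorem fib_univ {F : (Fin m → Fin n → ℝ) → ℝ≥0∞} (hF : Measurable F)
    (r : Fin m → ℝ) (c : Fin n → ℝ) : fib ζ F r c Set.univ = fibInt ζ F r c := by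
  rw [fib_apply hF MeasurableSet.univ]
  simp

theorem measurable_fibInt {F : (Fin m → Fin n → ℝ) → ℝ≥0∞} (hF : Measurable F) :
    Measurable fun t : (Fin m → ℝ) × (Fin n → ℝ) => fibInt ζ F t.1 t.2 := by
  unfold fibInt
  exact (hF.comp measurable_completion).lintegral_prod_right'

omit [SigmaFinite ζ] in
theorem fibInt_const_mul (a : ℝ≥0∞) {F : (Fin m → Fin n → ℝ) → ℝ≥0∞} (hF : Measurable F)
    (r : Fin m → ℝ) (c : Fin n → ℝ) :
    fibInt ζ (fun x => a * F x) r c = a * fibInt ζ F r c :=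
  lintegral_const_mul _ (hF.comp (measurable_completion_right r c))

omit [SigmaFinite ζ] in
/-- Functions of the margin can be taken out of fiber integrals. -/
theorem fibInt_mul_margin {F : (Fin (m + 1) → Fin (n + 1) → ℝ) → ℝ≥0∞} (hF : Measurable F)
    (φ : (Fin (m + 1) → ℝ) × (Fin (n + 1) → ℝ) → ℝ≥0∞)
    (ρ : Fin m → ℝ) (c : Fin (n + 1) → ℝ) :
    fibInt ζ (fun x => φ (marginMap x) * F x) (rowExt ρ c) c =
      φ (rowExt ρ c, c) * fibInt ζ F (rowExt ρ c) c := by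
  rw [← fibInt_const_mul _ hF]
  unfold fibInt
  refine lintegral_congr fun y => ?_
  have h := marginMap_completion ρ c y
  change φ (marginMap (completion (rowExt ρ c) c y)) * _ = _
  rw [h]

theorem measurable_rowExt : Measurable fun p : (Fin n → ℝ) × (Fin m → ℝ) => rowExt p.2 p.1 := by
  refine measurable_pi_iff.2 fun i => ?_
  refine Fin.lastCases ?_ (fun i => ?_) i
  · simp only [rowExt, Fin.snoc_last]
    fun_prop
  · simp only [rowExt, Fin.snoc_castSucc]
    fun_prop

/-- The parameters of the chart: column sums, and row sums but the last one. -/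
noncomputable def marginParam (ζ : Measure ℝ) (m n : ℕ) : Measure ((Fin n → ℝ) × (Fin m → ℝ)) :=
  (Measure.pi fun _ => ζ).prod (Measure.pi fun _ => ζ)

/-- Fubini in the chart `mp_chart`: integrate over the fibers first, then over the margins, which
are parametrized by all column sums and all row sums but the last. -/
theorem IsLattice.lintegral_baseModel (h : IsLattice ζ Γ)
    {H : (Fin (m + 1) → Fin (n + 1) → ℝ) → ℝ≥0∞} (hH : Measurable H) :
    ∫⁻ x, H x ∂baseModel ζ (m + 1) (n + 1) =
      ∫⁻ p, fibInt ζ H (rowExt p.2 p.1) p.1 ∂marginParam ζ m (n + 1) := by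
  have hc := (h.mp_chart m n)
  have hm1 : Measurable fun p : ((Fin m → Fin n → ℝ) × (Fin m → ℝ)) × (Fin (n + 1) → ℝ) =>
      H (completion (rowExt p.1.2 p.2) p.2 p.1.1) := hH.comp hc.measurable
  rw [← hc.lintegral_comp hH, lintegral_prod_symm' _ hm1]
  have hm2 : Measurable fun p : (Fin (n + 1) → ℝ) × (Fin m → ℝ) =>
      fibInt ζ H (rowExt p.2 p.1) p.1 :=
    (measurable_fibInt hH).comp (measurable_rowExt.prodMk measurable_fst)
  rw [marginParam, lintegral_prod _ hm2.aemeasurable]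
  refine lintegral_congr fun c => ?_
  have hm3 : Measurable fun q : (Fin m → Fin n → ℝ) × (Fin m → ℝ) =>
      H (completion (rowExt q.2 c) c q.1) := hm1.comp (measurable_id.prodMk measurable_const)
  rw [lintegral_prod_symm' _ hm3]
  rfl

theorem MeasurePreserving.withDensity_comp {α β : Type*} [MeasurableSpace α] [MeasurableSpace β]
    {μ : Measure α} {ν : Measure β} {f : α → β} (hf : MeasurePreserving f μ ν) {g : β → ℝ≥0∞}
    (hg : Measurable g) : (μ.withDensity (g ∘ f)).map f = ν.withDensity g := by
  ext s hs
  rw [Measure.map_apply hf.measurable hs, withDensity_apply _ hs,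
    withDensity_apply _ (hf.measurable hs)]
  exact hf.setLIntegral_comp_preimage hs hg

theorem pi_pi_withDensity (p : Fin m → Fin n → ℝ → ℝ≥0∞) (hp : ∀ i j, Measurable (p i j))
    [∀ i j, SigmaFinite (ζ.withDensity (p i j))] :
    Measure.pi (fun i => Measure.pi fun j => ζ.withDensity (p i j)) =
      (baseModel ζ m n).withDensity (prodWt p) := by
  have h1 := (measurePreserving_curry fun i j => ζ.withDensity (p i j)).map_eq
  have h2 : MeasurePreserving _ _ (baseModel ζ m n) :=
    measurePreserving_curry fun (_ : Fin m) (_ : Fin n) => ζ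
  rw [← h1, ← MeasurePreserving.withDensity_comp h2 (measurable_prodWt hp),
    pi_withDensity (fun _ => ζ) (fun e : Fin m × Fin n => p e.1 e.2) fun e => hp e.1 e.2]
  congr 2
  ext x
  simp only [Function.comp, prodWt, Fintype.prod_prod_type]
  rfl

theorem baseModel_withDensity {p : ℝ → ℝ≥0∞} (hp : Measurable p)
    [SigmaFinite (ζ.withDensity p)] :
    baseModel (ζ.withDensity p) m n = (baseModel ζ m n).withDensity (prodWt fun _ _ => p) :=
  pi_pi_withDensity (fun _ _ => p) fun _ _ => hp

theorem IsLattice.lintegral_baseModel_withDensity (h : IsLattice ζ Γ) {p : ℝ → ℝ≥0∞}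
    (hp : Measurable p) [SigmaFinite (ζ.withDensity p)]
    {H : (Fin (m + 1) → Fin (n + 1) → ℝ) → ℝ≥0∞} (hH : Measurable H) :
    ∫⁻ x, H x ∂baseModel (ζ.withDensity p) (m + 1) (n + 1) =
      ∫⁻ t, ∫⁻ x, H x ∂fib ζ (prodWt fun _ _ => p) (rowExt t.2 t.1) t.1
        ∂marginParam ζ m (n + 1) := by
  have hP : Measurable (prodWt fun (_ : Fin (m + 1)) (_ : Fin (n + 1)) => p) :=
    measurable_prodWt fun _ _ => hp
  rw [baseModel_withDensity hp, lintegral_withDensity_eq_lintegral_mul _ hP hH,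
    h.lintegral_baseModel (hP.mul hH)]
  refine lintegral_congr fun t => ?_
  rw [lintegral_fib hP hH]
  rfl

/-- A kernel that agrees with the normalized fiber measures is a disintegration. -/
theorem IsLattice.isMarginDisintegration (h : IsLattice ζ Γ) {p : ℝ → ℝ≥0∞}
    (hp : Measurable p) [SigmaFinite (ζ.withDensity p)]
    (Λ : (Fin (m + 1) → ℝ) × (Fin (n + 1) → ℝ) → Measure (Fin (m + 1) → Fin (n + 1) → ℝ))
    (hΛ : ∀ E, MeasurableSet E → Measurable fun t => Λ t E)
    (hfib : ∀ᵐ t ∂marginParam ζ m (n + 1),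
      fibInt ζ (prodWt fun _ _ => p) (rowExt t.2 t.1) t.1 ≠ 0 →
      fibInt ζ (prodWt fun _ _ => p) (rowExt t.2 t.1) t.1 ≠ ∞ ∧
      Λ (rowExt t.2 t.1, t.1) = (fibInt ζ (prodWt fun _ _ => p) (rowExt t.2 t.1) t.1)⁻¹ •
        fib ζ (prodWt fun _ _ => p) (rowExt t.2 t.1) t.1) :
    IsMarginDisintegration (ζ.withDensity p) (m + 1) (n + 1) Λ := by
  have hP : Measurable (prodWt fun (_ : Fin (m + 1)) (_ : Fin (n + 1)) => p) :=
    measurable_prodWt fun _ _ => hp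
  have hΛm : Measurable Λ := Measure.measurable_of_measurable_coe _ hΛ
  refine ⟨?_, hΛ, ?_⟩
  · classical
    have hU : MeasurableSet {t | Λ t Set.univ = 1} :=
      (hΛ _ MeasurableSet.univ) (measurableSet_singleton 1)
    -- Measurability of `t ↦ Λ t {x | marginMap x ≠ t}`, where the set varies with `t`, is available
    -- for finite kernels. So `Λ` is replaced by `0` at the margins where it is not a probability
    -- measure.
    let κ : Kernel ((Fin (m + 1) → ℝ) × (Fin (n + 1) → ℝ)) (Fin (m + 1) → Fin (n + 1) → ℝ) :=
      Kernel.piecewise hU ⟨Λ, hΛm⟩ 0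
    have : IsFiniteKernel κ := by
      refine ⟨1, ENNReal.one_lt_top, fun t => ?_⟩
      rw [Kernel.piecewise_apply]
      split_ifs with ht
      · exact le_of_eq ht
      · simp
    have hD : MeasurableSet {q : ((Fin (m + 1) → ℝ) × (Fin (n + 1) → ℝ)) ×
        (Fin (m + 1) → Fin (n + 1) → ℝ) | marginMap q.2 ≠ q.1} :=
      (measurableSet_eq_fun (measurable_marginMap.comp measurable_snd) measurable_fst).compl
    have hκ := Kernel.measurable_kernel_prodMk_left (κ := κ) hD
    have hS : MeasurableSet ({t | Λ t Set.univ = 1} ∩ {t | κ t {x | marginMap x ≠ t} = 0}) :=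
      hU.inter (hκ (measurableSet_singleton 0))
    have key : ∀ᵐ t ∂(baseModel (ζ.withDensity p) (m + 1) (n + 1)).map marginMap,
        t ∈ {t | Λ t Set.univ = 1} ∩ {t | κ t {x | marginMap x ≠ t} = 0} := by
      refine (ae_map_iff (p := fun t => t ∈ {t | Λ t Set.univ = 1} ∩
        {t | κ t {x | marginMap x ≠ t} = 0}) measurable_marginMap.aemeasurable hS).2 ?_
      rw [ae_iff]
      have hS' := measurable_marginMap hS.compl
      change baseModel (ζ.withDensity p) (m + 1) (n + 1) (marginMap ⁻¹' _ᶜ) = 0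
      rw [← lintegral_indicator_one hS',
        h.lintegral_baseModel_withDensity hp (measurable_one.indicator hS'),
        lintegral_eq_zero_iff']
      · filter_upwards [hfib] with t ht
        rw [lintegral_indicator_one hS', Pi.zero_apply]
        by_cases h0 : fibInt ζ (prodWt fun _ _ => p) (rowExt t.2 t.1) t.1 = 0
        · rw [← fib_univ hP] at h0
          exact measure_mono_null (Set.subset_univ _) h0
        · obtain ⟨h1, h2⟩ := ht h0
          have hfibm : fib ζ (prodWt fun _ _ => p) (rowExt t.2 t.1) t.1
              {x | marginMap x ≠ (rowExt t.2 t.1, t.1)} = 0 := by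
            have hs : MeasurableSet {x : Fin (m + 1) → Fin (n + 1) → ℝ |
                marginMap x ≠ (rowExt t.2 t.1, t.1)} :=
              (measurableSet_eq_fun measurable_marginMap measurable_const).compl
            rw [fib, Measure.map_apply (measurable_completion_right _ _) hs]
            have he : completion (rowExt t.2 t.1) t.1 ⁻¹'
                {x | marginMap x ≠ (rowExt t.2 t.1, t.1)} = ∅ := by
              ext y
              simp only [Set.mem_preimage, Set.mem_ofPred_eq, Set.mem_empty_iff_false, iff_false,
                not_not]
              exact marginMap_completion t.2 t.1 y
            rw [he, measure_empty]
          have h3 : (rowExt t.2 t.1, t.1) ∈ {t | Λ t Set.univ = 1} := by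
            rw [Set.mem_ofPred_eq, h2, Measure.smul_apply, fib_univ hP, smul_eq_mul,
              ENNReal.inv_mul_cancel h0 h1]
          have h4 : (rowExt t.2 t.1, t.1) ∈ {t | κ t {x | marginMap x ≠ t} = 0} := by
            rw [Set.mem_ofPred_eq, Kernel.piecewise_apply, if_pos h3]
            change Λ _ _ = 0
            rw [h2, Measure.smul_apply, hfibm, smul_zero]
          refine measure_mono_null ?_ hfibm
          intro x hx hx'
          refine hx ?_
          rw [hx']
          exact ⟨h3, h4⟩
      · refine Measurable.aemeasurable ?_
        have := (measurable_fibInt (ζ := ζ) (hP.mul (measurable_one.indicator hS'))).comp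
          ((measurable_rowExt (m := m) (n := n + 1)).prodMk measurable_fst)
        convert this using 1
        ext t
        rw [lintegral_fib hP (measurable_one.indicator hS')]
        rfl
    filter_upwards [key] with t ht
    refine ⟨⟨ht.1⟩, ?_⟩
    have := ht.2
    rw [Set.mem_ofPred_eq, Kernel.piecewise_apply, if_pos ht.1] at this
    exact this
  · intro f hf
    have hL : Measurable fun t => ∫⁻ x, f x ∂Λ t := (Measure.measurable_lintegral hf).comp hΛm
    have hL' : Measurable fun x : Fin (m + 1) → Fin (n + 1) → ℝ =>
        ∫⁻ z, f z ∂Λ (marginMap x) := hL.comp measurable_marginMap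
    rw [lintegral_map hL measurable_marginMap, h.lintegral_baseModel_withDensity hp hf,
      h.lintegral_baseModel_withDensity hp hL']
    refine lintegral_congr_ae ?_
    filter_upwards [hfib] with t ht
    rw [lintegral_fib hP hf, lintegral_fib hP hL']
    have h5 := fibInt_mul_margin (ζ := ζ) hP (fun t => ∫⁻ x, f x ∂Λ t) t.2 t.1
    simp_rw [mul_comm (∫⁻ x, f x ∂Λ _)] at h5
    rw [h5]
    by_cases h0 : fibInt ζ (prodWt fun _ _ => p) (rowExt t.2 t.1) t.1 = 0
    · rw [h0, zero_mul, ← lintegral_fib hP hf]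
      rw [← fib_univ hP] at h0
      rw [Measure.measure_univ_eq_zero.1 h0]
      simp
    · obtain ⟨h1, h2⟩ := ht h0
      rw [h2, lintegral_smul_measure, lintegral_fib hP hf, smul_eq_mul, ← mul_assoc,
        ENNReal.mul_inv_cancel h0 h1, one_mul]

/-! ### The conditional law as a normalized fiber measure -/

theorem marginFiber_eq {m n : ℕ} (t : (Fin m → ℝ) × (Fin n → ℝ)) :
    marginFiber t.1 t.2 = {x | marginMap x = t} := by
  ext x
  simp only [marginFiber, marginMap, Set.mem_ofPred_eq, Prod.ext_iff, funext_iff]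

theorem measurableSet_marginFiber {m n : ℕ} (r : Fin m → ℝ) (c : Fin n → ℝ) :
    MeasurableSet (marginFiber r c) := by
  rw [marginFiber_eq (r, c)]
  exact measurableSet_eq_fun measurable_marginMap measurable_const

theorem measurable_condLaw (μ : Measure ℝ) [SigmaFinite μ] {m n : ℕ}
    {E : Set (Fin m → Fin n → ℝ)} (hE : MeasurableSet E) :
    Measurable fun t : (Fin m → ℝ) × (Fin n → ℝ) => condLaw μ t.1 t.2 E := by
  classical
  have h1 : ∀ E' : Set (Fin m → Fin n → ℝ), MeasurableSet E' →
      Measurable fun t : (Fin m → ℝ) × (Fin n → ℝ) =>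
        baseModel μ m n (marginFiber t.1 t.2 ∩ E') := by
    intro E' hE'
    have hD : MeasurableSet {q : ((Fin m → ℝ) × (Fin n → ℝ)) × (Fin m → Fin n → ℝ) |
        marginMap q.2 = q.1 ∧ q.2 ∈ E'} :=
      (measurableSet_eq_fun (measurable_marginMap.comp measurable_snd) measurable_fst).inter
        (measurable_snd hE')
    convert measurable_measure_prodMk_left (ν := baseModel μ m n) hD using 2 with t
    rw [marginFiber_eq]
    rfl
  have h0 : Measurable fun t : (Fin m → ℝ) × (Fin n → ℝ) =>
      baseModel μ m n (marginFiber t.1 t.2) := by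
    simpa using h1 Set.univ MeasurableSet.univ
  have hF : Measurable (prodWt fun (_ : Fin m) (_ : Fin n) => μ.rnDeriv volume) :=
    measurable_prodWt fun _ _ => μ.measurable_rnDeriv volume
  have hS : MeasurableSet {t : (Fin m → ℝ) × (Fin n → ℝ) |
      baseModel μ m n (marginFiber t.1 t.2) ≠ 0 ∧ baseModel μ m n (marginFiber t.1 t.2) ≠ ∞} :=
    (h0 (measurableSet_singleton 0).compl).inter (h0 (measurableSet_singleton ∞).compl)
  have h2 : (fun t : (Fin m → ℝ) × (Fin n → ℝ) => condLaw μ t.1 t.2 E) = fun t =>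
      if t ∈ {t : (Fin m → ℝ) × (Fin n → ℝ) |
        baseModel μ m n (marginFiber t.1 t.2) ≠ 0 ∧ baseModel μ m n (marginFiber t.1 t.2) ≠ ∞}
      then (baseModel μ m n (marginFiber t.1 t.2))⁻¹ * baseModel μ m n (marginFiber t.1 t.2 ∩ E)
      else (fibInt volume (prodWt fun _ _ => μ.rnDeriv volume) t.1 t.2)⁻¹ *
        fibInt volume (fun x => prodWt (fun _ _ => μ.rnDeriv volume) x * E.indicator 1 x)
          t.1 t.2 := by
    ext t
    rw [condLaw]
    simp only [Set.mem_ofPred_eq]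
    split_ifs with h
    · rw [cond_apply (measurableSet_marginFiber _ _)]
    · rw [Measure.smul_apply, fiberMeasure_eq_fib, fib_univ hF, fib_apply hF hE, smul_eq_mul]
  rw [h2]
  refine Measurable.ite hS (h0.inv.mul (h1 E hE)) ?_
  exact (measurable_fibInt hF).inv.mul
    (measurable_fibInt (hF.mul (measurable_one.indicator hE)))

variable {ζ : Measure ℝ} [SigmaFinite ζ] {Γ : AddSubgroup ℝ} {m n : ℕ}

/-- Fiber integrals are almost everywhere finite if the base measure has an exponential moment. -/
theorem IsLattice.ae_fibInt_ne_top (h : IsLattice ζ Γ) {p : ℝ → ℝ≥0∞}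
    (hp : Measurable p) [SigmaFinite (ζ.withDensity p)] (θ : ℝ)
    (hθ : ∫⁻ x, ENNReal.ofReal (Real.exp (θ * x)) ∂ζ.withDensity p ≠ ∞) :
    ∀ᵐ t ∂marginParam ζ m (n + 1),
      fibInt ζ (prodWt fun _ _ => p) (rowExt t.2 t.1) t.1 ≠ ∞ := by
  have hP : Measurable (prodWt fun (_ : Fin (m + 1)) (_ : Fin (n + 1)) => p) :=
    measurable_prodWt fun _ _ => hp
  -- The weight `exp (θ · total)` is a positive function of the margin, so it factors out of every
  -- fiber integral, while its integral over the base model is a product of finite one-dimensional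
  -- integrals.
  set φ : (Fin (m + 1) → ℝ) × (Fin (n + 1) → ℝ) → ℝ≥0∞ := fun t =>
    ENNReal.ofReal (Real.exp (θ * ∑ j, t.2 j)) with hφ
  have hφm : Measurable φ := by
    rw [hφ]
    fun_prop
  have hH : Measurable fun x : Fin (m + 1) → Fin (n + 1) → ℝ => φ (marginMap x) :=
    hφm.comp measurable_marginMap
  have h1 := h.lintegral_baseModel_withDensity hp hH
  have h2 : ∫⁻ x, φ (marginMap x) ∂baseModel (ζ.withDensity p) (m + 1) (n + 1) ≠ ∞ := by
    have h3 := (measurePreserving_curry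
      fun (_ : Fin (m + 1)) (_ : Fin (n + 1)) => ζ.withDensity p)
    have h4 : baseModel (ζ.withDensity p) (m + 1) (n + 1) =
      Measure.pi fun _ => Measure.pi fun _ => ζ.withDensity p := rfl
    rw [h4, ← h3.lintegral_comp hH]
    have h5 : ∀ x : Fin (m + 1) × Fin (n + 1) → ℝ,
        φ (marginMap (MeasurableEquiv.curry (Fin (m + 1)) (Fin (n + 1)) ℝ x)) =
        ∏ e, ENNReal.ofReal (Real.exp (θ * x e)) := by
      intro x
      rw [← ENNReal.ofReal_prod_of_nonneg fun _ _ => (Real.exp_pos _).le, ← Real.exp_sum,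
        ← Finset.mul_sum, Fintype.sum_prod_type, Finset.sum_comm]
      rfl
    simp_rw [h5]
    rw [lintegral_pi_prod _ (fun _ y => ENNReal.ofReal (Real.exp (θ * y)))
      fun _ => by fun_prop]
    exact (ENNReal.prod_lt_top fun _ _ => lt_top_iff_ne_top.2 hθ).ne
  rw [h1] at h2
  have h6 : ∀ t : (Fin (n + 1) → ℝ) × (Fin m → ℝ),
      ∫⁻ x, φ (marginMap x) ∂fib ζ (prodWt fun _ _ => p) (rowExt t.2 t.1) t.1 =
      φ (rowExt t.2 t.1, t.1) * fibInt ζ (prodWt fun _ _ => p) (rowExt t.2 t.1) t.1 := by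
    intro t
    rw [lintegral_fib hP hH, ← fibInt_mul_margin hP φ]
    simp_rw [mul_comm]
  simp_rw [h6] at h2
  have h7 : Measurable fun t : (Fin (n + 1) → ℝ) × (Fin m → ℝ) =>
      φ (rowExt t.2 t.1, t.1) * fibInt ζ (prodWt fun _ _ => p) (rowExt t.2 t.1) t.1 :=
    (hφm.comp (measurable_rowExt.prodMk measurable_fst)).mul
      ((measurable_fibInt hP).comp (measurable_rowExt.prodMk measurable_fst))
  filter_upwards [ae_lt_top h7 h2] with t ht htop
  rw [htop, ENNReal.mul_top] at ht
  · exact lt_irrefl _ ht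
  · simp [hφ, Real.exp_pos]

theorem exists_exp_integrable {μ : Measure ℝ} {θ : ℝ} (hθ : θ ∈ tiltDomain μ) :
    ∫⁻ x, ENNReal.ofReal (Real.exp (θ * x)) ∂μ ≠ ∞ := by
  have h0 : θ ∈ integrableExpSet id μ := interior_subset hθ
  have h1 : Integrable (fun x => Real.exp (θ * x)) μ := h0
  have := h1.hasFiniteIntegral
  rw [hasFiniteIntegral_iff_ofReal (ae_of_all _ fun x => (Real.exp_pos _).le)] at this
  exact this.ne

/-- A fiber only sees one value of the column sums, which is a null set of parameters. Hence
`condLaw` is given by its second branch in the Lebesgue case. -/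
theorem baseModel_marginFiber_volume {p : ℝ → ℝ≥0∞} (hp : Measurable p)
    [SigmaFinite ((volume : Measure ℝ).withDensity p)]
    (r : Fin (m + 1) → ℝ) (c : Fin (n + 1) → ℝ) :
    baseModel ((volume : Measure ℝ).withDensity p) (m + 1) (n + 1) (marginFiber r c) = 0 := by
  rw [baseModel_withDensity hp]
  refine withDensity_absolutelyContinuous _ _ ?_
  rw [← lintegral_indicator_one (measurableSet_marginFiber r c),
    isLattice_volume.lintegral_baseModel
      (measurable_one.indicator (measurableSet_marginFiber r c))]
  have hz : ∀ᵐ t ∂marginParam volume m (n + 1), t.1 ≠ c := by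
    have : (marginParam volume m (n + 1)) {t | ¬ t.1 ≠ c} = 0 := by
      have e : {t : (Fin (n + 1) → ℝ) × (Fin m → ℝ) | ¬ t.1 ≠ c} = {c} ×ˢ Set.univ := by
        ext t
        simp
      rw [e, marginParam, Measure.prod_prod]
      have hc : (Measure.pi fun _ : Fin (n + 1) => (volume : Measure ℝ)) {c} = 0 := by
        rw [← Set.univ_pi_singleton, Measure.pi_pi]
        exact Finset.prod_eq_zero (Finset.mem_univ 0) (by simp)
      rw [hc, zero_mul]
    exact this
  refine (lintegral_congr_ae ?_).trans lintegral_zero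
  filter_upwards [hz] with t ht
  unfold fibInt
  refine (lintegral_congr fun y => ?_).trans lintegral_zero
  rw [Set.indicator_of_notMem]
  intro hmem
  refine ht ?_
  ext j
  rw [← hmem.2 j, sum_completion_col]

theorem condLaw_volume {p : ℝ → ℝ≥0∞} (hp : Measurable p)
    [SigmaFinite ((volume : Measure ℝ).withDensity p)]
    (r : Fin (m + 1) → ℝ) (c : Fin (n + 1) → ℝ) :
    condLaw ((volume : Measure ℝ).withDensity p) r c =
      (fibInt volume (prodWt fun _ _ => ((volume : Measure ℝ).withDensity p).rnDeriv volume) r c)⁻¹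
        • fib volume (prodWt fun _ _ => ((volume : Measure ℝ).withDensity p).rnDeriv volume) r c := by
  rw [condLaw, if_neg (by simp [baseModel_marginFiber_volume hp]), fiberMeasure_eq_fib,
    fib_univ (measurable_prodWt fun _ _ => Measure.measurable_rnDeriv _ _)]

theorem intCount_pi_singleton {N : ℕ} {x : Fin N → ℝ} (hx : ∀ i, x i ∈ intSubgroup) :
    (Measure.pi fun _ : Fin N => intCount) {x} = 1 := by
  rw [← Set.univ_pi_singleton, Measure.pi_pi]
  refine Finset.prod_eq_one fun i _ => ?_
  obtain ⟨z, hz⟩ := hx i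
  rw [← hz]
  exact intCount_singleton z

/-- For integral margins, the restriction of the base model to the fiber is the fiber measure. -/
theorem lintegral_baseModel_restrict_intCount {p : ℝ → ℝ≥0∞} (hp : Measurable p)
    [SigmaFinite (intCount.withDensity p)] {r : Fin (m + 1) → ℝ} {c : Fin (n + 1) → ℝ}
    (hr : ∀ i, r i ∈ intSubgroup) (hc : ∀ j, c j ∈ intSubgroup) (hrc : ∑ i, r i = ∑ j, c j) :
    (baseModel (intCount.withDensity p) (m + 1) (n + 1)).restrict (marginFiber r c) =
      fib intCount (prodWt fun _ _ => p) r c := by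
  have hP : Measurable (prodWt fun (_ : Fin (m + 1)) (_ : Fin (n + 1)) => p) :=
    measurable_prodWt fun _ _ => hp
  refine Measure.ext_of_lintegral _ fun f hf => ?_
  have hM := measurableSet_marginFiber r c
  have hfi : Measurable ((marginFiber r c).indicator f) := hf.indicator hM
  rw [← lintegral_indicator hM, isLattice_intCount.lintegral_baseModel_withDensity hp hfi]
  have hρ : rowExt (fun i => r i.castSucc) c = r := rowExt_eq r c hrc
  have h1 : ∀ t : (Fin (n + 1) → ℝ) × (Fin m → ℝ),
      ∫⁻ x, (marginFiber r c).indicator f x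
        ∂fib intCount (prodWt fun _ _ => p) (rowExt t.2 t.1) t.1 =
      ({(c, fun i => r i.castSucc)} : Set _).indicator (fun _ =>
        ∫⁻ x, f x ∂fib intCount (prodWt fun _ _ => p) r c) t := by
    intro t
    rw [lintegral_fib hP hfi]
    by_cases ht : t = (c, fun i => r i.castSucc)
    · subst ht
      rw [Set.indicator_of_mem (Set.mem_singleton _), lintegral_fib hP hf]
      simp only [hρ]
      unfold fibInt
      refine lintegral_congr fun y => ?_
      beta_reduce
      rw [Set.indicator_of_mem]
      exact ⟨sum_completion_row r c y hrc, sum_completion_col r c y⟩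
    · rw [Set.indicator_of_notMem (by simpa using ht)]
      unfold fibInt
      refine (lintegral_congr fun y => ?_).trans lintegral_zero
      beta_reduce
      rw [Set.indicator_of_notMem, mul_zero]
      intro hmem
      refine ht ?_
      have hmar : marginMap (completion (rowExt t.2 t.1) t.1 y) = (r, c) := by
        rw [marginFiber_eq (r, c)] at hmem
        exact hmem
      have h2 := (marginMap_completion t.2 t.1 y).symm.trans hmar
      have h3 := congrArg Prod.fst h2
      have h4 := congrArg Prod.snd h2
      simp only at h3 h4
      ext i
      · simp [h4]
      · simp only [← h3, rowExt, Fin.snoc_castSucc]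
  simp_rw [h1]
  rw [lintegral_indicator (measurableSet_singleton _), setLIntegral_const]
  -- For counting measure the parameters of the margin form an atom of mass one, so the restriction
  -- to the fiber is the fiber measure without any normalizing factor.
  have h5 : marginParam intCount m (n + 1) {(c, fun i => r i.castSucc)} = 1 := by
    rw [marginParam, ← Set.singleton_prod_singleton, Measure.prod_prod,
      intCount_pi_singleton hc, intCount_pi_singleton fun i => hr _, one_mul]
  rw [h5, mul_one]

theorem condLaw_intCount {p : ℝ → ℝ≥0∞} (hp : Measurable p)
    [SigmaFinite (intCount.withDensity p)] {r : Fin (m + 1) → ℝ} {c : Fin (n + 1) → ℝ}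
    (hr : ∀ i, r i ∈ intSubgroup) (hc : ∀ j, c j ∈ intSubgroup) (hrc : ∑ i, r i = ∑ j, c j)
    (h0 : fibInt intCount (prodWt fun _ _ => p) r c ≠ 0)
    (h1 : fibInt intCount (prodWt fun _ _ => p) r c ≠ ∞) :
    condLaw (intCount.withDensity p) r c =
      (fibInt intCount (prodWt fun _ _ => p) r c)⁻¹ • fib intCount (prodWt fun _ _ => p) r c := by
  have h2 := lintegral_baseModel_restrict_intCount hp hr hc hrc
  have h3 : baseModel (intCount.withDensity p) (m + 1) (n + 1) (marginFiber r c) =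
      fibInt intCount (prodWt fun _ _ => p) r c := by
    rw [← fib_univ (measurable_prodWt fun _ _ => hp), ← h2, Measure.restrict_apply_univ]
  rw [condLaw, h3, if_pos ⟨h0, h1⟩, ProbabilityTheory.cond, h2, h3]

/-- The exponential moment at `θ` makes almost every fiber integral finite, which is what
normalization requires; the rest is `IsLattice.isMarginDisintegration`. -/
theorem isMarginDisintegration_condLaw {μ : Measure ℝ} [SigmaFinite μ] {θ : ℝ}
    (hθ : θ ∈ tiltDomain μ) (hμ : μ ≪ intCount ∨ μ ≪ volume) {m n : ℕ} (hm : 0 < m)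
    (hn : 0 < n) : IsMarginDisintegration μ m n fun t => condLaw μ t.1 t.2 := by
  obtain ⟨m, rfl⟩ := Nat.exists_eq_succ_of_ne_zero hm.ne'
  obtain ⟨n, rfl⟩ := Nat.exists_eq_succ_of_ne_zero hn.ne'
  have hE := fun E (hE : MeasurableSet E) => measurable_condLaw μ (m := m + 1) (n := n + 1) hE
  have hfin := exists_exp_integrable hθ
  rcases hμ with hμ | hμ
  · have hd : intCount.withDensity (μ.rnDeriv intCount) = μ := Measure.withDensity_rnDeriv_eq _ _ hμ
    have hp := μ.measurable_rnDeriv intCount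
    generalize μ.rnDeriv intCount = p at hd hp
    subst hd
    refine isLattice_intCount.isMarginDisintegration hp _ hE ?_
    have hmem : ∀ᵐ t ∂marginParam intCount m (n + 1),
        (∀ j, t.1 j ∈ intSubgroup) ∧ ∀ i, t.2 i ∈ intSubgroup :=
      (Measure.quasiMeasurePreserving_fst.ae (ae_pi_mem isLattice_intCount.ae_mem _)).and
        (Measure.quasiMeasurePreserving_snd.ae (ae_pi_mem isLattice_intCount.ae_mem _))
    filter_upwards [isLattice_intCount.ae_fibInt_ne_top hp θ hfin, hmem] with t ht htm h0
    refine ⟨ht, condLaw_intCount hp (fun i => ?_) htm.1 (sum_rowExt _ _) h0 ht⟩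
    refine Fin.lastCases ?_ (fun i => ?_) i
    · simp only [rowExt, Fin.snoc_last]
      exact intSubgroup.sub_mem (intSubgroup.sum_mem fun j _ => htm.1 j)
        (intSubgroup.sum_mem fun j _ => htm.2 j)
    · simp only [rowExt, Fin.snoc_castSucc]
      exact htm.2 i
  · have hd : volume.withDensity (μ.rnDeriv volume) = μ := Measure.withDensity_rnDeriv_eq _ _ hμ
    have hp := μ.measurable_rnDeriv volume
    have : SigmaFinite ((volume : Measure ℝ).withDensity (μ.rnDeriv volume)) := by
      rw [hd]
      infer_instance
    have key := isLattice_volume.isMarginDisintegration (m := m) (n := n) hp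
      (fun t => condLaw μ t.1 t.2) hE ?_
    · rwa [hd] at key
    · have h1 := isLattice_volume.ae_fibInt_ne_top (m := m) (n := n) hp θ (by rw [hd]; exact hfin)
      filter_upwards [h1] with t ht _
      refine ⟨ht, ?_⟩
      have := condLaw_volume hp (rowExt t.2 t.1) t.1
      rwa [hd] at this

/-! ### Exponential tilts -/

section tilt
variable {μ : Measure ℝ} {θ : ℝ}

theorem integrable_exp_of_mem (hθ : θ ∈ tiltDomain μ) : Integrable (fun x => Real.exp (θ * x)) μ := by
  have h0 : θ ∈ integrableExpSet id μ := interior_subset hθ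
  exact h0

theorem isOpen_tiltDomain : IsOpen (tiltDomain μ) := isOpen_interior

theorem isProbabilityMeasure_tilt [NeZero μ] (hθ : θ ∈ tiltDomain μ) :
    IsProbabilityMeasure (tilt μ θ) :=
  isProbabilityMeasure_tilted (integrable_exp_of_mem hθ)

theorem hasDerivAt_logPartition (hθ : θ ∈ tiltDomain μ) :
    HasDerivAt (logPartition μ) (tiltMean μ θ) θ :=
  (analyticAt_cgf hθ).differentiableAt.hasDerivAt

theorem exp_logPartition [NeZero μ] (hθ : θ ∈ tiltDomain μ) :
    Real.exp (logPartition μ θ) = ∫ x, Real.exp (θ * x) ∂μ :=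
  exp_cgf (integrable_exp_of_mem hθ)

theorem tilt_eq_withDensity [NeZero μ] (hθ : θ ∈ tiltDomain μ) :
    tilt μ θ = μ.withDensity fun x => ENNReal.ofReal (Real.exp (θ * x - logPartition μ θ)) := by
  rw [tilt, Measure.tilted]
  congr 1
  ext x
  rw [Real.exp_sub, exp_logPartition hθ]

/-- The density of the tilt with respect to `ζ`, for `μ` with density `p`. -/
noncomputable def tiltDens (μ : Measure ℝ) (p : ℝ → ℝ≥0∞) (θ x : ℝ) : ℝ≥0∞ :=
  ENNReal.ofReal (Real.exp (θ * x - logPartition μ θ)) * p x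

theorem measurable_tiltDens {p : ℝ → ℝ≥0∞} (hp : Measurable p) :
    Measurable (tiltDens μ p θ) := by
  unfold tiltDens
  fun_prop

theorem withDensity_tiltDens {ζ : Measure ℝ} {p : ℝ → ℝ≥0∞} (hp : Measurable p)
    (hμ : ζ.withDensity p = μ) [NeZero μ] (hθ : θ ∈ tiltDomain μ) :
    ζ.withDensity (tiltDens μ p θ) = tilt μ θ := by
  rw [tilt_eq_withDensity hθ]
  conv_rhs => rw [← hμ]
  rw [← withDensity_mul ζ hp (by fun_prop), hμ]
  congr 1
  ext x
  exact mul_comm _ _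

theorem lintegral_exp_tilt [NeZero μ] (hθ : θ ∈ tiltDomain μ) {s : ℝ}
    (hs : θ + s ∈ tiltDomain μ) (a : ℝ) :
    ∫⁻ x, ENNReal.ofReal (Real.exp (s * (x - a))) ∂tilt μ θ =
      ENNReal.ofReal (Real.exp (logPartition μ (θ + s) - logPartition μ θ - s * a)) := by
  have h1 : ∀ x, ENNReal.ofReal (Real.exp (θ * x - logPartition μ θ)) *
      ENNReal.ofReal (Real.exp (s * (x - a))) =
      ENNReal.ofReal (Real.exp (-logPartition μ θ - s * a)) *
        ENNReal.ofReal (Real.exp ((θ + s) * x)) := by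
    intro x
    rw [← ENNReal.ofReal_mul (Real.exp_pos _).le, ← ENNReal.ofReal_mul (Real.exp_pos _).le,
      ← Real.exp_add, ← Real.exp_add]
    ring_nf
  rw [tilt_eq_withDensity hθ, lintegral_withDensity_eq_lintegral_mul _ (by fun_prop)
    (by fun_prop)]
  simp only [Pi.mul_apply, h1]
  rw [lintegral_const_mul _ (by fun_prop), ← ofReal_integral_eq_lintegral_ofReal
    (integrable_exp_of_mem hs) (ae_of_all _ fun x => (Real.exp_pos _).le), ← exp_logPartition hs,
    ← ENNReal.ofReal_mul (Real.exp_pos _).le, ← Real.exp_add]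
  ring_nf

theorem integral_tilt (hθ : θ ∈ tiltDomain μ) : ∫ x, x ∂tilt μ θ = tiltMean μ θ :=
  integral_tilted_mul_self (X := id) hθ

theorem integrable_id_tilt (hθ : θ ∈ tiltDomain μ) : Integrable (fun x => x) (tilt μ θ) :=
  memLp_one_iff_integrable.1 (memLp_tilted_mul (X := id) hθ 1)

/-- Tangent lines lie below the log-partition function. -/
theorem tangent_le [NeZero μ] (hθ : θ ∈ tiltDomain μ) {θ' : ℝ} (hθ' : θ' ∈ tiltDomain μ) :
    logPartition μ θ + tiltMean μ θ * (θ' - θ) ≤ logPartition μ θ' := by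
  have := isProbabilityMeasure_tilt hθ
  set z := tiltMean μ θ with hz
  have hs : θ + (θ' - θ) ∈ tiltDomain μ := by simpa using hθ'
  have h1 := lintegral_exp_tilt hθ hs z
  have hlin : Integrable (fun x => (θ' - θ) * (x - z)) (tilt μ θ) :=
    ((integrable_id_tilt hθ).sub (integrable_const z)).const_mul _
  have hexp : Integrable (fun x => Real.exp ((θ' - θ) * (x - z))) (tilt μ θ) := by
    refine ⟨by fun_prop, ?_⟩
    rw [hasFiniteIntegral_iff_ofReal (ae_of_all _ fun x => (Real.exp_pos _).le), h1]
    exact ENNReal.ofReal_lt_top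
  have h3 : ∫ x, ((θ' - θ) * (x - z) + 1) ∂tilt μ θ = 1 := by
    rw [integral_add hlin (integrable_const 1), integral_const_mul,
      integral_sub (integrable_id_tilt hθ) (integrable_const z), integral_tilt hθ]
    simp [z]
  -- Jensen's inequality in the form `1 + x ≤ exp x`: the exponent is centered under the tilt at
  -- `θ`.
  have h2 : 1 ≤ ∫ x, Real.exp ((θ' - θ) * (x - z)) ∂tilt μ θ := by
    rw [← h3]
    exact integral_mono (hlin.add (integrable_const 1)) hexp fun x => Real.add_one_le_exp _
  rw [← ofReal_integral_eq_lintegral_ofReal hexp (ae_of_all _ fun x => (Real.exp_pos _).le),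
    ENNReal.ofReal_eq_ofReal_iff (by linarith) (Real.exp_pos _).le] at h1
  rw [h1, Real.one_le_exp_iff, add_sub_cancel] at h2
  linarith

/-- Quadratic upper bound for the cumulant generating function near `0`. -/
theorem exists_logPartition_le (hθ : θ ∈ tiltDomain μ) :
    ∃ C > 0, ∃ s₀ > 0, ∀ s, |s| ≤ s₀ → θ + s ∈ tiltDomain μ ∧
      logPartition μ (θ + s) - logPartition μ θ - s * tiltMean μ θ ≤ C * s ^ 2 := by
  obtain ⟨q, hq⟩ := analyticAt_cgf hθ
  -- The cumulant generating function is analytic, so its remainder after the linear Taylor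
  -- polynomial is `O(s ^ 2)`.
  have h1 := hq.isBigO_sub_partialSum_pow 2
  obtain ⟨C, hC, hb⟩ := h1.exists_pos
  rw [IsBigOWith] at hb
  have h2 : ∀ᶠ s in 𝓝 (0 : ℝ), θ + s ∈ tiltDomain μ := by
    have : Tendsto (fun s => θ + s) (𝓝 (0 : ℝ)) (𝓝 θ) := by
      have : Continuous fun s : ℝ => θ + s := by fun_prop
      simpa using this.tendsto 0
    exact this.eventually (isOpen_tiltDomain.mem_nhds hθ)
  obtain ⟨ε, hε, h3⟩ := Metric.eventually_nhds_iff.1 (hb.and h2)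
  refine ⟨C, hC, ε / 2, by positivity, fun s hs => ?_⟩
  have h4 := h3 (y := s) (by rw [dist_zero_right, Real.norm_eq_abs]; linarith)
  refine ⟨h4.2, ?_⟩
  have h5 := h4.1
  have hder : q 1 (fun _ => 1) = tiltMean μ θ := hq.hasDerivAt.deriv.symm
  have hq0 : q 0 (fun _ => s) = logPartition μ θ := hq.coeff_zero _
  have hq1 : q 1 (fun _ => s) = s * tiltMean μ θ := by
    rw [← hder]
    simp
  rw [FormalMultilinearSeries.partialSum, Finset.sum_range_succ, Finset.sum_range_one, hq0, hq1,
    Real.norm_eq_abs, norm_pow, norm_norm, Real.norm_eq_abs, sq_abs] at h5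
  have h6 := (le_abs_self _).trans h5
  change logPartition μ (θ + s) - _ ≤ _ at h6
  linarith

theorem exists_mgf_tilt_le [NeZero μ] (hθ : θ ∈ tiltDomain μ) :
    ∃ C > 0, ∃ s₀ > 0, ∀ s, |s| ≤ s₀ →
      ∫⁻ x, ENNReal.ofReal (Real.exp (s * (x - tiltMean μ θ))) ∂tilt μ θ ≤
        ENNReal.ofReal (Real.exp (C * s ^ 2)) := by
  obtain ⟨C, hC, s₀, hs₀, h⟩ := exists_logPartition_le hθ
  refine ⟨C, hC, s₀, hs₀, fun s hs => ?_⟩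
  rw [lintegral_exp_tilt hθ (h s hs).1]
  exact ENNReal.ofReal_le_ofReal (Real.exp_le_exp.2 (h s hs).2)

end tilt

/-- Hoeffding's lemma, with the constant `1/8` relaxed to `1`. -/
theorem lintegral_exp_indicator_le (ν : Measure ℝ) [IsProbabilityMeasure ν] {S : Set ℝ}
    (hS : MeasurableSet S) (s : ℝ) :
    ∫⁻ x, ENNReal.ofReal (Real.exp (s * (S.indicator (fun _ => (1 : ℝ)) x - ν.real S))) ∂ν ≤
      ENNReal.ofReal (Real.exp (s ^ 2)) := by
  have hm : Measurable (S.indicator fun _ => (1 : ℝ)) := measurable_const.indicator hS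
  have h := hasSubgaussianMGF_of_mem_Icc (μ := ν) (a := 0) (b := 1)
    hm.aemeasurable (ae_of_all _ fun x => by
      by_cases hx : x ∈ S <;> simp [hx])
  have hint : ∫ x, S.indicator (fun _ => (1 : ℝ)) x ∂ν = ν.real S := by
    rw [integral_indicator hS]; simp
  rw [hint] at h
  rw [← ofReal_integral_eq_lintegral_ofReal (h.integrable_exp_mul s)
    (ae_of_all _ fun x => (Real.exp_pos _).le)]
  refine ENNReal.ofReal_le_ofReal ((h.mgf_le s).trans (Real.exp_le_exp.2 ?_))
  norm_num
  nlinarith [sq_nonneg s]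

/-! ### Maximum likelihood and typical tables -/

section mle
variable {μ : Measure ℝ} {m n : ℕ} {r : Fin m → ℝ} {c : Fin n → ℝ} {α : Fin m → ℝ} {β : Fin n → ℝ}

theorem logLikelihood_swap (α : Fin m → ℝ) (β : Fin n → ℝ) :
    logLikelihood μ c r β α = logLikelihood μ r c α β := by
  unfold logLikelihood
  rw [Finset.sum_comm, add_comm (∑ i, r i * α i)]
  simp only [add_comm]

theorem IsMLE.swap (h : IsMLE μ r c α β) : IsMLE μ c r β α := by
  refine ⟨fun j i => add_comm (α i) (β j) ▸ h.1 i j, fun β' α' h' => ?_⟩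
  rw [logLikelihood_swap α' β', logLikelihood_swap α β]
  exact h.2 α' β' fun i j => add_comm (β' j) (α' i) ▸ h' j i

/-- First-order condition in the single parameter `α i`: small perturbations remain admissible
because `tiltDomain` is open, so the derivative of the likelihood vanishes. -/
theorem IsMLE.sum_row (h : IsMLE μ r c α β) (i : Fin m) :
    ∑ j, tiltMean μ (α i + β j) = r i := by
  classical
  let e : Fin m → ℝ := fun i' => if i' = i then 1 else 0
  let g : ℝ → ℝ := fun t => logLikelihood μ r c (fun i' => α i' + t * e i') β
  have hd : HasDerivAt g (∑ i', r i' * e i' + 0 -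
      ∑ i', ∑ j, tiltMean μ (α i' + β j) * e i') 0 := by
    have hl : ∀ i', HasDerivAt (fun t : ℝ => α i' + t * e i') (e i') 0 := fun i' => by
      simpa using ((hasDerivAt_id (0 : ℝ)).mul_const (e i')).const_add (α i')
    refine ((HasDerivAt.fun_sum fun i' _ => (hl i').const_mul (r i')).add
      (hasDerivAt_const _ _)).sub (HasDerivAt.fun_sum fun i' _ => HasDerivAt.fun_sum fun j _ => ?_)
    have h1 := hasDerivAt_logPartition (h.1 i' j)
    have h2 := (hl i').add_const (β j)
    refine HasDerivAt.comp (h₂ := logPartition μ) (0 : ℝ) ?_ h2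
    simpa using h1
  have hloc : IsLocalMax g 0 := by
    have hev : ∀ᶠ t in 𝓝 (0 : ℝ), ∀ i' j, (α i' + t * e i') + β j ∈ tiltDomain μ := by
      refine eventually_all.2 fun i' => eventually_all.2 fun j => ?_
      have hc : Continuous fun t : ℝ => (α i' + t * e i') + β j := by fun_prop
      refine hc.continuousAt.eventually (isOpen_tiltDomain.mem_nhds ?_)
      simpa using h.1 i' j
    filter_upwards [hev] with t ht
    have := h.2 _ _ ht
    simpa [g] using this
  have h0 := hloc.hasDerivAt_eq_zero hd
  simp only [e, mul_ite, mul_one, mul_zero, Finset.sum_ite_eq', Finset.mem_univ, if_true,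
    add_zero] at h0
  have h1 : ∑ i', ∑ j, (if i' = i then tiltMean μ (α i' + β j) else 0) =
      ∑ j, tiltMean μ (α i + β j) := by
    rw [Finset.sum_comm]
    simp
  rw [h1] at h0
  linarith

theorem IsMLE.sum_col (h : IsMLE μ r c α β) (j : Fin n) :
    ∑ i, tiltMean μ (α i + β j) = c j := by
  rw [← h.swap.sum_row j]
  simp only [add_comm]

/-- Two parameters with the same mean give the same value of the entropy: the tangent at each of
them, evaluated at the other, gives one inequality. -/
theorem meanEntropy_tiltMean [NeZero μ] {θ : ℝ} (hθ : θ ∈ tiltDomain μ) :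
    meanEntropy μ (tiltMean μ θ) = ((θ * tiltMean μ θ - logPartition μ θ : ℝ) : EReal) := by
  refine le_antisymm (iInf_le_of_le ⟨θ, hθ, rfl⟩ le_rfl) (le_iInf fun θ' => ?_)
  have h := tangent_le θ'.2.1 hθ
  rw [θ'.2.2] at h
  exact EReal.coe_le_coe_iff.2 (by linarith)

/-- Fenchel–Young inequality. -/
theorem le_meanEntropy [NeZero μ] {θ : ℝ} (hθ : θ ∈ tiltDomain μ) (z : ℝ) :
    ((θ * z - logPartition μ θ : ℝ) : EReal) ≤ meanEntropy μ z := by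
  refine le_iInf fun θ' => ?_
  have h := tangent_le θ'.2.1 hθ
  rw [θ'.2.2] at h
  exact EReal.coe_le_coe_iff.2 (by linarith)

/-- Equality case of Fenchel–Young: `θ` then minimizes `ψ(t) - z t`, so the derivative vanishes
there. -/
theorem eq_tiltMean_of_meanEntropy_eq [NeZero μ] {θ z : ℝ} (hθ : θ ∈ tiltDomain μ)
    (h : meanEntropy μ z = ((θ * z - logPartition μ θ : ℝ) : EReal)) : z = tiltMean μ θ := by
  rcases isEmpty_or_nonempty {θ : ℝ // θ ∈ tiltDomain μ ∧ tiltMean μ θ = z} with he | ⟨⟨θ', hθ', rfl⟩⟩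
  · rw [meanEntropy, iInf_of_empty] at h
    exact absurd h.symm (EReal.coe_ne_top _)
  rw [meanEntropy_tiltMean hθ', EReal.coe_eq_coe_iff] at h
  have hloc : IsLocalMin (fun t => logPartition μ t - tiltMean μ θ' * t) θ := by
    filter_upwards [isOpen_tiltDomain.mem_nhds hθ] with t ht
    have := tangent_le hθ' ht
    linarith
  have h0 := hloc.hasDerivAt_eq_zero
    ((hasDerivAt_logPartition hθ).sub ((hasDerivAt_id θ).const_mul (tiltMean μ θ')))
  linarith

/-- Summing Fenchel–Young over the cells with the parameters `α i + β j` bounds the total entropy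
from below by an expression that is linear in the table and so depends on its margin only. The
tilted means attain it, and equality of the sums forces equality in every cell. -/
theorem IsMLE.isTypicalTable [NeZero μ] (h : IsMLE μ r c α β) :
    IsTypicalTable μ r c (fun i j => tiltMean μ (α i + β j)) ∧
      ∀ Z, IsTypicalTable μ r c Z → Z = fun i j => tiltMean μ (α i + β j) := by
  have hcoe : ∀ F : Fin m → Fin n → ℝ, ∑ i, ∑ j, ((F i j : ℝ) : EReal) =
      ((∑ i, ∑ j, F i j : ℝ) : EReal) := by
    intro F
    have hs : ∀ {ι : Type} (s : Finset ι) (f : ι → ℝ),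
        ∑ i ∈ s, ((f i : ℝ) : EReal) = ((∑ i ∈ s, f i : ℝ) : EReal) := fun s f =>
      (map_sum (⟨⟨Real.toEReal, EReal.coe_zero⟩, EReal.coe_add⟩ : ℝ →+ EReal) f s).symm
    simp only [hs]
  have hlin : ∀ x ∈ marginFiber r c, ∑ i, ∑ j, ((α i + β j) * x i j - logPartition μ (α i + β j)) =
      ∑ i, r i * α i + ∑ j, c j * β j - ∑ i, ∑ j, logPartition μ (α i + β j) := by
    intro x hx
    have h1 : ∑ i, ∑ j, β j * x i j = ∑ j, c j * β j := by
      rw [Finset.sum_comm]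
      refine Finset.sum_congr rfl fun j _ => ?_
      rw [← Finset.mul_sum, hx.2 j, mul_comm]
    have h2 : ∑ i, ∑ j, α i * x i j = ∑ i, r i * α i := by
      refine Finset.sum_congr rfl fun i _ => ?_
      rw [← Finset.mul_sum, hx.1 i, mul_comm]
    simp only [add_mul, Finset.sum_sub_distrib, Finset.sum_add_distrib, h1, h2]
  have hZ : (fun i j => tiltMean μ (α i + β j)) ∈ marginFiber r c := ⟨h.sum_row, h.sum_col⟩
  have hval : ∑ i, ∑ j, meanEntropy μ (tiltMean μ (α i + β j)) =
      ((∑ i, r i * α i + ∑ j, c j * β j - ∑ i, ∑ j, logPartition μ (α i + β j) : ℝ) : EReal) := by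
    rw [← hlin _ hZ, ← hcoe]
    exact Finset.sum_congr rfl fun i _ => Finset.sum_congr rfl fun j _ =>
      meanEntropy_tiltMean (h.1 i j)
  refine ⟨⟨hZ, ?_, fun Z' hZ' => ?_⟩, fun Z' hZ' => ?_⟩
  · rw [hval]
    exact EReal.coe_ne_top _
  · rw [hval, ← hlin _ hZ', ← hcoe]
    exact Finset.sum_le_sum fun i _ => Finset.sum_le_sum fun j _ => le_meanEntropy (h.1 i j) _
  · have hle := hZ'.2.2 _ hZ
    have hnt := hZ'.2.1
    simp only [hval] at hle
    rw [← Finset.sum_product' Finset.univ Finset.univ fun i j => meanEntropy μ (Z' i j)] at hnt hle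
    -- Infinite values have to be excluded before the sums can be compared in the reals: no cell is
    -- `⊥` by Fenchel–Young, and therefore a cell equal to `⊤` would make the whole sum `⊤`.
    have hbot : ∀ i j, meanEntropy μ (Z' i j) ≠ ⊥ := fun i j hb => by
      have := le_meanEntropy (h.1 i j) (Z' i j)
      rw [hb, le_bot_iff] at this
      exact EReal.coe_ne_bot _ this
    have htop : ∀ i j, meanEntropy μ (Z' i j) ≠ ⊤ := by
      intro i j ht
      apply hnt
      rw [← Finset.add_sum_erase _ _ (Finset.mk_mem_product (Finset.mem_univ i)
        (Finset.mem_univ j)), ht]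
      refine EReal.top_add_of_ne_bot fun hb => ?_
      have hs : ∀ s : Finset (Fin m × Fin n), ∑ x ∈ s, meanEntropy μ (Z' x.1 x.2) ≠ ⊥ := by
        intro s
        induction s using Finset.cons_induction with
        | empty => simp
        | cons a s ha ih =>
          rw [Finset.sum_cons, Ne, EReal.add_eq_bot_iff, not_or]
          exact ⟨hbot _ _, ih⟩
      exact hs _ hb
    choose d hd using fun i j => (⟨_, (EReal.coe_toReal (htop i j) (hbot i j)).symm⟩ :
      ∃ d : ℝ, meanEntropy μ (Z' i j) = d)
    rw [Finset.sum_product' Finset.univ Finset.univ fun i j => meanEntropy μ (Z' i j)] at hle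
    simp only [hd] at hle
    rw [hcoe, EReal.coe_le_coe_iff, ← hlin _ hZ'.1] at hle
    have hterm : ∀ i j, (α i + β j) * Z' i j - logPartition μ (α i + β j) ≤
        d i j := fun i j => by
      rw [← EReal.coe_le_coe_iff, ← hd]
      exact le_meanEntropy (h.1 i j) _
    have heq : ∑ i, ∑ j, ((α i + β j) * Z' i j - logPartition μ (α i + β j)) =
        ∑ i, ∑ j, d i j :=
      le_antisymm (Finset.sum_le_sum fun i _ => Finset.sum_le_sum fun j _ => hterm i j) hle
    ext i j
    have h1 := (Finset.sum_eq_sum_iff_of_le fun i _ => Finset.sum_le_sum fun j _ =>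
      hterm i j).1 heq i (Finset.mem_univ i)
    have h2 := (Finset.sum_eq_sum_iff_of_le fun j _ => hterm i j).1 h1 j (Finset.mem_univ j)
    exact eq_tiltMean_of_meanEntropy_eq (h.1 i j) (by rw [h2, hd])

end mle

/-! ### Tame means lie strictly between points of the support -/

section range
variable {μ : Measure ℝ} {δ z : ℝ}

theorem InTameRange.lowerEnd_lt (hδ : 0 < δ) (h : InTameRange μ δ z) : lowerEnd μ < z := by
  by_contra! hc
  have h1 : lowerEnd μ + (δ : EReal) ≤ z := (le_max_left _ _).trans h.1
  have h2 : ((z + δ : ℝ) : EReal) ≤ z := by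
    rw [EReal.coe_add]
    exact (add_le_add_left hc _).trans h1
  rw [EReal.coe_le_coe_iff] at h2
  linarith

theorem InTameRange.lt_upperEnd (hδ : 0 < δ) (h : InTameRange μ δ z) : (z : EReal) < upperEnd μ := by
  by_contra! hc
  have h1 : (z : EReal) ≤ upperEnd μ - (δ : EReal) := h.2.trans (min_le_left _ _)
  have h2 : (z : EReal) ≤ ((z - δ : ℝ) : EReal) := by
    rw [EReal.coe_sub]
    exact h1.trans (EReal.sub_le_sub hc le_rfl)
  rw [EReal.coe_le_coe_iff] at h2
  linarith

theorem InTameRange.exists_lt (hδ : 0 < δ) (h : InTameRange μ δ z) : ∃ x ∈ μ.support, x < z := by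
  obtain ⟨_, ⟨x, hx, rfl⟩, hxz⟩ := sInf_lt_iff.1 (h.lowerEnd_lt hδ)
  exact ⟨x, hx, EReal.coe_lt_coe_iff.1 hxz⟩

theorem InTameRange.exists_gt (hδ : 0 < δ) (h : InTameRange μ δ z) : ∃ x ∈ μ.support, z < x := by
  obtain ⟨_, ⟨x, hx, rfl⟩, hxz⟩ := lt_sSup_iff.1 (h.lt_upperEnd hδ)
  exact ⟨x, hx, EReal.coe_lt_coe_iff.1 hxz⟩

theorem InTameRange.neZero (hδ : 0 < δ) (h : InTameRange μ δ z) : NeZero μ := by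
  refine ⟨fun h0 => ?_⟩
  obtain ⟨x, hx, -⟩ := h.exists_lt hδ
  simp [h0] at hx

end range

/-! ### Almost everywhere properties of completions -/

section ae
variable {ζ : Measure ℝ} [SigmaFinite ζ] {Γ : AddSubgroup ℝ}

/-- The change of variables `mp_snoc` turns the sum into a coordinate. The same device, with
`mp_chart`, handles column sums and totals. -/
theorem IsLattice.qmp_sum (h : IsLattice ζ Γ) (n : ℕ) :
    Measure.QuasiMeasurePreserving (fun v : Fin (n + 1) → ℝ => ∑ j, v j)
      (Measure.pi fun _ => ζ) ζ := by
  refine ⟨by fun_prop, ?_⟩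
  rw [← (h.mp_snoc n).map_eq, Measure.map_map (by fun_prop) (h.mp_snoc n).measurable]
  have : ((fun v : Fin (n + 1) → ℝ => ∑ j, v j) ∘ fun p : (Fin n → ℝ) × ℝ =>
      (Fin.snoc p.1 (p.2 - ∑ j, p.1 j) : Fin (n + 1) → ℝ)) = Prod.snd := by
    ext p
    simp [Fin.sum_univ_castSucc]
  rw [this]
  exact Measure.quasiMeasurePreserving_snd.absolutelyContinuous

theorem IsLattice.qmp_col (h : IsLattice ζ Γ) (m n : ℕ) (j : Fin (n + 1)) :
    Measure.QuasiMeasurePreserving (fun y : Fin (m + 1) → Fin (n + 1) → ℝ => ∑ i, y i j)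
      (baseModel ζ (m + 1) (n + 1)) ζ := by
  refine ⟨by fun_prop, ?_⟩
  rw [← (h.mp_chart m n).map_eq, Measure.map_map (by fun_prop) (h.mp_chart m n).measurable]
  have : ((fun y : Fin (m + 1) → Fin (n + 1) → ℝ => ∑ i, y i j) ∘
      fun p : ((Fin m → Fin n → ℝ) × (Fin m → ℝ)) × (Fin (n + 1) → ℝ) =>
        completion (rowExt p.1.2 p.2) p.2 p.1.1) =
      (fun c : Fin (n + 1) → ℝ => c j) ∘ Prod.snd := by
    ext p
    exact sum_completion_col _ _ _ j
  rw [this]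
  exact ((Measure.quasiMeasurePreserving_eval (fun _ => ζ) j).comp
    Measure.quasiMeasurePreserving_snd).absolutelyContinuous

theorem IsLattice.qmp_total (h : IsLattice ζ Γ) (m n : ℕ) :
    Measure.QuasiMeasurePreserving (fun y : Fin (m + 1) → Fin (n + 1) → ℝ => ∑ i, ∑ j, y i j)
      (baseModel ζ (m + 1) (n + 1)) ζ := by
  refine ⟨by fun_prop, ?_⟩
  rw [← (h.mp_chart m n).map_eq, Measure.map_map (by fun_prop) (h.mp_chart m n).measurable]
  have : ((fun y : Fin (m + 1) → Fin (n + 1) → ℝ => ∑ i, ∑ j, y i j) ∘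
      fun p : ((Fin m → Fin n → ℝ) × (Fin m → ℝ)) × (Fin (n + 1) → ℝ) =>
        completion (rowExt p.1.2 p.2) p.2 p.1.1) =
      (fun c : Fin (n + 1) → ℝ => ∑ j, c j) ∘ Prod.snd := by
    ext p
    simp only [Function.comp_apply]
    rw [Finset.sum_comm]
    exact Finset.sum_congr rfl fun j _ => sum_completion_col _ _ _ j
  rw [this]
  exact ((h.qmp_sum n).comp Measure.quasiMeasurePreserving_snd).absolutelyContinuous

/-- Every entry of a completion is a nonsingular function of the free entries, so almost sure
properties of densities may be used on each individual fiber. Two rows and two columns are needed: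
otherwise the sums are empty and the completed entries are constants, which may fall into the null
set. -/
theorem IsLattice.ae_completion (h : IsLattice ζ Γ) {m n : ℕ} {r : Fin (m + 2) → ℝ}
    {c : Fin (n + 2) → ℝ} (hr : ∀ i, r i ∈ Γ) (hc : ∀ j, c j ∈ Γ)
    {Q : Fin (m + 2) → Fin (n + 2) → ℝ → Prop} (hQ : ∀ i j, ∀ᵐ x ∂ζ, Q i j x) :
    ∀ᵐ y ∂baseModel ζ (m + 1) (n + 1), ∀ i j, Q i j (completion r c y i j) := by
  refine ae_all_iff.2 fun i => ae_all_iff.2 fun j => ?_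
  have hrow : ∀ i, Measure.QuasiMeasurePreserving (fun y : Fin (m + 1) → Fin (n + 1) → ℝ => y i)
      (baseModel ζ (m + 1) (n + 1)) (Measure.pi fun _ => ζ) := fun i =>
    Measure.quasiMeasurePreserving_eval (fun _ => Measure.pi fun _ => ζ) i
  induction i using Fin.lastCases with
  | cast i =>
    induction j using Fin.lastCases with
    | cast j =>
      simp only [completion_castSucc_castSucc]
      exact ((Measure.quasiMeasurePreserving_eval (fun _ => ζ) j).comp (hrow i)).ae (hQ _ _)
    | last =>
      simp only [completion_castSucc_last]
      exact ((h.mp _ (hr i.castSucc)).quasiMeasurePreserving.comp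
        ((h.qmp_sum n).comp (hrow i))).ae (hQ _ _)
  | last =>
    induction j using Fin.lastCases with
    | cast j =>
      simp only [completion_last_castSucc]
      exact ((h.mp _ (hc j.castSucc)).quasiMeasurePreserving.comp (h.qmp_col m n j)).ae (hQ _ _)
    | last =>
      simp only [completion_last_last]
      have ha : -∑ i : Fin (m + 1), r i.castSucc + c (Fin.last (n + 1)) ∈ Γ :=
        add_mem (neg_mem (sum_mem fun i _ => hr _)) (hc _)
      have := ((h.mp_add ha).quasiMeasurePreserving.comp (h.qmp_total m n)).ae (hQ (Fin.last _) (Fin.last _))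
      filter_upwards [this] with y hy
      have hy' : Q (Fin.last (m + 1)) (Fin.last (n + 1))
        (∑ i, ∑ j, y i j + (-∑ i : Fin (m + 1), r i.castSucc + c (Fin.last (n + 1)))) := hy
      rwa [← add_assoc, ← sub_eq_add_neg] at hy'

theorem IsLattice.fib_congr (h : IsLattice ζ Γ) {m n : ℕ} {r : Fin (m + 2) → ℝ}
    {c : Fin (n + 2) → ℝ} (hr : ∀ i, r i ∈ Γ) (hc : ∀ j, c j ∈ Γ)
    {f g : Fin (m + 2) → Fin (n + 2) → ℝ → ℝ≥0∞} (hfg : ∀ i j, f i j =ᵐ[ζ] g i j) :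
    fib ζ (prodWt f) r c = fib ζ (prodWt g) r c := by
  unfold fib
  congr 1
  refine withDensity_congr_ae ?_
  filter_upwards [h.ae_completion hr hc hfg] with y hy
  exact Finset.prod_congr rfl fun i _ => Finset.prod_congr rfl fun j _ => hy i j

theorem IsLattice.fibInt_congr (h : IsLattice ζ Γ) {m n : ℕ} {r : Fin (m + 2) → ℝ}
    {c : Fin (n + 2) → ℝ} (hr : ∀ i, r i ∈ Γ) (hc : ∀ j, c j ∈ Γ)
    {f g : Fin (m + 2) → Fin (n + 2) → ℝ → ℝ≥0∞} (hfg : ∀ i j, f i j =ᵐ[ζ] g i j) :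
    fibInt ζ (prodWt f) r c = fibInt ζ (prodWt g) r c := by
  refine lintegral_congr_ae ?_
  filter_upwards [h.ae_completion hr hc hfg] with y hy
  exact Finset.prod_congr rfl fun i _ => Finset.prod_congr rfl fun j _ => hy i j

end ae

/-! ### Symmetries of fiber integrals -/

section symm
variable {ζ : Measure ℝ} [SigmaFinite ζ] {m n : ℕ}

theorem completion_transpose {r : Fin (m + 1) → ℝ} {c : Fin (n + 1) → ℝ}
    (hrc : ∑ i, r i = ∑ j, c j) (y : Fin m → Fin n → ℝ) :
    completion c r (fun j i => y i j) = fun j i => completion r c y i j := by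
  rw [← completion_restrict (r := c) (c := r) (fun j i => completion r c y i j)
    (fun j => sum_completion_col r c y j) (fun i => sum_completion_row r c y hrc i)]
  simp only [completion_castSucc_castSucc]

theorem mp_reindex {ι : Type*} [Fintype ι] {β : Type*} [MeasurableSpace β] (ν : Measure β)
    [SigmaFinite ν] {κ : Type*} [Fintype κ] (e : κ ≃ ι) :
    MeasurePreserving (fun (y : ι → β) i => y (e i)) (Measure.pi fun _ => ν)
      (Measure.pi fun _ => ν) :=
  measurePreserving_arrowCongr' (fun _ => ν) (fun _ => ν) e.symm (MeasurableEquiv.refl β)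
    fun _ => MeasurePreserving.id ν

theorem mp_transpose (ζ : Measure ℝ) [SigmaFinite ζ] (m n : ℕ) :
    MeasurePreserving (fun (y : Fin m → Fin n → ℝ) j i => y i j)
      (baseModel ζ m n) (baseModel ζ n m) := by
  have h1 := (measurePreserving_curry fun (_ : Fin m) (_ : Fin n) => ζ).symm
  have h2 := mp_reindex ζ (Equiv.prodComm (Fin n) (Fin m))
  have h3 := measurePreserving_curry fun (_ : Fin n) (_ : Fin m) => ζ
  exact h3.comp (h2.comp h1)

theorem fibInt_transpose {F : (Fin (m + 1) → Fin (n + 1) → ℝ) → ℝ≥0∞} (hF : Measurable F)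
    {r : Fin (m + 1) → ℝ} {c : Fin (n + 1) → ℝ} (hrc : ∑ i, r i = ∑ j, c j) :
    fibInt ζ (fun x => F fun i j => x j i) c r = fibInt ζ F r c := by
  unfold fibInt
  have hm : Measurable fun y : Fin n → Fin m → ℝ => F fun i j => completion c r y j i :=
    hF.comp (measurable_pi_lambda _ fun i => measurable_pi_lambda _ fun j =>
      (measurable_pi_apply i).comp ((measurable_pi_apply j).comp (measurable_completion_right c r)))
  have := (mp_transpose ζ m n).lintegral_comp hm
  refine this.symm.trans (lintegral_congr fun y => ?_)
  exact (congrArg (fun z : Fin (n + 1) → Fin (m + 1) → ℝ => F fun i j => z j i)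
    (completion_transpose hrc y))

/-- The chart singles out the last row and column, so only exchanges of the other rows act on it by
permuting coordinates. -/
theorem completion_swap (r : Fin (m + 1) → ℝ) (c : Fin (n + 1) → ℝ) (y : Fin m → Fin n → ℝ)
    (a b : Fin m) :
    completion (fun i => r (Equiv.swap a.castSucc b.castSucc i)) c (fun i => y (Equiv.swap a b i)) =
      fun i => completion r c y (Equiv.swap a.castSucc b.castSucc i) := by
  have h1 : ∀ i : Fin m, Equiv.swap a.castSucc b.castSucc i.castSucc =
      (Equiv.swap a b i).castSucc := fun i => (Fin.castSucc_injective m).swap_apply a b i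
  have h2 : Equiv.swap a.castSucc b.castSucc (Fin.last m) = Fin.last m :=
    Equiv.swap_apply_of_ne_of_ne (Fin.castSucc_lt_last a).ne' (Fin.castSucc_lt_last b).ne'
  ext i j
  induction i using Fin.lastCases with
  | cast i =>
    rw [h1]
    induction j using Fin.lastCases with
    | cast j => simp only [completion_castSucc_castSucc]
    | last => simp only [completion_castSucc_last, h1]
  | last =>
    rw [h2]
    induction j using Fin.lastCases with
    | cast j =>
      simp only [completion_last_castSucc]
      rw [Equiv.sum_comp (Equiv.swap a b) fun i => y i j]
    | last =>
      simp only [completion_last_last, h1]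
      rw [Equiv.sum_comp (Equiv.swap a b) fun i => ∑ j, y i j,
        Equiv.sum_comp (Equiv.swap a b) fun i => r i.castSucc]

theorem fibInt_swap {F : (Fin (m + 1) → Fin (n + 1) → ℝ) → ℝ≥0∞} (hF : Measurable F)
    (r : Fin (m + 1) → ℝ) (c : Fin (n + 1) → ℝ) (a b : Fin m) :
    fibInt ζ (fun x => F fun i => x (Equiv.swap a.castSucc b.castSucc i)) r c =
      fibInt ζ F (fun i => r (Equiv.swap a.castSucc b.castSucc i)) c := by
  unfold fibInt
  have hmp := mp_reindex (Measure.pi fun _ : Fin n => ζ) (Equiv.swap a b)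
  have hm : Measurable fun y : Fin m → Fin n → ℝ =>
      F (completion (fun i => r (Equiv.swap a.castSucc b.castSucc i)) c y) :=
    hF.comp (measurable_completion_right _ _)
  refine Eq.trans (lintegral_congr fun y => ?_) (hmp.lintegral_comp hm)
  exact (congrArg F (completion_swap r c y a b)).symm

end symm

/-! ### The law of an entry of the conditioned matrix -/

section entry
variable {ζ : Measure ℝ} [SigmaFinite ζ] {Γ : AddSubgroup ℝ} {m n : ℕ}

/-- The last row has `n + 2` cells and the last column `m + 1` further ones. Bounding these `m + n +
3` determined cells by `M` leaves exactly the product density of the free entries, so events that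
are rare under independence have small mass on the fiber. -/
theorem IsLattice.fibInt_indicator_le (h : IsLattice ζ Γ) {r : Fin (m + 2) → ℝ}
    {c : Fin (n + 2) → ℝ} (hr : ∀ i, r i ∈ Γ) (hc : ∀ j, c j ∈ Γ)
    {f : Fin (m + 2) → Fin (n + 2) → ℝ → ℝ≥0∞} (hf : ∀ i j, Measurable (f i j))
    [∀ i j, SigmaFinite (ζ.withDensity (f i j))] {M : ℝ≥0} (hM : ∀ i j, ∀ᵐ x ∂ζ, f i j x ≤ M)
    {E : Set (Fin (m + 1) → Fin (n + 1) → ℝ)} (hE : MeasurableSet E) :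
    ∫⁻ y, prodWt f (completion r c y) * E.indicator 1 y ∂baseModel ζ (m + 1) (n + 1) ≤
      M ^ (m + n + 3) * Measure.pi (fun i : Fin (m + 1) => Measure.pi fun j : Fin (n + 1) =>
        ζ.withDensity (f i.castSucc j.castSucc)) E := by
  have hg : Measurable (prodWt fun (i : Fin (m + 1)) (j : Fin (n + 1)) => f i.castSucc j.castSucc) :=
    measurable_prodWt fun i j => hf _ _
  have := pi_pi_withDensity (ζ := ζ) (fun (i : Fin (m + 1)) (j : Fin (n + 1)) =>
    f i.castSucc j.castSucc) fun i j => hf _ _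
  rw [this, withDensity_apply _ hE, ← lintegral_indicator hE,
    ← lintegral_const_mul _ (hg.indicator hE)]
  refine lintegral_mono_ae ?_
  filter_upwards [h.ae_completion hr hc hM] with y hy
  by_cases hyE : y ∈ E
  · have hrow : ∏ i : Fin (m + 1), ∏ j, f i.castSucc j (completion r c y i.castSucc j) ≤
        ∏ i : Fin (m + 1), ((∏ j : Fin (n + 1), f i.castSucc j.castSucc (y i j)) * M) := by
      refine Finset.prod_le_prod' fun i _ => ?_
      rw [Fin.prod_univ_castSucc]
      simp only [completion_castSucc_castSucc]
      exact mul_le_mul_right (hy _ _) _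
    have hlast : ∏ j, f (Fin.last (m + 1)) j (completion r c y (Fin.last (m + 1)) j) ≤
        (M : ℝ≥0∞) ^ (n + 2) := by
      calc _ ≤ ∏ _j : Fin (n + 2), (M : ℝ≥0∞) := Finset.prod_le_prod' fun j _ => hy _ _
        _ = _ := by simp
    rw [Set.indicator_of_mem hyE, Set.indicator_of_mem hyE, Pi.one_apply, mul_one, prodWt,
      Fin.prod_univ_castSucc]
    refine (mul_le_mul' hrow hlast).trans_eq ?_
    rw [Finset.prod_mul_distrib, prodWt, Finset.prod_const, Finset.card_univ, Fintype.card_fin]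
    ring
  · simp [hyE]

/-- The exponent per cell is `s ^ 2 - s t`, which is minimal at `s = t / 2` with value `-t ^ 2 / 4`;
the factor `2` accounts for the two signs. -/
theorem pi_pi_chernoff {ν : Measure ℝ} [IsProbabilityMeasure ν]
    {N : Fin m → Fin n → Measure ℝ} [∀ i j, IsProbabilityMeasure (N i j)] (I : Finset (Fin m))
    (J : Finset (Fin n)) (hN : ∀ i ∈ I, ∀ j ∈ J, N i j = ν) {S : Set ℝ} (hS : MeasurableSet S)
    {t : ℝ} (ht : 0 < t) :
    Measure.pi (fun i => Measure.pi fun j => N i j)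
      {y | t * (I.card * J.card) ≤
        |∑ i ∈ I, ∑ j ∈ J, (S.indicator (fun _ => (1 : ℝ)) (y i j) - ν.real S)|} ≤
      ENNReal.ofReal (2 * Real.exp (-(t ^ 2 * (I.card * J.card) / 4))) := by
  have hmi : Measurable (S.indicator fun _ => (1 : ℝ)) := measurable_const.indicator hS
  have hone : ∀ s : ℝ, s ^ 2 = (t / 2) ^ 2 →
      Measure.pi (fun i => Measure.pi fun j => N i j)
      {y | (t ^ 2 / 2) * (I.card * J.card) ≤
        s * ∑ i ∈ I, ∑ j ∈ J, (S.indicator (fun _ => (1 : ℝ)) (y i j) - ν.real S)} ≤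
      ENNReal.ofReal (Real.exp (-(t ^ 2 * (I.card * J.card) / 4))) := by
    intro s hs
    rw [← (measurePreserving_curry N).measure_preimage_equiv]
    have h1 := pi_chernoff (fun e : Fin m × Fin n => N e.1 e.2) (I ×ˢ J)
      (fun _ x => S.indicator (fun _ => (1 : ℝ)) x - ν.real S) (fun _ => hmi.sub_const _)
      s 1 ((t ^ 2 / 2) * (I.card * J.card)) (fun e he => by
        rw [Finset.mem_product] at he
        rw [hN _ he.1 _ he.2, one_mul]
        exact lintegral_exp_indicator_le ν hS s)
    refine (measure_mono ?_).trans (h1.trans (ENNReal.ofReal_le_ofReal (Real.exp_le_exp.2 ?_)))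
    · intro x hx
      simp only [Set.mem_preimage, Set.mem_ofPred_eq] at hx ⊢
      rw [Finset.sum_product]
      exact hx
    · rw [Finset.card_product, hs]
      push_cast
      nlinarith
  have hsub : {y : Fin m → Fin n → ℝ | t * (I.card * J.card) ≤
        |∑ i ∈ I, ∑ j ∈ J, (S.indicator (fun _ => (1 : ℝ)) (y i j) - ν.real S)|} ⊆
      {y | (t ^ 2 / 2) * (I.card * J.card) ≤
        t / 2 * ∑ i ∈ I, ∑ j ∈ J, (S.indicator (fun _ => (1 : ℝ)) (y i j) - ν.real S)} ∪
      {y | (t ^ 2 / 2) * (I.card * J.card) ≤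
        -(t / 2) * ∑ i ∈ I, ∑ j ∈ J, (S.indicator (fun _ => (1 : ℝ)) (y i j) - ν.real S)} := by
    intro y hy
    simp only [Set.mem_union, Set.mem_ofPred_eq] at hy ⊢
    rcases le_abs.1 hy with h1 | h1
    · left; nlinarith
    · right; nlinarith
  refine (measure_mono hsub).trans ((measure_union_le _ _).trans ?_)
  rw [two_mul, ENNReal.ofReal_add (Real.exp_pos _).le (Real.exp_pos _).le]
  exact add_le_add (hone _ rfl) (hone _ (by ring))

/-- Permuting a row within a block of identical rows does not change the fiber measure. -/
theorem fib_entry_row {r : Fin (m + 1) → ℝ} {c : Fin (n + 1) → ℝ}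
    {f : Fin (m + 1) → Fin (n + 1) → ℝ → ℝ≥0∞} (hf : ∀ i j, Measurable (f i j)) {a b : Fin m}
    (hr : r a.castSucc = r b.castSucc) (hfab : f a.castSucc = f b.castSucc) (j : Fin (n + 1))
    {S : Set ℝ} (hS : MeasurableSet S) :
    fib ζ (prodWt f) r c {x | x a.castSucc j ∈ S} =
      fib ζ (prodWt f) r c {x | x b.castSucc j ∈ S} := by
  classical
  have hm : ∀ i : Fin (m + 1), MeasurableSet {x : Fin (m + 1) → Fin (n + 1) → ℝ | x i j ∈ S} :=
    fun i => hS.preimage ((measurable_pi_apply j).comp (measurable_pi_apply i))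
  rw [fib_apply (measurable_prodWt hf) (hm _), fib_apply (measurable_prodWt hf) (hm _)]
  have hr' : (fun i => r (Equiv.swap a.castSucc b.castSucc i)) = r := by
    ext i
    rw [Equiv.swap_apply_def]
    split_ifs with h1 h2
    · rw [h1, hr]
    · rw [h2, hr]
    · rfl
  have hf' : ∀ i, f (Equiv.swap a.castSucc b.castSucc i) = f i := by
    intro i
    rw [Equiv.swap_apply_def]
    split_ifs with h1 h2
    · rw [h1, hfab]
    · rw [h2, hfab]
    · rfl
  have h := fibInt_swap (ζ := ζ) (F := fun x => prodWt f x *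
    {x : Fin (m + 1) → Fin (n + 1) → ℝ | x a.castSucc j ∈ S}.indicator 1 x)
    ((measurable_prodWt hf).mul (measurable_one.indicator (hm _))) r c a b
  rw [hr'] at h
  rw [← h]
  congr 1
  ext x
  congr 1
  · unfold prodWt
    rw [← Equiv.prod_comp (Equiv.swap a.castSucc b.castSucc)]
    exact Finset.prod_congr rfl fun i _ => Finset.prod_congr rfl fun j _ => by rw [hf']; simp
  · simp only [Set.indicator_apply, Set.mem_ofPred_eq, Equiv.swap_apply_left,
      Pi.one_apply]

theorem fib_entry_col {r : Fin (m + 1) → ℝ} {c : Fin (n + 1) → ℝ} (hrc : ∑ i, r i = ∑ j, c j)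
    {f : Fin (m + 1) → Fin (n + 1) → ℝ → ℝ≥0∞} (hf : ∀ i j, Measurable (f i j)) {a b : Fin n}
    (hc : c a.castSucc = c b.castSucc) (hfab : ∀ i, f i a.castSucc = f i b.castSucc)
    (i : Fin (m + 1)) {S : Set ℝ} (hS : MeasurableSet S) :
    fib ζ (prodWt f) r c {x | x i a.castSucc ∈ S} =
      fib ζ (prodWt f) r c {x | x i b.castSucc ∈ S} := by
  have key : ∀ j : Fin (n + 1), fib ζ (prodWt f) r c {x | x i j ∈ S} =
      fib ζ (prodWt fun j i => f i j) c r {x | x j i ∈ S} := by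
    intro j
    have hm : MeasurableSet {x : Fin (m + 1) → Fin (n + 1) → ℝ | x i j ∈ S} :=
      hS.preimage ((measurable_pi_apply j).comp (measurable_pi_apply i))
    have hm' : MeasurableSet {x : Fin (n + 1) → Fin (m + 1) → ℝ | x j i ∈ S} :=
      hS.preimage ((measurable_pi_apply i).comp (measurable_pi_apply j))
    rw [fib_apply (measurable_prodWt hf) hm,
      fib_apply (measurable_prodWt fun j i => hf i j) hm', ← fibInt_transpose _ hrc]
    · congr 1
      ext x
      congr 1
      exact Finset.prod_comm
    · exact (measurable_prodWt hf).mul (measurable_one.indicator hm)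
  rw [key, key]
  exact fib_entry_row (fun j i => hf i j) hc (funext fun i => hfab i) i hS

/-- The law of an entry in a large block of exchangeable entries of the conditioned matrix is close
to the unconditioned one, unless the fiber has very small density. -/
theorem IsLattice.abs_entry_sub_le (h : IsLattice ζ Γ) {r : Fin (m + 2) → ℝ}
    {c : Fin (n + 2) → ℝ} (hr : ∀ i, r i ∈ Γ) (hc : ∀ j, c j ∈ Γ) (hrc : ∑ i, r i = ∑ j, c j)
    {f : Fin (m + 2) → Fin (n + 2) → ℝ → ℝ≥0∞} (hf : ∀ i j, Measurable (f i j))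
    [∀ i j, IsProbabilityMeasure (ζ.withDensity (f i j))] {M : ℝ≥0}
    (hM : ∀ i j, ∀ᵐ x ∂ζ, f i j x ≤ M) {I : Finset (Fin (m + 1))} {J : Finset (Fin (n + 1))}
    {i₀ : Fin (m + 1)} {j₀ : Fin (n + 1)} (hi₀ : i₀ ∈ I) (hj₀ : j₀ ∈ J)
    (hrI : ∀ i ∈ I, r i.castSucc = r i₀.castSucc) (hcJ : ∀ j ∈ J, c j.castSucc = c j₀.castSucc)
    (hfI : ∀ i ∈ I, f i.castSucc = f i₀.castSucc)
    (hfJ : ∀ i, ∀ j ∈ J, f i j.castSucc = f i j₀.castSucc)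
    (h0 : fibInt ζ (prodWt f) r c ≠ 0) (h1 : fibInt ζ (prodWt f) r c ≠ ∞) {S : Set ℝ}
    (hS : MeasurableSet S) {t : ℝ} (ht : 0 < t) :
    |((fibInt ζ (prodWt f) r c)⁻¹ • fib ζ (prodWt f) r c).real {x | x i₀.castSucc j₀.castSucc ∈ S} -
      (ζ.withDensity (f i₀.castSucc j₀.castSucc)).real S| ≤
      t + 2 * M ^ (m + n + 3) * Real.exp (-(t ^ 2 * (I.card * J.card) / 4)) /
        (fibInt ζ (prodWt f) r c).toReal := by
  classical
  set Φ := fibInt ζ (prodWt f) r c with hΦ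
  set lam := Φ⁻¹ • fib ζ (prodWt f) r c with hlam
  set ν := ζ.withDensity (f i₀.castSucc j₀.castSucc) with hν
  have hpw := measurable_prodWt hf
  have hprob : IsProbabilityMeasure lam := ⟨by
    rw [hlam, Measure.smul_apply, fib_univ hpw, smul_eq_mul]
    exact ENNReal.inv_mul_cancel h0 h1⟩
  have hmS : ∀ (i : Fin (m + 1)) (j : Fin (n + 1)),
      MeasurableSet {x : Fin (m + 2) → Fin (n + 2) → ℝ | x i.castSucc j.castSucc ∈ S} :=
    fun i j => hS.preimage ((measurable_pi_apply _).comp (measurable_pi_apply _))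
  have hex : ∀ i ∈ I, ∀ j ∈ J, lam.real {x | x i.castSucc j.castSucc ∈ S} =
      lam.real {x | x i₀.castSucc j₀.castSucc ∈ S} := by
    intro i hi j hj
    simp only [measureReal_def, hlam, Measure.smul_apply]
    rw [fib_entry_row hf (hrI i hi) (hfI i hi) _ hS,
      fib_entry_col hrc hf (hcJ j hj) (fun i => hfJ i j hj) _ hS]
  set K : ℝ := I.card * J.card with hK
  have hKpos : 0 < K := by
    have h1 : 0 < I.card := Finset.card_pos.2 ⟨_, hi₀⟩
    have h2 : 0 < J.card := Finset.card_pos.2 ⟨_, hj₀⟩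
    positivity
  -- `D` is `K` times the deviation of the frequency of `S` in the block `I × J`. By exchangeability
  -- its mean under the conditioned law is `K` times the difference to be bounded; and `|D|` is
  -- below `t K` off an event that is exponentially rare under independence.
  let D : (Fin (m + 1) → Fin (n + 1) → ℝ) → ℝ := fun y =>
    ∑ i ∈ I, ∑ j ∈ J, (S.indicator (fun _ => (1 : ℝ)) (y i j) - ν.real S)
  have hmi : Measurable (S.indicator fun _ => (1 : ℝ)) := measurable_const.indicator hS
  have hDm : Measurable D := by
    refine Finset.measurable_sum _ fun i _ => Finset.measurable_sum _ fun j _ => ?_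
    exact (hmi.comp ((measurable_pi_apply j).comp (measurable_pi_apply i))).sub_const _
  let R : (Fin (m + 2) → Fin (n + 2) → ℝ) → Fin (m + 1) → Fin (n + 1) → ℝ :=
    fun x i j => x i.castSucc j.castSucc
  have hRm : Measurable R := measurable_pi_lambda _ fun i => measurable_pi_lambda _ fun j =>
    (measurable_pi_apply _).comp (measurable_pi_apply _)
  let E : Set (Fin (m + 1) → Fin (n + 1) → ℝ) := {y | t * K ≤ |D y|}
  have hE : MeasurableSet E := measurableSet_le measurable_const hDm.abs
  have hDle : ∀ y, |D y| ≤ K := by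
    intro y
    refine (Finset.abs_sum_le_sum_abs _ _).trans ?_
    have : ∀ i ∈ I, |∑ j ∈ J, (S.indicator (fun _ => (1 : ℝ)) (y i j) - ν.real S)| ≤ J.card := by
      intro i _
      refine (Finset.abs_sum_le_sum_abs _ _).trans ?_
      refine (Finset.sum_le_card_nsmul _ _ 1 fun j _ => ?_).trans (by simp)
      have h1 : 0 ≤ ν.real S := measureReal_nonneg
      have h2 : ν.real S ≤ 1 := measureReal_le_one
      by_cases hy : y i j ∈ S
      · rw [Set.indicator_of_mem hy, abs_le]; constructor <;> linarith
      · rw [Set.indicator_of_notMem hy, abs_le]; constructor <;> linarith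
    refine (Finset.sum_le_card_nsmul _ _ _ this).trans (by simp [hK])
  have hDR : Measurable fun x => D (R x) := hDm.comp hRm
  -- the mean of `D`
  have hmean : ∫ x, D (R x) ∂lam =
      K * (lam.real {x | x i₀.castSucc j₀.castSucc ∈ S} - ν.real S) := by
    have hint : ∀ i j, Integrable (fun x => S.indicator (fun _ => (1 : ℝ)) (R x i j)) lam := by
      intro i j
      have : (fun x => S.indicator (fun _ => (1 : ℝ)) (R x i j)) =
          {x | R x i j ∈ S}.indicator fun _ => 1 := by
        ext x; simp [Set.indicator_apply]
      rw [this]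
      exact (integrable_const 1).indicator (hmS i j)
    have hint' : ∀ i j, Integrable
        (fun x => S.indicator (fun _ => (1 : ℝ)) (R x i j) - ν.real S) lam :=
      fun i j => (hint i j).sub (integrable_const _)
    simp only [D]
    rw [integral_finsetSum _ fun i _ => integrable_finsetSum _ fun j _ =>
      hint' i j]
    have : ∀ i ∈ I, ∫ x, ∑ j ∈ J, (S.indicator (fun _ => (1 : ℝ)) (R x i j) - ν.real S) ∂lam =
        J.card * (lam.real {x | x i₀.castSucc j₀.castSucc ∈ S} - ν.real S) := by
      intro i hi
      rw [integral_finsetSum _ fun j _ => hint' i j,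
        Finset.sum_congr rfl fun j hj => show _ =
          lam.real {x | x i₀.castSucc j₀.castSucc ∈ S} - ν.real S from ?_]
      · rw [Finset.sum_const, nsmul_eq_mul]
      · rw [integral_sub (hint i j) (integrable_const _)]
        have h2 : (fun x => S.indicator (fun _ => (1 : ℝ)) (R x i j)) =
            {x | R x i j ∈ S}.indicator fun _ => 1 := by
          ext x; simp [Set.indicator_apply]
        rw [h2, integral_indicator (hmS i j), ← hex i hi j hj]
        simp
    rw [Finset.sum_congr rfl this]
    simp only [Finset.sum_const, nsmul_eq_mul, hK]
    ring
  -- the exceptional set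
  have hbad : lam.real (R ⁻¹' E) ≤
      2 * M ^ (m + n + 3) * Real.exp (-(t ^ 2 * K / 4)) / Φ.toReal := by
    have hub := h.fibInt_indicator_le hr hc hf hM hE
    have hch := pi_pi_chernoff (N := fun (i : Fin (m + 1)) (j : Fin (n + 1)) =>
      ζ.withDensity (f i.castSucc j.castSucc)) (ν := ν) I J
      (fun i hi j hj => by rw [hν, hfI i hi, hfJ _ j hj]) hS ht
    have hfE : fib ζ (prodWt f) r c (R ⁻¹' E) ≤
        M ^ (m + n + 3) * ENNReal.ofReal (2 * Real.exp (-(t ^ 2 * K / 4))) := by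
      rw [fib_apply hpw (hRm hE)]
      refine le_trans (le_of_eq ?_) (hub.trans (mul_le_mul_right hch _))
      refine lintegral_congr fun y => ?_
      have hy : R (completion r c y) = y := by
        ext i j
        exact completion_castSucc_castSucc _ _ _ _ _
      simp only [Set.indicator_apply, Set.mem_preimage, hy]
      rfl
    have hne : (M : ℝ≥0∞) ^ (m + n + 3) * ENNReal.ofReal (2 * Real.exp (-(t ^ 2 * K / 4))) ≠ ∞ :=
      ENNReal.mul_ne_top (ENNReal.pow_ne_top ENNReal.coe_ne_top) ENNReal.ofReal_ne_top
    have h2 := ENNReal.toReal_mono hne hfE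
    rw [ENNReal.toReal_mul, ENNReal.toReal_pow, ENNReal.coe_toReal,
      ENNReal.toReal_ofReal (by positivity)] at h2
    rw [measureReal_def, hlam, Measure.smul_apply, smul_eq_mul, ENNReal.toReal_mul,
      ENNReal.toReal_inv, inv_mul_eq_div]
    refine div_le_div_of_nonneg_right (h2.trans_eq (by ring)) ENNReal.toReal_nonneg
  -- conclusion
  have hpt : ∀ x, |D (R x)| ≤ t * K + K * (R ⁻¹' E).indicator (fun _ => 1) x := by
    intro x
    by_cases hx : R x ∈ E
    · rw [Set.indicator_of_mem (show x ∈ R ⁻¹' E from hx)]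
      have := hDle (R x)
      have : 0 < t * K := by positivity
      linarith
    · rw [Set.indicator_of_notMem (show x ∉ R ⁻¹' E from hx)]
      have : |D (R x)| < t * K := not_le.1 hx
      linarith
  have hDint : Integrable (fun x => |D (R x)|) lam :=
    (integrable_const K).mono' (hDR.abs.aestronglyMeasurable) (ae_of_all _ fun x => by
      rw [Real.norm_eq_abs, abs_abs]; exact hDle _)
  have hind : Integrable ((R ⁻¹' E).indicator fun _ => (1 : ℝ)) lam :=
    (integrable_const 1).indicator (hRm hE)
  have h3 : |∫ x, D (R x) ∂lam| ≤ t * K + K * lam.real (R ⁻¹' E) := by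
    have hsum : Integrable (fun x => t * K + K * (R ⁻¹' E).indicator (fun _ => (1 : ℝ)) x) lam :=
      (integrable_const (t * K)).add (hind.const_mul K)
    refine (abs_integral_le_integral_abs).trans ((integral_mono hDint hsum hpt).trans_eq ?_)
    rw [integral_add (integrable_const _) (hind.const_mul K), integral_const, integral_const_mul,
      integral_indicator (hRm hE)]
    simp
  rw [hmean, abs_mul, abs_of_pos hKpos] at h3
  have h4 : |lam.real {x | x i₀.castSucc j₀.castSucc ∈ S} - ν.real S| ≤
      t + lam.real (R ⁻¹' E) := by
    have : K * |lam.real {x | x i₀.castSucc j₀.castSucc ∈ S} - ν.real S| ≤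
      K * (t + lam.real (R ⁻¹' E)) := h3.trans_eq (by ring)
    exact le_of_mul_le_mul_left this hKpos
  linarith

end entry

/-! ### The conditioned law in terms of tilted densities -/

section tilted
variable {ζ : Measure ℝ} [SigmaFinite ζ] {Γ : AddSubgroup ℝ} {m n : ℕ}

/-- On a fiber, the product of tilted densities is proportional to the product of densities. -/
theorem prodWt_tiltDens (μ : Measure ℝ) (p : ℝ → ℝ≥0∞) (α : Fin m → ℝ) (β : Fin n → ℝ)
    {r : Fin m → ℝ} {c : Fin n → ℝ} {x : Fin m → Fin n → ℝ} (hx : x ∈ marginFiber r c) :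
    prodWt (fun i j => tiltDens μ p (α i + β j)) x =
      ENNReal.ofReal (Real.exp (∑ i, r i * α i + ∑ j, c j * β j -
        ∑ i, ∑ j, logPartition μ (α i + β j))) * prodWt (fun _ _ => p) x := by
  unfold prodWt tiltDens
  simp only [Finset.prod_mul_distrib]
  congr 1
  have h1 : ∑ i, ∑ j, β j * x i j = ∑ j, c j * β j := by
    rw [Finset.sum_comm]
    refine Finset.sum_congr rfl fun j _ => ?_
    rw [← Finset.mul_sum, hx.2 j, mul_comm]
  have h2 : ∑ i, ∑ j, α i * x i j = ∑ i, r i * α i := by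
    refine Finset.sum_congr rfl fun i _ => ?_
    rw [← Finset.mul_sum, hx.1 i, mul_comm]
  rw [← h1, ← h2, ← Finset.sum_add_distrib, ← Finset.sum_sub_distrib, Real.exp_sum,
    ENNReal.ofReal_prod_of_nonneg fun i _ => (Real.exp_pos _).le]
  refine Finset.prod_congr rfl fun i _ => ?_
  rw [← Finset.sum_add_distrib, ← Finset.sum_sub_distrib, Real.exp_sum,
    ENNReal.ofReal_prod_of_nonneg fun i _ => (Real.exp_pos _).le]
  refine Finset.prod_congr rfl fun j _ => ?_
  rw [add_mul]

theorem completion_mem_marginFiber {r : Fin (m + 1) → ℝ} {c : Fin (n + 1) → ℝ}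
    (hrc : ∑ i, r i = ∑ j, c j) (y : Fin m → Fin n → ℝ) : completion r c y ∈ marginFiber r c :=
  ⟨sum_completion_row r c y hrc, sum_completion_col r c y⟩

-- The constant cancels in the normalization, so conditioning the tilted product and conditioning
-- the base product give the same law.
omit [SigmaFinite ζ] in
theorem exists_fib_tiltDens (μ : Measure ℝ) {p : ℝ → ℝ≥0∞} (hp : Measurable p)
    (α : Fin (m + 1) → ℝ) (β : Fin (n + 1) → ℝ) {r : Fin (m + 1) → ℝ} {c : Fin (n + 1) → ℝ}
    (hrc : ∑ i, r i = ∑ j, c j) :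
    ∃ a : ℝ≥0∞, a ≠ 0 ∧ a ≠ ∞ ∧
      fib ζ (prodWt fun i j => tiltDens μ p (α i + β j)) r c = a • fib ζ (prodWt fun _ _ => p) r c ∧
      fibInt ζ (prodWt fun i j => tiltDens μ p (α i + β j)) r c =
        a * fibInt ζ (prodWt fun _ _ => p) r c := by
  have hpw : Measurable (prodWt fun (_ : Fin (m + 1)) (_ : Fin (n + 1)) => p) :=
    measurable_prodWt fun _ _ => hp
  have hfib : fib ζ (prodWt fun i j => tiltDens μ p (α i + β j)) r c =
      ENNReal.ofReal (Real.exp (∑ i, r i * α i + ∑ j, c j * β j -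
        ∑ i, ∑ j, logPartition μ (α i + β j))) • fib ζ (prodWt fun _ _ => p) r c := by
    unfold fib
    have hm : Measurable fun y => prodWt (fun (_ : Fin (m + 1)) (_ : Fin (n + 1)) => p)
        (completion r c y) := hpw.comp (measurable_completion_right r c)
    rw [← Measure.map_smul, ← withDensity_smul _ hm]
    congr 1
    congr 1
    ext y
    exact prodWt_tiltDens μ p α β (completion_mem_marginFiber hrc y)
  refine ⟨_, ?_, ENNReal.ofReal_ne_top, hfib, ?_⟩
  · rw [Ne, ENNReal.ofReal_eq_zero, not_le]
    exact Real.exp_pos _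
  · rw [← fib_univ hpw, ← fib_univ (measurable_prodWt fun i j => measurable_tiltDens hp), hfib]
    rfl

theorem tvDist_le {P Q : Measure ℝ} {ε : ℝ}
    (h : ∀ S, MeasurableSet S → |P.real S - Q.real S| ≤ ε) : tvDist P Q ≤ ε := by
  have : Nonempty {S : Set ℝ // MeasurableSet S} := ⟨⟨∅, MeasurableSet.empty⟩⟩
  exact ciSup_le fun S => h S.1 S.2

/-- The conditioned laws for `μ = p ζ` are given by fiber measures. -/
def CondLawEqFib (ζ : Measure ℝ) (Γ : AddSubgroup ℝ) (μ : Measure ℝ) (p : ℝ → ℝ≥0∞) : Prop :=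
  ∀ (m n : ℕ) (r : Fin (m + 2) → ℝ) (c : Fin (n + 2) → ℝ), (∀ i, r i ∈ Γ) → (∀ j, c j ∈ Γ) →
    ∑ i, r i = ∑ j, c j → fibInt ζ (prodWt fun _ _ => p) r c ≠ 0 →
    fibInt ζ (prodWt fun _ _ => p) r c ≠ ∞ →
    condLaw μ r c = (fibInt ζ (prodWt fun _ _ => p) r c)⁻¹ • fib ζ (prodWt fun _ _ => p) r c

theorem condLawEqFib_intCount {p : ℝ → ℝ≥0∞} (hp : Measurable p)
    [SigmaFinite (intCount.withDensity p)] :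
    CondLawEqFib intCount intSubgroup (intCount.withDensity p) p :=
  fun _ _ _ _ hr hc hrc h0 h1 => condLaw_intCount hp hr hc hrc h0 h1

theorem condLawEqFib_volume {p : ℝ → ℝ≥0∞} (hp : Measurable p)
    [SigmaFinite ((volume : Measure ℝ).withDensity p)] :
    CondLawEqFib volume ⊤ ((volume : Measure ℝ).withDensity p) p := by
  intro m n r c hr hc _ _ _
  have h : ∀ (_ : Fin (m + 2)) (_ : Fin (n + 2)),
      ((volume : Measure ℝ).withDensity p).rnDeriv volume =ᵐ[volume] p :=
    fun _ _ => Measure.rnDeriv_withDensity volume hp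
  rw [condLaw_volume hp, isLattice_volume.fib_congr hr hc h, isLattice_volume.fibInt_congr hr hc h]

theorem card_castSucc_ge {N : ℕ} (P : Fin (N + 1) → Prop) [DecidablePred P] :
    (Finset.univ.filter P).card ≤ (Finset.univ.filter fun i : Fin N => P i.castSucc).card + 1 := by
  have : Finset.univ.filter P ⊆ insert (Fin.last N)
      ((Finset.univ.filter fun i : Fin N => P i.castSucc).image Fin.castSucc) := by
    intro i hi
    induction i using Fin.lastCases with
    | last => simp
    | cast i =>
      refine Finset.mem_insert_of_mem (Finset.mem_image_of_mem _ ?_)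
      simpa using hi
  exact (Finset.card_le_card this).trans ((Finset.card_insert_le _ _).trans
    (Nat.add_le_add_right Finset.card_image_le 1))

theorem sum_comp_cloning {N m₀ k : ℕ} {d : Fin N → Fin m₀}
    (hd : ∀ a, (Finset.univ.filter fun i => d i = a).card = k) (g : Fin m₀ → ℝ) :
    ∑ i, g (d i) = k * ∑ a, g a := by
  rw [← Finset.sum_fiberwise (s := Finset.univ) (g := d), Finset.mul_sum]
  refine Finset.sum_congr rfl fun a _ => ?_
  rw [Finset.sum_congr rfl fun i hi => show g (d i) = g a by rw [(Finset.mem_filter.1 hi).2],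
    Finset.sum_const, hd, nsmul_eq_mul]

theorem card_cloning {N m₀ k : ℕ} {d : Fin N → Fin m₀}
    (hd : ∀ a, (Finset.univ.filter fun i => d i = a).card = k) : N = m₀ * k := by
  have := Finset.card_eq_sum_card_fiberwise (f := d) (s := Finset.univ) (t := Finset.univ)
    fun _ _ => Finset.mem_coe.2 (Finset.mem_univ _)
  simpa [hd] using this

/-- Total variation bound for the corner of the conditioned matrix for a cloned margin in terms of
a lower bound for the density of the margin. -/
theorem IsLattice.tv_corner_le (h : IsLattice ζ Γ) {μ : Measure ℝ} [NeZero μ] {p : ℝ → ℝ≥0∞}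
    (hp : Measurable p) (hμ : ζ.withDensity p = μ) (hcond : CondLawEqFib ζ Γ μ p) {m₀ n₀ : ℕ}
    {r₀ : Fin m₀ → ℝ} {c₀ : Fin n₀ → ℝ} {α : Fin m₀ → ℝ} {β : Fin n₀ → ℝ}
    (hdom : ∀ a b, α a + β b ∈ tiltDomain μ) (hrc₀ : ∑ a, r₀ a = ∑ b, c₀ b) {M : ℝ≥0}
    (hM1 : 1 ≤ M) (hM : ∀ a b, ∀ᵐ x ∂ζ, tiltDens μ p (α a + β b) x ≤ M) {N N' k : ℕ} (hk : 2 ≤ k)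
    (d : Fin N → Fin m₀) (d' : Fin N' → Fin n₀) (hN : 0 < N) (hN' : 0 < N')
    (hd : ∀ a, (Finset.univ.filter fun i => d i = a).card = k)
    (hd' : ∀ b, (Finset.univ.filter fun j => d' j = b).card = k)
    (hr : ∀ a, k * r₀ a ∈ Γ) (hc : ∀ b, k * c₀ b ∈ Γ) {e : ℝ} (he : k ≤ e)
    (hlow : ENNReal.ofReal (Real.exp (-e)) ≤
      fibInt ζ (prodWt fun i j => tiltDens μ p (α (d i) + β (d' j)))
        (fun i => k * r₀ (d i)) (fun j => k * c₀ (d' j))) :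
    IsProbabilityMeasure
      ((condLaw μ (fun i => k * r₀ (d i)) (fun j => k * c₀ (d' j))).map corner) ∧
    tvDist ((condLaw μ (fun i => k * r₀ (d i)) (fun j => k * c₀ (d' j))).map corner)
      (tilt μ (α (d ⟨0, hN⟩) + β (d' ⟨0, hN'⟩))) ≤
      (4 * √(2 + (m₀ + n₀) * Real.log M) + 2) * (√e / k) := by
  have hNk := card_cloning hd
  have hNk' := card_cloning hd'
  have hge : ∀ {N m₀ : ℕ}, 0 < N → N = m₀ * k → ∃ M, N = M + 2 := fun {N m₀} h0 h1 => by
    have : 0 < m₀ := Nat.pos_of_ne_zero fun h => by simp [h] at h1; omega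
    exact ⟨N - 2, by nlinarith [Nat.sub_add_cancel (show 2 ≤ N by nlinarith)]⟩
  obtain ⟨m, rfl⟩ := hge hN hNk
  obtain ⟨n, rfl⟩ := hge hN' hNk'
  set r : Fin (m + 2) → ℝ := fun i => k * r₀ (d i) with hrdef
  set c : Fin (n + 2) → ℝ := fun j => k * c₀ (d' j) with hcdef
  have hrc : ∑ i, r i = ∑ j, c j := by
    rw [hrdef, hcdef, ← Finset.mul_sum, ← Finset.mul_sum, sum_comp_cloning hd,
      sum_comp_cloning hd', hrc₀]
  let f : Fin (m + 2) → Fin (n + 2) → ℝ → ℝ≥0∞ := fun i j => tiltDens μ p (α (d i) + β (d' j))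
  have hf : ∀ i j, Measurable (f i j) := fun i j => measurable_tiltDens hp
  have hprob : ∀ i j, IsProbabilityMeasure (ζ.withDensity (f i j)) := fun i j => by
    rw [withDensity_tiltDens hp hμ (hdom _ _)]
    exact isProbabilityMeasure_tilt (hdom _ _)
  have hrΓ : ∀ i, r i ∈ Γ := fun i => hr _
  have hcΓ : ∀ j, c j ∈ Γ := fun j => hc _
  set Φ := fibInt ζ (prodWt f) r c with hΦ
  have hΦ0 : Φ ≠ 0 := fun h0 => by
    have hlow' : ENNReal.ofReal (Real.exp (-e)) ≤ Φ := hlow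
    rw [h0, nonpos_iff_eq_zero, ENNReal.ofReal_eq_zero] at hlow'
    exact (Real.exp_pos _).not_ge hlow'
  have hΦtop : Φ ≠ ∞ := by
    have h1 := h.fibInt_indicator_le hrΓ hcΓ hf (fun i j => hM _ _) MeasurableSet.univ
    refine ne_top_of_le_ne_top ?_ (le_trans (le_of_eq ?_) h1)
    · exact ENNReal.mul_ne_top (ENNReal.pow_ne_top ENNReal.coe_ne_top) (measure_ne_top _ _)
    · exact lintegral_congr fun y => by simp
  obtain ⟨a, ha0, hat, hafib, haint⟩ := exists_fib_tiltDens (ζ := ζ) μ hp (fun i => α (d i))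
    (fun j => β (d' j)) hrc
  have hΦa : Φ = a * fibInt ζ (prodWt fun _ _ => p) r c := haint
  have hlaw : condLaw μ r c = Φ⁻¹ • fib ζ (prodWt f) r c := by
    rw [hcond m n r c hrΓ hcΓ hrc (fun h0 => hΦ0 (by rw [hΦa, h0, mul_zero]))
      (fun h0 => hΦtop (by rw [hΦa, h0, ENNReal.mul_top ha0])), hΦa,
      show fib ζ (prodWt f) r c = _ from hafib, smul_smul,
      ENNReal.mul_inv (Or.inl ha0) (Or.inl hat), mul_right_comm,
      ENNReal.inv_mul_cancel ha0 hat, one_mul]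
  have hcm : Measurable (corner : (Fin (m + 2) → Fin (n + 2) → ℝ) → ℝ) := by
    unfold corner
    simp only [Nat.zero_lt_succ, and_self, dite_true]
    exact (measurable_pi_apply _).comp (measurable_pi_apply _)
  have hpm : IsProbabilityMeasure (condLaw μ r c) := ⟨by
    rw [hlaw, Measure.smul_apply, fib_univ (measurable_prodWt hf), smul_eq_mul]
    exact ENNReal.inv_mul_cancel hΦ0 hΦtop⟩
  refine ⟨Measure.isProbabilityMeasure_map hcm.aemeasurable, tvDist_le fun S hS => ?_⟩
  have hkpos : (0 : ℝ) < k := by positivity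
  have hepos : 0 < e := hkpos.trans_le he
  -- With at least `k ^ 2 / 4` cells in the block, this `t` makes the Chernoff exponent at least `B
  -- e`. The summand `(m₀ + n₀) log M` of `B` pays for the power of `M`, one unit pays for the
  -- factor `1 / Φ ≤ exp e`, and the last unit leaves `exp (-e)`.
  set B : ℝ := 2 + (m₀ + n₀) * Real.log M with hB
  have hlogM : 0 ≤ Real.log M := Real.log_nonneg (by exact_mod_cast hM1)
  have hB2 : 2 ≤ B := by
    have : 0 ≤ (m₀ + n₀) * Real.log M := by positivity
    linarith
  set t : ℝ := 4 * √B * (√e / k) with ht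
  have htpos : 0 < t := by positivity
  let I : Finset (Fin (m + 1)) := Finset.univ.filter fun i => d i.castSucc = d 0
  let J : Finset (Fin (n + 1)) := Finset.univ.filter fun j => d' j.castSucc = d' 0
  -- The last row is not free, so the block of the corner may lose one of its `k` rows; the same
  -- holds for columns.
  have hI : k ≤ I.card + 1 := by
    rw [← hd (d 0)]
    exact card_castSucc_ge fun i => d i = d 0
  have hJ : k ≤ J.card + 1 := by
    rw [← hd' (d' 0)]
    exact card_castSucc_ge fun i => d' i = d' 0
  have hkey := h.abs_entry_sub_le hrΓ hcΓ hrc hf (fun i j => hM _ _) (I := I) (J := J) (i₀ := 0)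
    (j₀ := 0) (by simp [I]) (by simp [J])
    (fun i hi => by simp only [r, (Finset.mem_filter.1 hi).2]; rfl)
    (fun j hj => by simp only [c, (Finset.mem_filter.1 hj).2]; rfl)
    (fun i hi => by simp only [f, (Finset.mem_filter.1 hi).2]; rfl)
    (fun i j hj => by simp only [f, (Finset.mem_filter.1 hj).2]; rfl) hΦ0 hΦtop hS htpos
  rw [measureReal_def, Measure.map_apply hcm hS, ← measureReal_def, hlaw]
  have hcorner : corner ⁻¹' S =
      {x : Fin (m + 2) → Fin (n + 2) → ℝ | x (0 : Fin (m + 1)).castSucc (0 : Fin (n + 1)).castSucc ∈ S} := by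
    ext x
    simp only [corner, Nat.zero_lt_succ, and_self, dite_true, Set.mem_preimage, Set.mem_ofPred_eq]
    rfl
  have hν : ζ.withDensity (f (0 : Fin (m + 1)).castSucc (0 : Fin (n + 1)).castSucc) =
      tilt μ (α (d ⟨0, hN⟩) + β (d' ⟨0, hN'⟩)) :=
    withDensity_tiltDens hp hμ (hdom _ _)
  rw [← hcorner, hν] at hkey
  refine hkey.trans ?_
  have hΦge : Real.exp (-e) ≤ Φ.toReal := by
    rw [← ENNReal.toReal_ofReal (Real.exp_pos (-e)).le]
    exact ENNReal.toReal_mono hΦtop hlow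
  have hMpow : (M : ℝ) ^ (m + n + 3) ≤ Real.exp (((m₀ + n₀) * Real.log M) * e) := by
    have hM0 : (0 : ℝ) < M := by exact_mod_cast zero_lt_one.trans_le hM1
    rw [← Real.exp_log (pow_pos hM0 _), Real.log_pow]
    refine Real.exp_le_exp.2 ?_
    have h1 : ((m + n + 3 : ℕ) : ℝ) ≤ (m₀ + n₀) * e := by
      have h2 : ((m + n + 3 : ℕ) : ℝ) ≤ (m₀ + n₀) * k := by
        have h3 : m + n + 3 ≤ (m₀ + n₀) * k := by rw [add_mul, ← hNk, ← hNk']; omega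
        exact_mod_cast h3
      exact h2.trans (mul_le_mul_of_nonneg_left he (by positivity))
    calc _ ≤ (m₀ + n₀) * e * Real.log M := mul_le_mul_of_nonneg_right h1 hlogM
      _ = _ := by ring
  have hIJ : (k : ℝ) ^ 2 / 4 ≤ I.card * J.card := by
    have hI' : (k : ℝ) ≤ I.card + 1 := by exact_mod_cast hI
    have hJ' : (k : ℝ) ≤ J.card + 1 := by exact_mod_cast hJ
    have hk2 : (2 : ℝ) ≤ k := by exact_mod_cast hk
    have h1 : (k : ℝ) / 2 ≤ I.card := by linarith
    have h2 : (k : ℝ) / 2 ≤ J.card := by linarith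
    calc (k : ℝ) ^ 2 / 4 = k / 2 * (k / 2) := by ring
      _ ≤ _ := by gcongr
  have ht2 : B * e ≤ t ^ 2 * (I.card * J.card) / 4 := by
    have h1 : t ^ 2 * ((k : ℝ) ^ 2 / 4) / 4 = B * e := by
      rw [ht, mul_pow, mul_pow, div_pow, Real.sq_sqrt (by linarith), Real.sq_sqrt hepos.le]
      field_simp
    rw [← h1]
    gcongr
  have htail : 2 * (M : ℝ) ^ (m + n + 3) * Real.exp (-(t ^ 2 * (I.card * J.card) / 4)) / Φ.toReal ≤
      2 * (√e / k) := by
    have h1 : 2 * (M : ℝ) ^ (m + n + 3) * Real.exp (-(t ^ 2 * (I.card * J.card) / 4)) / Φ.toReal ≤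
        2 * Real.exp (((m₀ + n₀) * Real.log M) * e) * Real.exp (-(B * e)) / Real.exp (-e) := by
      gcongr
    refine h1.trans ?_
    rw [mul_assoc, mul_div_assoc, ← Real.exp_add, ← Real.exp_sub]
    have h2 : (m₀ + n₀) * Real.log M * e + -(B * e) - -e = -e := by rw [hB]; ring
    rw [h2]
    refine mul_le_mul_of_nonneg_left ?_ (by norm_num)
    -- The remaining `exp (-e)` is at most `1 / k`, hence at most `√e / k`, because `k ≤ e ≤ exp e`.
    have h3 : 1 ≤ √e := by
      rw [Real.one_le_sqrt]
      exact le_trans (by exact_mod_cast (by omega : 1 ≤ k)) he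
    rw [Real.exp_neg, le_div_iff₀ hkpos, inv_mul_le_iff₀ (Real.exp_pos _)]
    have h4 : (k : ℝ) ≤ Real.exp e := by
      have := Real.add_one_le_exp e
      linarith
    calc (k : ℝ) ≤ Real.exp e * 1 := by linarith
      _ ≤ _ := by gcongr
  calc _ ≤ t + 2 * (√e / k) := by linarith
    _ = _ := by rw [ht]; ring

end tilted

/-! ### Balanced integer flows -/

/-- Hermite's identity: raising `a` by one shifts the summands cyclically, and the one that wraps
around gains one. -/
theorem sum_range_add_ediv {L : ℕ} (hL : 0 < L) (a : ℤ) :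
    ∑ j ∈ Finset.range L, (a + j) / (L : ℤ) = a := by
  have hstep : ∀ a : ℤ, ∑ j ∈ Finset.range L, (a + 1 + j) / (L : ℤ) =
      ∑ j ∈ Finset.range L, (a + j) / (L : ℤ) + 1 := by
    intro a
    have h1 := Finset.sum_range_succ (fun j : ℕ => (a + j) / (L : ℤ)) L
    have h2 := Finset.sum_range_succ' (fun j : ℕ => (a + j) / (L : ℤ)) L
    have h3 : (a + (L : ℤ)) / (L : ℤ) = a / L + 1 := by
      rw [Int.add_ediv_of_dvd_right dvd_rfl, Int.ediv_self (by omega)]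
    have h4 : ∀ j : ℕ, (a + 1 + (j : ℤ)) = a + ((j + 1 : ℕ) : ℤ) := fun j => by push_cast; ring
    simp only [h4]
    push_cast at h1 h2 h3 ⊢
    simp only [add_zero] at h2
    linarith
  have h0 : ∑ j ∈ Finset.range L, ((0 : ℤ) + j) / (L : ℤ) = 0 := by
    refine Finset.sum_eq_zero fun j hj => ?_
    rw [zero_add]
    exact Int.ediv_eq_zero_of_lt (by omega) (by exact_mod_cast Finset.mem_range.1 hj)
  induction a using Int.induction_on with
  | zero => exact h0
  | succ i ih => rw [hstep, ih]
  | pred i ih =>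
    have := hstep (-(i : ℤ) - 1)
    rw [sub_add_cancel, ih] at this
    linarith

/-- Nonnegative row totals can be split into `L` columns with nearly integer entries and nearly
equal column totals. -/
theorem exists_balanced {L B K : ℕ} (hL : 0 < L) (d : Fin K → ℝ)
    (h0 : ∀ i, 0 ≤ d i) (hB : ∀ i, d i ≤ L * B) :
    ∃ (x : Fin K → Fin L → ℝ) (n : Fin K → Fin L → ℕ), (∀ i j, n i j ≤ B) ∧
      (∀ i j, |x i j - n i j| ≤ 1 / L) ∧ (∀ i, ∑ j, x i j = d i) ∧
      (∀ j, |∑ i, x i j - (∑ i, d i) / L| < 1) ∧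
      ((∀ i, ∃ z : ℤ, (z : ℝ) = d i) → ∀ i j, x i j = n i j) := by
  classical
  have hL' : (0 : ℝ) < L := by exact_mod_cast hL
  have hLz : (0 : ℤ) < L := by exact_mod_cast hL
  let D : ℕ → ℝ := fun i => if h : i < K then d ⟨i, h⟩ else 0
  let P : ℕ → ℝ := fun i => ∑ l ∈ Finset.range i, D l
  have hP : ∀ i : Fin K, P (i + 1) = P i + d i := fun i => by
    simp only [P, Finset.sum_range_succ, D, i.2, dite_true]
  have hPK : P K = ∑ i, d i := by
    simp only [P, D, Finset.sum_range, Fin.is_lt, dite_true, Fin.eta]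
  let a : ℕ → ℤ := fun i => ⌊P i⌋
  have ha1 : ∀ i, (a i : ℝ) ≤ P i := fun i => Int.floor_le _
  have ha2 : ∀ i, P i < a i + 1 := fun i => Int.lt_floor_add_one _
  have ha0 : a 0 = 0 := by simp [a, P]
  have hmono : ∀ i : Fin K, a i ≤ a (i + 1) := fun i =>
    Int.floor_le_floor (by rw [hP]; linarith [h0 i])
  have hle : ∀ i : Fin K, a (i + 1) ≤ a i + L * B := fun i => by
    have : ⌊P (i + 1)⌋ ≤ ⌊P i + ((L * B : ℤ) : ℝ)⌋ := by
      refine Int.floor_le_floor ?_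
      rw [hP]; push_cast; linarith [hB i]
    rwa [Int.floor_add_intCast] at this
  -- The rounded partial sums `a i` are distributed evenly over the columns by Hermite's identity.
  -- The increments of `q` in `i` are nonnegative integer entries with row sums `a (i + 1) - a i`,
  -- and in each column they telescope, so that any two column sums differ by at most one.
  let q : ℕ → ℕ → ℤ := fun i j => (a i + j) / L
  let e : Fin K → Fin L → ℤ := fun i j => q (i + 1) j - q i j
  have he0 : ∀ i j, 0 ≤ e i j := fun i j =>
    sub_nonneg.2 (Int.ediv_le_ediv hLz (by linarith [hmono i]))
  have heB : ∀ i j, e i j ≤ B := fun i j => by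
    have h1 : q (i + 1) j ≤ (a i + j + B * L) / L :=
      Int.ediv_le_ediv hLz (by linarith [hle i])
    rw [Int.add_mul_ediv_right _ _ hLz.ne'] at h1
    simp only [e, q] at h1 ⊢
    linarith
  -- The fractional part lost in row `i` by rounding; it is spread evenly over the `L` columns and
  -- vanishes for integer data.
  let ε : Fin K → ℝ := fun i => d i - (a (i + 1) - a i)
  have hε : ∀ i, |ε i| ≤ 1 := fun i => by
    rw [abs_le]
    have := hP i
    constructor <;> simp only [ε] <;> linarith [ha1 i, ha2 i, ha1 (i + 1), ha2 (i + 1)]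
  have hcast : ∀ i j, ((e i j).toNat : ℝ) = e i j := fun i j => by
    rw [← Int.cast_natCast, Int.toNat_of_nonneg (he0 i j)]
  have htel : ∀ g : ℕ → ℝ, ∑ i : Fin K, (g (i + 1) - g i) = g K - g 0 := fun g => by
    rw [← Finset.sum_range_sub, Finset.sum_range]
  refine ⟨fun i j => e i j + ε i / L, fun i j => (e i j).toNat, fun i j => ?_, fun i j => ?_,
    fun i => ?_, fun j => ?_, fun hint i j => ?_⟩
  · exact Int.toNat_le.2 (heB i j)
  · rw [hcast, add_sub_cancel_left, abs_div, abs_of_pos hL']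
    gcongr
    exact hε i
  · rw [Finset.sum_add_distrib, Finset.sum_const, Finset.card_univ, Fintype.card_fin,
      nsmul_eq_mul, mul_div_cancel₀ _ hL'.ne', ← Int.cast_sum]
    have h1 : ∑ j : Fin L, e i j = a (i + 1) - a i := by
      simp only [e, q, Finset.sum_sub_distrib]
      have h2 := fun b : ℤ => sum_range_add_ediv hL b
      simp only [Finset.sum_range] at h2
      rw [h2, h2]
    rw [h1]
    simp only [ε]
    push_cast
    ring
  · have h1 : ∑ i : Fin K, ((e i j : ℝ) + ε i / L) = q K j + (P K - a K) / L := by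
      have h2 := htel fun i => (q i j : ℝ)
      have h3 := htel P
      have h4 := htel fun i => (a i : ℝ)
      have hq0 : q 0 j = 0 := by
        simp only [q, ha0, zero_add]
        exact Int.ediv_eq_zero_of_lt (by omega) (by exact_mod_cast j.2)
      have hP0 : P 0 = 0 := by simp [P]
      rw [Finset.sum_add_distrib, ← Finset.sum_div]
      simp only [hq0, ha0, hP0, Int.cast_zero, sub_zero] at h2 h3 h4
      have h5 : ∑ i, ε i = P K - a K := by
        rw [← h3, ← h4, ← Finset.sum_sub_distrib]
        exact Finset.sum_congr rfl fun i _ => by simp only [ε, hP]; ring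
      rw [h5, ← h2]
      push_cast [e]
      rfl
    rw [h1, ← hPK]
    have h6 : (q K j : ℝ) * L ≤ a K + (j : ℕ) := by
      exact_mod_cast Int.ediv_mul_le (a K + (j : ℕ)) hLz.ne'
    have h7 : (a K : ℝ) + (j : ℕ) + 1 ≤ (q K j + 1) * L := by
      have h8 := Int.lt_ediv_add_one_mul_self (a K + (j : ℕ)) hLz
      have h9 : a K + (j : ℕ) + 1 ≤ (q K j + 1) * L := h8
      exact_mod_cast h9
    have h10 : ((j : ℕ) : ℝ) + 1 ≤ L := by exact_mod_cast j.2
    have h11 : ((j : ℕ) : ℝ) ≥ 0 := by positivity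
    have h12 : (q K j : ℝ) + (P K - a K) / L - P K / L = (q K j * L - a K) / L := by
      field_simp
      ring
    rw [h12, abs_div, abs_of_pos hL', div_lt_one hL', abs_lt]
    constructor <;> nlinarith
  · have hPint : ∀ i, ∃ z : ℤ, (z : ℝ) = P i := by
      intro i
      have : ∀ l, ∃ z : ℤ, (z : ℝ) = D l := by
        intro l
        by_cases h : l < K
        · simpa [D, h] using hint ⟨l, h⟩
        · exact ⟨0, by simp [D, h]⟩
      choose z hz using this
      exact ⟨∑ l ∈ Finset.range i, z l, by push_cast; simp only [hz, P]⟩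
    have haP : ∀ i, (a i : ℝ) = P i := fun i => by
      obtain ⟨z, hz⟩ := hPint i
      simp only [a, ← hz, Int.floor_intCast]
    have : ε i = 0 := by
      simp only [ε, haP, hP]
      ring
    beta_reduce
    rw [hcast, this, zero_div, add_zero]

/-- The closeness to a grid `u + s {0, …, B}`. -/
def gridNear (u s : ℝ) (B : ℕ) (h : ℝ) : Set ℝ := {x | ∃ l : ℕ, l ≤ B ∧ |x - (u + s * l)| ≤ h}

theorem gridNear_mono {u s h h' : ℝ} {B : ℕ} {x y : ℝ} (hx : x ∈ gridNear u s B h)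
    (hxy : |y - x| ≤ h' - h) : y ∈ gridNear u s B h' := by
  obtain ⟨l, hl, h1⟩ := hx
  refine ⟨l, hl, ?_⟩
  calc |y - (u + s * l)| = |(y - x) + (x - (u + s * l))| := by ring_nf
    _ ≤ |y - x| + |x - (u + s * l)| := abs_add_le _ _
    _ ≤ h' := by linarith

theorem exists_balanced_grid {L B K : ℕ} (hL : 0 < L) {u s : ℝ} (hs : 0 < s) (e : Fin K → ℝ)
    (h0 : ∀ i, L * u ≤ e i) (hB : ∀ i, e i ≤ L * (u + s * B)) :
    ∃ (x : Fin K → Fin L → ℝ), (∀ i j, x i j ∈ gridNear u s B (s / L)) ∧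
      (∀ i, ∑ j, x i j = e i) ∧ (∀ j, |∑ i, x i j - (∑ i, e i) / L| < s) ∧
      (s = 1 → u ∈ intSubgroup → (∀ i, e i ∈ intSubgroup) → ∀ i j, x i j ∈ intSubgroup) := by
  have hL' : (0 : ℝ) < L := by exact_mod_cast hL
  obtain ⟨x, n, hnB, hxn, hrow, hcol, hint⟩ := exists_balanced (B := B) hL
    (fun i => (e i - L * u) / s) (fun i => div_nonneg (by linarith [h0 i]) hs.le)
    (fun i => by rw [div_le_iff₀ hs]; nlinarith [hB i])
  refine ⟨fun i j => u + s * x i j, fun i j => ⟨n i j, hnB i j, ?_⟩, fun i => ?_, fun j => ?_,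
    fun hs1 hu he i j => ?_⟩
  · rw [show u + s * x i j - (u + s * n i j) = s * (x i j - n i j) by ring, abs_mul,
      abs_of_pos hs]
    calc s * |x i j - n i j| ≤ s * (1 / L) := by gcongr; exact hxn i j
      _ = s / L := by ring
  · rw [Finset.sum_add_distrib, ← Finset.mul_sum, hrow]
    simp only [Finset.sum_const, Finset.card_univ, Fintype.card_fin, nsmul_eq_mul]
    field_simp
    ring
  · have h1 := hcol j
    rw [← Finset.sum_div, Finset.sum_sub_distrib, Finset.sum_const, Finset.card_univ,
      Fintype.card_fin, nsmul_eq_mul] at h1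
    rw [Finset.sum_add_distrib, ← Finset.mul_sum, Finset.sum_const, Finset.card_univ,
      Fintype.card_fin, nsmul_eq_mul]
    have h2 : K * u + s * ∑ i, x i j - (∑ i, e i) / L =
        s * (∑ i, x i j - (∑ i, e i - K * (L * u)) / s / L) := by
      field_simp
      ring
    rw [h2, abs_mul, abs_of_pos hs]
    calc _ < s * 1 := by gcongr
      _ = s := mul_one s
  · subst hs1
    have hd : ∀ i, ∃ z : ℤ, (z : ℝ) = (e i - L * u) / 1 := fun i => by
      have : e i - (L : ℕ) • u ∈ intSubgroup := sub_mem (he i) (nsmul_mem hu L)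
      obtain ⟨z, hz⟩ := mem_intSubgroup.1 this
      exact ⟨z, by rw [hz, nsmul_eq_mul, div_one]⟩
    beta_reduce
    rw [hint hd i j, one_mul]
    exact add_mem hu (mem_intSubgroup.2 ⟨n i j, by push_cast; rfl⟩)

/-- Given the entries of an upper left block, the remaining `L` rows and `L` columns of a matrix can
be filled with entries close to a grid, so that the margins are prescribed. -/
theorem exists_fill {m n L B : ℕ} (hL : 0 < L) {u s : ℝ} (hs : 0 < s)
    (y : Fin m → Fin n → ℝ) (r : Fin (m + L) → ℝ) (c : Fin (n + L) → ℝ) {r' c' : ℝ}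
    (hr' : ∀ i : Fin L, r (Fin.natAdd m i) = r') (hc' : ∀ j : Fin L, c (Fin.natAdd n j) = c')
    (hrc : ∑ i, r i = ∑ j, c j)
    (h1 : ∀ j, L * u ≤ c (Fin.castAdd L j) - ∑ i, y i j ∧
      c (Fin.castAdd L j) - ∑ i, y i j ≤ L * (u + s * B))
    (h2 : ∀ i, L * u ≤ r (Fin.castAdd L i) - ∑ j, y i j ∧
      r (Fin.castAdd L i) - ∑ j, y i j ≤ L * (u + s * B))
    (h3 : L * u + s ≤ r' - (∑ j, (c (Fin.castAdd L j) - ∑ i, y i j)) / L ∧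
      r' - (∑ j, (c (Fin.castAdd L j) - ∑ i, y i j)) / L ≤ L * (u + s * B) - s) :
    ∃ x : Fin (m + L) → Fin (n + L) → ℝ,
      (∀ i j, x (Fin.castAdd L i) (Fin.castAdd L j) = y i j) ∧
      (∀ i, ∑ j, x i j = r i) ∧ (∀ j, ∑ i, x i j = c j) ∧
      (∀ (i : Fin (m + L)) (j : Fin (n + L)), (m ≤ (i : ℕ) ∨ n ≤ (j : ℕ)) → x i j ∈ gridNear u s B (2 * s / L)) ∧
      (s = 1 → u ∈ intSubgroup → (∀ i, r i ∈ intSubgroup) → (∀ j, c j ∈ intSubgroup) →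
        (∀ i j, y i j ∈ intSubgroup) → ∀ i j, x i j ∈ intSubgroup) := by
  have hL' : (0 : ℝ) < L := by exact_mod_cast hL
  have hmL : (0 : ℝ) < (m + L : ℕ) := by exact_mod_cast (by omega : 0 < m + L)
  -- The lower left part, transposed: what is missing in each old column is split over the `L` new
  -- rows, almost equally among these rows.
  obtain ⟨b, hbg, hbr, hbc, hbi⟩ := exists_balanced_grid (B := B) hL hs
    (fun j => c (Fin.castAdd L j) - ∑ i, y i j) (fun j => (h1 j).1) (fun j => (h1 j).2)
  -- What is missing in each row, old or new, is split over the `L` new columns. The imbalance of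
  -- `b` changes the deficit of a new row by less than `s`, which is the margin left in `h3`.
  let e : Fin (m + L) → ℝ := Fin.addCases (fun i => r (Fin.castAdd L i) - ∑ j, y i j)
    (fun i => r' - ∑ j, b j i)
  have he1 : ∀ i : Fin m, e (Fin.castAdd L i) = r (Fin.castAdd L i) - ∑ j, y i j := fun i => by
    simp [e]
  have he2 : ∀ i : Fin L, e (Fin.natAdd m i) = r' - ∑ j, b j i := fun i => by
    simp [e]
  have heb : ∀ i, L * u ≤ e i ∧ e i ≤ L * (u + s * B) := by
    intro i
    induction i using Fin.addCases with
    | left i => rw [he1]; exact h2 i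
    | right i =>
      rw [he2]
      have := abs_lt.1 (hbc i)
      constructor <;> linarith [h3.1, h3.2]
  obtain ⟨a, hag, har, hac, hai⟩ := exists_balanced_grid (B := B) hL hs e (fun i => (heb i).1)
    (fun i => (heb i).2)
  have hesum : ∑ i, e i = L * c' := by
    have hb : ∑ i, ∑ j, b j i = ∑ j, (c (Fin.castAdd L j) - ∑ i, y i j) := by
      rw [Finset.sum_comm]
      exact Finset.sum_congr rfl fun j _ => hbr j
    have hy : ∑ i, ∑ j, y i j = ∑ j, ∑ i, y i j := Finset.sum_comm
    rw [Fin.sum_univ_add, Fin.sum_univ_add] at hrc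
    rw [Fin.sum_univ_add]
    simp only [he1, he2, hr', hc', Finset.sum_sub_distrib, Finset.sum_const, Finset.card_univ,
      Fintype.card_fin, nsmul_eq_mul, hb] at hrc ⊢
    linarith
  rw [hesum, mul_div_cancel_left₀ _ hL'.ne'] at hac
  -- The sums over the new columns are now right up to an error below `s`. Each error is spread over
  -- all rows of its column; the errors add up to zero, so the row sums are not affected.
  let t : Fin L → ℝ := fun j => (c' - ∑ i, a i j) / (m + L : ℕ)
  have htsum : ∑ j, t j = 0 := by
    rw [← Finset.sum_div, Finset.sum_sub_distrib, Finset.sum_comm]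
    simp only [har, hesum, Finset.sum_const, Finset.card_univ, Fintype.card_fin, nsmul_eq_mul,
      sub_self, zero_div]
  let x : Fin (m + L) → Fin (n + L) → ℝ := fun i =>
    Fin.addCases (fun j => Fin.addCases (fun i => y i j) (fun i => b j i) i) (fun j => a i j + t j)
  have hx11 : ∀ i j, x (Fin.castAdd L i) (Fin.castAdd L j) = y i j := fun i j => by simp [x]
  have hx21 : ∀ i j, x (Fin.natAdd m i) (Fin.castAdd L j) = b j i := fun i j => by simp [x]
  have hx2 : ∀ i j, x i (Fin.natAdd n j) = a i j + t j := fun i j => by simp [x]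
  refine ⟨x, hx11, fun i => ?_, fun j => ?_, fun i j hij => ?_, fun hs1 hu hr hc hy => ?_⟩
  · rw [Fin.sum_univ_add]
    simp only [hx2, Finset.sum_add_distrib, htsum, har]
    induction i using Fin.addCases with
    | left i => simp only [hx11, he1]; ring
    | right i => simp only [hx21, he2, hr']; ring
  · induction j using Fin.addCases with
    | left j =>
      rw [Fin.sum_univ_add]
      simp only [hx11, hx21, hbr]
      ring
    | right j =>
      simp only [hx2, Finset.sum_add_distrib, Finset.sum_const, Finset.card_univ,
        Fintype.card_fin, nsmul_eq_mul, t, hc']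
      field_simp
      ring
  · induction j using Fin.addCases with
    | left j =>
      induction i using Fin.addCases with
      | left i =>
        have h4 := i.2
        have h5 := j.2
        simp only [Fin.val_castAdd] at hij
        omega
      | right i =>
        rw [hx21]
        refine gridNear_mono (hbg j i) ?_
        · rw [sub_self, abs_zero, sub_nonneg]; gcongr; linarith
    | right j =>
      rw [hx2]
      refine gridNear_mono (hag i j) ?_
      · have h4 : |t j| ≤ s / L := by
          rw [abs_div, abs_of_pos hmL, abs_sub_comm]
          refine (div_le_div_of_nonneg_right (hac j).le hmL.le).trans ?_
          refine div_le_div_of_nonneg_left hs.le hL' ?_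
          exact_mod_cast (by omega : L ≤ m + L)
        rw [add_sub_cancel_left]
        refine h4.trans_eq ?_
        ring
  · have hb : ∀ j i, b j i ∈ intSubgroup :=
      hbi hs1 hu fun j => sub_mem (hc _) (sum_mem fun i _ => hy i j)
    have he : ∀ i, e i ∈ intSubgroup := by
      intro i
      induction i using Fin.addCases with
      | left i => rw [he1]; exact sub_mem (hr _) (sum_mem fun j _ => hy i j)
      | right i => rw [he2, ← hr' i]; exact sub_mem (hr _) (sum_mem fun j _ => hb j i)
    have ha := hai hs1 hu he
    -- For integer data the column errors are integers of absolute value below `s = 1`, so there is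
    -- nothing to correct.
    have ht : ∀ j, t j = 0 := by
      intro j
      obtain ⟨z, hz⟩ := mem_intSubgroup.1 (sub_mem (sum_mem fun i (_ : i ∈ Finset.univ) => ha i j)
        (hc' j ▸ hc (Fin.natAdd n j)))
      have h5 := hac j
      rw [← hz, hs1] at h5
      have h6 : z = 0 := by
        have : |z| < 1 := by exact_mod_cast h5
        exact Int.abs_lt_one_iff.1 this
      rw [h6, Int.cast_zero] at hz
      simp only [t]
      rw [← neg_sub, ← hz, neg_zero, zero_div]
    intro i j
    induction j using Fin.addCases with
    | left j =>
      induction i using Fin.addCases with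
      | left i => rw [hx11]; exact hy i j
      | right i => rw [hx21]; exact hb j i
    | right j => rw [hx2, ht, add_zero]; exact ha i j

/-! ### Fiber integrals with weights only on a block -/

theorem measurableSet_gridNear (u s : ℝ) (B : ℕ) (h : ℝ) : MeasurableSet (gridNear u s B h) := by
  have : gridNear u s B h = ⋃ l ∈ Finset.range (B + 1), Metric.closedBall (u + s * l) h := by
    ext x
    simp [gridNear, Real.dist_eq]
  rw [this]
  exact Finset.measurableSet_biUnion _ fun _ _ => measurableSet_closedBall

/-- Completed entries are affine in the free ones with coefficients `0`, `1`, `-1`; the corner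
collects all `m * n` perturbations and is the worst case. -/
theorem abs_completion_sub_le {m n : ℕ} (hm : 1 ≤ m) (hn : 1 ≤ n) (r : Fin (m + 1) → ℝ)
    (c : Fin (n + 1) → ℝ) {y y' : Fin m → Fin n → ℝ} {ρ : ℝ} (h : ∀ i j, |y i j - y' i j| ≤ ρ)
    (i : Fin (m + 1)) (j : Fin (n + 1)) :
    |completion r c y i j - completion r c y' i j| ≤ m * n * ρ := by
  have hm' : (1 : ℝ) ≤ m := by exact_mod_cast hm
  have hn' : (1 : ℝ) ≤ n := by exact_mod_cast hn
  have hρ : 0 ≤ ρ := (abs_nonneg _).trans (h ⟨0, hm⟩ ⟨0, hn⟩)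
  have hrow : ∀ i, |∑ j, y i j - ∑ j, y' i j| ≤ n * ρ := fun i => by
    rw [← Finset.sum_sub_distrib]
    refine (Finset.abs_sum_le_sum_abs _ _).trans ?_
    refine (Finset.sum_le_card_nsmul _ _ ρ fun j _ => h i j).trans (by simp)
  have hcol : ∀ j, |∑ i, y i j - ∑ i, y' i j| ≤ m * ρ := fun j => by
    rw [← Finset.sum_sub_distrib]
    refine (Finset.abs_sum_le_sum_abs _ _).trans ?_
    refine (Finset.sum_le_card_nsmul _ _ ρ fun i _ => h i j).trans (by simp)
  have htot : |∑ i, ∑ j, y i j - ∑ i, ∑ j, y' i j| ≤ m * (n * ρ) := by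
    rw [← Finset.sum_sub_distrib]
    refine (Finset.abs_sum_le_sum_abs _ _).trans ?_
    refine (Finset.sum_le_card_nsmul _ _ (n * ρ) fun i _ => hrow i).trans (by simp)
  induction i using Fin.lastCases with
  | cast i =>
    induction j using Fin.lastCases with
    | cast j =>
      rw [completion_castSucc_castSucc, completion_castSucc_castSucc]
      refine (h i j).trans (le_mul_of_one_le_left hρ (one_le_mul_of_one_le_of_one_le hm' hn'))
    | last =>
      rw [completion_castSucc_last, completion_castSucc_last, sub_sub_sub_cancel_left,
        abs_sub_comm, mul_assoc]
      exact (hrow i).trans (le_mul_of_one_le_left (by positivity) hm')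
  | last =>
    induction j using Fin.lastCases with
    | cast j =>
      rw [completion_last_castSucc, completion_last_castSucc, sub_sub_sub_cancel_left,
        abs_sub_comm]
      refine (hcol j).trans ?_
      nlinarith [mul_nonneg (by positivity : (0 : ℝ) ≤ m * ρ) (sub_nonneg.2 hn')]
    | last =>
      rw [completion_last_last, completion_last_last, add_sub_add_right_eq_sub,
        sub_sub_sub_cancel_right, mul_assoc]
      exact htot

/-- The cell weights equal to `f` on the upper left `m₁ × n₁` block and to the indicator of `T`
elsewhere. -/
noncomputable def blockWt {m n : ℕ} (m₁ n₁ : ℕ) (f : Fin m → Fin n → ℝ → ℝ≥0∞) (T : Set ℝ)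
    (i : Fin m) (j : Fin n) : ℝ → ℝ≥0∞ :=
  if (i : ℕ) < m₁ ∧ (j : ℕ) < n₁ then f i j else T.indicator 1

theorem measurable_blockWt {m n : ℕ} {m₁ n₁ : ℕ} {f : Fin m → Fin n → ℝ → ℝ≥0∞} {T : Set ℝ}
    (hf : ∀ i j, Measurable (f i j)) (hT : MeasurableSet T) (i : Fin m) (j : Fin n) :
    Measurable (blockWt m₁ n₁ f T i j) := by
  unfold blockWt
  split_ifs
  · exact hf i j
  · exact measurable_one.indicator hT

section fill
variable {ζ : Measure ℝ} [SigmaFinite ζ] {Γ : AddSubgroup ℝ}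

/-- The free cells outside the upper left block are kept within `ρ` of the filled matrix, at the
price of `2 ρ` each. The last row and column then follow automatically: `completion` is Lipschitz,
and `hh` keeps all these cells within `h` of the grid, where their weights are `1`. -/
theorem le_fibInt_blockWt {m₁ n₁ l : ℕ} (hm : 1 ≤ m₁) (hn : 1 ≤ n₁)
    {r : Fin (m₁ + l + 1) → ℝ} {c : Fin (n₁ + l + 1) → ℝ}
    {f : Fin (m₁ + l + 1) → Fin (n₁ + l + 1) → ℝ → ℝ≥0∞} (hf : ∀ i j, Measurable (f i j))
    [∀ i j, SigmaFinite (ζ.withDensity (f i j))] {u s h₀ h ρ : ℝ} {B : ℕ} (hρ : 0 < ρ)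
    (hh : h₀ + ((m₁ + l : ℕ) : ℝ) * ((n₁ + l : ℕ) : ℝ) * ρ ≤ h)
    (hball : ∀ x ∈ Γ, ENNReal.ofReal (2 * ρ) ≤ ζ (Metric.closedBall x ρ))
    {W : Set (Fin m₁ → Fin n₁ → ℝ)} (hW : MeasurableSet W)
    (hfill : ∀ y ∈ W, ∃ x : Fin (m₁ + l + 1) → Fin (n₁ + l + 1) → ℝ,
      (∀ i j, x (Fin.castAdd (l + 1) i) (Fin.castAdd (l + 1) j) = y i j) ∧
      (∀ i, ∑ j, x i j = r i) ∧ (∀ j, ∑ i, x i j = c j) ∧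
      (∀ (i : Fin (m₁ + l + 1)) (j : Fin (n₁ + l + 1)), (m₁ ≤ (i : ℕ) ∨ n₁ ≤ (j : ℕ)) →
        x i j ∈ gridNear u s B h₀) ∧ ∀ i j, x i j ∈ Γ) :
    Measure.pi (fun i : Fin m₁ => Measure.pi fun j : Fin n₁ =>
      ζ.withDensity (f (Fin.castAdd (l + 1) i) (Fin.castAdd (l + 1) j))) W *
      ENNReal.ofReal (2 * ρ) ^ ((m₁ + l) * (n₁ + l) - m₁ * n₁) ≤
      fibInt ζ (prodWt (blockWt m₁ n₁ f (gridNear u s B h))) r c := by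
  classical
  let ι := Fin (m₁ + l) × Fin (n₁ + l)
  let p : ι → Prop := fun e => (e.1 : ℕ) < m₁ ∧ (e.2 : ℕ) < n₁
  let E : {e : ι // p e} ≃ Fin m₁ × Fin n₁ :=
    { toFun := fun e => (⟨e.1.1, e.2.1⟩, ⟨e.1.2, e.2.2⟩)
      invFun := fun e => ⟨(Fin.castAdd l e.1, Fin.castAdd l e.2), e.1.2, e.2.2⟩
      left_inv := fun e => rfl
      right_inv := fun e => rfl }
  let g : ι → ℝ → ℝ≥0∞ := fun e => if p e then f e.1.castSucc e.2.castSucc else 1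
  have hg : ∀ e, Measurable (g e) := fun e => by
    simp only [g]
    split_ifs
    · exact hf _ _
    · exact measurable_one
  let ν : ι → Measure ℝ := fun e => ζ.withDensity (g e)
  have hν1 : ∀ e : {e // p e}, ν e = ζ.withDensity (f e.1.1.castSucc e.1.2.castSucc) := fun e => by
    simp only [ν, g, e.2, if_true]
  have hν2 : ∀ e : {e // ¬ p e}, ν e = ζ := fun e => by
    simp only [ν, g, e.2, if_false, withDensity_one]
  have hσ : ∀ e, SigmaFinite (ν e) := fun e => by
    by_cases he : p e
    · rw [hν1 ⟨e, he⟩]; infer_instance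
    · rw [hν2 ⟨e, he⟩]; infer_instance
  let Blk : ({e // p e} → ℝ) → Fin m₁ → Fin n₁ → ℝ := fun w i j => w (E.symm (i, j))
  have hBlk : MeasurePreserving Blk (Measure.pi fun e : {e // p e} => ν e)
      (Measure.pi fun i : Fin m₁ => Measure.pi fun j : Fin n₁ =>
        ζ.withDensity (f (Fin.castAdd (l + 1) i) (Fin.castAdd (l + 1) j))) := by
    have h1 := measurePreserving_curry fun (i : Fin m₁) (j : Fin n₁) =>
      ζ.withDensity (f (Fin.castAdd (l + 1) i) (Fin.castAdd (l + 1) j))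
    have h2 := measurePreserving_arrowCongr' (fun e : {e // p e} => ν e)
      (fun e : Fin m₁ × Fin n₁ =>
        ζ.withDensity (f (Fin.castAdd (l + 1) e.1) (Fin.castAdd (l + 1) e.2))) E
      (MeasurableEquiv.refl ℝ) fun e => by
        rw [hν1 e]
        exact MeasurePreserving.id _
    exact h1.comp h2
  let T := gridNear u s B h
  have hT : MeasurableSet T := measurableSet_gridNear _ _ _ _
  let mat : (ι → ℝ) → Fin (m₁ + l) → Fin (n₁ + l) → ℝ := fun y i j => y (i, j)
  have hmat : Measurable mat := (MeasurableEquiv.curry _ _ ℝ).measurable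
  let A : Set (ι → ℝ) := {y | ∀ (i : Fin (m₁ + l + 1)) (j : Fin (n₁ + l + 1)),
    (m₁ ≤ (i : ℕ) ∨ n₁ ≤ (j : ℕ)) → completion r c (mat y) i j ∈ T}
  have hA : MeasurableSet A := by
    have hcm : Measurable fun y => completion r c (mat y) :=
      (measurable_completion_right r c).comp hmat
    have hAeq : A = ⋂ (i : Fin (m₁ + l + 1)) (j : Fin (n₁ + l + 1))
        (_ : m₁ ≤ (i : ℕ) ∨ n₁ ≤ (j : ℕ)), (fun y => completion r c (mat y) i j) ⁻¹' T := by
      ext y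
      simp only [A, Set.mem_ofPred_eq, Set.mem_iInter, Set.mem_preimage]
    rw [hAeq]
    exact MeasurableSet.iInter fun i => MeasurableSet.iInter fun j => MeasurableSet.iInter
      fun _ => hT.preimage ((measurable_pi_apply j).comp ((measurable_pi_apply i).comp hcm))
  choose! X hX1 hX2 hX3 hX4 hX5 using hfill
  have hcard : Fintype.card {e : ι // ¬ p e} = (m₁ + l) * (n₁ + l) - m₁ * n₁ := by
    rw [Fintype.card_subtype_compl, Fintype.card_congr E]
    simp [ι]
  have hcorr := pi_correction p ν (Blk ⁻¹' W) (hBlk.measurable hW)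
    (fun w e => X (Blk w) e.1.1.castSucc e.1.2.castSucc) ρ (ENNReal.ofReal (2 * ρ))
    (fun w hw e => by rw [hν2]; exact hball _ (hX5 _ hw _ _)) A hA ?_
  · rw [hBlk.measure_preimage hW.nullMeasurableSet, hcard] at hcorr
    refine hcorr.trans ?_
    have h1 := pi_withDensity (fun _ : ι => ζ) g hg
    rw [show Measure.pi ν = _ from h1, withDensity_apply _ hA, ← lintegral_indicator hA]
    have h2 := measurePreserving_curry fun (_ : Fin (m₁ + l)) (_ : Fin (n₁ + l)) => ζ
    have hm' : Measurable fun y => prodWt (blockWt m₁ n₁ f T) (completion r c y) :=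
      (measurable_prodWt (measurable_blockWt hf hT)).comp (measurable_completion_right r c)
    have h3 := h2.lintegral_comp hm'
    refine le_trans (lintegral_mono fun y => ?_) h3.le
    change _ ≤ prodWt (blockWt m₁ n₁ f T) (completion r c (mat y))
    by_cases hy : y ∈ A
    · rw [Set.indicator_of_mem hy]
      refine le_of_eq ?_
      have hone : ∀ (i : Fin (m₁ + l + 1)) (j : Fin (n₁ + l + 1)), (m₁ ≤ (i : ℕ) ∨ n₁ ≤ (j : ℕ)) →
          blockWt m₁ n₁ f T i j (completion r c (mat y) i j) = 1 := by
        intro i j hij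
        have hT' := hy i j hij
        unfold blockWt
        rw [if_neg (by omega), Set.indicator_of_mem hT', Pi.one_apply]
      unfold prodWt
      rw [Fin.prod_univ_castSucc,
        Finset.prod_eq_one (s := Finset.univ)
          (f := fun j => blockWt m₁ n₁ f T (Fin.last (m₁ + l)) j _)
          fun j _ => hone _ _ (Or.inl (by simp)), mul_one, Fintype.prod_prod_type]
      refine Finset.prod_congr rfl fun i _ => ?_
      rw [Fin.prod_univ_castSucc, hone _ (Fin.last _) (Or.inr (by simp)), mul_one]
      refine Finset.prod_congr rfl fun j _ => ?_
      by_cases hp : p (i, j)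
      · rw [completion_castSucc_castSucc]
        unfold blockWt
        rw [if_pos (show (i.castSucc : ℕ) < m₁ ∧ (j.castSucc : ℕ) < n₁ from hp)]
        simp only [g, hp, if_true]
        rfl
      · rw [hone _ _ (by simp only [p] at hp; simp only [Fin.val_castSucc]; omega)]
        simp only [g, hp, if_false, Pi.one_apply]
    · rw [Set.indicator_of_notMem hy]
      exact zero_le
  · intro y hyW hy i j hij
    set w : {e // p e} → ℝ := fun e => y e with hw
    have hcomp := completion_restrict (r := r) (c := c) (X (Blk w)) (hX2 _ hyW) (hX3 _ hyW)
    refine gridNear_mono (hX4 _ hyW i j hij) (h' := h) ?_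
    have h4 := abs_completion_sub_le (m := m₁ + l) (n := n₁ + l) (by omega) (by omega) r c
      (y := mat y) (y' := fun i j => X (Blk w) i.castSucc j.castSucc) (ρ := ρ) (fun i j => ?_) i j
    · have h5 := congrFun (congrFun hcomp i) j
      refine le_trans ?_ (by linarith : ((m₁ + l : ℕ) : ℝ) * ((n₁ + l : ℕ) : ℝ) * ρ ≤ h - h₀)
      rw [← h5]
      exact h4
    · by_cases hp : p (i, j)
      · have h5 := hX1 _ hyW ⟨i, hp.1⟩ ⟨j, hp.2⟩
        have h6 : X (Blk w) i.castSucc j.castSucc = y (i, j) := h5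
        rw [h6]
        simp only [mat, sub_self, abs_zero]
        exact hρ.le
      · exact hy ⟨(i, j), hp⟩

end fill

theorem le_volume_closedBall (ρ x : ℝ) :
    ENNReal.ofReal (2 * ρ) ≤ volume (Metric.closedBall x ρ) := by
  rw [Real.volume_closedBall]

theorem le_intCount_closedBall {ρ : ℝ} (hρ : 0 < ρ) (hρ' : 2 * ρ ≤ 1) {x : ℝ}
    (hx : x ∈ intSubgroup) : ENNReal.ofReal (2 * ρ) ≤ intCount (Metric.closedBall x ρ) := by
  obtain ⟨z, rfl⟩ := mem_intSubgroup.1 hx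
  calc ENNReal.ofReal (2 * ρ) ≤ 1 := by simpa using ENNReal.ofReal_le_ofReal hρ'
    _ = intCount {(z : ℝ)} := (intCount_singleton z).symm
    _ ≤ _ := measure_mono (Set.singleton_subset_iff.2 (Metric.mem_closedBall_self hρ.le))

/-! ### Concentration of partial sums of a random block -/

theorem exists_pos_le_forall {ι : Type*} [Finite ι] (f : ι → ℝ) (hf : ∀ i, 0 < f i) :
    ∃ ε > 0, ∀ i, ε ≤ f i := by
  rcases isEmpty_or_nonempty ι with h | h
  · exact ⟨1, one_pos, fun i => h.elim i⟩
  · obtain ⟨i, hi⟩ := Finite.exists_min f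
    exact ⟨f i, hf i, hi⟩

theorem exists_forall_le_pos {ι : Type*} [Finite ι] (f : ι → ℝ) : ∃ C > 0, ∀ i, f i ≤ C := by
  rcases isEmpty_or_nonempty ι with h | h
  · exact ⟨1, one_pos, fun i => h.elim i⟩
  · obtain ⟨i, hi⟩ := Finite.exists_max f
    exact ⟨max (f i) 1, by positivity, fun j => (hi j).trans (le_max_left _ _)⟩

/-- The measure has sub-Gaussian moments around `z` in the range `|s| ≤ s₀`. -/
def SubGaussNear (ν : Measure ℝ) (z C s₀ : ℝ) : Prop :=
  ∀ s, |s| ≤ s₀ → ∫⁻ x, ENNReal.ofReal (Real.exp (s * (x - z))) ∂ν ≤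
    ENNReal.ofReal (Real.exp (C * s ^ 2))

theorem exists_subGaussNear_tilt {μ : Measure ℝ} [NeZero μ] {ι κ : Type*} [Finite ι] [Finite κ]
    {α : ι → ℝ} {β : κ → ℝ} (hdom : ∀ a b, α a + β b ∈ tiltDomain μ) :
    ∃ C > 0, ∃ s₀ > 0, ∀ a b,
      SubGaussNear (tilt μ (α a + β b)) (tiltMean μ (α a + β b)) C s₀ := by
  choose C hC s₀ hs₀ h using fun e : ι × κ => exists_mgf_tilt_le (hdom e.1 e.2)
  obtain ⟨C', hC', hC''⟩ := exists_forall_le_pos C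
  obtain ⟨s', hs', hs''⟩ := exists_pos_le_forall s₀ hs₀
  refine ⟨C', hC', s', hs', fun a b s hs => (h (a, b) s (hs.trans (hs'' _))).trans ?_⟩
  refine ENNReal.ofReal_le_ofReal (Real.exp_le_exp.2 ?_)
  exact mul_le_mul_of_nonneg_right (hC'' _) (sq_nonneg _)

theorem pi_pi_sum_chernoff {m n : ℕ} {N : Fin m → Fin n → Measure ℝ}
    [∀ i j, IsProbabilityMeasure (N i j)] {z : Fin m → Fin n → ℝ} {C s₀ : ℝ}
    (hN : ∀ i j, SubGaussNear (N i j) (z i j) C s₀) (S : Finset (Fin m × Fin n)) {σ τ : ℝ}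
    (hσ : 0 < σ) (hσ' : σ ≤ s₀) :
    Measure.pi (fun i => Measure.pi fun j => N i j)
      {y | τ < |∑ e ∈ S, (y e.1 e.2 - z e.1 e.2)|} ≤
      ENNReal.ofReal (2 * Real.exp (C * σ ^ 2 * S.card - σ * τ)) := by
  have hone : ∀ s : ℝ, |s| = σ →
      Measure.pi (fun i => Measure.pi fun j => N i j)
      {y | σ * τ ≤ s * ∑ e ∈ S, (y e.1 e.2 - z e.1 e.2)} ≤
      ENNReal.ofReal (Real.exp (C * σ ^ 2 * S.card - σ * τ)) := by
    intro s hs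
    rw [← (measurePreserving_curry N).measure_preimage_equiv]
    have h1 := pi_chernoff (fun e : Fin m × Fin n => N e.1 e.2) S
      (fun e x => x - z e.1 e.2) (fun e => by fun_prop) s C (σ * τ) (fun e he =>
        hN e.1 e.2 s (hs.trans_le hσ'))
    rw [← sq_abs, hs] at h1
    exact h1
  have hsub : {y : Fin m → Fin n → ℝ | τ < |∑ e ∈ S, (y e.1 e.2 - z e.1 e.2)|} ⊆
      {y | σ * τ ≤ σ * ∑ e ∈ S, (y e.1 e.2 - z e.1 e.2)} ∪
      {y | σ * τ ≤ -σ * ∑ e ∈ S, (y e.1 e.2 - z e.1 e.2)} := by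
    intro y hy
    simp only [Set.mem_union, Set.mem_ofPred_eq] at hy ⊢
    rcases lt_abs.1 hy with h1 | h1
    · left; nlinarith
    · right; nlinarith
  refine (measure_mono hsub).trans ((measure_union_le _ _).trans ?_)
  rw [two_mul, ENNReal.ofReal_add (Real.exp_pos _).le (Real.exp_pos _).le]
  exact add_le_add (hone _ (abs_of_pos hσ)) (hone _ (by rw [abs_neg, abs_of_pos hσ]))

/-- Blocks with small deviations of row sums, column sums and total, and with entries in `Γ`. -/
def goodBlock {m n : ℕ} (z : Fin m → Fin n → ℝ) (Γ : AddSubgroup ℝ) (τ τ' : ℝ) :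
    Set (Fin m → Fin n → ℝ) :=
  {y | (∀ i, |∑ j, (y i j - z i j)| ≤ τ) ∧ (∀ j, |∑ i, (y i j - z i j)| ≤ τ) ∧
    |∑ i, ∑ j, (y i j - z i j)| ≤ τ' ∧ ∀ i j, y i j ∈ Γ}

theorem measurableSet_goodBlock {m n : ℕ} (z : Fin m → Fin n → ℝ) {Γ : AddSubgroup ℝ}
    (hΓ : MeasurableSet (Γ : Set ℝ)) (τ τ' : ℝ) : MeasurableSet (goodBlock z Γ τ τ') := by
  have h0 : ∀ i j, Measurable fun y : Fin m → Fin n → ℝ => y i j := fun i j =>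
    (measurable_pi_apply j).comp (measurable_pi_apply i)
  have h : goodBlock z Γ τ τ' = (⋂ i, {y | |∑ j, (y i j - z i j)| ≤ τ}) ∩
      ((⋂ j, {y | |∑ i, (y i j - z i j)| ≤ τ}) ∩ ({y | |∑ i, ∑ j, (y i j - z i j)| ≤ τ'} ∩
        ⋂ i, ⋂ j, (fun y => y i j) ⁻¹' Γ)) := by
    ext y
    simp [goodBlock]
  rw [h]
  refine (MeasurableSet.iInter fun i => measurableSet_le (Measurable.abs ?_) measurable_const).inter
    ((MeasurableSet.iInter fun j => measurableSet_le (Measurable.abs ?_) measurable_const).inter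
    ((measurableSet_le (Measurable.abs ?_) measurable_const).inter
    (MeasurableSet.iInter fun i => MeasurableSet.iInter fun j => h0 i j hΓ)))
  · exact Finset.measurable_sum _ fun j _ => (h0 i j).sub_const _
  · exact Finset.measurable_sum _ fun i _ => (h0 i j).sub_const _
  · exact Finset.measurable_sum _ fun i _ => Finset.measurable_sum _ fun j _ => (h0 i j).sub_const _

/-- Union bound over the row sums and column sums, at the scale `σ`, and the total, at its own scale
`σ'`. The total must be controlled separately: its deviation is much smaller than the sum of the
bounds for the individual rows, and only that is affordable for the `L × L` corner of the band. -/
theorem half_le_goodBlock {m n : ℕ} {N : Fin m → Fin n → Measure ℝ}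
    [∀ i j, IsProbabilityMeasure (N i j)] {z : Fin m → Fin n → ℝ} {C s₀ : ℝ} (hC : 0 < C)
    (hN : ∀ i j, SubGaussNear (N i j) (z i j) C s₀) {Γ : AddSubgroup ℝ}
    (hΓ : MeasurableSet (Γ : Set ℝ)) (hNΓ : ∀ i j, ∀ᵐ x ∂N i j, x ∈ Γ) {σ σ' τ τ' v : ℝ}
    (hσ : 0 < σ) (hσ₀ : σ ≤ s₀) (hσ' : 0 < σ') (hσ₀' : σ' ≤ s₀) (hm : m ≤ v) (hn : n ≤ v)
    (hnum : 4 * v * Real.exp (C * σ ^ 2 * v - σ * τ) +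
      2 * Real.exp (C * σ' ^ 2 * v ^ 2 - σ' * τ') ≤ 1 / 2) :
    1 / 2 ≤ Measure.pi (fun i => Measure.pi fun j => N i j) (goodBlock z Γ τ τ') := by
  classical
  set P := Measure.pi (fun i => Measure.pi fun j => N i j) with hP
  have hv : 0 ≤ v := (Nat.cast_nonneg m).trans hm
  have hrow : ∀ i, P {y | τ < |∑ j, (y i j - z i j)|} ≤
      ENNReal.ofReal (2 * Real.exp (C * σ ^ 2 * v - σ * τ)) := by
    intro i
    have h1 := pi_pi_sum_chernoff hN ({i} ×ˢ Finset.univ) (τ := τ) hσ hσ₀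
    simp only [Finset.sum_product, Finset.sum_singleton] at h1
    refine h1.trans (ENNReal.ofReal_le_ofReal ?_)
    gcongr
    simpa using hn
  have hcol : ∀ j, P {y | τ < |∑ i, (y i j - z i j)|} ≤
      ENNReal.ofReal (2 * Real.exp (C * σ ^ 2 * v - σ * τ)) := by
    intro j
    have h1 := pi_pi_sum_chernoff hN (Finset.univ ×ˢ {j}) (τ := τ) hσ hσ₀
    simp only [Finset.sum_product, Finset.sum_singleton] at h1
    refine h1.trans (ENNReal.ofReal_le_ofReal ?_)
    gcongr
    simpa using hm
  have htot : P {y | τ' < |∑ i, ∑ j, (y i j - z i j)|} ≤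
      ENNReal.ofReal (2 * Real.exp (C * σ' ^ 2 * v ^ 2 - σ' * τ')) := by
    have h1 := pi_pi_sum_chernoff hN (Finset.univ ×ˢ Finset.univ) (τ := τ') hσ' hσ₀'
    simp only [Finset.sum_product] at h1
    refine h1.trans (ENNReal.ofReal_le_ofReal ?_)
    gcongr
    rw [Finset.card_product, sq]
    push_cast
    simp only [Finset.card_univ, Fintype.card_fin]
    gcongr
  have hmem : P {y | ¬ ∀ i j, y i j ∈ Γ} = 0 := by
    have : ∀ᵐ y ∂P, ∀ i j, y i j ∈ Γ := by
      refine ae_all_iff.2 fun i => ae_all_iff.2 fun j => ?_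
      exact ((Measure.quasiMeasurePreserving_eval (fun j => N i j) j).comp
        (Measure.quasiMeasurePreserving_eval (fun i => Measure.pi fun j => N i j) i)).ae (hNΓ i j)
    exact this
  have hsub : (goodBlock z Γ τ τ')ᶜ ⊆ ((⋃ i, {y | τ < |∑ j, (y i j - z i j)|}) ∪
      (⋃ j, {y | τ < |∑ i, (y i j - z i j)|})) ∪
      ({y | τ' < |∑ i, ∑ j, (y i j - z i j)|} ∪ {y | ¬ ∀ i j, y i j ∈ Γ}) := by
    intro y hy
    by_contra hcon
    simp only [Set.mem_union, Set.mem_iUnion, Set.mem_ofPred_eq, not_or, not_exists, not_lt,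
      not_not] at hcon
    exact hy ⟨hcon.1.1, hcon.1.2, hcon.2.1, hcon.2.2⟩
  have hcompl : P (goodBlock z Γ τ τ')ᶜ ≤ 1 / 2 := by
    refine (measure_mono hsub).trans ?_
    refine (measure_union_le _ _).trans (le_trans (add_le_add ((measure_union_le _ _).trans
      (add_le_add ((measure_iUnion_le _).trans (ENNReal.tsum_le_tsum hrow))
      ((measure_iUnion_le _).trans (ENNReal.tsum_le_tsum hcol))))
      ((measure_union_le _ _).trans (add_le_add htot hmem.le))) ?_)
    set A := Real.exp (C * σ ^ 2 * v - σ * τ)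
    set A' := Real.exp (C * σ' ^ 2 * v ^ 2 - σ' * τ')
    have hA : 0 < A := Real.exp_pos _
    have hA' : 0 < A' := Real.exp_pos _
    have h12 : (1 / 2 : ℝ≥0∞) = ENNReal.ofReal (1 / 2) := by
      rw [ENNReal.ofReal_div_of_pos two_pos]; simp
    rw [tsum_fintype, tsum_fintype, Finset.sum_const, Finset.sum_const, Finset.card_univ,
      Finset.card_univ, Fintype.card_fin, Fintype.card_fin, nsmul_eq_mul, nsmul_eq_mul, add_zero,
      h12, ← ENNReal.ofReal_natCast m, ← ENNReal.ofReal_natCast n,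
      ← ENNReal.ofReal_mul (Nat.cast_nonneg _), ← ENNReal.ofReal_mul (Nat.cast_nonneg _),
      ← ENNReal.ofReal_add (by positivity) (by positivity),
      ← ENNReal.ofReal_add (by positivity) (by positivity)]
    refine ENNReal.ofReal_le_ofReal (le_trans ?_ hnum)
    have h1 : (m : ℝ) * (2 * A) ≤ v * (2 * A) := by gcongr
    have h2 : (n : ℝ) * (2 * A) ≤ v * (2 * A) := by gcongr
    linarith
  have h1 := prob_compl_eq_one_sub (μ := P) (measurableSet_goodBlock z hΓ τ τ')
  rw [h1] at hcompl
  have h2 : (1 : ℝ≥0∞) ≤ 1 / 2 + P (goodBlock z Γ τ τ') := tsub_le_iff_right.1 hcompl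
  exact (ENNReal.add_le_add_iff_left (a := 1 / 2) (by simp)).1
    (by rw [ENNReal.add_halves]; exact h2)

/-! ### Weighted fiber integrals for cloned margins -/

section cloned
variable {ζ : Measure ℝ} [SigmaFinite ζ] {Γ : AddSubgroup ℝ}

/-- The grid `u + s ℕ` is compatible with the lattice `Γ`. -/
def GridCompat (Γ : AddSubgroup ℝ) (u s : ℝ) : Prop :=
  Γ = ⊤ ∨ (Γ = intSubgroup ∧ s = 1 ∧ u ∈ intSubgroup)

/-- All means stay `η` away from the ends of the grid, so a band of width `l + 1` can absorb a
deviation `η (l + 1)` in each line and half of `η (l + 1) ^ 2` in total; the other half covers, by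
`hη`, the rounding slack `s` of `exists_fill`. The band rows have equal means (`zc`), as have the
band columns (`zr`), so that the new lines have equal prescribed sums. -/
theorem exists_fill_of_goodBlock {m₁ n₁ l B : ℕ} {u s η : ℝ} (hs : 0 < s)
    {z : Fin (m₁ + l + 1) → Fin (n₁ + l + 1) → ℝ}
    (hz : ∀ i j, u + η ≤ z i j ∧ z i j ≤ u + s * B - η)
    {zr : Fin (m₁ + l + 1) → ℝ} {zc : Fin (n₁ + l + 1) → ℝ} {z' : ℝ}
    (hzr : ∀ (i : Fin (m₁ + l + 1)) (j : Fin (l + 1)), z i (Fin.natAdd n₁ j) = zr i)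
    (hzc : ∀ (i : Fin (l + 1)) (j : Fin (n₁ + l + 1)), z (Fin.natAdd m₁ i) j = zc j)
    (hz' : ∀ i : Fin (l + 1), zr (Fin.natAdd m₁ i) = z')
    (hη : 2 * s ≤ η * (l + 1 : ℕ)) (hgrid : GridCompat Γ u s)
    (hr : ∀ i, ∑ j, z i j ∈ Γ) (hc : ∀ j, ∑ i, z i j ∈ Γ) {y : Fin m₁ → Fin n₁ → ℝ}
    (hy : y ∈ goodBlock
      (fun i j => z (Fin.castAdd (l + 1) i) (Fin.castAdd (l + 1) j)) Γ
      (η * (l + 1 : ℕ)) (η * (l + 1 : ℕ) ^ 2 / 2)) :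
    ∃ x : Fin (m₁ + l + 1) → Fin (n₁ + l + 1) → ℝ,
      (∀ i j, x (Fin.castAdd (l + 1) i) (Fin.castAdd (l + 1) j) = y i j) ∧
      (∀ i, ∑ j, x i j = ∑ j, z i j) ∧ (∀ j, ∑ i, x i j = ∑ i, z i j) ∧
      (∀ (i : Fin (m₁ + l + 1)) (j : Fin (n₁ + l + 1)), (m₁ ≤ (i : ℕ) ∨ n₁ ≤ (j : ℕ)) →
        x i j ∈ gridNear u s B (2 * s / (l + 1 : ℕ))) ∧ ∀ i j, x i j ∈ Γ := by
  obtain ⟨hy1, hy2, hy3, hy4⟩ := hy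
  beta_reduce at hy1 hy2 hy3
  have hL : (0 : ℝ) < (l + 1 : ℕ) := by positivity
  have hsplit : ∀ i, ∑ j, z i j =
      ∑ j : Fin n₁, z i (Fin.castAdd (l + 1) j) + (l + 1 : ℕ) * zr i := fun i => by
    have h1 := Fin.sum_univ_add (a := n₁) (b := l + 1) fun j => z i j
    refine h1.trans ?_
    simp only [hzr, Finset.sum_const, Finset.card_univ, Fintype.card_fin, nsmul_eq_mul]
  have hsplit' : ∀ j, ∑ i, z i j =
      ∑ i : Fin m₁, z (Fin.castAdd (l + 1) i) j + (l + 1 : ℕ) * zc j := fun j => by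
    have h1 := Fin.sum_univ_add (a := m₁) (b := l + 1) fun i => z i j
    refine h1.trans ?_
    simp only [hzc, Finset.sum_const, Finset.card_univ, Fintype.card_fin, nsmul_eq_mul]
  have hzr' : ∀ i, u + η ≤ zr i ∧ zr i ≤ u + s * B - η := fun i => hzr i 0 ▸ hz i _
  have hzc' : ∀ j, u + η ≤ zc j ∧ zc j ≤ u + s * B - η := fun j => hzc 0 j ▸ hz _ j
  have hzz : ∀ j : Fin (l + 1), zc (Fin.natAdd n₁ j) = z' := fun j => by
    rw [← hzc 0, hzr, hz']
  have hrz : ∀ i : Fin (l + 1), ∑ j, z (Fin.natAdd m₁ i) j =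
      ∑ j : Fin n₁, zc (Fin.castAdd (l + 1) j) + (l + 1 : ℕ) * z' := fun i => by
    rw [hsplit, hz']
    simp only [hzc]
  have hcz : ∀ j : Fin (l + 1), ∑ i, z i (Fin.natAdd n₁ j) =
      ∑ i : Fin m₁, zr (Fin.castAdd (l + 1) i) + (l + 1 : ℕ) * z' := fun j => by
    rw [hsplit', hzz]
    simp only [hzr]
  have hcb : ∀ j : Fin n₁, ∑ i, z i (Fin.castAdd (l + 1) j) - ∑ i, y i j =
      (l + 1 : ℕ) * zc (Fin.castAdd (l + 1) j) -
        ∑ i, (y i j - z (Fin.castAdd (l + 1) i) (Fin.castAdd (l + 1) j)) := fun j => by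
    rw [hsplit', Finset.sum_sub_distrib]
    ring
  have hrb : ∀ i : Fin m₁, ∑ j, z (Fin.castAdd (l + 1) i) j - ∑ j, y i j =
      (l + 1 : ℕ) * zr (Fin.castAdd (l + 1) i) -
        ∑ j, (y i j - z (Fin.castAdd (l + 1) i) (Fin.castAdd (l + 1) j)) := fun i => by
    rw [hsplit, Finset.sum_sub_distrib]
    ring
  obtain ⟨x, hx1, hx2, hx3, hx4, hx5⟩ := exists_fill (B := B) (L := l + 1) (u := u) (Nat.succ_pos l) hs y
    (fun i => ∑ j, z i j) (fun j => ∑ i, z i j) hrz hcz Finset.sum_comm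
    (fun j => by
      have h1 := abs_le.1 (hy2 j)
      have h2 := hzc' (Fin.castAdd (l + 1) j)
      rw [show ∑ i, z i (Fin.castAdd (l + 1) j) - ∑ i, y i j = _ from hcb j]
      constructor <;> nlinarith)
    (fun i => by
      have h1 := abs_le.1 (hy1 i)
      have h2 := hzr' (Fin.castAdd (l + 1) i)
      rw [show ∑ j, z (Fin.castAdd (l + 1) i) j - ∑ j, y i j = _ from hrb i]
      constructor <;> nlinarith)
    (by
      have h1 : ∑ j : Fin n₁, (∑ i, z i (Fin.castAdd (l + 1) j) - ∑ i, y i j) =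
          (l + 1 : ℕ) * ∑ j : Fin n₁, zc (Fin.castAdd (l + 1) j) -
            ∑ i, ∑ j, (y i j - z (Fin.castAdd (l + 1) i) (Fin.castAdd (l + 1) j)) := by
        rw [Finset.sum_congr rfl fun j _ => hcb j, Finset.sum_sub_distrib, Finset.mul_sum,
          Finset.sum_comm (s := Finset.univ) (t := (Finset.univ : Finset (Fin m₁)))]
      rw [show ∑ j : Fin n₁, (∑ i, z i (Fin.castAdd (l + 1) j) - ∑ i, y i j) = _ from h1]
      set D := ∑ i, ∑ j, (y i j - z (Fin.castAdd (l + 1) i) (Fin.castAdd (l + 1) j))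
      have h2 : |D / (l + 1 : ℕ)| ≤ η * (l + 1 : ℕ) / 2 := by
        rw [abs_div, abs_of_pos hL, div_le_iff₀ hL]
        refine hy3.trans_eq ?_
        ring
      have h3 := abs_le.1 h2
      have h4 := hzr' (Fin.natAdd m₁ (0 : Fin (l + 1)))
      rw [hz'] at h4
      have h5 : ∑ j : Fin n₁, zc (Fin.castAdd (l + 1) j) + (l + 1 : ℕ) * z' -
          ((l + 1 : ℕ) * ∑ j : Fin n₁, zc (Fin.castAdd (l + 1) j) - D) / (l + 1 : ℕ) =
          (l + 1 : ℕ) * z' + D / (l + 1 : ℕ) := by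
        field_simp
        ring
      rw [h5]
      constructor <;> nlinarith)
  refine ⟨x, hx1, hx2, hx3, hx4, ?_⟩
  rcases hgrid with rfl | ⟨rfl, hs1, hu⟩
  · exact fun _ _ => trivial
  · exact hx5 hs1 hu hr hc hy4

end cloned

/-! ### Averaging over translations along the fiber -/

section average
variable {m n : ℕ}

theorem prodWt_eq (w : Fin m → Fin n → ℝ → ℝ≥0∞) (x : Fin m → Fin n → ℝ) :
    prodWt w x = ∏ e : Fin m × Fin n, w e.1 e.2 (x e.1 e.2) :=
  (Fintype.prod_prod_type fun e : Fin m × Fin n => w e.1 e.2 (x e.1 e.2)).symm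

/-- Fiber integrals over the reals are invariant under translations by matrices with margin `0`. -/
theorem fibInt_add (F : (Fin (m + 1) → Fin (n + 1) → ℝ) → ℝ≥0∞)
    {r : Fin (m + 1) → ℝ} {c : Fin (n + 1) → ℝ} (hrc : ∑ i, r i = ∑ j, c j)
    {w : Fin (m + 1) → Fin (n + 1) → ℝ} (hr : ∀ i, ∑ j, w i j = 0) (hc : ∀ j, ∑ i, w i j = 0) :
    fibInt volume (fun x => F (x + w)) r c = fibInt volume F r c := by
  unfold fibInt
  have h := lintegral_add_right_eq_self (μ := (volume : Measure (Fin m → Fin n → ℝ)))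
    (fun y => F (completion r c y)) (fun i j => w i.castSucc j.castSucc)
  refine Eq.trans (lintegral_congr fun y => congrArg F ?_) h
  have h1 := completion_restrict (r := r) (c := c) (completion r c y + w)
    (fun i => by
      simp only [Pi.add_apply, Finset.sum_add_distrib, hr, add_zero]
      exact sum_completion_row r c y hrc i)
    (fun j => by
      simp only [Pi.add_apply, Finset.sum_add_distrib, hc, add_zero]
      exact sum_completion_col r c y j)
  refine h1.symm.trans (congrArg (completion r c) ?_)
  ext i j
  simp only [Pi.add_apply]
  congr 1
  exact completion_castSucc_castSucc r c y i j

/-- Translations by `T • (a ⊗ b)` have zero margin and preserve fiber integrals. Averaging over `|T|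
≤ ε` replaces the weights on `Q` by their joint averages, so a lower bound for these averages
suffices. -/
theorem le_fibInt_of_average {r : Fin (m + 1) → ℝ} {c : Fin (n + 1) → ℝ}
    (hrc : ∑ i, r i = ∑ j, c j) {w w' : Fin (m + 1) → Fin (n + 1) → ℝ → ℝ≥0∞}
    (hw : ∀ i j, Measurable (w i j)) (hw' : ∀ i j, Measurable (w' i j))
    {a : Fin (m + 1) → ℝ} {b : Fin (n + 1) → ℝ} (ha : ∑ i, a i = 0) (hb : ∑ j, b j = 0)
    (Q : Finset (Fin (m + 1) × Fin (n + 1))) (hQ : ∀ e ∉ Q, a e.1 * b e.2 = 0)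
    (hQw : ∀ e ∉ Q, w' e.1 e.2 = w e.1 e.2) {ε : ℝ} (hε : 0 < ε) {q : ℝ≥0∞}
    (h : ∀ x : Fin (m + 1) → Fin (n + 1) → ℝ,
      ENNReal.ofReal (2 * ε) * (q * ∏ e ∈ Q, w' e.1 e.2 (x e.1 e.2)) ≤
        ∫⁻ T in Set.Icc (-ε) ε, ∏ e ∈ Q, w e.1 e.2 (x e.1 e.2 + T * (a e.1 * b e.2))) :
    q * fibInt volume (prodWt w') r c ≤ fibInt volume (prodWt w) r c := by
  classical
  have hpw := measurable_prodWt hw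
  have hpw' := measurable_prodWt hw'
  have hε2 : ENNReal.ofReal (2 * ε) ≠ 0 := by
    rw [Ne, ENNReal.ofReal_eq_zero, not_le]; positivity
  let W : ℝ → Fin (m + 1) → Fin (n + 1) → ℝ := fun T i j => T * (a i * b j)
  have hW : Measurable fun p : (Fin (m + 1) → Fin (n + 1) → ℝ) × ℝ => p.1 + W p.2 := by
    refine measurable_pi_lambda _ fun i => measurable_pi_lambda _ fun j => ?_
    have h1 : Measurable fun x : Fin (m + 1) → Fin (n + 1) → ℝ => x i j :=
      (measurable_pi_apply j).comp (measurable_pi_apply i)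
    exact (h1.comp measurable_fst).add (measurable_snd.mul_const _)
  have hinv : ∀ T, fibInt volume (fun x => prodWt w (x + W T)) r c =
      fibInt volume (prodWt w) r c := fun T =>
    fibInt_add (prodWt w) hrc (fun i => by simp only [W, ← Finset.mul_sum, hb, mul_zero])
      (fun j => by simp only [W, ← Finset.mul_sum, ← Finset.sum_mul, ha, zero_mul, mul_zero])
  have hvol : (volume : Measure ℝ) (Set.Icc (-ε) ε) = ENNReal.ofReal (2 * ε) := by
    rw [Real.volume_Icc]; congr 1; ring
  have havg : ENNReal.ofReal (2 * ε) * fibInt volume (prodWt w) r c =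
      fibInt volume (fun x => ∫⁻ T in Set.Icc (-ε) ε, prodWt w (x + W T)) r c := by
    have h1 : ∫⁻ T in Set.Icc (-ε) ε, fibInt volume (fun x => prodWt w (x + W T)) r c =
        ENNReal.ofReal (2 * ε) * fibInt volume (prodWt w) r c := by
      simp only [hinv, lintegral_const, Measure.restrict_apply MeasurableSet.univ, Set.univ_inter,
        hvol, mul_comm]
    rw [← h1]
    unfold fibInt
    refine lintegral_lintegral_swap ?_
    have h2 : Measurable fun p : ℝ × (Fin (m + 1 - 1) → Fin (n + 1 - 1) → ℝ) =>
        prodWt w (completion r c p.2 + W p.1) :=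
      hpw.comp (hW.comp (((measurable_completion_right r c).comp measurable_snd).prodMk
        measurable_fst))
    exact h2.aemeasurable
  have hle : ENNReal.ofReal (2 * ε) * (q * fibInt volume (prodWt w') r c) ≤
      ENNReal.ofReal (2 * ε) * fibInt volume (prodWt w) r c := by
    rw [havg, ← fibInt_const_mul q hpw', ← fibInt_const_mul _ (hpw'.const_mul q)]
    refine lintegral_mono fun y => ?_
    beta_reduce
    set x := completion r c y
    have h1 : ∀ T, prodWt w (x + W T) =
        (∏ e ∈ Qᶜ, w e.1 e.2 (x e.1 e.2)) *
          ∏ e ∈ Q, w e.1 e.2 (x e.1 e.2 + T * (a e.1 * b e.2)) := by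
      intro T
      rw [prodWt_eq, ← Finset.prod_compl_mul_prod Q]
      congr 1
      refine Finset.prod_congr rfl fun e he => ?_
      rw [Finset.mem_compl] at he
      simp only [Pi.add_apply, W, hQ e he, mul_zero, add_zero]
    have h2 : prodWt w' x = (∏ e ∈ Qᶜ, w e.1 e.2 (x e.1 e.2)) *
        ∏ e ∈ Q, w' e.1 e.2 (x e.1 e.2) := by
      rw [prodWt_eq, ← Finset.prod_compl_mul_prod Q]
      congr 1
      refine Finset.prod_congr rfl fun e he => ?_
      rw [Finset.mem_compl] at he
      rw [hQw e he]
    simp only [h1]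
    have h3 : Measurable fun T : ℝ => ∏ e ∈ Q, w e.1 e.2 (x e.1 e.2 + T * (a e.1 * b e.2)) :=
      Finset.measurable_prod _ fun e _ => (hw _ _).comp (by fun_prop)
    rw [lintegral_const_mul _ h3, h2]
    calc _ = (∏ e ∈ Qᶜ, w e.1 e.2 (x e.1 e.2)) *
        (ENNReal.ofReal (2 * ε) * (q * ∏ e ∈ Q, w' e.1 e.2 (x e.1 e.2))) := by ring
      _ ≤ _ := mul_le_mul_right (h x) _
  exact (ENNReal.mul_le_mul_iff_right hε2 ENNReal.ofReal_ne_top).1 hle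

end average

/-! ### Zero sum weights on small groups -/

/-- Pairs carry the weights `1, -1`, and at most one triple carries `1, 1, -2`. A product of two
groups is then a tile of at most nine cells, on which the rank one matrix `κ ⊗ κ'` has zero margin
and entries of absolute value between `1` and `4`. -/
theorem exists_grouping {ι : Type*} [DecidableEq ι] (S : Finset ι) (hS : 2 ≤ S.card) :
    ∃ (P : Finset (Finset ι)) (κ : ι → ℝ), (P : Set (Finset ι)).PairwiseDisjoint id ∧
      P.biUnion id = S ∧ (∀ g ∈ P, g.card ≤ 3 ∧ ∑ i ∈ g, κ i = 0) ∧
      ∀ i, 1 ≤ |κ i| ∧ |κ i| ≤ 2 := by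
  induction S using Finset.strongInduction with
  | H S ih =>
    obtain ⟨a, ha⟩ : S.Nonempty := Finset.card_pos.1 (by omega)
    have h1 : 1 ≤ (S.erase a).card := by rw [Finset.card_erase_of_mem ha]; omega
    obtain ⟨b, hb⟩ := Finset.card_pos.1 h1
    have hab : a ≠ b := (Finset.ne_of_mem_erase hb).symm
    set S' := (S.erase a).erase b with hS'
    have hcard : S'.card + 2 = S.card := by
      rw [hS', Finset.card_erase_of_mem hb, Finset.card_erase_of_mem ha]; omega
    have hSeq : S = {a, b} ∪ S' := by
      rw [hS', Finset.insert_union, Finset.singleton_union, Finset.insert_erase hb,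
        Finset.insert_erase ha]
    have haS' : a ∉ S' := by simp [hS']
    have hbS' : b ∉ S' := by simp [hS']
    rcases Nat.lt_or_ge S'.card 2 with h2 | h2
    · refine ⟨{S}, ?_⟩
      rcases Nat.lt_or_ge S'.card 1 with h3 | h3
      · have h4 : S' = ∅ := Finset.card_eq_zero.1 (by omega)
        rw [h4, Finset.union_empty] at hSeq
        refine ⟨fun i => if i = a then 1 else -1, by simp, by simp, ?_, fun i => ?_⟩
        · intro g hg
          rw [Finset.mem_singleton.1 hg]
          refine ⟨by omega, ?_⟩
          rw [hSeq, Finset.sum_pair hab]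
          simp [hab.symm]
        · beta_reduce
          split_ifs <;> norm_num
      · obtain ⟨d, hd⟩ := Finset.card_eq_one.1 (show S'.card = 1 by omega)
        have hda : d ≠ a := fun h => haS' (by rw [hd, h]; simp)
        have hdb : d ≠ b := fun h => hbS' (by rw [hd, h]; simp)
        refine ⟨fun i => if i = d then -2 else 1, by simp, by simp, ?_, fun i => ?_⟩
        · intro g hg
          rw [Finset.mem_singleton.1 hg]
          refine ⟨by omega, ?_⟩
          rw [hSeq, hd, Finset.sum_union (by simp [hda, hdb]),
            Finset.sum_pair hab, Finset.sum_singleton]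
          simp [hda.symm, hdb.symm]
          norm_num
        · beta_reduce
          split_ifs <;> norm_num
    · obtain ⟨P, κ, hP1, hP2, hP3, hP4⟩ := ih S' (by
        rw [hS']
        exact (Finset.erase_ssubset hb).trans (Finset.erase_ssubset ha)) h2
      have hsub : ∀ g ∈ P, g ⊆ S' := fun g hg => by
        rw [← hP2]; exact Finset.subset_biUnion_of_mem id hg
      refine ⟨insert {a, b} P, fun i => if i = a then 1 else if i = b then -1 else κ i,
        ?_, ?_, ?_, ?_⟩
      · rw [Finset.coe_insert, Set.pairwiseDisjoint_insert]
        refine ⟨hP1, fun g hg _ => ?_⟩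
        refine Finset.disjoint_left.2 fun x hx hx' => ?_
        have := hsub g hg hx'
        simp only [id, Finset.mem_insert, Finset.mem_singleton] at hx
        rcases hx with rfl | rfl
        · exact haS' this
        · exact hbS' this
      · rw [Finset.biUnion_insert, hP2, id, ← hSeq]
      · intro g hg
        rcases Finset.mem_insert.1 hg with rfl | hg
        · refine ⟨Finset.card_le_two.trans (by norm_num), ?_⟩
          rw [Finset.sum_pair hab]
          simp [hab.symm]
        · refine ⟨(hP3 g hg).1, ?_⟩
          rw [← (hP3 g hg).2]
          refine Finset.sum_congr rfl fun i hi => ?_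
          have hiS := hsub g hg hi
          beta_reduce
          rw [if_neg (ne_of_mem_of_not_mem hiS haS'), if_neg (ne_of_mem_of_not_mem hiS hbS')]
      · intro i
        beta_reduce
        split_ifs
        · norm_num
        · norm_num
        · exact hP4 i

/-! ### From density points to neighborhoods -/

/-- `E` fills most of the balls of radius `5 ε` around the points `u` and `u + s`. -/
def FillsNear (E : Set ℝ) (u s ε : ℝ) : Prop :=
  ∀ l : ℕ, l ≤ 1 → volume (Metric.closedBall (u + s * l) (5 * ε) \ E) ≤ ENNReal.ofReal (ε / 9)

/-- A point within `ε` of the grid moves by at most `4 ε`, hence stays in the ball of radius `5 ε`;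
and as `|v| ≥ 1`, the set of bad `T` is no larger than the missing part of the ball. -/
theorem volume_bad_le {E : Set ℝ} {u s ε : ℝ} (hE : FillsNear E u s ε) {x : ℝ}
    (hx : x ∈ gridNear u s 1 ε) {v : ℝ} (hv1 : 1 ≤ |v|) (hv4 : |v| ≤ 4) :
    volume {T : ℝ | T ∈ Set.Icc (-ε) ε ∧ x + T * v ∉ E} ≤ ENNReal.ofReal (ε / 9) := by
  obtain ⟨l, hl, hxl⟩ := hx
  have hv0 : v ≠ 0 := fun h => by simp [h] at hv1; linarith
  have hsub : {T : ℝ | T ∈ Set.Icc (-ε) ε ∧ x + T * v ∉ E} ⊆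
      (fun T => v * T) ⁻¹' ((fun t => x + t) ⁻¹' (Metric.closedBall (u + s * l) (5 * ε) \ E)) := by
    rintro T ⟨hT, hTE⟩
    refine ⟨?_, by simpa [mul_comm] using hTE⟩
    rw [Metric.mem_closedBall, Real.dist_eq]
    have h1 : |T| ≤ ε := abs_le.2 hT
    have h2 : |v * T| ≤ 4 * ε := by
      rw [abs_mul]; gcongr
    calc |x + v * T - (u + s * l)| = |(x - (u + s * l)) + v * T| := by ring_nf
      _ ≤ |x - (u + s * l)| + |v * T| := abs_add_le _ _
      _ ≤ 5 * ε := by linarith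
  refine (measure_mono hsub).trans ?_
  rw [Real.volume_preimage_mul_left hv0, measure_preimage_add]
  calc _ ≤ 1 * ENNReal.ofReal (ε / 9) := by
        refine mul_le_mul' ?_ (hE l hl)
        rw [← ENNReal.ofReal_one]
        refine ENNReal.ofReal_le_ofReal ?_
        rw [abs_inv]
        exact inv_le_one_of_one_le₀ hv1
    _ = _ := one_mul _

section tiles
variable {m n : ℕ} {r : Fin (m + 1) → ℝ} {c : Fin (n + 1) → ℝ}

/-- The weights `w` with `g` in place of the weights of the cells in `Q`. -/
def replaceWt (w : Fin m → Fin n → ℝ → ℝ≥0∞) (g : ℝ → ℝ≥0∞) (Q : Finset (Fin m × Fin n)) :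
    Fin m → Fin n → ℝ → ℝ≥0∞ := fun i j => if (i, j) ∈ Q then g else w i j

theorem measurable_replaceWt {w : Fin m → Fin n → ℝ → ℝ≥0∞} {g : ℝ → ℝ≥0∞}
    (hw : ∀ i j, Measurable (w i j)) (hg : Measurable g) (Q : Finset (Fin m × Fin n)) (i : Fin m)
    (j : Fin n) : Measurable (replaceWt w g Q i j) := by
  unfold replaceWt
  split_ifs
  exacts [hg, hw i j]

/-- Each of the at most nine cells excludes a set of `T` of measure `ε / 9`. So at least half of the
translation parameters in `[-ε, ε]` bring all cells of the tile into `E` simultaneously. -/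
theorem le_fibInt_tile (hrc : ∑ i, r i = ∑ j, c j)
    {w : Fin (m + 1) → Fin (n + 1) → ℝ → ℝ≥0∞} (hw : ∀ i j, Measurable (w i j)) {E : Set ℝ}
    {u s ε : ℝ} (hε : 0 < ε) (hE : FillsNear E u s ε)
    {g : Finset (Fin (m + 1))} {g' : Finset (Fin (n + 1))} (hg : g.card ≤ 3) (hg' : g'.card ≤ 3)
    {κ : Fin (m + 1) → ℝ} {κ' : Fin (n + 1) → ℝ} (hκ : ∑ i ∈ g, κ i = 0) (hκ' : ∑ j ∈ g', κ' j = 0)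
    (hκb : ∀ i, 1 ≤ |κ i| ∧ |κ i| ≤ 2) (hκb' : ∀ i, 1 ≤ |κ' i| ∧ |κ' i| ≤ 2)
    (hwE : ∀ i ∈ g, ∀ j ∈ g', w i j = E.indicator 1) :
    2⁻¹ * fibInt volume (prodWt (replaceWt w ((gridNear u s 1 ε).indicator 1) (g ×ˢ g'))) r c ≤
      fibInt volume (prodWt w) r c := by
  classical
  set T₀ := gridNear u s 1 ε with hT₀
  have hTm : MeasurableSet T₀ := measurableSet_gridNear _ _ _ _
  have hw' := measurable_replaceWt hw (measurable_one.indicator hTm) (g ×ˢ g')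
  refine le_fibInt_of_average hrc hw hw' (a := fun i => if i ∈ g then κ i else 0)
    (b := fun j => if j ∈ g' then κ' j else 0) (by simpa [Finset.sum_ite_mem] using hκ)
    (by simpa [Finset.sum_ite_mem] using hκ') (g ×ˢ g') (fun e he => ?_) (fun e he => ?_) hε
    fun x => ?_
  · rw [Finset.mem_product, not_and_or] at he
    rcases he with h | h <;> simp [h]
  · simp only [replaceWt, he, if_false]
  · have h1 : ∏ e ∈ g ×ˢ g', replaceWt w (T₀.indicator 1) (g ×ˢ g') e.1 e.2 (x e.1 e.2) =
        ∏ e ∈ g ×ˢ g', T₀.indicator 1 (x e.1 e.2) :=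
      Finset.prod_congr rfl fun e he => by simp only [replaceWt, he, if_true]
    have h2 : ∀ T : ℝ, ∏ e ∈ g ×ˢ g', w e.1 e.2 (x e.1 e.2 + T * ((if e.1 ∈ g then κ e.1 else 0) *
        if e.2 ∈ g' then κ' e.2 else 0)) =
        ∏ e ∈ g ×ˢ g', E.indicator 1 (x e.1 e.2 + T * (κ e.1 * κ' e.2)) := fun T =>
      Finset.prod_congr rfl fun e he => by
        rw [Finset.mem_product] at he
        rw [hwE _ he.1 _ he.2, if_pos he.1, if_pos he.2]
    rw [h1]
    simp only [h2]
    by_cases hx : ∀ e ∈ g ×ˢ g', x e.1 e.2 ∈ T₀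
    · rw [Finset.prod_eq_one fun e he => by rw [Set.indicator_of_mem (hx e he), Pi.one_apply],
        mul_one]
      let bad : Set ℝ := ⋃ e ∈ g ×ˢ g', {T : ℝ | T ∈ Set.Icc (-ε) ε ∧
        x e.1 e.2 + T * (κ e.1 * κ' e.2) ∉ E}
      have hbad : volume bad ≤ ENNReal.ofReal ε := by
        refine (measure_biUnion_finset_le _ _).trans ?_
        have h3 : ∀ e ∈ g ×ˢ g', volume {T : ℝ | T ∈ Set.Icc (-ε) ε ∧
            x e.1 e.2 + T * (κ e.1 * κ' e.2) ∉ E} ≤ ENNReal.ofReal (ε / 9) := fun e he => by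
          have h4 := hκb e.1
          have h5 := hκb' e.2
          refine volume_bad_le hE (hx e he) ?_ ?_
          · rw [abs_mul]; nlinarith
          · rw [abs_mul]; nlinarith
        refine (Finset.sum_le_card_nsmul _ _ _ h3).trans ?_
        have h4 : (g ×ˢ g').card ≤ 9 := by
          rw [Finset.card_product]
          calc _ ≤ 3 * 3 := Nat.mul_le_mul hg hg'
            _ = 9 := rfl
        rw [nsmul_eq_mul]
        calc ((g ×ˢ g').card : ℝ≥0∞) * ENNReal.ofReal (ε / 9)
            ≤ (9 : ℕ) * ENNReal.ofReal (ε / 9) := by gcongr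
          _ = ENNReal.ofReal (9 * (ε / 9)) := by
            rw [ENNReal.ofReal_mul (by norm_num)]; norm_num
          _ = ENNReal.ofReal ε := by congr 1; ring
      -- `E` is not assumed to be measurable, hence the measurable hull of the bad set.
      have hsub : Set.Icc (-ε) ε \ toMeasurable volume bad ⊆ Set.Icc (-ε) ε := Set.sdiff_subset
      have hm1 : MeasurableSet (Set.Icc (-ε) ε \ toMeasurable volume bad) :=
        measurableSet_Icc.diff (measurableSet_toMeasurable _ _)
      calc ENNReal.ofReal (2 * ε) * 2⁻¹ = ENNReal.ofReal ε := by
            rw [ENNReal.ofReal_mul two_pos.le, mul_comm, ← mul_assoc]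
            simp [ENNReal.inv_mul_cancel]
        _ ≤ volume (Set.Icc (-ε) ε \ toMeasurable volume bad) := by
            refine le_trans ?_ (le_measure_sdiff)
            rw [measure_toMeasurable, Real.volume_Icc]
            refine ENNReal.le_sub_of_add_le_right (ne_top_of_le_ne_top ENNReal.ofReal_ne_top hbad) ?_
            refine (add_le_add le_rfl hbad).trans_eq ?_
            rw [← ENNReal.ofReal_add hε.le hε.le]
            congr 1
            ring
        _ = ∫⁻ _ in Set.Icc (-ε) ε \ toMeasurable volume bad, 1 := by simp
        _ ≤ ∫⁻ T in Set.Icc (-ε) ε \ toMeasurable volume bad,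
              ∏ e ∈ g ×ˢ g', E.indicator 1 (x e.1 e.2 + T * (κ e.1 * κ' e.2)) := by
            refine setLIntegral_mono' hm1 fun T hT => ?_
            rw [Finset.prod_eq_one fun e he => ?_]
            have : x e.1 e.2 + T * (κ e.1 * κ' e.2) ∈ E := by
              by_contra hcon
              refine hT.2 (subset_toMeasurable _ _ ?_)
              exact Set.mem_biUnion (s := fun e : Fin (m + 1) × Fin (n + 1) => e ∈ g ×ˢ g')
                he ⟨hT.1, hcon⟩
            rw [Set.indicator_of_mem this, Pi.one_apply]
        _ ≤ _ := lintegral_mono_set hsub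
    · push Not at hx
      obtain ⟨e, he, hxe⟩ := hx
      rw [Finset.prod_eq_zero he (Set.indicator_of_notMem hxe _), mul_zero, mul_zero]
      exact zero_le

/-- The products of groups partition `S × S'` into tiles, which are treated one after the other.
Each tile costs a factor `1/2`, and there are no more tiles than cells. -/
theorem le_fibInt_rect (hrc : ∑ i, r i = ∑ j, c j)
    {w : Fin (m + 1) → Fin (n + 1) → ℝ → ℝ≥0∞} (hw : ∀ i j, Measurable (w i j)) {E : Set ℝ}
    {u s ε : ℝ} (hε : 0 < ε) (hE : FillsNear E u s ε)
    {S : Finset (Fin (m + 1))} {S' : Finset (Fin (n + 1))} (hS : 2 ≤ S.card) (hS' : 2 ≤ S'.card)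
    (hwE : ∀ i ∈ S, ∀ j ∈ S', w i j = E.indicator 1) :
    2⁻¹ ^ (S.card * S'.card) *
      fibInt volume (prodWt (replaceWt w ((gridNear u s 1 ε).indicator 1) (S ×ˢ S'))) r c ≤
      fibInt volume (prodWt w) r c := by
  classical
  obtain ⟨P, κ, hP1, hP2, hP3, hP4⟩ := exists_grouping S hS
  obtain ⟨P', κ', hP1', hP2', hP3', hP4'⟩ := exists_grouping S' hS'
  set v : ℝ → ℝ≥0∞ := (gridNear u s 1 ε).indicator 1 with hv
  have hvm : Measurable v := measurable_one.indicator (measurableSet_gridNear _ _ _ _)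
  have key : ∀ 𝒯 : Finset (Finset (Fin (m + 1)) × Finset (Fin (n + 1))), 𝒯 ⊆ P ×ˢ P' →
      2⁻¹ ^ (𝒯.biUnion fun t => t.1 ×ˢ t.2).card *
        fibInt volume (prodWt (replaceWt w v (𝒯.biUnion fun t => t.1 ×ˢ t.2))) r c ≤
      fibInt volume (prodWt w) r c := by
    intro 𝒯
    induction 𝒯 using Finset.induction_on with
    | empty =>
      intro _
      simp only [Finset.biUnion_empty, Finset.card_empty, pow_zero, one_mul]
      refine le_of_eq ?_
      congr 2
    | insert t 𝒯 ht ih =>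
      intro hsub
      have ht' := Finset.mem_product.1 (hsub (Finset.mem_insert_self t 𝒯))
      have hsub' : 𝒯 ⊆ P ×ˢ P' := (Finset.subset_insert _ _).trans hsub
      refine le_trans ?_ (ih hsub')
      set U := 𝒯.biUnion fun t => t.1 ×ˢ t.2 with hU
      have hdisj : Disjoint (t.1 ×ˢ t.2) U := by
        rw [hU, Finset.disjoint_biUnion_right]
        intro t' ht''
        have h1 := Finset.mem_product.1 (hsub' ht'')
        have hne : t ≠ t' := fun h => ht (h ▸ ht'')
        rw [Finset.disjoint_product]
        by_cases h2 : t.1 = t'.1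
        · right
          exact hP1' ht'.2 h1.2 fun h3 => hne (Prod.ext h2 h3)
        · left
          exact hP1 ht'.1 h1.1 h2
      have hsubS : ∀ i ∈ t.1, i ∈ S := fun i hi => by
        rw [← hP2]; exact Finset.mem_biUnion.2 ⟨t.1, ht'.1, hi⟩
      have hsubS' : ∀ i ∈ t.2, i ∈ S' := fun i hi => by
        rw [← hP2']; exact Finset.mem_biUnion.2 ⟨t.2, ht'.2, hi⟩
      have htile := le_fibInt_tile hrc (measurable_replaceWt hw hvm U) hε hE
        (hP3 _ ht'.1).1 (hP3' _ ht'.2).1 (hP3 _ ht'.1).2 (hP3' _ ht'.2).2 hP4 hP4'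
        (fun i hi j hj => by
          have : (i, j) ∉ U := Finset.disjoint_left.1 hdisj (Finset.mk_mem_product hi hj)
          simp only [replaceWt, this, if_false]
          exact hwE i (hsubS i hi) j (hsubS' j hj))
      rw [Finset.biUnion_insert, ← hU, Finset.card_union_of_disjoint hdisj]
      have heq : replaceWt (replaceWt w v U) v (t.1 ×ˢ t.2) = replaceWt w v (t.1 ×ˢ t.2 ∪ U) := by
        ext i j x
        simp only [replaceWt, Finset.mem_union]
        split_ifs <;> tauto
      rw [← hv, heq] at htile
      -- The power counts cells rather than tiles, which is enough for a nonempty tile; an empty one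
      -- changes nothing.
      have h2 : (2⁻¹ : ℝ≥0∞) ^ (t.1 ×ˢ t.2).card ≤ 2⁻¹ ∨ (t.1 ×ˢ t.2).card = 0 := by
        rcases Nat.eq_zero_or_pos (t.1 ×ˢ t.2).card with h | h
        · exact Or.inr h
        · left
          calc (2⁻¹ : ℝ≥0∞) ^ (t.1 ×ˢ t.2).card ≤ 2⁻¹ ^ 1 :=
              pow_le_pow_right_of_le_one' (by simp) h
            _ = 2⁻¹ := pow_one _
      rcases h2 with h2 | h2
      · rw [pow_add]
        calc _ = 2⁻¹ ^ U.card * (2⁻¹ ^ (t.1 ×ˢ t.2).card *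
              fibInt volume (prodWt (replaceWt w v (t.1 ×ˢ t.2 ∪ U))) r c) := by ring
          _ ≤ 2⁻¹ ^ U.card * (2⁻¹ *
              fibInt volume (prodWt (replaceWt w v (t.1 ×ˢ t.2 ∪ U))) r c) := by gcongr
          _ ≤ _ := by gcongr
      · rw [h2, Finset.card_eq_zero.1 h2, Finset.empty_union, zero_add]
  have h1 := key (P ×ˢ P') subset_rfl
  have h2 : (P ×ˢ P').biUnion (fun t => t.1 ×ˢ t.2) = S ×ˢ S' := by
    ext e
    simp only [Finset.mem_biUnion, Finset.mem_product, Prod.exists, ← hP2, ← hP2', id]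
    constructor
    · rintro ⟨g, g', ⟨h1, h2⟩, h3, h4⟩
      exact ⟨⟨g, h1, h3⟩, ⟨g', h2, h4⟩⟩
    · rintro ⟨⟨g, h1, h3⟩, ⟨g', h2, h4⟩⟩
      exact ⟨g, g', ⟨h1, h2⟩, h3, h4⟩
  rwa [h2, Finset.card_product] at h1

end tiles

/-! ### Grids on which the density is bounded below -/

/-- Off the upper left block, the densities `g (d i) (d' j)` of a fiber integral can be replaced, at
the cost of a factor `c` per cell, by the indicator of a neighborhood of a grid. -/
def GridBound (ζ : Measure ℝ) (Γ : AddSubgroup ℝ) {m₀ n₀ : ℕ} (g : Fin m₀ → Fin n₀ → ℝ → ℝ≥0∞)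
    (u s : ℝ) (B : ℕ) (ε c : ℝ) : Prop :=
  ∀ (m₁ n₁ l : ℕ), 2 ≤ m₁ → 2 ≤ n₁ → 1 ≤ l → ∀ (d : Fin (m₁ + l + 1) → Fin m₀)
    (d' : Fin (n₁ + l + 1) → Fin n₀) (r : Fin (m₁ + l + 1) → ℝ) (t : Fin (n₁ + l + 1) → ℝ),
    (∀ i, r i ∈ Γ) → (∀ j, t j ∈ Γ) → ∑ i, r i = ∑ j, t j →
    ENNReal.ofReal c ^ ((l + 1) * ((m₁ + l + 1) + (n₁ + l + 1))) *
      fibInt ζ (prodWt (blockWt m₁ n₁ (fun i j => g (d i) (d' j)) (gridNear u s B ε))) r t ≤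
      fibInt ζ (prodWt fun i j => g (d i) (d' j)) r t

theorem card_filter_ge (m l : ℕ) :
    (Finset.univ.filter fun i : Fin (m + l) => m ≤ (i : ℕ)).card = l := by
  have : (Finset.univ.filter fun i : Fin (m + l) => m ≤ (i : ℕ)) =
      Finset.univ.map (Fin.natAddEmb m) := by
    ext i
    simp only [Finset.mem_filter, Finset.mem_univ, true_and, Finset.mem_map, Fin.natAddEmb_apply]
    constructor
    · intro h
      exact ⟨⟨i - m, by omega⟩, Fin.ext (by simp; omega)⟩
    · rintro ⟨j, rfl⟩
      simp
  rw [this, Finset.card_map, Finset.card_univ, Fintype.card_fin]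

theorem card_filter_lt (m l : ℕ) :
    (Finset.univ.filter fun i : Fin (m + l) => (i : ℕ) < m).card = m := by
  have h := Finset.card_filter_add_card_filter_not (s := Finset.univ)
    (fun i : Fin (m + l) => (i : ℕ) < m)
  simp only [not_lt, card_filter_ge, Finset.card_univ, Fintype.card_fin] at h
  omega

theorem pow_mul_blockWt_le {m₁ n₁ l : ℕ} {f : Fin (m₁ + l) → Fin (n₁ + l) → ℝ → ℝ≥0∞}
    {S : Set ℝ} {q : ℝ≥0∞} (hq : q ≤ 1) {x : Fin (m₁ + l) → Fin (n₁ + l) → ℝ}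
    (hf : ∀ i j, x i j ∈ S → q ≤ f i j (x i j)) :
    q ^ (l * ((m₁ + l) + (n₁ + l))) * prodWt (blockWt m₁ n₁ f S) x ≤ prodWt f x := by
  classical
  let R : Finset (Fin (m₁ + l) × Fin (n₁ + l)) :=
    Finset.univ.filter fun e => ¬((e.1 : ℕ) < m₁ ∧ (e.2 : ℕ) < n₁)
  have hR : R.card ≤ l * ((m₁ + l) + (n₁ + l)) := by
    have hsub : R ⊆ (Finset.univ.filter fun i : Fin (m₁ + l) => m₁ ≤ (i : ℕ)) ×ˢ Finset.univ ∪
        Finset.univ ×ˢ (Finset.univ.filter fun i : Fin (n₁ + l) => n₁ ≤ (i : ℕ)) := by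
      intro e he
      simp only [R, Finset.mem_filter, Finset.mem_univ, true_and] at he
      simp only [Finset.mem_union, Finset.mem_product, Finset.mem_filter, Finset.mem_univ,
        true_and, and_true]
      omega
    refine (Finset.card_le_card hsub).trans ((Finset.card_union_le _ _).trans ?_)
    rw [Finset.card_product, Finset.card_product, card_filter_ge, card_filter_ge]
    simp only [Finset.card_univ, Fintype.card_fin]
    exact le_of_eq (by ring)
  have h1 : q ^ R.card * prodWt (blockWt m₁ n₁ f S) x ≤ prodWt f x := by
    have h2 : q ^ R.card = ∏ e : Fin (m₁ + l) × Fin (n₁ + l), if e ∈ R then q else 1 := by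
      rw [Finset.prod_ite_mem, Finset.univ_inter, Finset.prod_const]
    rw [prodWt_eq, prodWt_eq, h2, ← Finset.prod_mul_distrib]
    refine Finset.prod_le_prod' fun e _ => ?_
    by_cases he : e ∈ R
    · rw [if_pos he]
      have he' : ¬((e.1 : ℕ) < m₁ ∧ (e.2 : ℕ) < n₁) := by simpa [R] using he
      unfold blockWt
      rw [if_neg he']
      by_cases hx : x e.1 e.2 ∈ S
      · rw [Set.indicator_of_mem hx, Pi.one_apply, mul_one]
        exact hf _ _ hx
      · rw [Set.indicator_of_notMem hx, mul_zero]
        exact zero_le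
    · rw [if_neg he, one_mul]
      have he' : (e.1 : ℕ) < m₁ ∧ (e.2 : ℕ) < n₁ := by simpa [R] using he
      unfold blockWt
      rw [if_pos he']
  exact (mul_le_mul_left (pow_le_pow_right_of_le_one' hq hR) _).trans h1

/-- The cells off the upper left block form two disjoint rectangles, the full lower strip and the
upper right part, and `le_fibInt_rect` applies to each of them. -/
theorem blockWt_replace {m₁ n₁ l : ℕ} (f : Fin (m₁ + l) → Fin (n₁ + l) → ℝ → ℝ≥0∞)
    (E T : Set ℝ) :
    replaceWt (replaceWt (blockWt m₁ n₁ f E) (T.indicator 1)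
      ((Finset.univ.filter fun i : Fin (m₁ + l) => m₁ ≤ (i : ℕ)) ×ˢ Finset.univ)) (T.indicator 1)
      ((Finset.univ.filter fun i : Fin (m₁ + l) => (i : ℕ) < m₁) ×ˢ
        (Finset.univ.filter fun j : Fin (n₁ + l) => n₁ ≤ (j : ℕ))) = blockWt m₁ n₁ f T := by
  ext i j x
  simp only [replaceWt, blockWt, Finset.mem_product, Finset.mem_filter, Finset.mem_univ, true_and,
    and_true]
  by_cases h1 : (i : ℕ) < m₁ <;> by_cases h2 : (j : ℕ) < n₁ <;>
    simp [h1, h2, not_le.2, not_lt.1]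

/-- The factor `c` is the lower bound for the densities on `E`, and the factor `1/2` per cell is the
price for passing from `E` to full neighborhoods of the two grid points, near which `E` is only
known to fill most of the space. -/
theorem gridBound_volume {m₀ n₀ : ℕ} {g : Fin m₀ → Fin n₀ → ℝ → ℝ≥0∞}
    (hg : ∀ a b, Measurable (g a b)) {E : Set ℝ} (hEm : MeasurableSet E) {c : ℝ}
    (hc1 : c ≤ 1) (hE : ∀ a b, ∀ x ∈ E, ENNReal.ofReal c ≤ g a b x) {u s ε : ℝ}
    (hε : 0 < ε) (hfill : FillsNear E u s ε) : GridBound volume ⊤ g u s 1 ε (c / 2) := by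
  classical
  intro m₁ n₁ l hm hn hl d d' r t _ _ hrt
  set f : Fin (m₁ + (l + 1)) → Fin (n₁ + (l + 1)) → ℝ → ℝ≥0∞ := fun i j => g (d i) (d' j) with hf
  have hfm : ∀ i j, Measurable (f i j) := fun i j => hg _ _
  have hbm : ∀ i j, Measurable (blockWt m₁ n₁ f E i j) := measurable_blockWt hfm hEm
  set T := gridNear u s 1 ε with hT
  have hTm : MeasurableSet T := measurableSet_gridNear _ _ _ _
  have hTi : Measurable (T.indicator (1 : ℝ → ℝ≥0∞)) := measurable_one.indicator hTm
  set S2 : Finset (Fin (m₁ + (l + 1))) := Finset.univ.filter fun i => m₁ ≤ (i : ℕ) with hS2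
  set S1 : Finset (Fin (m₁ + (l + 1))) := Finset.univ.filter fun i => (i : ℕ) < m₁ with hS1
  set S2' : Finset (Fin (n₁ + (l + 1))) := Finset.univ.filter fun i => n₁ ≤ (i : ℕ) with hS2'
  have hcS2 : S2.card = l + 1 := card_filter_ge _ _
  have hcS1 : S1.card = m₁ := card_filter_lt _ _
  have hcS2' : S2'.card = l + 1 := card_filter_ge _ _
  have h1 := le_fibInt_rect (m := m₁ + l) (n := n₁ + l) hrt hbm hε hfill (S := S2)
    (S' := Finset.univ) (by omega) (by simp; omega) (fun i hi j _ => by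
      have : m₁ ≤ (i : ℕ) := by simpa [hS2] using hi
      unfold blockWt
      rw [if_neg (by omega)])
  have h2 := le_fibInt_rect (m := m₁ + l) (n := n₁ + l) hrt
    (measurable_replaceWt hbm hTi (S2 ×ˢ Finset.univ)) hε hfill (S := S1)
    (S' := S2') (by omega) (by omega) (fun i hi j hj => by
      have h3 : (i : ℕ) < m₁ := by simpa [hS1] using hi
      have h4 : n₁ ≤ (j : ℕ) := by simpa [hS2'] using hj
      have h5 : i ∉ S2 := by simp only [hS2, Finset.mem_filter, not_and, not_le]; exact fun _ => h3
      simp only [replaceWt, Finset.mem_product, h5, false_and, if_false]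
      unfold blockWt
      rw [if_neg (by omega)])
  rw [blockWt_replace f E T, hcS1, hcS2'] at h2
  rw [hcS2, Finset.card_univ, Fintype.card_fin] at h1
  set L := (l + 1) * ((m₁ + l + 1) + (n₁ + l + 1)) with hL
  set Φ := fibInt volume (prodWt (blockWt m₁ n₁ f T)) r t with hΦ
  have hq : ENNReal.ofReal c ≤ 1 := by simpa using ENNReal.ofReal_le_ofReal hc1
  have h3 : ENNReal.ofReal c ^ L * fibInt volume (prodWt (blockWt m₁ n₁ f E)) r t ≤
      fibInt volume (prodWt f) r t := by
    rw [← fibInt_const_mul _ (measurable_prodWt hbm)]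
    refine lintegral_mono fun y => ?_
    exact pow_mul_blockWt_le (l := l + 1) hq fun i j hx => hE _ _ _ hx
  have hpow : (2⁻¹ : ℝ≥0∞) ^ L ≤ 2⁻¹ ^ ((l + 1) * (n₁ + l + 1)) * 2⁻¹ ^ (m₁ * (l + 1)) := by
    rw [← pow_add]
    refine pow_le_pow_right_of_le_one' (by simp) ?_
    rw [hL]
    nlinarith
  have hc2 : ENNReal.ofReal (c / 2) = ENNReal.ofReal c * 2⁻¹ := by
    rw [ENNReal.ofReal_div_of_pos two_pos, div_eq_mul_inv]
    simp
  calc ENNReal.ofReal (c / 2) ^ L * Φ = ENNReal.ofReal c ^ L * (2⁻¹ ^ L * Φ) := by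
        rw [hc2, mul_pow]; ring
    _ ≤ ENNReal.ofReal c ^ L * ((2⁻¹ ^ ((l + 1) * (n₁ + l + 1)) * 2⁻¹ ^ (m₁ * (l + 1))) * Φ) := by
        gcongr
    _ = ENNReal.ofReal c ^ L * (2⁻¹ ^ ((l + 1) * (n₁ + l + 1)) *
          (2⁻¹ ^ (m₁ * (l + 1)) * Φ)) := by ring
    _ ≤ ENNReal.ofReal c ^ L * (2⁻¹ ^ ((l + 1) * (n₁ + l + 1)) *
          fibInt volume (prodWt (replaceWt (blockWt m₁ n₁ f E) (T.indicator 1)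
            (S2 ×ˢ Finset.univ))) r t) := by gcongr
    _ ≤ ENNReal.ofReal c ^ L * fibInt volume (prodWt (blockWt m₁ n₁ f E)) r t := by gcongr
    _ ≤ _ := h3

/-- All completed entries are integers, and an integer closer than `1` to a point of the integer
grid agrees with it. -/
theorem gridBound_intCount {m₀ n₀ : ℕ} {g : Fin m₀ → Fin n₀ → ℝ → ℝ≥0∞}
    (hg : ∀ a b, Measurable (g a b)) {u : ℝ} (hu : u ∈ intSubgroup) {B : ℕ} {c : ℝ} (hc1 : c ≤ 1)
    (hE : ∀ a b, ∀ l : ℕ, l ≤ B → ENNReal.ofReal c ≤ g a b (u + l)) {ε : ℝ} (hε : ε < 1) :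
    GridBound intCount intSubgroup g u 1 B ε c := by
  intro m₁ n₁ l hm hn hl d d' r t hr ht hrt
  set f : Fin (m₁ + (l + 1)) → Fin (n₁ + (l + 1)) → ℝ → ℝ≥0∞ := fun i j => g (d i) (d' j) with hf
  have hfm : ∀ i j, Measurable (f i j) := fun i j => hg _ _
  have hbm := measurable_blockWt (m₁ := m₁) (n₁ := n₁) hfm (measurableSet_gridNear u 1 B ε)
  have hq : ENNReal.ofReal c ≤ 1 := by simpa using ENNReal.ofReal_le_ofReal hc1
  change ENNReal.ofReal c ^ _ *
    fibInt intCount (prodWt (blockWt m₁ n₁ f (gridNear u 1 B ε))) r t ≤ fibInt intCount (prodWt f) r t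
  rw [← fibInt_const_mul _ (measurable_prodWt hbm)]
  refine lintegral_mono_ae ?_
  have hint := isLattice_intCount.ae_mem
  filter_upwards [ae_baseModel_mem hint (m₁ + l) (n₁ + l)] with y hy
  refine pow_mul_blockWt_le (l := l + 1) hq fun i j hx => ?_
  have hmem := completion_mem (m := m₁ + l) (n := n₁ + l) hr ht hy i j
  obtain ⟨a, ha, hxa⟩ := hx
  obtain ⟨z, hz⟩ := mem_intSubgroup.1 (sub_mem hmem
    (add_mem hu (mem_intSubgroup.2 ⟨(a : ℤ), by push_cast; rfl⟩)))
  have h0 : z = 0 := by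
    have h1 : |(z : ℝ)| < 1 := by
      rw [hz]
      refine lt_of_le_of_lt ?_ hε
      rwa [one_mul] at hxa
    exact Int.abs_lt_one_iff.1 (by exact_mod_cast h1)
  rw [h0, Int.cast_zero] at hz
  have h2 : completion r t y i j = u + a := by linarith
  change _ ≤ g _ _ (completion r t y i j)
  rw [h2]
  exact hE _ _ a ha

/-! ### A lower bound for the density of cloned margins -/

section slow
variable {ζ : Measure ℝ} [SigmaFinite ζ] {Γ : AddSubgroup ℝ} {m₀ n₀ : ℕ}
  {g : Fin m₀ → Fin n₀ → ℝ → ℝ≥0∞} {z : Fin m₀ → Fin n₀ → ℝ} {u s ε c η C s₀ : ℝ} {B : ℕ}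

/-- Assembly: the upper left block is good with probability at least `1/2`, a good block extends to
a filled matrix, and each band cell costs at most a factor `c` for its density and `2 ρ` for its
position. -/
theorem le_fibInt_of_gridBound (h : IsLattice ζ Γ) (hΓ : MeasurableSet (Γ : Set ℝ))
    (hg : ∀ a b, Measurable (g a b)) [∀ a b, IsProbabilityMeasure (ζ.withDensity (g a b))]
    (hs : 0 < s) (hz : ∀ a b, u + η ≤ z a b ∧ z a b ≤ u + s * B - η) (hgrid : GridCompat Γ u s)
    (hG : GridBound ζ Γ g u s B ε c) (hC : 0 < C)
    (hN : ∀ a b, SubGaussNear (ζ.withDensity (g a b)) (z a b) C s₀) {m₁ n₁ l : ℕ} (hm : 2 ≤ m₁)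
    (hn : 2 ≤ n₁) (hl : 1 ≤ l) {d : Fin (m₁ + l + 1) → Fin m₀} {d' : Fin (n₁ + l + 1) → Fin n₀}
    {a₀ : Fin m₀} {b₀ : Fin n₀} (hd : ∀ i : Fin (l + 1), d (Fin.natAdd m₁ i) = a₀)
    (hd' : ∀ i : Fin (l + 1), d' (Fin.natAdd n₁ i) = b₀)
    (hr : ∀ i, ∑ j, z (d i) (d' j) ∈ Γ) (hc : ∀ j, ∑ i, z (d i) (d' j) ∈ Γ)
    (hη : 2 * s ≤ η * (l + 1 : ℕ)) {ρ : ℝ} (hρ : 0 < ρ)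
    (hh : 2 * s / (l + 1 : ℕ) + ((m₁ + l : ℕ) : ℝ) * ((n₁ + l : ℕ) : ℝ) * ρ ≤ ε)
    (hball : ∀ x ∈ Γ, ENNReal.ofReal (2 * ρ) ≤ ζ (Metric.closedBall x ρ))
    {σ σ' v : ℝ} (hσ : 0 < σ) (hσ₀ : σ ≤ s₀) (hσ' : 0 < σ') (hσ₀' : σ' ≤ s₀) (hmv : m₁ ≤ v)
    (hnv : n₁ ≤ v)
    (hnum : 4 * v * Real.exp (C * σ ^ 2 * v - σ * (η * (l + 1 : ℕ))) +
      2 * Real.exp (C * σ' ^ 2 * v ^ 2 - σ' * (η * (l + 1 : ℕ) ^ 2 / 2)) ≤ 1 / 2) :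
    ENNReal.ofReal c ^ ((l + 1) * ((m₁ + l + 1) + (n₁ + l + 1))) *
      (1 / 2 * ENNReal.ofReal (2 * ρ) ^ ((m₁ + l) * (n₁ + l) - m₁ * n₁)) ≤
      fibInt ζ (prodWt fun i j => g (d i) (d' j)) (fun i => ∑ j, z (d i) (d' j))
        (fun j => ∑ i, z (d i) (d' j)) := by
  refine le_trans ?_ (hG m₁ n₁ l hm hn hl d d' _ _ hr hc Finset.sum_comm)
  refine mul_le_mul_right ?_ _
  have h1 := half_le_goodBlock (m := m₁) (n := n₁)
    (N := fun i j => ζ.withDensity (g (d (Fin.castAdd (l + 1) i)) (d' (Fin.castAdd (l + 1) j))))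
    (z := fun i j => z (d (Fin.castAdd (l + 1) i)) (d' (Fin.castAdd (l + 1) j))) hC
    (fun i j => hN _ _) hΓ (fun i j => withDensity_absolutelyContinuous _ _ h.ae_mem) hσ hσ₀ hσ'
    hσ₀' hmv hnv hnum
  refine le_trans (mul_le_mul_left h1 _) ?_
  exact le_fibInt_blockWt (f := fun (i : Fin (m₁ + l + 1)) (j : Fin (n₁ + l + 1)) =>
      g (d i) (d' j)) (by omega) (by omega) (fun i j => hg _ _) hρ hh hball
    (measurableSet_goodBlock _ hΓ _ _) fun y hy =>
      exists_fill_of_goodBlock (z := fun (i : Fin (m₁ + l + 1)) (j : Fin (n₁ + l + 1)) =>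
        z (d i) (d' j)) hs (fun i j => hz _ _) (zr := fun i => z (d i) b₀)
        (zc := fun j => z a₀ (d' j)) (z' := z a₀ b₀) (fun i j => congrArg (z (d i)) (hd' j))
        (fun i j => congrArg (fun a => z a (d' j)) (hd i))
        (fun i => congrArg (fun a => z a b₀) (hd i)) hη hgrid hr hc hy

theorem eventually_log_ge (X : ℝ) : ∀ᶠ k : ℕ in atTop, X ≤ Real.log k :=
  (Real.tendsto_log_atTop.comp tendsto_natCast_atTop_atTop).eventually_ge_atTop X

theorem eventually_natCast_ge (X : ℝ) : ∀ᶠ k : ℕ in atTop, X ≤ (k : ℝ) :=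
  tendsto_natCast_atTop_atTop.eventually_ge_atTop X

theorem eventually_sqrt_mul_log_le {X : ℝ} (hX : 0 < X) :
    ∀ᶠ k : ℕ in atTop, √(k : ℝ) * Real.log k ≤ X * k := by
  have h1 := (isLittleO_log_rpow_atTop (r := 1 / 2) (by norm_num)).bound hX
  filter_upwards [tendsto_natCast_atTop_atTop.eventually h1, eventually_natCast_ge 1,
    eventually_log_ge 0] with k hk hk1 hk0
  rw [← Real.sqrt_eq_rpow, Real.norm_of_nonneg hk0, Real.norm_of_nonneg (Real.sqrt_nonneg _)] at hk
  calc √(k : ℝ) * Real.log k ≤ √(k : ℝ) * (X * √(k : ℝ)) := by gcongr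
    _ = X * (√(k : ℝ) * √(k : ℝ)) := by ring
    _ = X * k := by rw [Real.mul_self_sqrt (by linarith)]

/-- A line sum of at most `V k` terms exceeds `η L` with probability `O(k ^ (-3))`, since `K η = 3`
and `L ≥ K √k log k`; this survives the union over `O(k)` lines. The total of at most `(V k) ^ 2`
terms fluctuates on the scale `k`, far below `L ^ 2`, which is of order at least `k log ^ 2 k`. -/
theorem slow_numeric {K η C V k L : ℝ} (hη : 0 < η) (hK : K * η = 3) (hV : 0 < V) (hC : 0 < C)
    (hk : 1 ≤ k) (hkV : 16 * V * Real.exp (C * V) ≤ k) (hlog : 1 ≤ Real.log k)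
    (hlog2 : C * V ^ 2 + 3 ≤ η * K ^ 2 / 2 * Real.log k) (hL : K * (√k * Real.log k) ≤ L) :
    4 * (V * k) * Real.exp (C * (1 / √k) ^ 2 * (V * k) - 1 / √k * (η * L)) +
      2 * Real.exp (C * (1 / k) ^ 2 * (V * k) ^ 2 - 1 / k * (η * L ^ 2 / 2)) ≤ 1 / 2 := by
  have hk0 : 0 < k := by linarith
  have hsq : 0 < √k := Real.sqrt_pos.2 hk0
  have hsq2 : √k ^ 2 = k := Real.sq_sqrt hk0.le
  have hK0 : 0 < K := by
    by_contra! h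
    nlinarith
  have hL0 : 0 ≤ K * (√k * Real.log k) := by positivity
  have e1 : C * (1 / √k) ^ 2 * (V * k) = C * V := by
    rw [div_pow, hsq2]
    field_simp
  have e2 : 3 * Real.log k ≤ 1 / √k * (η * L) := by
    calc 3 * Real.log k = 1 / √k * (η * (K * (√k * Real.log k))) := by
          rw [← hK]; field_simp
      _ ≤ _ := by gcongr
  have e3 : C * (1 / k) ^ 2 * (V * k) ^ 2 = C * V ^ 2 := by field_simp
  have e4 : C * V ^ 2 + 3 ≤ 1 / k * (η * L ^ 2 / 2) := by
    calc C * V ^ 2 + 3 ≤ η * K ^ 2 / 2 * Real.log k := hlog2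
      _ ≤ η * K ^ 2 / 2 * Real.log k ^ 2 := by
          gcongr
          nlinarith
      _ = 1 / k * (η * (K * (√k * Real.log k)) ^ 2 / 2) := by
          rw [mul_pow, mul_pow, hsq2]
          field_simp
      _ ≤ _ := by gcongr
  have h1 : 4 * (V * k) * Real.exp (C * (1 / √k) ^ 2 * (V * k) - 1 / √k * (η * L)) ≤ 1 / 4 := by
    calc 4 * (V * k) * Real.exp (C * (1 / √k) ^ 2 * (V * k) - 1 / √k * (η * L))
        ≤ 4 * (V * k) * Real.exp (C * V - 3 * Real.log k) := by
          rw [e1]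
          gcongr
      _ = 4 * (V * k) * (Real.exp (C * V) / k ^ 3) := by
          rw [Real.exp_sub, show 3 * Real.log k = Real.log (k ^ 3) by
            rw [Real.log_pow]; norm_num, Real.exp_log (by positivity)]
      _ = 16 * V * Real.exp (C * V) / (4 * k ^ 2) := by field_simp; ring
      _ ≤ k / (4 * k ^ 2) := by gcongr
      _ = 1 / (4 * k) := by field_simp
      _ ≤ 1 / 4 := by
          apply one_div_le_one_div_of_le <;> linarith
  have h2 : 2 * Real.exp (C * (1 / k) ^ 2 * (V * k) ^ 2 - 1 / k * (η * L ^ 2 / 2)) ≤ 1 / 4 := by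
    have h3 : Real.exp (C * (1 / k) ^ 2 * (V * k) ^ 2 - 1 / k * (η * L ^ 2 / 2)) ≤
        Real.exp (-3) := Real.exp_le_exp.2 (by linarith)
    have h4 : Real.exp (-3) ≤ 1 / 8 := by
      have h5 : (8 : ℝ) ≤ Real.exp 3 := by
        have := Real.add_one_le_exp (1 : ℝ)
        have h6 : Real.exp 3 = Real.exp 1 ^ 3 := by rw [← Real.exp_nat_mul]; norm_num
        rw [h6]
        have h7 : (2 : ℝ) ≤ Real.exp 1 := by linarith
        calc (8 : ℝ) = 2 ^ 3 := by norm_num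
          _ ≤ _ := by gcongr
      rw [Real.exp_neg, ← one_div]
      exact one_div_le_one_div_of_le (by norm_num) h5
    linarith
  linarith

/-- The band width is of order `√k log k`, just above the fluctuations of the line sums. The band
then has `O(k ^ (3/2) log k)` cells, each of which costs a factor at least `k ^ (-3)`; this is where
the exponent `k ^ (3/2) log ^ 2 k` comes from. -/
theorem eventually_exists_band {s ε c η C s₀ V : ℝ} (hη : 0 < η) (hε : 0 < ε)
    (hc : 0 < c) (hC : 0 < C) (hs₀ : 0 < s₀) (hV0 : 0 < V) :
    ∃ C' > 0, ∀ᶠ k : ℕ in atTop, 4 ≤ k ∧ ∃ (l : ℕ) (ρ : ℝ), 1 ≤ l ∧ 2 * (l + 1) ≤ k ∧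
      2 * s ≤ η * (l + 1 : ℕ) ∧ 0 < ρ ∧ 2 * ρ ≤ 1 ∧
      2 * s / (l + 1 : ℕ) + V * k * (V * k) * ρ ≤ ε ∧ 1 / √(k : ℝ) ≤ s₀ ∧ 1 / (k : ℝ) ≤ s₀ ∧
      4 * (V * k) * Real.exp (C * (1 / √(k : ℝ)) ^ 2 * (V * k) - 1 / √(k : ℝ) * (η * (l + 1 : ℕ))) +
        2 * Real.exp (C * (1 / (k : ℝ)) ^ 2 * (V * k) ^ 2 -
          1 / (k : ℝ) * (η * (l + 1 : ℕ) ^ 2 / 2)) ≤ 1 / 2 ∧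
      ∀ E : ℕ, (E : ℝ) ≤ (l + 1 : ℕ) * (V * k) →
        Real.exp (-(C' * (k * √k * Real.log k ^ 2))) ≤ 1 / 2 * (c * (2 * ρ)) ^ E := by
  set K : ℝ := 3 / η with hK
  have hK0 : 0 < K := by positivity
  have hKη : K * η = 3 := by rw [hK]; field_simp
  set q : ℝ := c * ε / V ^ 2 with hq
  have hq0 : 0 < q := by positivity
  refine ⟨6 * K * V + 1, by positivity, ?_⟩
  filter_upwards [eventually_natCast_ge 4, eventually_natCast_ge (16 * V * Real.exp (C * V)),
    eventually_log_ge 1, eventually_log_ge ((C * V ^ 2 + 3) / (η * K ^ 2 / 2)),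
    eventually_log_ge (2 / K), eventually_log_ge (2 * s / η / K),
    eventually_log_ge (2 * s / (ε / 2) / K), eventually_natCast_ge (1 / s₀ ^ 2),
    eventually_natCast_ge (1 / s₀), eventually_natCast_ge (ε / V ^ 2), eventually_natCast_ge (1 / q),
    eventually_sqrt_mul_log_le (X := 1 / (4 * K)) (by positivity)] with k hk4 hkV hlog1 hlog2 hlogK
    hlogη hlogε hks hks' hkε hkq hksl
  have hk0 : (0 : ℝ) < k := by linarith
  have hsq : 0 < √(k : ℝ) := Real.sqrt_pos.2 hk0
  have hsq1 : 1 ≤ √(k : ℝ) := by rw [Real.one_le_sqrt]; linarith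
  have hsq2 : √(k : ℝ) ^ 2 = k := Real.sq_sqrt hk0.le
  set y : ℝ := K * (√(k : ℝ) * Real.log k) with hy
  have hyK : K * Real.log k ≤ y := by
    rw [hy]
    gcongr
    nlinarith only [hsq1, hlog1]
  have hy2 : 2 ≤ y := by
    rw [div_le_iff₀ hK0] at hlogK
    linarith
  have hyη : 2 * s ≤ η * y := by
    rw [div_le_iff₀ hK0, div_le_iff₀ hη] at hlogη
    nlinarith only [hlogη, mul_le_mul_of_nonneg_left hyK hη.le]
  have hyε : 2 * s ≤ ε / 2 * y := by
    rw [div_le_iff₀ hK0, div_le_iff₀ (by positivity)] at hlogε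
    nlinarith only [hlogε, mul_le_mul_of_nonneg_left hyK hε.le]
  have hyk : y ≤ k / 4 := by
    calc y ≤ K * (1 / (4 * K) * k) := by rw [hy]; gcongr
      _ = k / 4 := by field_simp
  obtain ⟨l, hl⟩ : ∃ l, ⌈y⌉₊ = l + 1 := ⟨⌈y⌉₊ - 1, by
    have : 0 < ⌈y⌉₊ := Nat.ceil_pos.2 (by linarith)
    omega⟩
  have hLy : y ≤ (l + 1 : ℕ) := hl ▸ Nat.le_ceil y
  have hLy' : ((l + 1 : ℕ) : ℝ) ≤ 2 * y := by
    have := Nat.ceil_lt_add_one (show 0 ≤ y by linarith)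
    rw [hl] at this
    linarith
  have hLk : 2 * (l + 1) ≤ k := by
    have : (2 * (l + 1 : ℕ) : ℝ) ≤ k := by linarith
    exact_mod_cast this
  have hl1 : 1 ≤ l := by
    have : (2 : ℝ) ≤ (l + 1 : ℕ) := hy2.trans hLy
    have : 2 ≤ l + 1 := by exact_mod_cast this
    omega
  have hLη : 2 * s ≤ η * (l + 1 : ℕ) := hyη.trans (by gcongr)
  have hk4' : 4 ≤ k := by exact_mod_cast hk4
  -- Half of `ε` is for the Lipschitz error of `completion`, whose constant is of order `k ^ 2`, the
  -- other half for the distance of the filled entries from the grid.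
  set ρ : ℝ := ε / (2 * (V * k) ^ 2) with hρ
  have hρ0 : 0 < ρ := by positivity
  have hρ1 : 2 * ρ ≤ 1 := by
    have : 2 * ρ = ε / V ^ 2 / k ^ 2 := by rw [hρ]; field_simp
    rw [this, div_le_one (by positivity)]
    nlinarith only [hkε, hk4]
  have hσ₀ : 1 / √(k : ℝ) ≤ s₀ := by
    rw [div_le_iff₀ hsq]
    have h1 : 1 / s₀ ≤ √(k : ℝ) := by
      refine Real.le_sqrt_of_sq_le ?_
      rw [div_pow, one_pow]
      exact hks
    rw [div_le_iff₀ hs₀] at h1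
    linarith
  have hσ₀' : 1 / (k : ℝ) ≤ s₀ := by
    rw [div_le_iff₀ hs₀] at hks'
    rw [div_le_iff₀ hk0]
    linarith
  refine ⟨hk4', l, ρ, hl1, hLk, hLη, hρ0, hρ1, ?_, hσ₀, hσ₀',
    slow_numeric hη hKη hV0 hC (by linarith) hkV hlog1 ?_ hLy, fun E hE => ?_⟩
  · have h1 : 2 * s / (l + 1 : ℕ) ≤ ε / 2 := by
      rw [div_le_iff₀ (by positivity)]
      exact hyε.trans (by gcongr)
    have h3 : V * k * (V * k) * ρ = ε / 2 := by rw [hρ]; field_simp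
    linarith only [h1, h3]
  · rw [div_le_iff₀ (by positivity)] at hlog2
    linarith only [hlog2]
  have hEk : (E : ℝ) ≤ 2 * y * (V * k) := hE.trans (by gcongr)
  have h3 : Real.exp (-(3 * Real.log k)) ≤ c * (2 * ρ) := by
    have h4 : c * (2 * ρ) = q / k ^ 2 := by rw [hq, hρ]; field_simp
    rw [h4, Real.exp_neg, show 3 * Real.log k = Real.log ((k : ℝ) ^ 3) by
      rw [Real.log_pow]; norm_num, Real.exp_log (by positivity), inv_eq_one_div,
      div_le_div_iff₀ (by positivity) (by positivity)]
    rw [div_le_iff₀ hq0] at hkq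
    nlinarith only [sq_nonneg (k : ℝ), hkq]
  have h5 : Real.exp (-1) ≤ 1 / 2 := by
    rw [Real.exp_neg, ← one_div]
    exact one_div_le_one_div_of_le two_pos (by linarith [Real.add_one_le_exp (1 : ℝ)])
  calc Real.exp (-((6 * K * V + 1) * (k * √k * Real.log k ^ 2)))
      ≤ Real.exp (-1 + E * -(3 * Real.log k)) := by
        refine Real.exp_le_exp.2 ?_
        have h6 : E * (3 * Real.log k) ≤ 2 * y * (V * k) * (3 * Real.log k) := by gcongr
        have h7 : 2 * y * (V * k) * (3 * Real.log k) = 6 * K * V * (k * √k * Real.log k ^ 2) := by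
          rw [hy]; ring
        have h8 : 1 ≤ k * √k * Real.log k ^ 2 := by
          have := one_le_mul_of_one_le_of_one_le (one_le_mul_of_one_le_of_one_le
            (show (1 : ℝ) ≤ k by linarith) hsq1) (one_le_pow₀ hlog1 (n := 2))
          exact this
        linarith only [h6, h7, h8]
    _ = Real.exp (-1) * Real.exp (-(3 * Real.log k)) ^ E := by
        rw [Real.exp_add, ← Real.exp_nat_mul]
    _ ≤ _ := by gcongr

theorem exists_eq_add_band {N m₀ k l : ℕ} (hk : 4 ≤ k) (hl : 2 * (l + 1) ≤ k) (h0 : 0 < N)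
    (h1 : N = m₀ * k) : ∃ m₁, N = m₁ + l + 1 ∧ 2 ≤ m₁ := by
  have h2 : k ≤ N := h1 ▸ Nat.le_mul_of_pos_left k
    (Nat.pos_of_ne_zero fun h => by simp [h] at h1; omega)
  exact ⟨N - (l + 1), by omega, by omega⟩

/-- The conditions on the last `k` indices put the band, whose width is at most `k / 2`, inside a
single block of rows and a single block of columns of the cloning; this gives the equal means in the
band that filling requires. -/
theorem exists_slow_lower_bound (h : IsLattice ζ Γ) (hΓ : MeasurableSet (Γ : Set ℝ))
    (hball : ∀ ρ : ℝ, 0 < ρ → 2 * ρ ≤ 1 → ∀ x ∈ Γ,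
      ENNReal.ofReal (2 * ρ) ≤ ζ (Metric.closedBall x ρ))
    (hg : ∀ a b, Measurable (g a b)) [∀ a b, IsProbabilityMeasure (ζ.withDensity (g a b))]
    (hm₀ : 0 < m₀) (hs : 0 < s) (hη : 0 < η) (hε : 0 < ε) (hc : 0 < c)
    (hz : ∀ a b, u + η ≤ z a b ∧ z a b ≤ u + s * B - η) (hgrid : GridCompat Γ u s)
    (hG : GridBound ζ Γ g u s B ε c) (hC : 0 < C) (hs₀ : 0 < s₀)
    (hN : ∀ a b, SubGaussNear (ζ.withDensity (g a b)) (z a b) C s₀) :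
    ∃ C' > 0, ∀ᶠ k : ℕ in atTop, ∀ (N N' : ℕ) (d : Fin N → Fin m₀) (d' : Fin N' → Fin n₀),
      (∀ a, (Finset.univ.filter fun i => d i = a).card = k) →
      (∀ b, (Finset.univ.filter fun j => d' j = b).card = k) →
      (∃ a₀, ∀ i : Fin N, N ≤ (i : ℕ) + k → d i = a₀) →
      (∃ b₀, ∀ j : Fin N', N' ≤ (j : ℕ) + k → d' j = b₀) →
      (∀ a, (k : ℝ) * ∑ b, z a b ∈ Γ) → (∀ b, (k : ℝ) * ∑ a, z a b ∈ Γ) →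
      0 < N → 0 < N' →
      ENNReal.ofReal (Real.exp (-(C' * (k * √k * Real.log k ^ 2)))) ≤
        fibInt ζ (prodWt fun i j => g (d i) (d' j)) (fun i => k * ∑ b, z (d i) b)
          (fun j => k * ∑ a, z a (d' j)) := by
  set V : ℝ := m₀ + n₀ with hV
  have hV0 : 0 < V := by positivity
  have hc1 : 0 < min c 1 := by positivity
  obtain ⟨C', hC', hev⟩ := eventually_exists_band (s := s) hη hε hc1 hC hs₀ hV0
  refine ⟨C', hC', ?_⟩
  filter_upwards [hev] with k hk N N' d d' hd hd' ha₀ hb₀ hr hc' hN0 hN0'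
  obtain ⟨hk4', l, ρ, hl1, hLk, hLη, hρ0, hρ1, hρε, hσ₀, hσ₀', hnum, hfin⟩ := hk
  obtain ⟨a₀, ha₀⟩ := ha₀
  obtain ⟨b₀, hb₀⟩ := hb₀
  have hk0 : (0 : ℝ) < k := by exact_mod_cast (show 0 < k by omega)
  have hNk := card_cloning hd
  have hNk' := card_cloning hd'
  have hrow : ∀ i, ∑ j, z (d i) (d' j) = k * ∑ b, z (d i) b := fun i =>
    sum_comp_cloning hd' (z (d i))
  have hcol : ∀ j, ∑ i, z (d i) (d' j) = k * ∑ a, z a (d' j) := fun j =>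
    sum_comp_cloning hd fun a => z a (d' j)
  obtain ⟨m₁, rfl, hm₁⟩ := exists_eq_add_band hk4' hLk hN0 hNk
  obtain ⟨n₁, rfl, hn₁⟩ := exists_eq_add_band hk4' hLk hN0' hNk'
  have hsum : ((m₁ + l + 1 : ℕ) : ℝ) + (n₁ + l + 1 : ℕ) = V * k := by
    rw [hNk, hNk', hV]; push_cast; ring
  have hmv : ((m₁ + l : ℕ) : ℝ) ≤ V * k := by
    rw [← hsum]; push_cast; have : (0:ℝ) ≤ (n₁ + l : ℝ) := by positivity
    linarith
  have hnv : ((n₁ + l : ℕ) : ℝ) ≤ V * k := by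
    rw [← hsum]; push_cast; have : (0:ℝ) ≤ (m₁ + l : ℝ) := by positivity
    linarith
  have key := le_fibInt_of_gridBound (ρ := ρ) (σ := 1 / √(k : ℝ)) (σ' := 1 / (k : ℝ)) (v := V * k)
    (d := d) (d' := d') (a₀ := a₀) (b₀ := b₀)
    h hΓ hg hs hz hgrid hG hC hN hm₁ hn₁ hl1
    (fun i => ha₀ _ (by simp only [Fin.natAdd]; omega))
    (fun i => hb₀ _ (by simp only [Fin.natAdd]; omega))
    (fun i => by rw [hrow]; exact hr _) (fun j => by rw [hcol]; exact hc' _)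
    hLη hρ0 (le_trans (by gcongr) hρε) (hball ρ hρ0 hρ1) (by positivity) hσ₀ (by positivity) hσ₀'
    (le_trans (Nat.cast_le.2 (Nat.le_add_right _ _)) hmv)
    (le_trans (Nat.cast_le.2 (Nat.le_add_right _ _)) hnv) hnum
  simp only [hrow, hcol] at key
  refine le_trans ?_ key
  set E : ℕ := (l + 1) * ((m₁ + l + 1) + (n₁ + l + 1)) with hE
  have hEle : (m₁ + l) * (n₁ + l) - m₁ * n₁ ≤ E := by
    rw [Nat.sub_le_iff_le_add, hE]
    ring_nf
    omega
  have hEk : (E : ℝ) ≤ (l + 1 : ℕ) * (V * k) := by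
    rw [hE, ← hsum]
    push_cast
    exact le_rfl
  have h2 : ENNReal.ofReal (1 / 2 * (min c 1 * (2 * ρ)) ^ E) ≤
      ENNReal.ofReal c ^ E * (1 / 2 * ENNReal.ofReal (2 * ρ) ^ ((m₁ + l) * (n₁ + l) - m₁ * n₁)) := by
    rw [ENNReal.ofReal_mul (by norm_num), mul_pow, ENNReal.ofReal_mul (by positivity),
      ENNReal.ofReal_pow hc1.le, ENNReal.ofReal_pow (by positivity),
      ENNReal.ofReal_div_of_pos two_pos, ENNReal.ofReal_one, ENNReal.ofReal_ofNat]
    calc 1 / 2 * (ENNReal.ofReal (min c 1) ^ E * ENNReal.ofReal (2 * ρ) ^ E)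
        = ENNReal.ofReal (min c 1) ^ E * (1 / 2 * ENNReal.ofReal (2 * ρ) ^ E) := by ring
      _ ≤ _ := by
          gcongr ?_ * (_ * ?_)
          · exact pow_le_pow_left' (ENNReal.ofReal_le_ofReal (min_le_left _ _)) _
          · exact pow_le_pow_right_of_le_one'
              (by simpa using ENNReal.ofReal_le_ofReal hρ1) hEle
  refine le_trans (ENNReal.ofReal_le_ofReal (hfin E hEk)) h2

end slow

/-! ### Existence of grids -/

theorem exists_support_bounds {μ : Measure ℝ} {δ : ℝ} (hδ : 0 < δ) {ι : Type*} [Finite ι]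
    [Nonempty ι] {z : ι → ℝ} (h : ∀ i, InTameRange μ δ (z i)) :
    ∃ z₁ z₂ : ℝ, (∀ i, z₁ ≤ z i) ∧ (∀ i, z i ≤ z₂) ∧ μ (Set.Iio z₁) ≠ 0 ∧ μ (Set.Ioi z₂) ≠ 0 := by
  obtain ⟨i, hi⟩ := Finite.exists_min z
  obtain ⟨j, hj⟩ := Finite.exists_max z
  obtain ⟨x, hx, hxi⟩ := (h i).exists_lt hδ
  obtain ⟨y, hy, hyj⟩ := (h j).exists_gt hδ
  exact ⟨z i, z j, hi, hj, (Measure.mem_support_iff_forall x |>.1 hx _ (Iio_mem_nhds hxi)).ne',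
    (Measure.mem_support_iff_forall y |>.1 hy _ (Ioi_mem_nhds hyj)).ne'⟩

theorem exists_ofReal_le {t : ℝ≥0∞} (ht : t ≠ 0) : ∃ c : ℝ, 0 < c ∧ c ≤ 1 ∧ ENNReal.ofReal c ≤ t := by
  have h1 : min t 1 ≠ ∞ := ne_top_of_le_ne_top ENNReal.one_ne_top (min_le_right _ _)
  have h0 : min t 1 ≠ 0 := by simp [ht]
  refine ⟨(min t 1).toReal, ENNReal.toReal_pos h0 h1, ?_, ?_⟩
  · exact ENNReal.toReal_le_of_le_ofReal zero_le_one (by simp)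
  · rw [ENNReal.ofReal_toReal h1]
    exact min_le_left _ _

theorem exists_ofReal_le_forall {ι : Type*} [Finite ι] {t : ι → ℝ≥0∞} (ht : ∀ i, t i ≠ 0) :
    ∃ c : ℝ, 0 < c ∧ c ≤ 1 ∧ ∀ i, ENNReal.ofReal c ≤ t i := by
  choose c hc hc1 hct using fun i => exists_ofReal_le (ht i)
  obtain ⟨e, he, hec⟩ := exists_pos_le_forall c hc
  exact ⟨min e 1, by positivity, min_le_right _ _, fun i =>
    (ENNReal.ofReal_le_ofReal ((min_le_left _ _).trans (hec i))).trans (hct i)⟩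

/-- Lebesgue's density theorem: `E ∩ O` has positive measure, so it contains a density point of `E`.
-/
theorem eventually_volume_closedBall_sdiff_le {E : Set ℝ} (hE : MeasurableSet E) {O : Set ℝ}
    (hO : volume (E ∩ O) ≠ 0) :
    ∃ x ∈ O, ∀ᶠ ε in 𝓝[>] (0 : ℝ),
      volume (Metric.closedBall x (5 * ε) \ E) ≤ ENNReal.ofReal (ε / 9) := by
  have h1 := Besicovitch.ae_tendsto_measure_inter_div_of_measurableSet (volume : Measure ℝ) hE
  obtain ⟨x, hx, hx1⟩ := (frequently_ae_mem_iff.2 hO).and_eventually h1 |>.exists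
  refine ⟨x, hx.2, ?_⟩
  rw [Set.indicator_of_mem hx.1, Pi.one_apply] at hx1
  -- The ball of radius `5 ε` has volume `10 ε`, of which `ε / 9` is the proportion `1 / 90`.
  have hlt : ENNReal.ofReal (1 - 1 / 90) < 1 := by
    rw [ENNReal.ofReal_lt_one]; norm_num
  have h2 := hx1.eventually (lt_mem_nhds hlt)
  have h5 : Tendsto (fun ε : ℝ => 5 * ε) (𝓝[>] 0) (𝓝[>] 0) := by
    refine tendsto_nhdsWithin_iff.2 ⟨?_, ?_⟩
    · have : Tendsto (fun ε : ℝ => 5 * ε) (𝓝 0) (𝓝 (5 * 0)) :=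
        tendsto_id.const_mul 5
      rw [mul_zero] at this
      exact this.mono_left nhdsWithin_le_nhds
    · filter_upwards [self_mem_nhdsWithin] with ε hε
      have : 0 < ε := hε
      exact Set.mem_Ioi.2 (by linarith)
  filter_upwards [h5.eventually h2, self_mem_nhdsWithin] with ε h3 hε
  have hε : 0 < ε := hε
  have hvol : volume (Metric.closedBall x (5 * ε)) = ENNReal.ofReal (10 * ε) := by
    rw [Real.volume_closedBall]; congr 1; ring
  rw [hvol, ENNReal.lt_div_iff_mul_lt (Or.inl (by simp [hε])) (Or.inl ENNReal.ofReal_ne_top),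
    ← ENNReal.ofReal_mul (by norm_num), Set.inter_comm] at h3
  have h4 := measure_inter_add_sdiff (μ := volume) (Metric.closedBall x (5 * ε)) hE
  rw [hvol] at h4
  have h6 : volume (Metric.closedBall x (5 * ε) \ E) ≠ ∞ :=
    ne_top_of_le_ne_top ENNReal.ofReal_ne_top (h4 ▸ le_add_self)
  have h7 : volume (Metric.closedBall x (5 * ε) ∩ E) ≠ ∞ :=
    ne_top_of_le_ne_top ENNReal.ofReal_ne_top (h4 ▸ le_self_add)
  rw [← ENNReal.ofReal_toReal h6]
  rw [← ENNReal.ofReal_toReal h6, ← ENNReal.ofReal_toReal h7, ← ENNReal.ofReal_add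
    ENNReal.toReal_nonneg ENNReal.toReal_nonneg, ENNReal.ofReal_eq_ofReal_iff
    (by positivity) (by positivity)] at h4
  rw [← ENNReal.ofReal_toReal h7, ENNReal.ofReal_lt_ofReal_iff_of_nonneg
    (by norm_num; positivity)] at h3
  refine ENNReal.ofReal_le_ofReal ?_
  linarith

section exists_grid
variable {μ : Measure ℝ} {p : ℝ → ℝ≥0∞} {m₀ n₀ : ℕ}
  {α : Fin m₀ → ℝ} {β : Fin n₀ → ℝ} {δ : ℝ}

/-- These sets increase to `{p ≠ 0}`, so one of them charges both `O₁` and `O₂`. The bound on `|x|`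
is there to keep the exponential factor of the tilts away from zero. -/
theorem exists_volume_lower_set_inter_ne_zero (hp : Measurable p)
    (hμ : (volume : Measure ℝ).withDensity p = μ) {O₁ O₂ : Set ℝ} (h₁ : μ O₁ ≠ 0) (h₂ : μ O₂ ≠ 0) :
    ∃ n : ℕ, volume ({x | ENNReal.ofReal (1 / (n + 1)) ≤ p x ∧ |x| ≤ n} ∩ O₁) ≠ 0 ∧
      volume ({x | ENNReal.ofReal (1 / (n + 1)) ≤ p x ∧ |x| ≤ n} ∩ O₂) ≠ 0 := by
  set E : ℕ → Set ℝ := fun n => {x | ENNReal.ofReal (1 / (n + 1)) ≤ p x ∧ |x| ≤ n} with hE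
  have hmono : Monotone E := by
    intro n n' hn x hx
    have hn' : (n : ℝ) ≤ n' := by exact_mod_cast hn
    refine ⟨le_trans (ENNReal.ofReal_le_ofReal ?_) hx.1, hx.2.trans hn'⟩
    exact one_div_le_one_div_of_le (by positivity) (by linarith)
  have hex : ∀ O : Set ℝ, μ O ≠ 0 → ∃ n, volume (E n ∩ O) ≠ 0 := by
    intro O hO
    by_contra! hc
    refine hO ?_
    have h1 : volume ({x | p x ≠ 0} ∩ O) = 0 := by
      refine measure_mono_null ?_ (measure_iUnion_null hc)
      rintro x ⟨hx, hxO⟩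
      obtain ⟨c, hc0, -, hcx⟩ := exists_ofReal_le hx
      obtain ⟨n, hn⟩ := exists_nat_ge (max (1 / c) |x|)
      refine Set.mem_iUnion.2 ⟨n, ⟨le_trans (ENNReal.ofReal_le_ofReal ?_) hcx,
        (le_max_right _ _).trans hn⟩, hxO⟩
      rw [div_le_iff₀ (by positivity)]
      have h3 := (le_max_left _ _).trans hn
      rw [div_le_iff₀ hc0] at h3
      linarith
    rwa [← hμ, withDensity_apply_eq_zero hp]
  obtain ⟨n₁, hn₁⟩ := hex O₁ h₁
  obtain ⟨n₂, hn₂⟩ := hex O₂ h₂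
  refine ⟨max n₁ n₂, fun h => hn₁ ?_, fun h => hn₂ ?_⟩
  · exact measure_mono_null (Set.inter_subset_inter_left _ (hmono (le_max_left _ _))) h
  · exact measure_mono_null (Set.inter_subset_inter_left _ (hmono (le_max_right _ _))) h

/-- The grid consists of two density points of a set where `p` is bounded below, one to the left and
one to the right of all the means. -/
theorem exists_gridBound_volume (hp : Measurable p) (hμ : (volume : Measure ℝ).withDensity p = μ)
    (hm₀ : 0 < m₀) (hn₀ : 0 < n₀) (hδ : 0 < δ)
    (htame : ∀ a b, InTameRange μ δ (tiltMean μ (α a + β b))) :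
    ∃ u s ε c η : ℝ, ∃ B : ℕ, 0 < s ∧ 0 < η ∧ 0 < ε ∧ 0 < c ∧
      (∀ a b, u + η ≤ tiltMean μ (α a + β b) ∧ tiltMean μ (α a + β b) ≤ u + s * B - η) ∧
      GridCompat ⊤ u s ∧
      GridBound volume ⊤ (fun a b => tiltDens μ p (α a + β b)) u s B ε c := by
  have : Nonempty (Fin m₀ × Fin n₀) := ⟨⟨0, hm₀⟩, ⟨0, hn₀⟩⟩
  obtain ⟨z₁, z₂, hz₁, hz₂, h₁, h₂⟩ := exists_support_bounds (ι := Fin m₀ × Fin n₀)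
    (z := fun e => tiltMean μ (α e.1 + β e.2)) hδ fun e => htame _ _
  obtain ⟨n, hn₁, hn₂⟩ := exists_volume_lower_set_inter_ne_zero hp hμ h₁ h₂
  set E := {x | ENNReal.ofReal (1 / (n + 1)) ≤ p x ∧ |x| ≤ n} with hE
  have hEm : MeasurableSet E := (measurableSet_le measurable_const hp).inter
    (measurableSet_le measurable_id.abs measurable_const)
  obtain ⟨u, hu, hue⟩ := eventually_volume_closedBall_sdiff_le hEm hn₁
  obtain ⟨v, hv, hve⟩ := eventually_volume_closedBall_sdiff_le hEm hn₂
  have hu : u < z₁ := hu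
  have hv : z₂ < v := hv
  obtain ⟨ε, ⟨hε1, hε2⟩, hε⟩ := ((hue.and hve).and self_mem_nhdsWithin).exists
  have hε : 0 < ε := hε
  obtain ⟨c, hc, hc1, hcE⟩ := exists_ofReal_le_forall (ι := Fin m₀ × Fin n₀)
    (t := fun e => ENNReal.ofReal (Real.exp (-(|α e.1 + β e.2| * n) -
      logPartition μ (α e.1 + β e.2))) * ENNReal.ofReal (1 / (n + 1))) fun e => by
      refine mul_ne_zero ?_ ?_
      · simpa using Real.exp_pos _
      · simp only [ne_eq, ENNReal.ofReal_eq_zero, not_le]; positivity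
  have hz12 : z₁ ≤ z₂ := (hz₁ (Classical.arbitrary _)).trans (hz₂ _)
  refine ⟨u, v - u, ε, c / 2, min (z₁ - u) (v - z₂), 1, by linarith, ?_, hε, by positivity, ?_,
    Or.inl rfl, ?_⟩
  · exact lt_min (by linarith) (by linarith)
  · intro a b
    have h3 := hz₁ (a, b)
    have h4 := hz₂ (a, b)
    have h5 := min_le_left (z₁ - u) (v - z₂)
    have h6 := min_le_right (z₁ - u) (v - z₂)
    dsimp only at h3 h4
    push_cast
    constructor <;> linarith
  · refine gridBound_volume (fun a b => measurable_tiltDens hp) hEm hc1 ?_ hε ?_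
    · intro a b x hx
      refine (hcE (a, b)).trans ?_
      unfold tiltDens
      gcongr
      · have h3 : |(α a + β b) * x| ≤ |α a + β b| * n := by
          rw [abs_mul]
          exact mul_le_mul_of_nonneg_left hx.2 (abs_nonneg _)
        have := neg_le_of_abs_le h3
        linarith
      · exact hx.1
    · intro l hl
      interval_cases l
      · simpa using hε1
      · simpa using hε2

theorem exists_int_ne_zero {U : Set ℝ} (hμ : intCount.withDensity p = μ) (hU : MeasurableSet U)
    (h : μ U ≠ 0) : ∃ w : ℤ, (w : ℝ) ∈ U ∧ p w ≠ 0 := by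
  by_contra! hc
  refine h ?_
  rw [← hμ, withDensity_apply _ hU, ← lintegral_indicator hU, lintegral_intCount]
  refine ENNReal.tsum_eq_zero.2 fun w => ?_
  by_cases hw : (w : ℝ) ∈ U
  · rw [Set.indicator_of_mem hw, hc w hw]
  · rw [Set.indicator_of_notMem hw]

theorem intCast_mem_support_intCount (w : ℤ) : (w : ℝ) ∈ intCount.support := by
  refine (Measure.mem_support_iff_forall _).2 fun U hU => ?_
  refine lt_of_lt_of_le ?_ (measure_mono (Set.singleton_subset_iff.2 (mem_of_mem_nhds hU)))
  rw [intCount_singleton]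
  exact one_pos

/-- The range of the means is covered by an integer interval on which the tilted densities are
bounded below. -/
theorem exists_grid_intCount (hμ : intCount.withDensity p = μ)
    (hconv : ∀ u v w : ℤ, p u ≠ 0 → p v ≠ 0 → u ≤ w → w ≤ v → p w ≠ 0)
    (hm₀ : 0 < m₀) (hn₀ : 0 < n₀) (hδ : 0 < δ)
    (htame : ∀ a b, InTameRange μ δ (tiltMean μ (α a + β b))) :
    ∃ (u : ℤ) (c η : ℝ) (B : ℕ), 0 < η ∧ 0 < c ∧ c ≤ 1 ∧
      (∀ a b, u + η ≤ tiltMean μ (α a + β b) ∧ tiltMean μ (α a + β b) ≤ u + B - η) ∧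
      ∀ a b, ∀ l : ℕ, l ≤ B → ENNReal.ofReal c ≤ tiltDens μ p (α a + β b) (u + l) := by
  have : Nonempty (Fin m₀ × Fin n₀) := ⟨⟨0, hm₀⟩, ⟨0, hn₀⟩⟩
  obtain ⟨z₁, z₂, hz₁, hz₂, h₁, h₂⟩ := exists_support_bounds (ι := Fin m₀ × Fin n₀)
    (z := fun e => tiltMean μ (α e.1 + β e.2)) hδ fun e => htame _ _
  obtain ⟨u, hu, hpu⟩ := exists_int_ne_zero hμ measurableSet_Iio h₁
  obtain ⟨v, hv, hpv⟩ := exists_int_ne_zero hμ measurableSet_Ioi h₂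
  have hu : (u : ℝ) < z₁ := hu
  have hv : z₂ < (v : ℝ) := hv
  have hz12 : z₁ ≤ z₂ := (hz₁ (Classical.arbitrary _)).trans (hz₂ _)
  have huv : u < v := by
    have : (u : ℝ) < v := by linarith
    exact_mod_cast this
  obtain ⟨B, hB⟩ := Int.eq_ofNat_of_zero_le (show 0 ≤ v - u by omega)
  have hBr : (u : ℝ) + B = v := by
    have : u + (B : ℤ) = v := by omega
    exact_mod_cast this
  have hall : ∀ l : ℕ, l ≤ B → p (u + l) ≠ 0 := by
    intro l hl
    have := hconv u v (u + l) hpu hpv (by omega) (by omega)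
    push_cast at this
    exact this
  obtain ⟨c, hc, hc1, hcE⟩ := exists_ofReal_le_forall (ι := (Fin m₀ × Fin n₀) × Fin (B + 1))
    (t := fun e => tiltDens μ p (α e.1.1 + β e.1.2) (u + (e.2 : ℕ))) fun e => by
      refine mul_ne_zero ?_ (hall _ (by omega))
      simpa using Real.exp_pos _
  refine ⟨u, c, min (z₁ - u) (v - z₂), B, ?_, hc, hc1, ?_,
    fun a b l hl => hcE ((a, b), ⟨l, by omega⟩)⟩
  · exact lt_min (by linarith) (by linarith)
  · intro a b
    have h3 := hz₁ (a, b)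
    have h4 := hz₂ (a, b)
    have h5 := min_le_left (z₁ - u) (v - z₂)
    have h6 := min_le_right (z₁ - u) (v - z₂)
    dsimp only at h3 h4
    constructor <;> linarith

/-- Full support leaves no gaps: the integers charged by `μ` form an interval. -/
theorem ne_zero_of_support_eq (hμ : intCount.withDensity p = μ)
    (hsupp : μ.support = {x : ℝ | lowerEnd μ ≤ (x : EReal) ∧ (x : EReal) ≤ upperEnd μ} ∩
      intCount.support) {u v w : ℤ} (hu : p u ≠ 0) (hv : p v ≠ 0) (huw : u ≤ w) (hwv : w ≤ v) :
    p w ≠ 0 := by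
  have hmem : ∀ w : ℤ, p w ≠ 0 → (w : ℝ) ∈ μ.support := by
    intro w hw
    refine (Measure.mem_support_iff_forall _).2 fun U hU => ?_
    refine lt_of_lt_of_le ?_ (measure_mono (Set.singleton_subset_iff.2 (mem_of_mem_nhds hU)))
    rw [← hμ, withDensity_apply _ (measurableSet_singleton _), lintegral_singleton,
      intCount_singleton, mul_one]
    exact pos_iff_ne_zero.2 hw
  have h3 : (w : ℝ) ∈ μ.support := by
    rw [hsupp]
    refine ⟨⟨(sInf_le (Set.mem_image_of_mem _ (hmem u hu))).trans ?_,
      le_trans ?_ (le_sSup (Set.mem_image_of_mem _ (hmem v hv)))⟩,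
      intCast_mem_support_intCount _⟩
    · rw [EReal.coe_le_coe_iff]
      exact_mod_cast huw
    · rw [EReal.coe_le_coe_iff]
      exact_mod_cast hwv
  have h4 := ((Measure.mem_support_iff_forall _).1 h3 _
    (Metric.ball_mem_nhds _ (show (0 : ℝ) < 1 / 2 by norm_num))).ne'
  obtain ⟨w', hw', hpw⟩ := exists_int_ne_zero hμ Metric.isOpen_ball.measurableSet h4
  rw [Metric.mem_ball, Real.dist_eq, ← Int.cast_sub, ← Int.cast_abs] at hw'
  have h5 : |w' - w| < 1 := by
    have : ((|w' - w| : ℤ) : ℝ) < (1 : ℤ) := by push_cast at hw' ⊢; linarith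
    exact_mod_cast this
  have h6 : w' = w := by rw [Int.abs_lt_one_iff] at h5; omega
  rwa [h6] at hpw

theorem exists_gridBound_intCount (hp : Measurable p) (hμ : intCount.withDensity p = μ)
    (hsupp : μ.support = {x : ℝ | lowerEnd μ ≤ (x : EReal) ∧ (x : EReal) ≤ upperEnd μ} ∩
      intCount.support)
    (hm₀ : 0 < m₀) (hn₀ : 0 < n₀) (hδ : 0 < δ)
    (htame : ∀ a b, InTameRange μ δ (tiltMean μ (α a + β b))) :
    ∃ u s ε c η : ℝ, ∃ B : ℕ, 0 < s ∧ 0 < η ∧ 0 < ε ∧ 0 < c ∧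
      (∀ a b, u + η ≤ tiltMean μ (α a + β b) ∧ tiltMean μ (α a + β b) ≤ u + s * B - η) ∧
      GridCompat intSubgroup u s ∧
      GridBound intCount intSubgroup (fun a b => tiltDens μ p (α a + β b)) u s B ε c := by
  obtain ⟨u, c, η, B, hη, hc, hc1, hz, hcE⟩ := exists_grid_intCount hμ
    (fun u v w hu hv huw hwv => ne_zero_of_support_eq hμ hsupp hu hv huw hwv) hm₀ hn₀ hδ htame
  refine ⟨u, 1, 1 / 2, c, η, B, one_pos, hη, by norm_num, hc, fun a b => ?_,
    Or.inr ⟨rfl, rfl, u, rfl⟩, gridBound_intCount (fun a b => measurable_tiltDens hp) ⟨u, rfl⟩ hc1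
      hcE (by norm_num)⟩
  rw [one_mul]
  exact hz a b

end exists_grid

/-! ### Convergence of the corner law -/

theorem card_divNat {m k : ℕ} (a : Fin m) :
    (Finset.univ.filter fun i : Fin (m * k) => i.divNat = a).card = k := by
  have : (Finset.univ.filter fun i : Fin (m * k) => i.divNat = a) =
      Finset.univ.map ⟨fun b : Fin k => finProdFinEquiv (a, b), fun b b' h => by
        simpa using h⟩ := by
    ext i
    obtain ⟨⟨a', b⟩, rfl⟩ := finProdFinEquiv.surjective i
    have h1 : (finProdFinEquiv (a', b)).divNat = a' :=
      congrArg Prod.fst (finProdFinEquiv.symm_apply_apply (a', b))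
    simp only [Finset.mem_filter, Finset.mem_univ, true_and, h1, Finset.mem_map]
    constructor
    · rintro rfl
      exact ⟨b, rfl⟩
    · rintro ⟨b', hb'⟩
      exact (congrArg Prod.fst (finProdFinEquiv.injective hb')).symm
  rw [this, Finset.card_map, Finset.card_univ, Fintype.card_fin]

/-- The last `k` indices of the cloning form one block, which will contain the band. -/
theorem divNat_eq_last {m k : ℕ} (hm : 0 < m) (i : Fin (m * k)) (hi : m * k ≤ (i : ℕ) + k) :
    i.divNat = ⟨m - 1, by omega⟩ := by
  ext
  have hk : 0 < k := Nat.pos_of_ne_zero fun h => by subst h; exact absurd i.2 (by simp)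
  change (i : ℕ) / k = m - 1
  refine Nat.div_eq_of_lt_le ?_ ?_
  · rw [Nat.sub_mul]; omega
  · rw [Nat.sub_add_cancel hm]; exact i.2

theorem IsMLE.sum_eq {μ : Measure ℝ} {m n : ℕ} {r : Fin m → ℝ} {c : Fin n → ℝ} {α : Fin m → ℝ}
    {β : Fin n → ℝ} (h : IsMLE μ r c α β) : ∑ i, r i = ∑ j, c j := by
  simp only [← h.sum_row, ← h.sum_col]
  exact Finset.sum_comm

section converges
variable {ζ : Measure ℝ} [SigmaFinite ζ] {Γ : AddSubgroup ℝ} {m₀ n₀ : ℕ} {μ : Measure ℝ}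
  {p : ℝ → ℝ≥0∞} {r₀ : Fin m₀ → ℝ} {c₀ : Fin n₀ → ℝ} {α : Fin m₀ → ℝ} {β : Fin n₀ → ℝ}

theorem convergesTV_of_le {P : ℕ → Measure ℝ} {Q : Measure ℝ} {l : Filter ℕ} (hl : l ≤ atTop)
    {e rate : ℕ → ℝ} (hrate : (fun k : ℕ => √(e k) / k) =O[atTop] rate)
    (hrate0 : Tendsto rate atTop (𝓝 0)) {C : ℝ}
    (h : ∀ᶠ k in l, IsProbabilityMeasure (P k) ∧ tvDist (P k) Q ≤ C * (√(e k) / k)) :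
    ConvergesTV P Q l rate := by
  have hO : (fun k => tvDist (P k) Q) =O[l] rate := by
    refine IsBigO.trans ?_ (hrate.mono hl)
    refine IsBigO.of_bound C ?_
    filter_upwards [h] with k hk
    have h0 : 0 ≤ tvDist (P k) Q := Real.iSup_nonneg fun S => abs_nonneg _
    rw [Real.norm_of_nonneg h0, Real.norm_of_nonneg (by positivity)]
    exact hk.2
  exact ⟨h.mono fun k hk => hk.1, hO.trans_tendsto (hrate0.mono_left hl), hO⟩

theorem IsLattice.convergesTV (h : IsLattice ζ Γ) [NeZero μ] (hp : Measurable p)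
    (hμ : ζ.withDensity p = μ) (hcond : CondLawEqFib ζ Γ μ p) (hMLE : IsMLE μ r₀ c₀ α β)
    (hm : 0 < m₀) (hn : 0 < n₀)
    (hM : ∃ M : ℝ≥0, ∀ a b, ∀ᵐ x ∂ζ, tiltDens μ p (α a + β b) x ≤ M)
    {l : Filter ℕ} (hl : l ≤ atTop)
    (hΓ : ∀ᶠ k : ℕ in l, (∀ a, (k : ℝ) * r₀ a ∈ Γ) ∧ ∀ b, (k : ℝ) * c₀ b ∈ Γ) {e rate : ℕ → ℝ}
    (hke : ∀ᶠ k : ℕ in l, (k : ℝ) ≤ e k) (hrate : (fun k : ℕ => √(e k) / k) =O[atTop] rate)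
    (hrate0 : Tendsto rate atTop (𝓝 0))
    (hlow : ∀ᶠ k : ℕ in l, ENNReal.ofReal (Real.exp (-(e k))) ≤
      fibInt ζ (prodWt fun (i : Fin (m₀ * k)) (j : Fin (n₀ * k)) =>
        tiltDens μ p (α i.divNat + β j.divNat)) (fun i => k * r₀ i.divNat)
        (fun j => k * c₀ j.divNat)) :
    ConvergesTV (cornerLaw μ r₀ c₀) (tilt μ (α ⟨0, hm⟩ + β ⟨0, hn⟩)) l rate := by
  obtain ⟨M, hM⟩ := hM
  refine convergesTV_of_le hl hrate hrate0
    (C := 4 * √(2 + (m₀ + n₀) * Real.log (max M 1 : ℝ≥0)) + 2) ?_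
  filter_upwards [hl (eventually_ge_atTop 2), hΓ, hke, hlow] with k hk hΓk hkek hlowk
  have hN : 0 < m₀ * k := Nat.mul_pos hm (by omega)
  have hN' : 0 < n₀ * k := Nat.mul_pos hn (by omega)
  have key := h.tv_corner_le (M := max M 1) hp hμ hcond hMLE.1 hMLE.sum_eq (le_max_right _ _)
    (fun a b => (hM a b).mono fun x hx => hx.trans (by exact_mod_cast le_max_left _ _)) hk
    (fun i : Fin (m₀ * k) => i.divNat) (fun j : Fin (n₀ * k) => j.divNat) hN hN' card_divNat
    card_divNat hΓk.1 hΓk.2 hkek hlowk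
  have h0 : ∀ {m : ℕ} (hm : 0 < m) (hN : 0 < m * k),
      (⟨0, hN⟩ : Fin (m * k)).divNat = ⟨0, hm⟩ := fun _ _ => Fin.ext (Nat.zero_div k)
  rw [h0 hm, h0 hn] at key
  exact key

theorem tendsto_slowRate : Tendsto slowRate atTop (𝓝 0) := by
  have h1 := (isLittleO_log_rpow_atTop (r := 1 / 4) (by norm_num)).tendsto_div_nhds_zero.comp
    tendsto_natCast_atTop_atTop
  refine h1.congr fun k => ?_
  simp only [slowRate, Function.comp]
  rw [Real.rpow_neg (Nat.cast_nonneg k), div_eq_mul_inv, mul_comm]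

theorem tendsto_fastRate : Tendsto fastRate atTop (𝓝 0) := by
  have h1 : Tendsto (fun k : ℕ => Real.log k / (k : ℝ)) atTop (𝓝 0) := by
    have := (isLittleO_log_rpow_atTop (r := 1) (by norm_num)).tendsto_div_nhds_zero.comp
      tendsto_natCast_atTop_atTop
    refine this.congr fun k => ?_
    simp [Function.comp]
  have h2 := (Real.continuous_sqrt.tendsto 0).comp h1
  rw [Real.sqrt_zero] at h2
  refine h2.congr fun k => ?_
  simp only [fastRate, Function.comp]
  rw [Real.sqrt_div' _ (Nat.cast_nonneg k), Real.rpow_neg (Nat.cast_nonneg k), ← Real.sqrt_eq_rpow,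
    div_eq_mul_inv, mul_comm]

theorem sqrt_slow_isBigO (C : ℝ) :
    (fun k : ℕ => √(C * (k * √k * Real.log k ^ 2)) / k) =O[atTop] slowRate := by
  refine IsBigO.of_bound √C ?_
  filter_upwards [eventually_ge_atTop 1] with k hk
  have hk1 : (1 : ℝ) ≤ k := by exact_mod_cast hk
  have hk0 : (0 : ℝ) < k := by linarith
  have hlog : 0 ≤ Real.log k := Real.log_nonneg hk1
  have h1 : √(C * (k * √k * Real.log k ^ 2)) / k = √C * slowRate k := by
    rw [Real.sqrt_mul' _ (by positivity), Real.sqrt_mul (by positivity), Real.sqrt_sq hlog,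
      slowRate, mul_div_assoc]
    congr 1
    have h2 : (k : ℝ) * √k = (k : ℝ) ^ (3 / 2 : ℝ) := by
      rw [Real.sqrt_eq_rpow, show (3 / 2 : ℝ) = 1 + 1 / 2 by norm_num, Real.rpow_add hk0,
        Real.rpow_one]
    rw [h2, Real.sqrt_eq_rpow, ← Real.rpow_mul hk0.le, mul_div_right_comm]
    congr 1
    rw [show (-(1 / 4) : ℝ) = 3 / 2 * (1 / 2) - 1 by norm_num, Real.rpow_sub hk0, Real.rpow_one]
  rw [h1, norm_mul, Real.norm_of_nonneg (Real.sqrt_nonneg C)]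

theorem sqrt_fast_isBigO (C : ℝ) :
    (fun k : ℕ => √(C * (k * Real.log k)) / k) =O[atTop] fastRate := by
  refine IsBigO.of_bound √C ?_
  filter_upwards [eventually_ge_atTop 1] with k hk
  have hk1 : (1 : ℝ) ≤ k := by exact_mod_cast hk
  have hk0 : (0 : ℝ) < k := by linarith
  have hlog : 0 ≤ Real.log k := Real.log_nonneg hk1
  have h1 : √(C * (k * Real.log k)) / k = √C * fastRate k := by
    rw [Real.sqrt_mul' _ (by positivity), Real.sqrt_mul (by positivity), fastRate, mul_div_assoc]
    congr 1
    rw [mul_div_right_comm]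
    congr 1
    rw [show (-(1 / 2) : ℝ) = 1 / 2 - 1 by norm_num, Real.rpow_sub hk0, Real.rpow_one,
      Real.sqrt_eq_rpow]
  rw [h1, norm_mul, Real.norm_of_nonneg (Real.sqrt_nonneg C)]

theorem IsLattice.convergesTV_slow (h : IsLattice ζ Γ) (hΓm : MeasurableSet (Γ : Set ℝ))
    (hball : ∀ ρ : ℝ, 0 < ρ → 2 * ρ ≤ 1 → ∀ x ∈ Γ,
      ENNReal.ofReal (2 * ρ) ≤ ζ (Metric.closedBall x ρ)) [NeZero μ] (hp : Measurable p)
    (hμ : ζ.withDensity p = μ) (hcond : CondLawEqFib ζ Γ μ p) (hMLE : IsMLE μ r₀ c₀ α β)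
    (hm : 0 < m₀) (hn : 0 < n₀)
    (hM : ∃ M : ℝ≥0, ∀ a b, ∀ᵐ x ∂ζ, tiltDens μ p (α a + β b) x ≤ M)
    {l : Filter ℕ} (hl : l ≤ atTop)
    (hΓ : ∀ᶠ k : ℕ in l, (∀ a, (k : ℝ) * r₀ a ∈ Γ) ∧ ∀ b, (k : ℝ) * c₀ b ∈ Γ)
    (hgrid : ∃ u s ε c η : ℝ, ∃ B : ℕ, 0 < s ∧ 0 < η ∧ 0 < ε ∧ 0 < c ∧
      (∀ a b, u + η ≤ tiltMean μ (α a + β b) ∧ tiltMean μ (α a + β b) ≤ u + s * B - η) ∧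
      GridCompat Γ u s ∧
      GridBound ζ Γ (fun a b => tiltDens μ p (α a + β b)) u s B ε c) :
    ConvergesTV (cornerLaw μ r₀ c₀) (tilt μ (α ⟨0, hm⟩ + β ⟨0, hn⟩)) l slowRate := by
  obtain ⟨u, s, ε, c, η, B, hs, hη, hε, hc, hz, hcompat, hG⟩ := hgrid
  obtain ⟨C, hC, s₀, hs₀, hsub⟩ := exists_subGaussNear_tilt hMLE.1
  have hprob : ∀ a b, IsProbabilityMeasure (ζ.withDensity (tiltDens μ p (α a + β b))) :=
    fun a b => by
      rw [withDensity_tiltDens hp hμ (hMLE.1 a b)]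
      exact isProbabilityMeasure_tilt (hMLE.1 a b)
  obtain ⟨C', hC', hev⟩ := exists_slow_lower_bound h hΓm hball
    (fun a b => measurable_tiltDens hp) hm hs hη hε hc hz hcompat hG hC hs₀ fun a b => by
      rw [withDensity_tiltDens hp hμ (hMLE.1 a b)]
      exact hsub a b
  simp only [hMLE.sum_row, hMLE.sum_col] at hev
  -- The maximum with `1` secures `k ≤ e k`, which the total variation bound requires.
  refine h.convergesTV hp hμ hcond hMLE hm hn hM hl hΓ
    (e := fun k => max C' 1 * (k * √k * Real.log k ^ 2)) ?_ (sqrt_slow_isBigO _) tendsto_slowRate ?_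
  · filter_upwards [hl (eventually_ge_atTop 1), hl (eventually_log_ge 1)] with k hk hlog
    have hk1 : (1 : ℝ) ≤ k := by exact_mod_cast hk
    have h1 : (1 : ℝ) ≤ √k := by rwa [Real.one_le_sqrt]
    have h2 := one_le_pow₀ hlog (n := 2)
    have h3 := one_le_mul_of_one_le_of_one_le (one_le_mul_of_one_le_of_one_le
      (le_max_right C' 1) h1) h2
    calc (k : ℝ) = k * 1 := (mul_one _).symm
      _ ≤ k * (max C' 1 * √k * Real.log k ^ 2) := by gcongr
      _ = _ := by ring
  · filter_upwards [hl hev, hΓ, hl (eventually_ge_atTop 1)] with k hk hΓk hk1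
    refine le_trans (ENNReal.ofReal_le_ofReal (Real.exp_le_exp.2 ?_)) (hk (m₀ * k) (n₀ * k)
      (fun i => i.divNat) (fun j => j.divNat) card_divNat card_divNat
      ⟨⟨m₀ - 1, by omega⟩, fun i hi => divNat_eq_last hm i hi⟩
      ⟨⟨n₀ - 1, by omega⟩, fun i hi => divNat_eq_last hn i hi⟩ hΓk.1 hΓk.2
      (Nat.mul_pos hm (by omega)) (Nat.mul_pos hn (by omega)))
    have hlog : 0 ≤ Real.log k := Real.log_natCast_nonneg k
    have := le_max_left C' 1
    exact neg_le_neg (by gcongr)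

end converges

/-! ### The theorem for general densities on the integers and on the line -/

section main
variable {m₀ n₀ : ℕ} {μ : Measure ℝ} [SigmaFinite μ] {r₀ : Fin m₀ → ℝ} {c₀ : Fin n₀ → ℝ}
  {α : Fin m₀ → ℝ} {β : Fin n₀ → ℝ} {δ : ℝ}

theorem atTopIntegral_le : atTopIntegral r₀ c₀ ≤ atTop := inf_le_left

theorem eventually_atTopIntegral : ∀ᶠ k : ℕ in atTopIntegral r₀ c₀,
    (∀ a, (k : ℝ) * r₀ a ∈ intSubgroup) ∧ ∀ b, (k : ℝ) * c₀ b ∈ intSubgroup := by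
  refine mem_inf_of_right (mem_principal.2 fun k hk => ⟨fun a => ?_, fun b => ?_⟩)
  · obtain ⟨w, hw⟩ := hk.1 a
    exact mem_intSubgroup.2 ⟨w, hw.symm⟩
  · obtain ⟨w, hw⟩ := hk.2 b
    exact mem_intSubgroup.2 ⟨w, hw.symm⟩

theorem HasTameDensity.ae_tiltDens_le {ζ : Measure ℝ} [SigmaFinite ζ] [NeZero μ]
    (h : HasTameDensity μ ζ δ) (hdom : ∀ a b, α a + β b ∈ tiltDomain μ)
    (htame : ∀ a b, InTameRange μ δ (tiltMean μ (α a + β b))) :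
    ∃ M : ℝ≥0, ∀ a b, ∀ᵐ x ∂ζ, tiltDens μ (μ.rnDeriv ζ) (α a + β b) x ≤ M := by
  obtain ⟨M, hM⟩ := h.2.2
  refine ⟨M, fun a b => ?_⟩
  have h1 : (tilt μ (α a + β b)).rnDeriv ζ =ᵐ[ζ] tiltDens μ (μ.rnDeriv ζ) (α a + β b) := by
    rw [← withDensity_tiltDens (Measure.measurable_rnDeriv μ ζ)
      (Measure.withDensity_rnDeriv_eq μ ζ h.1) (hdom a b)]
    exact Measure.rnDeriv_withDensity _ (measurable_tiltDens (Measure.measurable_rnDeriv μ ζ))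
  filter_upwards [hM _ (hdom a b) (htame a b), h1] with x hx hx1
  rwa [← hx1]

theorem HasTameDensity.convergesTV_intCount (h : HasTameDensity μ intCount δ) (hm : 0 < m₀)
    (hn : 0 < n₀) (hδ : 0 < δ) (hMLE : IsMLE μ r₀ c₀ α β)
    (htame : ∀ a b, InTameRange μ δ (tiltMean μ (α a + β b))) :
    ConvergesTV (cornerLaw μ r₀ c₀) (tilt μ (α ⟨0, hm⟩ + β ⟨0, hn⟩))
      (atTopIntegral r₀ c₀) slowRate := by
  have : NeZero μ := (htame ⟨0, hm⟩ ⟨0, hn⟩).neZero hδ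
  have hp := Measure.measurable_rnDeriv μ intCount
  have hμ := Measure.withDensity_rnDeriv_eq μ intCount h.1
  have hcond : CondLawEqFib intCount intSubgroup μ (μ.rnDeriv intCount) := by
    have : SigmaFinite (intCount.withDensity (μ.rnDeriv intCount)) := by rwa [hμ]
    have := condLawEqFib_intCount hp
    rwa [hμ] at this
  exact isLattice_intCount.convergesTV_slow measurableEmbedding_intCast.measurableSet_range
    (fun ρ hρ hρ1 x hx => le_intCount_closedBall hρ hρ1 hx) hp hμ hcond hMLE hm hn
    (h.ae_tiltDens_le hMLE.1 htame) atTopIntegral_le eventually_atTopIntegral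
    (exists_gridBound_intCount hp hμ h.2.1 hm hn hδ htame)

theorem HasTameDensity.convergesTV_volume (h : HasTameDensity μ volume δ) (hm : 0 < m₀)
    (hn : 0 < n₀) (hδ : 0 < δ) (hMLE : IsMLE μ r₀ c₀ α β)
    (htame : ∀ a b, InTameRange μ δ (tiltMean μ (α a + β b))) :
    ConvergesTV (cornerLaw μ r₀ c₀) (tilt μ (α ⟨0, hm⟩ + β ⟨0, hn⟩)) atTop slowRate := by
  have : NeZero μ := (htame ⟨0, hm⟩ ⟨0, hn⟩).neZero hδ
  have hp := Measure.measurable_rnDeriv μ volume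
  have hμ := Measure.withDensity_rnDeriv_eq μ volume h.1
  have hcond : CondLawEqFib volume ⊤ μ (μ.rnDeriv volume) := by
    have : SigmaFinite ((volume : Measure ℝ).withDensity (μ.rnDeriv volume)) := by rwa [hμ]
    have := condLawEqFib_volume hp
    rwa [hμ] at this
  exact isLattice_volume.convergesTV_slow MeasurableSet.univ
    (fun ρ _ _ x _ => le_volume_closedBall ρ x) hp hμ hcond hMLE hm hn
    (h.ae_tiltDens_le hMLE.1 htame) le_rfl (Eventually.of_forall fun k => by simp)
    (exists_gridBound_volume hp hμ hm hn hδ htame)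

end main

/-! ### Symmetric unimodal functions -/

/-- `F` is a decreasing function of the distance to `C / 2` on `Γ`. -/
def SymmUnimodal (Γ : AddSubgroup ℝ) (C : ℝ) (F : ℝ → ℝ≥0∞) : Prop :=
  ∀ t ∈ Γ, ∀ t' ∈ Γ, |2 * t - C| ≤ |2 * t' - C| → F t' ≤ F t

/-- The interval with center `D / 2` and length `R`. -/
def centeredIcc (D R : ℝ) : Set ℝ := {x | |2 * x - D| ≤ R}

theorem measurableSet_centeredIcc (D R : ℝ) : MeasurableSet (centeredIcc D R) :=
  measurableSet_le (by fun_prop) measurable_const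

/-- `p` is the indicator of an interval, in the form in which it is used here. -/
def IntervalWt (p : ℝ → ℝ≥0∞) : Prop :=
  ∀ D, ∃ R, ∀ x, p x * p (D - x) = (centeredIcc D R).indicator 1 x

section unimodal
variable {ζ : Measure ℝ} [SigmaFinite ζ] {Γ : AddSubgroup ℝ}

omit [SigmaFinite ζ] in
theorem IsLattice.lintegral_sub_left (h : IsLattice ζ Γ) {a : ℝ} (ha : a ∈ Γ) (f : ℝ → ℝ≥0∞) :
    ∫⁻ x, f (a - x) ∂ζ = ∫⁻ x, f x ∂ζ :=
  (h.mp a ha).lintegral_comp_emb (MeasurableEquiv.subLeft a).measurableEmbedding f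

omit [SigmaFinite ζ] in
/-- Convolutions with intervals preserve unimodality. -/
theorem SymmUnimodal.conv (h : IsLattice ζ Γ) {F : ℝ → ℝ≥0∞} {C D R : ℝ} (hD : D ∈ Γ)
    (hF : SymmUnimodal Γ C F) : SymmUnimodal Γ (D + C)
      fun t => ∫⁻ x, (centeredIcc D R).indicator 1 x * F (t - x) ∂ζ := by
  intro t ht t' ht' htt
  have hA : ∀ t ∈ Γ, ∫⁻ x, (centeredIcc D R).indicator 1 x * F (t - x) ∂ζ =
      ∫⁻ x in {u | |2 * (t - u) - D| ≤ R}, F x ∂ζ := by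
    intro t ht
    rw [← lintegral_indicator (measurableSet_le (by fun_prop) measurable_const),
      ← h.lintegral_sub_left ht]
    refine lintegral_congr fun x => ?_
    classical
    simp only [Set.indicator_apply, centeredIcc, Set.mem_ofPred_eq, Pi.one_apply, sub_sub_cancel,
      ite_mul, one_mul, zero_mul]
  beta_reduce
  rw [hA t ht, hA t' ht']
  set A := {u : ℝ | |2 * (t - u) - D| ≤ R} with hAdef
  set A' := {u : ℝ | |2 * (t' - u) - D| ≤ R} with hAdef'
  have hAm : MeasurableSet A := measurableSet_le (by fun_prop) measurable_const
  have hAm' : MeasurableSet A' := measurableSet_le (by fun_prop) measurable_const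
  -- The integrals run over two intervals of equal length, and their common part cancels. The
  -- reflection `u ↦ t + t' - D - u` exchanges the two remaining parts, so it suffices to see that
  -- each `u ∈ A \ A'` is at least as close to `C / 2` as its mirror image.
  rw [← lintegral_inter_add_sdiff F A hAm', ← lintegral_inter_add_sdiff F A' hAm, Set.inter_comm A']
  refine add_le_add le_rfl ?_
  have hσ : t + t' - D ∈ Γ := Γ.sub_mem (Γ.add_mem ht ht') hD
  rw [← lintegral_indicator (hAm'.diff hAm), ← lintegral_indicator (hAm.diff hAm'),
    ← h.lintegral_sub_left hσ]
  refine lintegral_mono_ae ?_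
  filter_upwards [h.ae_mem] with u hu
  have hmem : t + t' - D - u ∈ A' \ A ↔ u ∈ A \ A' := by
    simp only [hAdef, hAdef', Set.mem_sdiff, Set.mem_ofPred_eq]
    have e1 : 2 * (t' - (t + t' - D - u)) - D = -(2 * (t - u) - D) := by ring
    have e2 : 2 * (t - (t + t' - D - u)) - D = -(2 * (t' - u) - D) := by ring
    rw [e1, e2, abs_neg, abs_neg]
  by_cases hu' : u ∈ A \ A'
  · rw [Set.indicator_of_mem (hmem.2 hu'), Set.indicator_of_mem hu']
    refine hF u hu _ (Γ.sub_mem hσ hu) ?_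
    have h1 : |2 * (t - u) - D| < |2 * (t' - u) - D| := lt_of_le_of_lt hu'.1 (not_le.1 hu'.2)
    rw [← sq_lt_sq] at h1
    rw [← sq_le_sq] at htt ⊢
    -- After squaring, `u ∈ A \ A'` and the hypothesis on `t, t'` say that `t + t' - D - 2 u` and `t
    -- + t' - D - C` both have the sign of `t' - t`; the claim is that their product is nonnegative.
    have h2 : 0 < (t' - t) * (t + t' - D - 2 * u) := by nlinarith
    have h3 : 0 ≤ (t' - t) * (t + t' - D - C) := by nlinarith
    have h4 : 0 ≤ (t' - t) ^ 2 * ((t + t' - D - C) * (t + t' - D - 2 * u)) := by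
      have := mul_nonneg h3 h2.le
      nlinarith
    have h5 : 0 < (t' - t) ^ 2 := by
      have : t' - t ≠ 0 := fun h0 => by simp [h0] at h2
      positivity
    have h6 := nonneg_of_mul_nonneg_right h4 h5
    nlinarith
  · rw [Set.indicator_of_notMem (fun h => hu' (hmem.1 h))]
    exact zero_le

theorem lintegral_pi_succ {n : ℕ} {f : (Fin (n + 1) → ℝ) → ℝ≥0∞} (hf : Measurable f) :
    ∫⁻ y, f y ∂Measure.pi (fun _ => ζ) =
      ∫⁻ x, ∫⁻ y, f (Fin.cons x y) ∂Measure.pi (fun _ : Fin n => ζ) ∂ζ := by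
  have hmp := (measurePreserving_piFinSuccAbove (fun _ : Fin (n + 1) => ζ) 0).symm
  rw [← hmp.lintegral_comp hf, lintegral_prod]
  · refine lintegral_congr fun x => lintegral_congr fun y => ?_
    simp [MeasurableEquiv.piFinSuccAbove_symm_apply, Fin.insertNthEquiv]
  · exact (hf.comp hmp.measurable).aemeasurable

/-- The conditional density of a sum, for product densities. -/
theorem symmUnimodal_lintegral_pi (h : IsLattice ζ Γ) {n : ℕ} {D R : Fin (n + 1) → ℝ}
    (hD : ∀ j, D j ∈ Γ) : SymmUnimodal Γ (∑ j, D j) fun t =>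
      ∫⁻ y : Fin n → ℝ, (∏ j : Fin n, (centeredIcc (D j.castSucc) (R j.castSucc)).indicator 1 (y j)) *
        (centeredIcc (D (Fin.last n)) (R (Fin.last n))).indicator 1 (t - ∑ j, y j)
        ∂Measure.pi fun _ => ζ := by
  induction n with
  | zero =>
    intro t _ t' _ htt
    beta_reduce
    rw [Measure.pi_of_empty (fun _ : Fin 0 => ζ) 0, lintegral_dirac, lintegral_dirac]
    rw [Fin.sum_univ_one] at htt
    simp only [Finset.univ_eq_empty, Finset.prod_empty, Finset.sum_empty, one_mul, sub_zero]
    by_cases h1 : t' ∈ centeredIcc (D (Fin.last 0)) (R (Fin.last 0))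
    · have h2 : t ∈ centeredIcc (D (Fin.last 0)) (R (Fin.last 0)) := le_trans htt h1
      rw [Set.indicator_of_mem h2]
      exact Set.indicator_le_self' (fun _ _ => zero_le) _
    · rw [Set.indicator_of_notMem h1]
      exact zero_le
  | succ n ih =>
    have hI : ∀ j, Measurable ((centeredIcc (D j) (R j)).indicator (1 : ℝ → ℝ≥0∞)) := fun j =>
      measurable_one.indicator (measurableSet_centeredIcc _ _)
    have h1 := SymmUnimodal.conv (R := R 0) h (hD 0) (ih (D := fun j => D j.succ)
      (R := fun j => R j.succ) fun j => hD _)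
    rw [← Fin.sum_univ_succ] at h1
    convert h1 using 2 with t
    have hm : ∀ t : ℝ, Measurable fun y : Fin (n + 1) → ℝ =>
        (∏ j : Fin (n + 1), (centeredIcc (D j.castSucc) (R j.castSucc)).indicator
          (1 : ℝ → ℝ≥0∞) (y j)) *
        (centeredIcc (D (Fin.last (n + 1))) (R (Fin.last (n + 1)))).indicator 1 (t - ∑ j, y j) := by
      intro t
      refine (Finset.measurable_prod _ fun j _ => (hI _).comp (measurable_pi_apply j)).mul ?_
      exact (hI _).comp (by fun_prop)
    rw [lintegral_pi_succ (hm t)]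
    refine lintegral_congr fun x => ?_
    rw [← lintegral_const_mul]
    · refine lintegral_congr fun y => ?_
      rw [Fin.prod_univ_succ, Fin.sum_univ_succ]
      simp only [Fin.cons_zero, Fin.cons_succ, Fin.castSucc_zero, Fin.castSucc_succ, Fin.succ_last,
        sub_sub, mul_assoc]
    · refine (Finset.measurable_prod _ fun j _ => (hI _).comp (measurable_pi_apply j)).mul ?_
      exact (hI _).comp (by fun_prop)

end unimodal

/-! ### Schur monotonicity of the volume of fibers -/

section schur
variable {ζ : Measure ℝ} [SigmaFinite ζ] {Γ : AddSubgroup ℝ} {p : ℝ → ℝ≥0∞}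

theorem lintegral_baseModel_succAbove {m n : ℕ} (a : Fin (m + 1))
    {f : (Fin (m + 1) → Fin n → ℝ) → ℝ≥0∞} (hf : Measurable f) :
    ∫⁻ y, f y ∂baseModel ζ (m + 1) n =
      ∫⁻ Y, ∫⁻ v, f (a.insertNth v Y) ∂(Measure.pi fun _ => ζ) ∂baseModel ζ m n := by
  have hmp := (measurePreserving_piFinSuccAbove
    (fun _ : Fin (m + 1) => Measure.pi fun _ : Fin n => ζ) a).symm
  unfold baseModel
  rw [← hmp.lintegral_comp hf, lintegral_prod_symm]
  · rfl
  · exact (hf.comp hmp.measurable).aemeasurable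

/-- Fix all rows except row `a` and the last one. In column `j` these two entries have a fixed sum
`D j`, so their joint weight `p x * p (D j - x)` is the indicator of an interval centered at `D j /
2`. What remains, in terms of row `a`, is a product of such indicators with the prescribed row sum
`r a`. -/
theorem prodWt_completion_insertNth (hp : IntervalWt p) {m n : ℕ} (a : Fin (m + 1))
    (q : Fin m → ℝ) (c : Fin (n + 1) → ℝ) (Y : Fin m → Fin n → ℝ) :
    ∃ (A : ℝ≥0∞) (D R : Fin (n + 1) → ℝ), ∑ j, D j = ∑ j, c j - ∑ i, q i ∧
      (∀ Γ : AddSubgroup ℝ, (∀ i, q i ∈ Γ) → (∀ j, c j ∈ Γ) → (∀ i j, Y i j ∈ Γ) → ∀ j, D j ∈ Γ) ∧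
      ∀ (r : Fin (m + 2) → ℝ) (_ : ∀ i : Fin m, r (a.succAbove i).castSucc = q i) (v : Fin n → ℝ),
        prodWt (fun _ _ => p) (completion r c (a.insertNth v Y)) =
          A * ((∏ j : Fin n, (centeredIcc (D j.castSucc) (R j.castSucc)).indicator 1 (v j)) *
            (centeredIcc (D (Fin.last n)) (R (Fin.last n))).indicator 1
              (r a.castSucc - ∑ j, v j)) := by
  set D : Fin (n + 1) → ℝ := Fin.snoc (fun j => c j.castSucc - ∑ i, Y i j)
    (c (Fin.last n) - ∑ i, (q i - ∑ j, Y i j)) with hD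
  choose R hR using hp
  refine ⟨∏ i, ((∏ j, p (Y i j)) * p (q i - ∑ j, Y i j)), D, fun j => R (D j), ?_, ?_, ?_⟩
  · rw [Fin.sum_univ_castSucc, Fin.sum_univ_castSucc (f := c)]
    simp only [hD, Fin.snoc_castSucc, Fin.snoc_last, Finset.sum_sub_distrib]
    rw [Finset.sum_comm (f := fun i j => Y i j)]
    ring
  · intro Γ hq hc hY j
    refine Fin.lastCases ?_ (fun j => ?_) j
    · simp only [hD, Fin.snoc_last]
      exact Γ.sub_mem (hc _) (Γ.sum_mem fun i _ => Γ.sub_mem (hq i) (Γ.sum_mem fun j _ => hY i j))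
    · simp only [hD, Fin.snoc_castSucc]
      exact Γ.sub_mem (hc _) (Γ.sum_mem fun i _ => hY i j)
  · intro r hr v
    unfold prodWt
    rw [Fin.prod_univ_castSucc, Fin.prod_univ_succAbove _ a, mul_right_comm, mul_comm]
    congr 1
    · refine Finset.prod_congr rfl fun i _ => ?_
      rw [Fin.prod_univ_castSucc]
      simp only [completion_castSucc_castSucc, completion_castSucc_last, hr,
        Fin.insertNth_apply_succAbove]
    · rw [← Finset.prod_mul_distrib, Fin.prod_univ_castSucc]
      congr 1
      · refine Finset.prod_congr rfl fun j _ => ?_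
        rw [← hR]
        simp only [completion_castSucc_castSucc, completion_last_castSucc, hD, Fin.snoc_castSucc,
          Fin.insertNth_apply_same]
        congr 2
        rw [Fin.sum_univ_succAbove _ a]
        simp only [Fin.insertNth_apply_same, Fin.insertNth_apply_succAbove]
        ring
      · rw [← hR]
        simp only [completion_castSucc_last, completion_last_last, hD, Fin.snoc_last,
          Fin.insertNth_apply_same]
        congr 2
        rw [Fin.sum_univ_succAbove _ a, Fin.sum_univ_succAbove (fun i : Fin (m + 1) => r i.castSucc) a]
        simp only [Fin.insertNth_apply_same, Fin.insertNth_apply_succAbove, hr,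
          Finset.sum_sub_distrib]
        ring

/-- For fixed other rows the integral over row `a` is a convolution of centered intervals at `r a`,
hence unimodal about half of the total of the two rows. Bringing the two row sums closer together
therefore increases the fiber integral. -/
theorem IsLattice.fibInt_le_of_last (h : IsLattice ζ Γ) (hpm : Measurable p) (hp : IntervalWt p)
    {m n : ℕ} {r r' : Fin (m + 2) → ℝ} {c : Fin (n + 1) → ℝ} (hr : ∀ i, r i ∈ Γ)
    (hr' : ∀ i, r' i ∈ Γ) (hc : ∀ j, c j ∈ Γ) (hrc : ∑ i, r i = ∑ j, c j) (a : Fin (m + 1))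
    (hoff : ∀ i, i ≠ a.castSucc → i ≠ Fin.last _ → r' i = r i)
    (hsum : r' a.castSucc + r' (Fin.last _) = r a.castSucc + r (Fin.last _))
    (hle : |r' a.castSucc - r' (Fin.last _)| ≤ |r a.castSucc - r (Fin.last _)|) :
    fibInt ζ (prodWt fun _ _ => p) r c ≤ fibInt ζ (prodWt fun _ _ => p) r' c := by
  have hm : ∀ r : Fin (m + 2) → ℝ, Measurable fun y : Fin (m + 1) → Fin n → ℝ =>
      prodWt (fun (_ : Fin (m + 2)) (_ : Fin (n + 1)) => p) (completion r c y) := fun r =>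
    (measurable_prodWt fun _ _ => hpm).comp (measurable_completion_right r c)
  refine (lintegral_baseModel_succAbove a (hm r)).trans_le
    (le_trans ?_ (lintegral_baseModel_succAbove a (hm r')).ge)
  refine lintegral_mono_ae ?_
  filter_upwards [ae_baseModel_mem h.ae_mem m n] with Y hY
  obtain ⟨A, D, R, hDsum, hDΓ, hA⟩ := prodWt_completion_insertNth hp a
    (fun i => r (a.succAbove i).castSucc) c Y
  have hDΓ := hDΓ Γ (fun i => hr _) hc hY
  have hqr' : ∀ i : Fin m, r' (a.succAbove i).castSucc = r (a.succAbove i).castSucc := fun i =>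
    hoff _ (fun h0 => Fin.succAbove_ne a i (Fin.castSucc_injective _ h0)) (Fin.castSucc_ne_last _)
  simp only [hA r (fun i => rfl), hA r' hqr']
  have hI : ∀ j, Measurable ((centeredIcc (D j) (R j)).indicator (1 : ℝ → ℝ≥0∞)) := fun j =>
    measurable_one.indicator (measurableSet_centeredIcc _ _)
  have hm2 : ∀ t : ℝ, Measurable fun v : Fin n → ℝ =>
      (∏ j : Fin n, (centeredIcc (D j.castSucc) (R j.castSucc)).indicator
          (1 : ℝ → ℝ≥0∞) (v j)) *
        (centeredIcc (D (Fin.last n)) (R (Fin.last n))).indicator 1 (t - ∑ j, v j) := by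
    intro t
    refine (Finset.measurable_prod _ fun j _ => (hI _).comp (measurable_pi_apply j)).mul ?_
    exact (hI _).comp (by fun_prop)
  rw [lintegral_const_mul _ (hm2 _), lintegral_const_mul _ (hm2 _)]
  refine mul_le_mul_right ?_ _
  refine symmUnimodal_lintegral_pi (R := R) h hDΓ _ (hr' _) _ (hr _) ?_
  have e : ∑ j, D j = r a.castSucc + r (Fin.last _) := by
    rw [hDsum, ← hrc, Fin.sum_univ_castSucc, Fin.sum_univ_succAbove _ a]
    ring
  have e1 : 2 * r' a.castSucc - ∑ j, D j = r' a.castSucc - r' (Fin.last _) := by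
    rw [e, ← hsum]; ring
  have e2 : 2 * r a.castSucc - ∑ j, D j = r a.castSucc - r (Fin.last _) := by rw [e]; ring
  rwa [e1, e2]

end schur

/-! ### Averaging margins over blocks -/

section schur
variable {ζ : Measure ℝ} [SigmaFinite ζ] {Γ : AddSubgroup ℝ} {p : ℝ → ℝ≥0∞}

/-- When neither row is the last one, row `b` is exchanged with the last row, the step is made
there, and the exchange is undone. Both exchanges are themselves instances of `fibInt_le_of_last`,
as they preserve the distance between the two row sums. -/
theorem IsLattice.fibInt_le_of_pair (h : IsLattice ζ Γ) (hpm : Measurable p) (hp : IntervalWt p)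
    {m n : ℕ} {r r' : Fin (m + 2) → ℝ} {c : Fin (n + 1) → ℝ} (hr : ∀ i, r i ∈ Γ)
    (hr' : ∀ i, r' i ∈ Γ) (hc : ∀ j, c j ∈ Γ) (hrc : ∑ i, r i = ∑ j, c j) {a b : Fin (m + 2)}
    (hab : a ≠ b) (hoff : ∀ i, i ≠ a → i ≠ b → r' i = r i) (hsum : r' a + r' b = r a + r b)
    (hle : |r' a - r' b| ≤ |r a - r b|) :
    fibInt ζ (prodWt fun _ _ => p) r c ≤ fibInt ζ (prodWt fun _ _ => p) r' c := by
  have hswap : ∀ (q : Fin (m + 2) → ℝ) (b : Fin (m + 1)), ∑ i, q i = ∑ j, c j →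
      ∑ i, q (Equiv.swap b.castSucc (Fin.last _) i) = ∑ j, c j := fun q b hq =>
    (Equiv.sum_comp (Equiv.swap b.castSucc (Fin.last _)) q).trans hq
  have hrc' : ∑ i, r' i = ∑ j, c j := by
    rw [← hrc, ← Finset.add_sum_erase _ _ (Finset.mem_univ a),
      ← Finset.add_sum_erase _ _ (Finset.mem_erase.2 ⟨hab.symm, Finset.mem_univ b⟩),
      ← Finset.add_sum_erase _ r (Finset.mem_univ a),
      ← Finset.add_sum_erase _ r (Finset.mem_erase.2 ⟨hab.symm, Finset.mem_univ b⟩),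
      ← add_assoc, ← add_assoc, hsum]
    congr 1
    refine Finset.sum_congr rfl fun i hi => ?_
    simp only [Finset.mem_erase, Finset.mem_univ, and_true] at hi
    exact hoff i hi.2 hi.1
  induction a using Fin.lastCases with
  | last =>
    induction b using Fin.lastCases with
    | last => exact absurd rfl hab
    | cast b =>
      refine h.fibInt_le_of_last hpm hp hr hr' hc hrc b (fun i h1 h2 => hoff i h2 h1) ?_ ?_
      · rw [add_comm, hsum, add_comm]
      · rwa [abs_sub_comm, abs_sub_comm (r _)]
  | cast a =>
    induction b using Fin.lastCases with
    | last => exact h.fibInt_le_of_last hpm hp hr hr' hc hrc a hoff hsum hle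
    | cast b =>
      set τ := Equiv.swap b.castSucc (Fin.last (m + 1)) with hτ
      have hτb : τ b.castSucc = Fin.last _ := Equiv.swap_apply_left _ _
      have hτl : τ (Fin.last _) = b.castSucc := Equiv.swap_apply_right _ _
      have hτo : ∀ i, i ≠ b.castSucc → i ≠ Fin.last _ → τ i = i := fun i h1 h2 =>
        Equiv.swap_apply_of_ne_of_ne h1 h2
      have hτa : τ a.castSucc = a.castSucc := hτo _ hab (Fin.castSucc_ne_last a)
      refine (h.fibInt_le_of_last (r' := fun i => r (τ i)) hpm hp hr (fun i => hr _) hc hrc b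
        (fun i h1 h2 => by rw [hτo i h1 h2]) (by rw [hτb, hτl, add_comm])
        (by rw [hτb, hτl, abs_sub_comm])).trans ?_
      refine (h.fibInt_le_of_last (r' := fun i => r' (τ i)) hpm hp (fun i => hr _) (fun i => hr' _)
        hc (hswap r b hrc) a (fun i h1 h2 => ?_) (by rwa [hτa, hτl]) (by rwa [hτa, hτl])).trans ?_
      · by_cases hib : i = b.castSucc
        · rw [hib, hτb]
          exact hoff _ (Fin.castSucc_ne_last a).symm (Fin.castSucc_ne_last b).symm
        · rw [hτo i hib h2]
          exact hoff i h1 hib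
      · exact h.fibInt_le_of_last (r' := r') hpm hp (fun i => hr' _) hr' hc (hswap r' b hrc') b
          (fun i h1 h2 => by rw [hτo i h1 h2]) (by rw [hτb, hτl, add_comm])
          (by rw [hτb, hτl, abs_sub_comm])

/-- Replacing the row sums within blocks by their averages increases the volume of the fiber. -/
theorem IsLattice.fibInt_le_of_rows (h : IsLattice ζ Γ) (hpm : Measurable p) (hp : IntervalWt p)
    {m n : ℕ} {ι : Type*} [DecidableEq ι] (d : Fin (m + 2) → ι) (ρ : ι → ℝ)
    (hρ : ∀ i, ρ (d i) ∈ Γ) {r : Fin (m + 2) → ℝ}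
    {c : Fin (n + 1) → ℝ} (hr : ∀ i, r i ∈ Γ) (hc : ∀ j, c j ∈ Γ) (hrc : ∑ i, r i = ∑ j, c j)
    (hd : ∀ a, ∑ i with d i = a, (r i - ρ a) = 0) :
    fibInt ζ (prodWt fun _ _ => p) r c ≤ fibInt ζ (prodWt fun _ _ => p) (fun i => ρ (d i)) c := by
  induction hN : (Finset.univ.filter fun i => r i ≠ ρ (d i)).card using Nat.strong_induction_on
    generalizing r with
  | _ N ih =>
    by_cases hall : ∀ i, r i = ρ (d i)
    · rw [show r = fun i => ρ (d i) from funext hall]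
    push Not at hall
    obtain ⟨i₀, hi₀⟩ := hall
    have hne : ∃ i ∈ Finset.univ.filter fun i => d i = d i₀, r i - ρ (d i₀) ≠ 0 :=
      ⟨i₀, by simp, sub_ne_zero.2 hi₀⟩
    obtain ⟨j, hj, hj0⟩ := Finset.exists_pos_of_sum_zero_of_exists_nonzero _ (hd _) hne
    have hne' : ∃ i ∈ Finset.univ.filter fun i => d i = d i₀, -(r i - ρ (d i₀)) ≠ 0 :=
      ⟨i₀, by simp, neg_ne_zero.2 (sub_ne_zero.2 hi₀)⟩
    obtain ⟨i, hi, hi0⟩ := Finset.exists_pos_of_sum_zero_of_exists_nonzero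
      (fun i => -(r i - ρ (d i₀))) (by rw [Finset.sum_neg_distrib, hd, neg_zero]) hne'
    simp only [Finset.mem_filter, Finset.mem_univ, true_and] at hi hj
    set a := d i₀ with ha
    have haΓ : ρ a ∈ Γ := hρ i₀
    have hij : i ≠ j := fun h0 => by rw [h0] at hi0; linarith
    -- A Robin Hood transfer from a row above the average of its block to one below it. The amount
    -- is the largest that overshoots neither, so at least one of the two rows reaches its average,
    -- the number of exceptional rows drops, and the row sums stay in `Γ`.
    set t := min (ρ a - r i) (r j - ρ a) with ht
    have ht0 : 0 ≤ t := le_min (by linarith) hj0.le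
    have ht1 : t ≤ ρ a - r i := min_le_left _ _
    have ht2 : t ≤ r j - ρ a := min_le_right _ _
    have htΓ : t ∈ Γ := by
      rcases min_choice (ρ a - r i) (r j - ρ a) with h1 | h1
      · rw [ht, h1]; exact Γ.sub_mem haΓ (hr i)
      · rw [ht, h1]; exact Γ.sub_mem (hr j) haΓ
    set r' : Fin (m + 2) → ℝ := fun e => r e + (if e = i then t else 0) - if e = j then t else 0
      with hr'def
    have hri : r' i = r i + t := by simp [hr'def, hij]
    have hrj : r' j = r j - t := by simp [hr'def, hij.symm]
    have hro : ∀ e, e ≠ i → e ≠ j → r' e = r e := fun e h1 h2 => by simp [hr'def, h1, h2]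
    have hr' : ∀ e, r' e ∈ Γ := fun e => by
      refine Γ.sub_mem (Γ.add_mem (hr e) ?_) ?_ <;> split_ifs <;> first | exact htΓ | exact Γ.zero_mem
    refine (h.fibInt_le_of_pair hpm hp hr hr' hc hrc hij hro (by rw [hri, hrj]; ring) ?_).trans
      (ih _ ?_ hr' ?_ ?_ rfl)
    · rw [hri, hrj, abs_le]
      have h1 : |r i - r j| = r j - r i := by rw [abs_of_neg (by linarith)]; ring
      rw [h1]
      constructor <;> linarith
    · rw [← hN]
      have hsub : (Finset.univ.filter fun e => r' e ≠ ρ (d e)) ⊆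
          Finset.univ.filter fun e => r e ≠ ρ (d e) := by
        intro e he
        simp only [Finset.mem_filter, Finset.mem_univ, true_and] at he ⊢
        by_cases h1 : e = i
        · rw [h1, hi]; linarith
        by_cases h2 : e = j
        · rw [h2, hj]; linarith
        rwa [hro e h1 h2] at he
      refine Finset.card_lt_card ⟨hsub, fun hsup => ?_⟩
      have h1 : r i ≠ ρ (d i) := by rw [hi]; linarith
      have h2 : r j ≠ ρ (d j) := by rw [hj]; linarith
      have h3 := (Finset.mem_filter.1 (hsup (Finset.mem_filter.2 ⟨Finset.mem_univ i, h1⟩))).2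
      have h4 := (Finset.mem_filter.1 (hsup (Finset.mem_filter.2 ⟨Finset.mem_univ j, h2⟩))).2
      rw [hri, hi] at h3
      rw [hrj, hj] at h4
      rcases min_choice (ρ a - r i) (r j - ρ a) with h5 | h5
      · exact h3 (by rw [ht, h5]; ring)
      · exact h4 (by rw [ht, h5]; ring)
    · rw [← hrc]
      simp [hr'def, Finset.sum_sub_distrib, Finset.sum_add_distrib]
    · intro b
      rw [← hd b, ← sub_eq_zero, ← Finset.sum_sub_distrib]
      have h1 : ∀ e, r' e - ρ b - (r e - ρ b) = (if e = i then t else 0) - if e = j then t else 0 :=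
        fun e => by simp only [hr'def]; ring
      simp only [h1, Finset.sum_sub_distrib, Finset.sum_ite_eq', Finset.mem_filter, Finset.mem_univ,
        true_and, hi, hj, sub_self]

theorem IsLattice.fibInt_le_of_blocks (h : IsLattice ζ Γ) (hpm : Measurable p) (hp : IntervalWt p)
    {m n : ℕ} {ι κ : Type*} [DecidableEq ι] [DecidableEq κ] (d : Fin (m + 2) → ι)
    (d' : Fin (n + 2) → κ) (ρ : ι → ℝ) (γ : κ → ℝ) (hρ : ∀ i, ρ (d i) ∈ Γ) (hγ : ∀ j, γ (d' j) ∈ Γ)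
    {r : Fin (m + 2) → ℝ} {c : Fin (n + 2) → ℝ} (hr : ∀ i, r i ∈ Γ) (hc : ∀ j, c j ∈ Γ)
    (hrc : ∑ i, r i = ∑ j, c j) (hrc' : ∑ i, ρ (d i) = ∑ j, c j)
    (hd : ∀ a, ∑ i with d i = a, (r i - ρ a) = 0)
    (hd' : ∀ b, ∑ j with d' j = b, (c j - γ b) = 0) (hrc'' : ∑ i, ρ (d i) = ∑ j, γ (d' j)) :
    fibInt ζ (prodWt fun _ _ => p) r c ≤
      fibInt ζ (prodWt fun _ _ => p) (fun i => ρ (d i)) fun j => γ (d' j) := by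
  have hm : ∀ m n : ℕ, Measurable (prodWt fun (_ : Fin m) (_ : Fin n) => p) := fun m n =>
    measurable_prodWt fun _ _ => hpm
  have htr : ∀ {m n : ℕ} {r : Fin (m + 1) → ℝ} {c : Fin (n + 1) → ℝ}, ∑ i, r i = ∑ j, c j →
      fibInt ζ (prodWt fun _ _ => p) c r = fibInt ζ (prodWt fun _ _ => p) r c := by
    intro m n r c hrc
    rw [← fibInt_transpose (hm _ _) hrc]
    congr 1
    ext x
    exact Finset.prod_comm
  refine (h.fibInt_le_of_rows hpm hp d ρ hρ hr hc hrc hd).trans ?_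
  rw [← htr hrc', ← htr hrc'']
  exact h.fibInt_le_of_rows hpm hp d' γ hγ hc hρ hrc'.symm hd'

/-- Upper bound for the probability of an event in terms of densities of margins. -/
theorem IsLattice.withDensity_le_of_fibInt_le (h : IsLattice ζ Γ) {m n : ℕ}
    {f : Fin (m + 1) → Fin (n + 1) → ℝ → ℝ≥0∞} (hf : ∀ i j, Measurable (f i j))
    {A : Set (Fin (m + 1) → Fin (n + 1) → ℝ)} (hA : MeasurableSet A) {I : Set ℝ} {K : ℝ≥0∞}
    (hrow : ∀ x ∈ A, prodWt f x ≠ 0 → ∀ i, ∑ j, x i j ∈ I)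
    (hcol : ∀ x ∈ A, prodWt f x ≠ 0 → ∀ j, ∑ i, x i j ∈ I) (hI : MeasurableSet I)
    (hK : ∀ x ∈ A, prodWt f x ≠ 0 → (∀ i j, x i j ∈ Γ) →
      fibInt ζ (prodWt f) (fun i => ∑ j, x i j) (fun j => ∑ i, x i j) ≤ K) :
    (baseModel ζ (m + 1) (n + 1)).withDensity (prodWt f) A ≤ K * ζ I ^ (m + (n + 1)) := by
  have hfm := measurable_prodWt hf
  rw [withDensity_apply _ hA, ← lintegral_indicator hA, h.lintegral_baseModel (hfm.indicator hA)]
  have hΓ : ∀ᵐ t ∂marginParam ζ m (n + 1), (∀ j, t.1 j ∈ Γ) ∧ ∀ i, t.2 i ∈ Γ := by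
    exact (Measure.quasiMeasurePreserving_fst.ae (ae_pi_mem h.ae_mem (n + 1))).and
      (Measure.quasiMeasurePreserving_snd.ae (ae_pi_mem h.ae_mem m))
  -- In the chart, a margin is given by `n + 1` column sums and `m` row sums; for points of `A` of
  -- positive weight all of them lie in `I`, and there the density of the margin is at most `K`.
  set S : Set ((Fin (n + 1) → ℝ) × (Fin m → ℝ)) :=
    (Set.univ.pi fun _ => I) ×ˢ Set.univ.pi fun _ => I with hS
  have hSm : MeasurableSet S := (MeasurableSet.univ_pi fun _ => hI).prod
    (MeasurableSet.univ_pi fun _ => hI)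
  calc ∫⁻ t, fibInt ζ (A.indicator (prodWt f)) (rowExt t.2 t.1) t.1 ∂marginParam ζ m (n + 1)
      ≤ ∫⁻ t, S.indicator (fun _ => K) t ∂marginParam ζ m (n + 1) := by
        refine lintegral_mono_ae ?_
        filter_upwards [hΓ] with t ht
        have hrc := sum_rowExt t.2 t.1
        have hrΓ : ∀ i, rowExt t.2 t.1 i ∈ Γ := by
          intro i
          refine Fin.lastCases ?_ (fun i => ?_) i
          · simp only [rowExt, Fin.snoc_last]
            exact Γ.sub_mem (Γ.sum_mem fun j _ => ht.1 j) (Γ.sum_mem fun i _ => ht.2 i)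
          · simp only [rowExt, Fin.snoc_castSucc]
            exact ht.2 i
        by_cases hex : ∃ y : Fin m → Fin n → ℝ, (∀ i j, y i j ∈ Γ) ∧
            completion (rowExt t.2 t.1) t.1 y ∈ A ∧
            prodWt f (completion (rowExt t.2 t.1) t.1 y) ≠ 0
        · obtain ⟨y, hyΓ, hyA, hy0⟩ := hex
          have hr := sum_completion_row (rowExt t.2 t.1) t.1 y hrc
          have hc := sum_completion_col (rowExt t.2 t.1) t.1 y
          have htS : t ∈ S := by
            refine ⟨fun j _ => hc j ▸ hcol _ hyA hy0 j, fun i _ => ?_⟩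
            have h2 := hrow _ hyA hy0 i.castSucc
            rw [hr] at h2
            simpa only [rowExt, Fin.snoc_castSucc] using h2
          rw [Set.indicator_of_mem htS]
          refine le_trans ?_ (hK _ hyA hy0 fun i j => completion_mem hrΓ ht.1 hyΓ i j)
          simp only [hr, hc]
          exact lintegral_mono fun y => Set.indicator_le_self _ _ _
        · refine le_trans (le_of_eq ?_) zero_le
          refine lintegral_eq_zero_of_ae_eq_zero ?_
          filter_upwards [ae_baseModel_mem h.ae_mem m n] with y hy
          by_contra h0
          have h1 : completion (rowExt t.2 t.1) t.1 y ∈ A := by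
            by_contra h2
            exact h0 (Set.indicator_of_notMem h2 _)
          refine hex ⟨y, hy, h1, fun h2 => h0 ?_⟩
          rw [Set.indicator_of_mem h1, h2]
          rfl
    _ = K * ζ I ^ (m + (n + 1)) := by
        rw [lintegral_indicator_const hSm, hS, marginParam, Measure.prod_prod, Measure.pi_pi,
          Measure.pi_pi]
        simp only [Finset.prod_const, Finset.card_univ, Fintype.card_fin]
        rw [← pow_add, add_comm m]

end schur

/-! ### Lower bounds for densities of cloned margins through block sums -/

/-- Chernoff's bound with `s = ±1 / k` for sums of at most `k ^ 2` terms: each of the `2 n`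
one-sided deviations has probability at most `exp (-4 n)`, where `n` is the number of blocks, and `2
n exp (-4 n) ≤ 1/2`. -/
theorem half_le_blocks {ι κ : Type*} [Fintype ι] [Fintype κ] [DecidableEq κ] {ν : ι → Measure ℝ}
    [∀ e, IsProbabilityMeasure (ν e)] (D : ι → κ) {z : κ → ℝ} {C s₀ k : ℝ}
    (hν : ∀ e, SubGaussNear (ν e) (z (D e)) C s₀) (hC : 0 ≤ C) (hk : 0 < k) (hks : 1 / k ≤ s₀)
    (hcard : ∀ b, ((Finset.univ.filter fun e => D e = b).card : ℝ) ≤ k ^ 2) :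
    1 / 2 ≤ Measure.pi ν {x | ∀ b, |∑ e with D e = b, (x e - z b)| ≤
      (C + 4 * Fintype.card κ) * k} := by
  set n : ℝ := (Fintype.card κ : ℝ) with hn
  set B : ℝ := C + 4 * n with hB
  have hn0 : 0 ≤ n := Nat.cast_nonneg _
  have hone : ∀ (b : κ) (s : ℝ), |s| = 1 / k →
      Measure.pi ν {x | B ≤ s * ∑ e with D e = b, (x e - z b)} ≤
        ENNReal.ofReal (Real.exp (-(4 * n))) := by
    intro b s hs
    refine (pi_chernoff ν (Finset.univ.filter fun e => D e = b) (fun _ x => x - z b)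
      (fun e => by fun_prop) s C B fun e he => ?_).trans ?_
    · have := hν e s (hs.trans_le hks)
      rwa [(Finset.mem_filter.1 he).2] at this
    · refine ENNReal.ofReal_le_ofReal (Real.exp_le_exp.2 ?_)
      have h1 : s ^ 2 = 1 / k ^ 2 := by rw [← sq_abs, hs, div_pow, one_pow]
      have h2 : C * s ^ 2 * (Finset.univ.filter fun e => D e = b).card ≤ C * s ^ 2 * k ^ 2 := by
        gcongr
        exact hcard b
      have h3 : C * s ^ 2 * k ^ 2 = C := by rw [h1]; field_simp
      linarith
  have hcompl : Measure.pi ν {x | ∀ b, |∑ e with D e = b, (x e - z b)| ≤ B * k}ᶜ ≤ 1 / 2 := by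
    have hsub : {x : ι → ℝ | ∀ b, |∑ e with D e = b, (x e - z b)| ≤ B * k}ᶜ ⊆
        ⋃ b, ({x | B ≤ 1 / k * ∑ e with D e = b, (x e - z b)} ∪
          {x | B ≤ -(1 / k) * ∑ e with D e = b, (x e - z b)}) := by
      intro x hx
      simp only [Set.mem_compl_iff, Set.mem_ofPred_eq, not_forall, not_le] at hx
      obtain ⟨b, hb⟩ := hx
      refine Set.mem_iUnion.2 ⟨b, ?_⟩
      rcases lt_abs.1 hb with h1 | h1
      · left
        change B ≤ 1 / k * _
        rw [one_div, inv_mul_eq_div, le_div_iff₀ hk]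
        exact h1.le
      · right
        change B ≤ -(1 / k) * _
        rw [neg_mul, ← mul_neg, one_div, inv_mul_eq_div, le_div_iff₀ hk]
        exact h1.le
    refine (measure_mono hsub).trans ((measure_iUnion_fintype_le _ _).trans ?_)
    calc ∑ b : κ, Measure.pi ν ({x | B ≤ 1 / k * ∑ e with D e = b, (x e - z b)} ∪
          {x | B ≤ -(1 / k) * ∑ e with D e = b, (x e - z b)})
        ≤ ∑ _b : κ, (ENNReal.ofReal (Real.exp (-(4 * n))) + ENNReal.ofReal (Real.exp (-(4 * n)))) := by
          refine Finset.sum_le_sum fun b _ => (measure_union_le _ _).trans (add_le_add ?_ ?_)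
          · exact hone b _ (abs_of_pos (by positivity))
          · exact hone b _ (by rw [abs_neg, abs_of_pos (by positivity)])
      _ = ENNReal.ofReal (n * (2 * Real.exp (-(4 * n)))) := by
          rw [Finset.sum_const, Finset.card_univ, nsmul_eq_mul, ← ENNReal.ofReal_add
            (Real.exp_pos _).le (Real.exp_pos _).le, ← two_mul, ENNReal.ofReal_mul hn0, hn,
            ENNReal.ofReal_natCast]
      _ ≤ ENNReal.ofReal (1 / 2) := by
          refine ENNReal.ofReal_le_ofReal ?_
          have h1 : 1 + 4 * n ≤ Real.exp (4 * n) := by linarith [Real.add_one_le_exp (4 * n)]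
          have h2 : Real.exp (-(4 * n)) ≤ 1 / (1 + 4 * n) := by
            rw [Real.exp_neg, ← one_div]
            exact one_div_le_one_div_of_le (by positivity) h1
          calc n * (2 * Real.exp (-(4 * n))) ≤ n * (2 * (1 / (1 + 4 * n))) := by gcongr
            _ ≤ 1 / 2 := by
                rw [mul_one_div, mul_div_assoc', div_le_div_iff₀ (by positivity) two_pos]
                linarith
      _ = 1 / 2 := by
          rw [ENNReal.ofReal_div_of_pos two_pos]
          simp
  set S := {x : ι → ℝ | ∀ b, |∑ e with D e = b, (x e - z b)| ≤ B * k}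
  have h1 : (1 : ℝ≥0∞) ≤ Measure.pi ν S + 1 / 2 := by
    calc (1 : ℝ≥0∞) = Measure.pi ν Set.univ := measure_univ.symm
      _ = Measure.pi ν (S ∪ Sᶜ) := by rw [Set.union_compl_self]
      _ ≤ _ := (measure_union_le _ _).trans (add_le_add le_rfl hcompl)
  have h2 : (1 : ℝ≥0∞) - 1 / 2 ≤ Measure.pi ν S := tsub_le_iff_right.2 h1
  refine le_trans (le_of_eq ?_) h2
  rw [one_div, ENNReal.one_sub_inv_two]

section blocks
variable {ζ : Measure ℝ} {Γ : AddSubgroup ℝ} {p : ℝ → ℝ≥0∞}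

/-- The explicit constant is needed here because it has to be compared between different margins. -/
theorem fibInt_tiltDens (μ : Measure ℝ) (hp : Measurable p) {m n : ℕ}
    (α : Fin (m + 1) → ℝ) (β : Fin (n + 1) → ℝ) {r : Fin (m + 1) → ℝ} {c : Fin (n + 1) → ℝ}
    (hrc : ∑ i, r i = ∑ j, c j) :
    fibInt ζ (prodWt fun i j => tiltDens μ p (α i + β j)) r c =
      ENNReal.ofReal (Real.exp (∑ i, r i * α i + ∑ j, c j * β j -
        ∑ i, ∑ j, logPartition μ (α i + β j))) * fibInt ζ (prodWt fun _ _ => p) r c := by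
  rw [← fibInt_const_mul _ (measurable_prodWt fun _ _ => hp)]
  unfold fibInt
  exact lintegral_congr fun y => prodWt_tiltDens μ p α β (completion_mem_marginFiber hrc y)

theorem sum_comp_eq {N m₀ : ℕ} (d : Fin N → Fin m₀) (r : Fin N → ℝ) (α : Fin m₀ → ℝ) :
    ∑ i, r i * α (d i) = ∑ a, (∑ i with d i = a, r i) * α a := by
  rw [← Finset.sum_fiberwise (s := Finset.univ) (g := d)]
  refine Finset.sum_congr rfl fun a _ => ?_
  rw [Finset.sum_mul]
  exact Finset.sum_congr rfl fun i hi => by rw [(Finset.mem_filter.1 hi).2]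

variable [SigmaFinite ζ]

/-- The likelihood factor depends on a margin only through its block sums, and by Schur monotonicity
the volume of the fiber is largest at the block-averaged margin. So the density of every margin
occurring in `A` is bounded by that of its block average. The remaining factor is the volume of the
range of margins, all of which lie in `[0, D]`. -/
theorem IsLattice.withDensity_le_of_blocks (h : IsLattice ζ Γ) {μ : Measure ℝ} (hpm : Measurable p)
    (hp : IntervalWt p) (hp0 : ∀ x, p x ≠ 0 → 0 ≤ x) {m n m₀ n₀ k : ℕ} (hk : 0 < k)
    {d : Fin (m + 2) → Fin m₀} {d' : Fin (n + 2) → Fin n₀}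
    (hd : ∀ a, (Finset.univ.filter fun i => d i = a).card = k)
    (hd' : ∀ b, (Finset.univ.filter fun j => d' j = b).card = k) (α : Fin m₀ → ℝ) (β : Fin n₀ → ℝ)
    {A : Set (Fin (m + 2) → Fin (n + 2) → ℝ)} (hA : MeasurableSet A) {D : ℝ}
    (hD : ∀ x ∈ A, ∑ i, ∑ j, x i j ≤ D) {K : ℝ≥0∞}
    (hK : ∀ x ∈ A, (∀ i j, 0 ≤ x i j) →
      (∀ a, (∑ i with d i = a, ∑ j, x i j) / k ∈ Γ) ∧
      (∀ b, (∑ j with d' j = b, ∑ i, x i j) / k ∈ Γ) ∧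
      ENNReal.ofReal (Real.exp (∑ a, (∑ i with d i = a, ∑ j, x i j) * α a +
        ∑ b, (∑ j with d' j = b, ∑ i, x i j) * β b -
        ∑ i, ∑ j, logPartition μ (α (d i) + β (d' j)))) *
      fibInt ζ (prodWt fun _ _ => p) (fun i => (∑ i' with d i' = d i, ∑ j, x i' j) / k)
        (fun j => (∑ j' with d' j' = d' j, ∑ i, x i j') / k) ≤ K) :
    (baseModel ζ (m + 2) (n + 2)).withDensity
      (prodWt fun i j => tiltDens μ p (α (d i) + β (d' j))) A ≤
      K * ζ (Set.Icc 0 D) ^ (m + 1 + (n + 2)) := by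
  have hpos : ∀ x : Fin (m + 2) → Fin (n + 2) → ℝ,
      prodWt (fun i j => tiltDens μ p (α (d i) + β (d' j))) x ≠ 0 → ∀ i j, 0 ≤ x i j := by
    intro x hx i j
    unfold prodWt at hx
    have h1 := Finset.prod_ne_zero_iff.1 (Finset.prod_ne_zero_iff.1 hx i (Finset.mem_univ _)) j
      (Finset.mem_univ _)
    exact hp0 _ (right_ne_zero_of_mul h1)
  have hk' : (k : ℝ) ≠ 0 := by exact_mod_cast hk.ne'
  refine h.withDensity_le_of_fibInt_le (m := m + 1) (n := n + 1) (fun i j => measurable_tiltDens hpm)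
    hA (fun x hx h0 i => ⟨?_, ?_⟩) (fun x hx h0 j => ⟨?_, ?_⟩) measurableSet_Icc
    fun x hx h0 hxΓ => ?_
  · exact Finset.sum_nonneg fun j _ => hpos x h0 i j
  · refine le_trans ?_ (hD x hx)
    exact Finset.single_le_sum (f := fun i => ∑ j, x i j)
      (fun i _ => Finset.sum_nonneg fun j _ => hpos x h0 i j) (Finset.mem_univ i)
  · exact Finset.sum_nonneg fun i _ => hpos x h0 i j
  · refine le_trans ?_ (hD x hx)
    rw [Finset.sum_comm]
    exact Finset.single_le_sum (f := fun j => ∑ i, x i j)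
      (fun j _ => Finset.sum_nonneg fun i _ => hpos x h0 i j) (Finset.mem_univ j)
  · obtain ⟨hρ, hγ, hle⟩ := hK x hx (hpos x h0)
    have hrc : ∑ i, ∑ j, x i j = ∑ j, ∑ i, x i j := Finset.sum_comm
    have e1 : ∑ i, (∑ i' with d i' = d i, ∑ j, x i' j) / k = ∑ i, ∑ j, x i j := by
      rw [sum_comp_cloning hd fun a => (∑ i' with d i' = a, ∑ j, x i' j) / k, ← Finset.sum_div,
        mul_div_cancel₀ _ hk', Finset.sum_fiberwise]
    have e2 : ∑ j, (∑ j' with d' j' = d' j, ∑ i, x i j') / k = ∑ j, ∑ i, x i j := by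
      rw [sum_comp_cloning hd' fun b => (∑ j' with d' j' = b, ∑ i, x i j') / k, ← Finset.sum_div,
        mul_div_cancel₀ _ hk', Finset.sum_fiberwise]
    refine le_trans ?_ hle
    rw [fibInt_tiltDens (m := m + 1) (n := n + 1) μ hpm (fun i => α (d i)) (fun j => β (d' j)) hrc,
      sum_comp_eq d (fun i => ∑ j, x i j) α, sum_comp_eq d' (fun j => ∑ i, x i j) β]
    refine mul_le_mul_right ?_ _
    refine h.fibInt_le_of_blocks hpm hp d d' (fun a => (∑ i' with d i' = a, ∑ j, x i' j) / k)
      (fun b => (∑ j' with d' j' = b, ∑ i, x i j') / k) (fun i => hρ _) (fun j => hγ _)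
      (fun i => Γ.sum_mem fun j _ => hxΓ i j) (fun j => Γ.sum_mem fun i _ => hxΓ i j) hrc
      (e1.trans hrc) (fun a => ?_) (fun b => ?_) (e1.trans (hrc.trans e2.symm))
    · rw [Finset.sum_sub_distrib, Finset.sum_const, hd, nsmul_eq_mul, mul_div_cancel₀ _ hk', sub_self]
    · rw [Finset.sum_sub_distrib, Finset.sum_const, hd', nsmul_eq_mul, mul_div_cancel₀ _ hk', sub_self]

end blocks

/-! ### Volumes of transportation polytopes -/

section volume
variable {m n : ℕ}

theorem completion_smul (s : ℝ) {r : Fin (m + 1) → ℝ} {c : Fin (n + 1) → ℝ}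
    (hrc : ∑ i, r i = ∑ j, c j) (y : Fin m → Fin n → ℝ) :
    completion (s • r) (s • c) (s • y) = s • completion r c y := by
  refine Eq.trans (congrArg (completion (s • r) (s • c)) ?_)
    (completion_restrict _ _ (s • completion r c y) (fun i => ?_) fun j => ?_)
  · ext i j
    simp only [Pi.smul_apply]
    congr 1
    exact (completion_castSucc_castSucc r c y i j).symm
  · simp only [Pi.smul_apply, ← Finset.smul_sum]
    exact congrArg (s • ·) (sum_completion_row r c y hrc i)
  · simp only [Pi.smul_apply, ← Finset.smul_sum]
    exact congrArg (s • ·) (sum_completion_col r c y j)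

/-- Scaling of fiber integrals over the reals. -/
theorem fibInt_smul (F : (Fin (m + 1) → Fin (n + 1) → ℝ) → ℝ≥0∞) {r : Fin (m + 1) → ℝ}
    {c : Fin (n + 1) → ℝ} (hrc : ∑ i, r i = ∑ j, c j) {s : ℝ} (hs : 0 < s) :
    fibInt volume F (s • r) (s • c) =
      ENNReal.ofReal (s ^ (m * n)) * fibInt volume (fun x => F (s • x)) r c := by
  unfold fibInt
  have h1 : Module.finrank ℝ (Fin m → Fin n → ℝ) = m * n := by
    rw [Module.finrank_pi_fintype]
    simp
  have h2 := Measure.map_addHaar_smul (volume : Measure (Fin m → Fin n → ℝ)) hs.ne'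
  rw [h1] at h2
  have h3 : ∫⁻ y, F (completion (s • r) (s • c) y)
      ∂Measure.map (s • ·) (volume : Measure (Fin m → Fin n → ℝ)) =
      ∫⁻ y : Fin m → Fin n → ℝ, F (s • completion r c y) := by
    rw [(measurableEmbedding_const_smul₀ hs.ne').lintegral_map]
    exact lintegral_congr fun y => congrArg F (completion_smul s hrc y)
  rw [h2, lintegral_smul_measure, abs_of_pos (by positivity)] at h3
  change ∫⁻ y : Fin m → Fin n → ℝ, F (completion (s • r) (s • c) y) = _ *
    ∫⁻ y : Fin m → Fin n → ℝ, F (s • completion r c y)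
  rw [← h3, smul_eq_mul, ← mul_assoc, ← ENNReal.ofReal_mul (by positivity),
    mul_inv_cancel₀ (by positivity), ENNReal.ofReal_one, one_mul]

/-- Adding the nonnegative matrix `w` maps one fiber into the other without changing Lebesgue
measure and without decreasing any weight. -/
theorem fibInt_le_add {p : ℝ → ℝ≥0∞} (hp : ∀ x t, 0 ≤ t → p x ≤ p (x + t))
    {r : Fin (m + 1) → ℝ} {c : Fin (n + 1) → ℝ} (hrc : ∑ i, r i = ∑ j, c j)
    {w : Fin (m + 1) → Fin (n + 1) → ℝ} (hw : ∀ i j, 0 ≤ w i j) :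
    fibInt volume (prodWt fun _ _ => p) r c ≤ fibInt volume (prodWt fun _ _ => p)
      (fun i => r i + ∑ j, w i j) (fun j => c j + ∑ i, w i j) := by
  unfold fibInt
  have h := lintegral_add_right_eq_self (μ := (volume : Measure (Fin m → Fin n → ℝ)))
    (fun y => prodWt (fun _ _ => p) (completion (fun i => r i + ∑ j, w i j)
      (fun j => c j + ∑ i, w i j) y)) (fun i j => w i.castSucc j.castSucc)
  refine le_trans ?_ h.le
  refine lintegral_mono fun y => ?_
  have h1 := completion_restrict (r := fun i => r i + ∑ j, w i j) (c := fun j => c j + ∑ i, w i j)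
    (completion r c y + w)
    (fun i => by
      simp only [Pi.add_apply, Finset.sum_add_distrib]
      exact congrArg (· + _) (sum_completion_row r c y hrc i))
    (fun j => by
      simp only [Pi.add_apply, Finset.sum_add_distrib]
      exact congrArg (· + _) (sum_completion_col r c y j))
  have h2 : completion (fun i => r i + ∑ j, w i j) (fun j => c j + ∑ i, w i j)
      (y + fun i j => w i.castSucc j.castSucc) = completion r c y + w := by
    refine Eq.trans (congrArg (completion _ _) ?_) h1
    ext i j
    simp only [Pi.add_apply]
    congr 1
    exact (completion_castSucc_castSucc r c y i j).symm
  refine le_trans ?_ (congrArg (prodWt fun _ _ => p) h2).ge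
  exact Finset.prod_le_prod' fun i _ => Finset.prod_le_prod' fun j _ => hp _ _ (hw i j)

end volume

/-! ### Lower bounds of order `exp (-O(k log k))`: Lebesgue measure -/

section fast

/-- An event of probability `exp (-O(k))` whose margins lie in a box with `O(k)` sides of polynomial
length yields a density at least `exp (-O(k log k))`. -/
theorem le_of_le_mul_pow {H D V : ℝ} (hH : 0 ≤ H) (hD : 1 ≤ D) {k E : ℕ} (hk : 1 ≤ k)
    (hlog : 1 ≤ Real.log k) (hE : (E : ℝ) ≤ V * k) {Φ : ℝ≥0∞}
    (h : ENNReal.ofReal (Real.exp (-(H * k))) ≤ Φ * ENNReal.ofReal (D * k ^ 2) ^ E) :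
    ENNReal.ofReal (Real.exp (-((H + V * (2 + Real.log D)) * (k * Real.log k)))) ≤ Φ := by
  have hk0 : (0 : ℝ) < k := by exact_mod_cast hk
  have hD0 : 0 < D := by linarith
  have hlogD : 0 ≤ Real.log D := Real.log_nonneg hD
  have hDk : 0 < D * (k : ℝ) ^ 2 := by positivity
  have h1 := ENNReal.div_le_of_le_mul h
  refine le_trans ?_ h1
  rw [← ENNReal.ofReal_pow hDk.le, ← ENNReal.ofReal_div_of_pos (by positivity)]
  refine ENNReal.ofReal_le_ofReal ?_
  rw [le_div_iff₀ (by positivity)]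
  have h2 : (D * (k : ℝ) ^ 2) ^ E = Real.exp (E * (Real.log D + 2 * Real.log k)) := by
    rw [Real.exp_nat_mul, Real.exp_add, Real.exp_log hD0, show 2 * Real.log k =
      Real.log ((k : ℝ) ^ 2) by rw [Real.log_pow]; norm_num, Real.exp_log (by positivity)]
  rw [h2, ← Real.exp_add, Real.exp_le_exp]
  have h3 : E * (Real.log D + 2 * Real.log k) ≤ V * k * ((2 + Real.log D) * Real.log k) := by
    have : Real.log D + 2 * Real.log k ≤ (2 + Real.log D) * Real.log k := by nlinarith
    have h0 : 0 ≤ Real.log D + 2 * Real.log k := by positivity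
    have hVk : 0 ≤ V * k := (Nat.cast_nonneg E).trans hE
    gcongr
  have h4 : H * k ≤ H * (k * Real.log k) := by
    have : (k : ℝ) ≤ k * Real.log k := by nlinarith
    gcongr
  linarith

theorem exp_neg_le_half {k : ℝ} (hk : 1 ≤ k) : Real.exp (-k) ≤ 1 / 2 := by
  rw [Real.exp_neg, ← one_div]
  exact one_div_le_one_div_of_le two_pos (by linarith [Real.add_one_le_exp k])

variable {N N' m₀ n₀ k : ℕ} {d : Fin N → Fin m₀} {d' : Fin N' → Fin n₀}

theorem card_block (hd : ∀ a, (Finset.univ.filter fun i => d i = a).card = k)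
    (hd' : ∀ b, (Finset.univ.filter fun j => d' j = b).card = k) (e : Fin m₀ × Fin n₀) :
    (Finset.univ.filter fun x : Fin N × Fin N' => (d x.1, d' x.2) = e).card = k * k := by
  have : (Finset.univ.filter fun x : Fin N × Fin N' => (d x.1, d' x.2) = e) =
      (Finset.univ.filter fun i => d i = e.1) ×ˢ Finset.univ.filter fun j => d' j = e.2 := by
    ext x
    simp [Prod.ext_iff]
  rw [this, Finset.card_product, hd, hd']

theorem sum_block_row (x : Fin N → Fin N' → ℝ) (a : Fin m₀) :
    ∑ i with d i = a, ∑ j, x i j =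
      ∑ b, ∑ e : Fin N × Fin N' with (d e.1, d' e.2) = (a, b), x e.1 e.2 := by
  have : ∀ b, (Finset.univ.filter fun e : Fin N × Fin N' => (d e.1, d' e.2) = (a, b)) =
      (Finset.univ.filter fun i => d i = a) ×ˢ Finset.univ.filter fun j => d' j = b := by
    intro b
    ext e
    simp
  simp only [this, Finset.sum_product]
  refine Eq.trans ?_ Finset.sum_comm
  exact Finset.sum_congr rfl fun i _ =>
    (Finset.sum_fiberwise Finset.univ d' fun j => x i j).symm

theorem sum_block_col (x : Fin N → Fin N' → ℝ) (b : Fin n₀) :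
    ∑ j with d' j = b, ∑ i, x i j =
      ∑ a, ∑ e : Fin N × Fin N' with (d e.1, d' e.2) = (a, b), x e.1 e.2 := by
  have : ∀ a, (Finset.univ.filter fun e : Fin N × Fin N' => (d e.1, d' e.2) = (a, b)) =
      (Finset.univ.filter fun i => d i = a) ×ˢ Finset.univ.filter fun j => d' j = b := by
    intro a
    ext e
    simp
  simp only [this, Finset.sum_product_right]
  refine Eq.trans ?_ Finset.sum_comm
  exact Finset.sum_congr rfl fun j _ =>
    (Finset.sum_fiberwise Finset.univ d fun i => x i j).symm

theorem sum_block_total (d : Fin N → Fin m₀) (d' : Fin N' → Fin n₀) (x : Fin N → Fin N' → ℝ) :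
    ∑ i, ∑ j, x i j = ∑ e' : Fin m₀ × Fin n₀,
      ∑ e : Fin N × Fin N' with (d e.1, d' e.2) = e', x e.1 e.2 := by
  rw [Finset.sum_fiberwise, Fintype.sum_prod_type]

theorem one_sub_ge_exp {ε : ℝ} (h0 : 0 ≤ ε) (h1 : ε ≤ 1 / 2) : Real.exp (-(2 * ε)) ≤ 1 - ε := by
  rw [Real.exp_neg, inv_le_comm₀ (Real.exp_pos _) (by linarith)]
  refine le_trans ?_ (Real.add_one_le_exp (2 * ε))
  rw [inv_le_iff_one_le_mul₀ (by linarith)]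
  nlinarith

/-- The volume of a fiber is not much smaller than that of a nearby fiber with block-constant
margin. -/
theorem pow_mul_fibInt_le {p : ℝ → ℝ≥0∞} (hpm : ∀ x t, 0 ≤ t → p x ≤ p (x + t))
    (hps : ∀ s x : ℝ, 0 < s → p (s * x) = p x) {m n : ℕ} {d : Fin (m + 1) → Fin m₀}
    {d' : Fin (n + 1) → Fin n₀} (hk : 0 < k)
    (hd : ∀ a, (Finset.univ.filter fun i => d i = a).card = k)
    (hd' : ∀ b, (Finset.univ.filter fun j => d' j = b).card = k) {z T : Fin m₀ → Fin n₀ → ℝ}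
    {s : ℝ} (hs : 0 < s) (hw : ∀ a b, s * (T a b / k ^ 2) ≤ z a b) :
    ENNReal.ofReal (s ^ (m * n)) *
      fibInt volume (prodWt fun _ _ => p) (fun i => (∑ b, T (d i) b) / k)
        (fun j => (∑ a, T a (d' j)) / k) ≤
      fibInt volume (prodWt fun _ _ => p) (fun i => k * ∑ b, z (d i) b)
        (fun j => k * ∑ a, z a (d' j)) := by
  have hk' : (k : ℝ) ≠ 0 := by exact_mod_cast hk.ne'
  set r : Fin (m + 1) → ℝ := fun i => (∑ b, T (d i) b) / k with hr
  set c : Fin (n + 1) → ℝ := fun j => (∑ a, T a (d' j)) / k with hc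
  have hrc : ∑ i, r i = ∑ j, c j := by
    rw [hr, hc, sum_comp_cloning hd fun a => (∑ b, T a b) / k,
      sum_comp_cloning hd' fun b => (∑ a, T a b) / k, ← Finset.sum_div, ← Finset.sum_div,
      Finset.sum_comm]
  have hrcs : ∑ i, (s • r) i = ∑ j, (s • c) j := by
    simp only [Pi.smul_apply, ← Finset.smul_sum, hrc]
  have h1 := fibInt_smul (prodWt fun _ _ => p) hrc hs
  have h2 : (fun x : Fin (m + 1) → Fin (n + 1) → ℝ => prodWt (fun _ _ => p) (s • x)) =
      prodWt fun _ _ => p := by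
    ext x
    exact Finset.prod_congr rfl fun i _ => Finset.prod_congr rfl fun j _ => hps s _ hs
  rw [h2] at h1
  rw [← h1]
  refine (fibInt_le_add hpm hrcs (w := fun i j => z (d i) (d' j) - s * (T (d i) (d' j) / k ^ 2))
    fun i j => sub_nonneg.2 (hw _ _)).trans (le_of_eq ?_)
  congr 1
  · ext i
    rw [sum_comp_cloning hd' fun b => z (d i) b - s * (T (d i) b / k ^ 2), Finset.sum_sub_distrib,
      ← Finset.mul_sum, ← Finset.sum_div]
    simp only [hr, Pi.smul_apply, smul_eq_mul]
    field_simp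
    ring
  · ext j
    rw [sum_comp_cloning hd fun a => z a (d' j) - s * (T a (d' j) / k ^ 2), Finset.sum_sub_distrib,
      ← Finset.mul_sum, ← Finset.sum_div]
    simp only [hc, Pi.smul_apply, smul_eq_mul]
    field_simp
    ring

theorem measurableSet_blocks {ι κ : Type*} [Fintype ι] [Countable κ] [DecidableEq κ] (D : ι → κ)
    (z : κ → ℝ) (τ : ℝ) :
    MeasurableSet {x : ι → ℝ | ∀ b, |∑ e with D e = b, (x e - z b)| ≤ τ} := by
  have : {x : ι → ℝ | ∀ b, |∑ e with D e = b, (x e - z b)| ≤ τ} =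
      ⋂ b, {x | |∑ e with D e = b, (x e - z b)| ≤ τ} := by
    ext x
    simp
  rw [this]
  exact MeasurableSet.iInter fun b => measurableSet_le (by fun_prop) measurable_const

/-- Change of the likelihood factor between margins given by block sums. -/
theorem likelihood_sub (T z : Fin m₀ → Fin n₀ → ℝ) (α : Fin m₀ → ℝ) (β : Fin n₀ → ℝ) (q : ℝ) :
    (∑ a, (∑ b, T a b) * α a + ∑ b, (∑ a, T a b) * β b) -
      (∑ a, (q * ∑ b, z a b) * α a + ∑ b, (q * ∑ a, z a b) * β b) =
      ∑ a, ∑ b, (T a b - q * z a b) * (α a + β b) := by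
  have h1 : ∀ S : Fin m₀ → Fin n₀ → ℝ, ∑ a, (∑ b, S a b) * α a + ∑ b, (∑ a, S a b) * β b =
      ∑ a, ∑ b, S a b * (α a + β b) := by
    intro S
    simp only [Finset.sum_mul, mul_add, Finset.sum_add_distrib]
    congr 1
    exact Finset.sum_comm
  have h2 : ∀ a, q * ∑ b, z a b = ∑ b, q * z a b := fun a => Finset.mul_sum _ _ _
  have h3 : ∀ b, q * ∑ a, z a b = ∑ a, q * z a b := fun b => Finset.mul_sum _ _ _
  simp only [h2, h3]
  rw [h1, h1 fun a b => q * z a b, ← Finset.sum_sub_distrib]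
  refine Finset.sum_congr rfl fun a _ => ?_
  rw [← Finset.sum_sub_distrib]
  exact Finset.sum_congr rfl fun b _ => by ring

/-- With probability at least `1/2` all block sums are within `B k` of their means `k ^ 2 z`. For
every such table, shrinking by a factor `1 - ε` with `ε = O(1 / k)` brings the block averages below
`z`, and a nonnegative matrix makes up for the difference. So its block-averaged margin has a fiber
of volume at most `(1 - ε) ^ (-O(k ^ 2)) = exp (O(k))` times that of the target margin, and the
likelihood factors differ by `exp (O(k))` as well. -/
theorem exists_fast_lower_bound_volume {μ : Measure ℝ} [NeZero μ] {p : ℝ → ℝ≥0∞} (hp : Measurable p)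
    (hpI : IntervalWt p) (hp0 : ∀ x, p x ≠ 0 → 0 ≤ x) (hpm : ∀ x t, 0 ≤ t → p x ≤ p (x + t))
    (hps : ∀ s x : ℝ, 0 < s → p (s * x) = p x) (hμ : (volume : Measure ℝ).withDensity p = μ)
    (hm : 0 < m₀) (hn : 0 < n₀)
    {α : Fin m₀ → ℝ} {β : Fin n₀ → ℝ} (hdom : ∀ a b, α a + β b ∈ tiltDomain μ)
    (hz : ∀ a b, 0 < tiltMean μ (α a + β b)) :
    ∃ C' > 0, ∀ᶠ k : ℕ in atTop, ∀ (N N' : ℕ) (d : Fin N → Fin m₀) (d' : Fin N' → Fin n₀),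
      (∀ a, (Finset.univ.filter fun i => d i = a).card = k) →
      (∀ b, (Finset.univ.filter fun j => d' j = b).card = k) →
      ENNReal.ofReal (Real.exp (-(C' * (k * Real.log k)))) ≤
        fibInt volume (prodWt fun i j => tiltDens μ p (α (d i) + β (d' j)))
          (fun i => k * ∑ b, tiltMean μ (α (d i) + β b))
          (fun j => k * ∑ a, tiltMean μ (α a + β (d' j))) := by
  set z : Fin m₀ → Fin n₀ → ℝ := fun a b => tiltMean μ (α a + β b) with hzdef
  obtain ⟨C, hC, s₀, hs₀, hsub⟩ := exists_subGaussNear_tilt hdom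
  obtain ⟨ζ₀, hζ₀, hζ⟩ := exists_pos_le_forall (fun e : Fin m₀ × Fin n₀ => z e.1 e.2)
    fun e => hz _ _
  set B : ℝ := C + 4 * (Fintype.card (Fin m₀ × Fin n₀) : ℕ) with hB
  have hB0 : 0 < B := by positivity
  set V : ℝ := m₀ + n₀ with hV
  -- `H₁ k` bounds the change of the log-likelihood factor and `H₂ k` the logarithm of the loss of
  -- volume under shrinking; `D₀ k ^ 2` bounds the total of the matrix.
  set H₁ : ℝ := ∑ a, ∑ b, B * |α a + β b| with hH₁
  have hH₁0 : 0 ≤ H₁ := Finset.sum_nonneg fun a _ => Finset.sum_nonneg fun b _ => by positivity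
  set H₂ : ℝ := 2 * (B / ζ₀) * (m₀ * n₀) with hH₂
  have hH₂0 : 0 ≤ H₂ := by positivity
  set D₀ : ℝ := ∑ e : Fin m₀ × Fin n₀, (z e.1 e.2 + B) + 1 with hD₀
  have hD₀1 : 1 ≤ D₀ := by
    have : 0 ≤ ∑ e : Fin m₀ × Fin n₀, (z e.1 e.2 + B) :=
      Finset.sum_nonneg fun e _ => add_nonneg (hz _ _).le hB0.le
    linarith
  refine ⟨(1 + H₁ + H₂) + V * (2 + Real.log D₀), by
    have := Real.log_nonneg hD₀1
    positivity, ?_⟩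
  filter_upwards [eventually_ge_atTop 2, eventually_log_ge 1, eventually_natCast_ge (1 / s₀),
    eventually_natCast_ge (2 * (B / ζ₀))] with k hk hlog hks hkB N N' d d' hd hd'
  have hk1 : (1 : ℝ) ≤ k := by exact_mod_cast (show 1 ≤ k by omega)
  have hk0 : (0 : ℝ) < k := by linarith
  have hNk := card_cloning hd
  have hNk' := card_cloning hd'
  obtain ⟨m, rfl⟩ : ∃ m, N = m + 2 := ⟨N - 2, by
    have := Nat.mul_le_mul hm hk
    omega⟩
  obtain ⟨n, rfl⟩ : ∃ n, N' = n + 2 := ⟨N' - 2, by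
    have := Nat.mul_le_mul hn hk
    omega⟩
  have hE : ((m + 1 + (n + 2) : ℕ) : ℝ) ≤ V * k := by
    have h1 : ((m + 2 : ℕ) : ℝ) + (n + 2 : ℕ) = V * k := by rw [hNk, hNk', hV]; push_cast; ring
    rw [← h1]
    push_cast
    linarith
  have hmn : (((m + 1) * (n + 1) : ℕ) : ℝ) ≤ (m₀ * n₀) * (k * k) := by
    have h1 : (m + 1) * (n + 1) ≤ (m + 2) * (n + 2) := by nlinarith
    have h2 : (((m + 2) * (n + 2) : ℕ) : ℝ) = (m₀ * n₀) * (k * k) := by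
      rw [hNk, hNk']; push_cast; ring
    rw [← h2]
    exact_mod_cast h1
  -- Chosen so that the deviation `B / k` of a block average equals `ε ζ₀ ≤ ε z`; then `(1 - ε) (z +
  -- B / k) ≤ z`.
  set ε : ℝ := B / ζ₀ / k with hε
  have hε0 : 0 ≤ ε := by positivity
  have hε1 : ε ≤ 1 / 2 := by
    rw [hε, div_le_iff₀ hk0]
    linarith
  refine le_of_le_mul_pow (by positivity) hD₀1 (by omega) hlog hE ?_
  set Φ := fibInt volume (prodWt fun i j => tiltDens μ p (α (d i) + β (d' j)))
          (fun i => k * ∑ b, tiltMean μ (α (d i) + β b))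
          (fun j => k * ∑ a, tiltMean μ (α a + β (d' j))) with hΦ
  have hrc : ∑ i, (k : ℝ) * ∑ b, z (d i) b = ∑ j, (k : ℝ) * ∑ a, z a (d' j) := by
    rw [sum_comp_cloning hd fun a => (k : ℝ) * ∑ b, z a b,
      sum_comp_cloning hd' fun b => (k : ℝ) * ∑ a, z a b, ← Finset.mul_sum, ← Finset.mul_sum,
      Finset.sum_comm]
  have hprob : ∀ a b, IsProbabilityMeasure ((volume : Measure ℝ).withDensity
      (tiltDens μ p (α a + β b))) := fun a b => by
    rw [withDensity_tiltDens hp hμ (hdom a b)]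
    exact isProbabilityMeasure_tilt (hdom a b)
  set D : Fin (m + 2) × Fin (n + 2) → Fin m₀ × Fin n₀ := fun e => (d e.1, d' e.2) with hDdef
  set A : Set (Fin (m + 2) → Fin (n + 2) → ℝ) :=
    {x | ∀ b, |∑ e with D e = b, (x e.1 e.2 - z b.1 b.2)| ≤ B * k} with hA
  have hAm : MeasurableSet A := by
    have h1 := measurableSet_blocks D (fun b => z b.1 b.2) (B * k)
    exact (MeasurableEquiv.curry (Fin (m + 2)) (Fin (n + 2)) ℝ).symm.measurable h1
  have hPA : 1 / 2 ≤ (baseModel volume (m + 2) (n + 2)).withDensity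
      (prodWt fun i j => tiltDens μ p (α (d i) + β (d' j))) A := by
    have h1 := half_le_blocks (ν := fun e : Fin (m + 2) × Fin (n + 2) =>
      (volume : Measure ℝ).withDensity (tiltDens μ p (α (d e.1) + β (d' e.2)))) D
      (z := fun b => z b.1 b.2) (k := k) (C := C) (s₀ := s₀) (fun e => by
        rw [withDensity_tiltDens hp hμ (hdom _ _)]
        exact hsub _ _) hC.le hk0 (by
        rw [div_le_iff₀ hs₀] at hks
        rw [div_le_iff₀ hk0]
        linarith) (fun b => by rw [card_block hd hd']; push_cast; rw [sq])
    rw [← pi_pi_withDensity (fun i j => tiltDens μ p (α (d i) + β (d' j))) fun i j =>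
      measurable_tiltDens hp, ← (measurePreserving_curry fun i j =>
      (volume : Measure ℝ).withDensity (tiltDens μ p (α (d i) + β (d' j)))).measure_preimage_equiv]
    exact h1
  have hT : ∀ x ∈ A, ∀ a b, |∑ e with D e = (a, b), x e.1 e.2 - k ^ 2 * z a b| ≤ B * k := by
    intro x hx a b
    have h1 := hx (a, b)
    rw [Finset.sum_sub_distrib, Finset.sum_const, card_block hd hd', nsmul_eq_mul] at h1
    push_cast at h1
    rwa [← sq] at h1
  have key := isLattice_volume.withDensity_le_of_blocks (μ := μ) hp hpI hp0 (by omega) hd hd' α β hAm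
    (D := D₀ * k ^ 2) (K := ENNReal.ofReal (Real.exp ((H₁ + H₂) * k)) * Φ) (fun x hx => ?_)
    (fun x hx _ => ⟨fun _ => AddSubgroup.mem_top _, fun _ => AddSubgroup.mem_top _, ?_⟩)
  · rw [Real.volume_Icc, sub_zero] at key
    have h1 := hPA.trans key
    have h2 : ENNReal.ofReal (Real.exp (-k)) ≤ 1 / 2 := by
      refine (ENNReal.ofReal_le_ofReal (exp_neg_le_half hk1)).trans (le_of_eq ?_)
      rw [ENNReal.ofReal_div_of_pos two_pos]
      simp
    have h3 := h2.trans h1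
    have h4 : Real.exp (-((1 + H₁ + H₂) * k)) = Real.exp (-((H₁ + H₂) * k)) * Real.exp (-k) := by
      rw [← Real.exp_add]; congr 1; ring
    rw [h4, ENNReal.ofReal_mul (Real.exp_pos _).le]
    refine (mul_le_mul_right h3 _).trans (le_of_eq ?_)
    rw [← mul_assoc, ← mul_assoc, ← ENNReal.ofReal_mul (Real.exp_pos _).le, ← Real.exp_add,
      neg_add_cancel, Real.exp_zero, ENNReal.ofReal_one, one_mul]
  · rw [sum_block_total d d']
    have h1 : ∀ e : Fin m₀ × Fin n₀, ∑ x' : Fin (m + 2) × Fin (n + 2) with (d x'.1, d' x'.2) = e,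
        x x'.1 x'.2 ≤ (z e.1 e.2 + B) * k ^ 2 := by
      intro e
      have h2 := (abs_le.1 (hT x hx e.1 e.2)).2
      have h3 : B * k ≤ B * k ^ 2 := by
        gcongr
        nlinarith
      have : ∑ x' with D x' = (e.1, e.2), x x'.1 x'.2 ≤ (z e.1 e.2 + B) * k ^ 2 := by linarith
      exact this
    refine (Finset.sum_le_sum fun e _ => h1 e).trans ?_
    rw [← Finset.sum_mul]
    gcongr
    linarith
  · set T : Fin m₀ → Fin n₀ → ℝ := fun a b => ∑ e with D e = (a, b), x e.1 e.2 with hTdef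
    simp only [sum_block_row (d' := d') x, sum_block_col (d := d) x]
    have hs : 0 < 1 - ε := by linarith
    have h1 := pow_mul_fibInt_le (m := m + 1) (n := n + 1) hpm hps (by omega) hd hd' (z := z)
      (T := T) hs fun a b => by
      have h2 := (abs_le.1 (hT x hx a b)).2
      have h3 : T a b / k ^ 2 ≤ z a b + B / k := by
        rw [div_le_iff₀ (by positivity)]
        have : (z a b + B / k) * k ^ 2 = k ^ 2 * z a b + B * k := by field_simp
        rw [this]
        linarith
      have h4 : B / k = ε * ζ₀ := by rw [hε]; field_simp
      have h5 : ε * ζ₀ ≤ ε * z a b := mul_le_mul_of_nonneg_left (hζ (a, b)) hε0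
      have h6 : (1 - ε) * (T a b / k ^ 2) ≤ (1 - ε) * (z a b + B / k) :=
        mul_le_mul_of_nonneg_left h3 hs.le
      have h7 : 0 ≤ ε * (B / k) := by positivity
      nlinarith
    have h8 : Real.exp (-(H₂ * k)) ≤ (1 - ε) ^ ((m + 1) * (n + 1)) := by
      calc Real.exp (-(H₂ * k)) ≤ Real.exp (((m + 1) * (n + 1) : ℕ) * -(2 * ε)) := by
            refine Real.exp_le_exp.2 ?_
            have h9 : (((m + 1) * (n + 1) : ℕ) : ℝ) * (2 * ε) ≤ (m₀ * n₀) * (k * k) * (2 * ε) := by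
              gcongr
            have h10 : (m₀ * n₀) * (k * k) * (2 * ε) = H₂ * k := by
              rw [hH₂, hε]; field_simp
            linarith
        _ = Real.exp (-(2 * ε)) ^ ((m + 1) * (n + 1)) := Real.exp_nat_mul _ _
        _ ≤ _ := by
            gcongr
            exact one_sub_ge_exp hε0 hε1
    set Φp := fibInt volume (prodWt fun _ _ => p) (fun i => (∑ b, T (d i) b) / k)
        (fun j => (∑ a, T a (d' j)) / k) with hΦp
    have h11 : Φp ≤ ENNReal.ofReal (Real.exp (H₂ * k)) *
        fibInt volume (prodWt fun _ _ => p) (fun i => k * ∑ b, z (d i) b)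
        (fun j => k * ∑ a, z a (d' j)) := by
      refine le_trans ?_ (mul_le_mul_right h1 _)
      rw [← mul_assoc, ← ENNReal.ofReal_mul (Real.exp_pos _).le]
      refine le_mul_of_one_le_left zero_le ?_
      rw [ENNReal.one_le_ofReal]
      calc (1 : ℝ) = Real.exp (H₂ * k) * Real.exp (-(H₂ * k)) := by
            rw [← Real.exp_add, add_neg_cancel, Real.exp_zero]
        _ ≤ _ := by gcongr
    refine (mul_le_mul_right h11 _).trans ?_
    have h12 : Φ = _ := fibInt_tiltDens (m := m + 1) (n := n + 1) μ hp (fun i => α (d i))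
      (fun j => β (d' j)) hrc
    rw [h12, ← mul_assoc, ← mul_assoc, ← ENNReal.ofReal_mul (Real.exp_pos _).le,
      ← ENNReal.ofReal_mul (Real.exp_pos _).le, ← Real.exp_add, ← Real.exp_add]
    refine mul_le_mul_left (ENNReal.ofReal_le_ofReal (Real.exp_le_exp.2 ?_)) _
    rw [sum_comp_cloning hd fun a => (k * ∑ b, z a b) * α a,
      sum_comp_cloning hd' fun b => (k * ∑ a, z a b) * β b, Finset.mul_sum, Finset.mul_sum]
    have h13 := likelihood_sub T z α β (k ^ 2)
    have h14 : ∑ a, ∑ b, (T a b - k ^ 2 * z a b) * (α a + β b) ≤ H₁ * k := by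
      rw [hH₁, Finset.sum_mul]
      refine Finset.sum_le_sum fun a _ => ?_
      rw [Finset.sum_mul]
      refine Finset.sum_le_sum fun b _ => ?_
      calc (T a b - k ^ 2 * z a b) * (α a + β b) ≤ |T a b - k ^ 2 * z a b| * |α a + β b| := by
            rw [← abs_mul]; exact le_abs_self _
        _ ≤ B * k * |α a + β b| := by
            gcongr
            exact hT x hx a b
        _ = _ := by ring
    have h15 : ∑ a, (k : ℝ) * ((k * ∑ b, z a b) * α a) = ∑ a, (k ^ 2 * ∑ b, z a b) * α a :=
      Finset.sum_congr rfl fun a _ => by ring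
    have h16 : ∑ b, (k : ℝ) * ((k * ∑ a, z a b) * β b) = ∑ b, (k ^ 2 * ∑ a, z a b) * β b :=
      Finset.sum_congr rfl fun b _ => by ring
    rw [h15, h16]
    linarith only [h13, h14]

end fast

/-! ### Integer tables and prescribed block sums -/

section fast
variable {m₀ n₀ : ℕ}

/-- Rounding of a matrix with integral margins to an integral matrix. -/
theorem exists_int_table (hm : 0 < m₀) (hn : 0 < n₀) (x : Fin m₀ → Fin n₀ → ℝ)
    (hr : ∀ a, ∑ b, x a b ∈ intSubgroup) (hc : ∀ b, ∑ a, x a b ∈ intSubgroup) :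
    ∃ s : Fin m₀ → Fin n₀ → ℝ, (∀ a b, s a b ∈ intSubgroup) ∧ (∀ a, ∑ b, s a b = ∑ b, x a b) ∧
      (∀ b, ∑ a, s a b = ∑ a, x a b) ∧ ∀ a b, |s a b - x a b| ≤ m₀ * n₀ := by
  obtain ⟨m, rfl⟩ : ∃ m, m₀ = m + 1 := ⟨m₀ - 1, by omega⟩
  obtain ⟨n, rfl⟩ : ∃ n, n₀ = n + 1 := ⟨n₀ - 1, by omega⟩
  set r : Fin (m + 1) → ℝ := fun a => ∑ b, x a b with hrdef
  set c : Fin (n + 1) → ℝ := fun b => ∑ a, x a b with hcdef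
  have hrc : ∑ a, r a = ∑ b, c b := Finset.sum_comm
  set y : Fin m → Fin n → ℝ := fun i j => x i.castSucc j.castSucc
  set y' : Fin m → Fin n → ℝ := fun i j => (⌊y i j⌋ : ℝ)
  have hx : completion r c y = x := completion_restrict r c x (fun _ => rfl) fun _ => rfl
  refine ⟨completion r c y', fun a b => completion_mem hr hc (fun i j => ⟨⌊y i j⌋, rfl⟩) a b,
    fun a => sum_completion_row r c y' hrc a, fun b => sum_completion_col r c y' b, fun a b => ?_⟩
  have hx' : x a b = completion r c y a b := by rw [hx]
  rw [hx']
  by_cases h0 : 1 ≤ m ∧ 1 ≤ n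
  · refine (abs_completion_sub_le h0.1 h0.2 r c (y := y') (y' := y) (ρ := 1) (fun i j => ?_)
      a b).trans ?_
    · rw [abs_sub_comm, abs_le]
      have h1 := Int.floor_le (y i j)
      have h2 := Int.lt_floor_add_one (y i j)
      constructor <;> linarith
    · push_cast
      nlinarith [show (0 : ℝ) ≤ m by positivity, show (0 : ℝ) ≤ n by positivity]
  · have : y' = y := by
      ext i j
      have := i.2
      have := j.2
      omega
    rw [this, sub_self, abs_zero]
    positivity

/-- An integer can be written as a sum of a given number of integers from an interval. -/
theorem exists_sum_eq {ι : Type*} [DecidableEq ι] (Q : Finset ι) (hQ : 0 < Q.card) {u : ℤ} {B : ℕ}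
    {S : ℝ} (hS : S ∈ intSubgroup) (h1 : Q.card * (u : ℝ) ≤ S) (h2 : S ≤ Q.card * ((u : ℝ) + B)) :
    ∃ g : ι → ℝ, ∑ e ∈ Q, g e = S ∧ ∀ e, ∃ l : ℕ, l ≤ B ∧ g e = u + l := by
  obtain ⟨w, rfl⟩ := mem_intSubgroup.1 hS
  set L := Q.card with hL
  have h1' : L * u ≤ w := by exact_mod_cast h1
  have h2' : w ≤ L * (u + B) := by exact_mod_cast h2
  have hL0 : (0 : ℤ) < L := by exact_mod_cast hQ
  -- Hermite's identity again: `w` is split into `L` integers that are as equal as possible, so the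
  -- bounds on the average `w / L` carry over to each of them.
  set v : Fin L → ℤ := fun j => (w + j) / L with hv
  have hv1 : ∀ j, u ≤ v j := fun j => by
    rw [hv, Int.le_ediv_iff_mul_le hL0]
    have : (0 : ℤ) ≤ (j : ℕ) := by positivity
    nlinarith
  have hv2 : ∀ j, v j ≤ u + B := fun j => by
    have h3 : (w + (j : ℕ)) / (L : ℤ) < u + B + 1 := by
      rw [Int.ediv_lt_iff_lt_mul hL0]
      have : ((j : ℕ) : ℤ) < L := by exact_mod_cast j.2
      nlinarith
    exact Int.lt_add_one_iff.1 h3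
  refine ⟨fun e => if h : e ∈ Q then (v (Q.equivFin ⟨e, h⟩) : ℝ) else u, ?_, fun e => ?_⟩
  · rw [← Finset.sum_attach]
    have h3 : ∀ e : Q, (if h : (e : ι) ∈ Q then (v (Q.equivFin ⟨e, h⟩) : ℝ) else u) =
        v (Q.equivFin e) := fun e => by rw [dif_pos e.2]
    simp only [h3]
    rw [← Finset.univ_eq_attach, Q.equivFin.sum_comp fun j => (v j : ℝ), ← Int.cast_sum]
    congr 1
    rw [← sum_range_add_ediv hQ w, Finset.sum_range]
  · beta_reduce
    by_cases h : e ∈ Q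
    · rw [dif_pos h]
      obtain ⟨l, hl⟩ := Int.eq_ofNat_of_zero_le (sub_nonneg.2 (hv1 (Q.equivFin ⟨e, h⟩)))
      refine ⟨l, ?_, ?_⟩
      · have := hv2 (Q.equivFin ⟨e, h⟩)
        omega
      · have : v (Q.equivFin ⟨e, h⟩) = u + (l : ℤ) := by omega
        rw [this]
        push_cast
        rfl
    · rw [dif_neg h]
      exact ⟨0, Nat.zero_le _, by simp⟩

/-- A lower bound for the probability of given block sums of independent integers. -/
theorem le_pi_block_sums {ι κ : Type*} [Fintype ι] [Fintype κ] [DecidableEq ι] [DecidableEq κ]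
    {ν : ι → Measure ℝ} [∀ e, IsProbabilityMeasure (ν e)] (D : ι → κ) {z s : κ → ℝ}
    {C s₀ k η c M : ℝ} {u : ℤ} {B K L : ℕ}
    (hν : ∀ e, SubGaussNear (ν e) (z (D e)) C s₀) (hC : 0 ≤ C) (hk : 0 < k) (hks : 1 / k ≤ s₀)
    (hcard : ∀ b, (Finset.univ.filter fun e => D e = b).card = K) (hK : (K : ℝ) = k ^ 2)
    (hΓ : ∀ e, ∀ᵐ x ∂ν e, x ∈ intSubgroup) (hs : ∀ b, s b ∈ intSubgroup)
    (hsz : ∀ b, |s b - k ^ 2 * z b| ≤ M) (hz : ∀ b, u + η ≤ z b ∧ z b ≤ u + B - η)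
    (hL : 0 < L) (hLK : L ≤ K) (hLη : M + (C + 4 * Fintype.card κ) * k ≤ L * η)
    (hc : ∀ e, ∀ l : ℕ, l ≤ B → ENNReal.ofReal c ≤ ν e {(u : ℝ) + l}) (hc1 : c ≤ 1) :
    1 / 2 * ENNReal.ofReal c ^ (Fintype.card κ * L) ≤
      Measure.pi ν {x | ∀ b, ∑ e with D e = b, x e = s b} := by
  -- In each block `L` cells are reserved. The others are sampled freely and have typical block sums
  -- with probability at least `1/2`; the reserved cells then make up the exact difference with
  -- values between `u` and `u + B`. By `hLη` the difference per reserved cell stays within `η` of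
  -- the mean, so such values exist.
  have hQex : ∀ b, ∃ Q ⊆ Finset.univ.filter fun e => D e = b, Q.card = L := fun b =>
    Finset.exists_subset_card_eq ((hcard b).symm ▸ hLK)
  choose Q hQs hQc using hQex
  have hQD : ∀ b, ∀ e ∈ Q b, D e = b := fun b e he => (Finset.mem_filter.1 (hQs b he)).2
  let P : ι → Prop := fun e => e ∉ Q (D e)
  let D' : {e // P e} → κ := fun e => D e
  have hfree : ∀ (b : κ) (F : ι → ℝ), ∑ e : {e // P e} with D' e = b, F e =
      ∑ e ∈ (Finset.univ.filter fun e => D e = b) \ Q b, F e := by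
    intro b F
    rw [Finset.sum_filter]
    refine (Finset.sum_subtype (Finset.univ.filter P) (p := P) (fun e => by simp)
      (fun e => if D e = b then F e else 0)).symm.trans ?_
    rw [← Finset.sum_filter, Finset.filter_filter]
    refine Finset.sum_congr ?_ fun _ _ => rfl
    ext e
    simp only [P, Finset.mem_filter, Finset.mem_univ, true_and, Finset.mem_sdiff]
    constructor
    · rintro ⟨h1, h2⟩
      exact ⟨h2, h2 ▸ h1⟩
    · rintro ⟨h1, h2⟩
      exact ⟨h1.symm ▸ h2, h1⟩
  have hfc : ∀ b, ((Finset.univ.filter fun e => D' e = b).card : ℝ) = k ^ 2 - L := by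
    intro b
    have h1 := hfree b fun _ => 1
    rw [Finset.sum_const, Finset.sum_const, nsmul_eq_mul, nsmul_eq_mul, mul_one, mul_one,
      Finset.card_sdiff_of_subset (hQs b), hcard, hQc, Nat.cast_sub hLK, hK] at h1
    exact h1
  set W : Set ({e // P e} → ℝ) := {w | ∀ b, |∑ e with D' e = b, (w e - z b)| ≤
      (C + 4 * Fintype.card κ) * k} ∩ ⋂ e, (fun w => w e) ⁻¹' (intSubgroup : Set ℝ) with hW
  have hWm : MeasurableSet W := (measurableSet_blocks D' z _).inter
    (MeasurableSet.iInter fun e => measurable_pi_apply e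
      measurableEmbedding_intCast.measurableSet_range)
  have hPW : 1 / 2 ≤ Measure.pi (fun e : {e // P e} => ν e) W := by
    refine (half_le_blocks (ν := fun e : {e // P e} => ν e) D'
      (fun e => hν e) hC hk hks fun b => ?_).trans ?_
    · rw [hfc]
      linarith [show (0 : ℝ) ≤ L by positivity]
    · refine measure_mono_ae ?_
      have h1 : ∀ᵐ w ∂Measure.pi (fun e : {e // P e} => ν e), ∀ e, w e ∈ intSubgroup :=
        ae_all_iff.2 fun e => (Measure.tendsto_eval_ae_ae (i := e)).eventually (hΓ e)
      filter_upwards [h1] with w hw hw'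
      exact ⟨hw', Set.mem_iInter.2 hw⟩
  have hfill : ∀ w ∈ W, ∀ b, ∃ g : ι → ℝ,
      ∑ e ∈ Q b, g e = s b - ∑ e with D' e = b, w e ∧
      ∀ e, ∃ l : ℕ, l ≤ B ∧ g e = u + l := by
    intro w hw b
    have h1 := abs_le.1 (hw.1 b)
    rw [Finset.sum_sub_distrib, Finset.sum_const, nsmul_eq_mul, hfc] at h1
    have h2 := abs_le.1 (hsz b)
    have h3 := hz b
    have hL0 : (0 : ℝ) < L := by exact_mod_cast hL
    refine exists_sum_eq (Q b) (by rw [hQc]; exact hL)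
      (intSubgroup.sub_mem (hs b) (intSubgroup.sum_mem fun e _ => Set.mem_iInter.1 hw.2 e)) ?_ ?_
    · rw [hQc]
      nlinarith [mul_le_mul_of_nonneg_left h3.1 hL0.le]
    · rw [hQc]
      nlinarith [mul_le_mul_of_nonneg_left h3.2 hL0.le]
  classical
  choose g hg1 hg2 using hfill
  let G : ({e // P e} → ℝ) → {e // ¬ P e} → ℝ := fun w e =>
    if hw : w ∈ W then g w hw (D e) e else 0
  have hcardQ : Fintype.card {e // ¬ P e} ≤ Fintype.card κ * L := by
    rw [Fintype.card_subtype]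
    calc (Finset.univ.filter fun e => ¬ P e).card ≤ (Finset.univ.biUnion Q).card := by
          refine Finset.card_le_card fun e he => Finset.mem_biUnion.2 ⟨D e, Finset.mem_univ _, ?_⟩
          simpa [P] using he
      _ ≤ ∑ b, (Q b).card := Finset.card_biUnion_le
      _ = Fintype.card κ * L := by simp [hQc]
  -- Radius `0`: the reserved cells are prescribed exactly, at the price of an atom of mass at least
  -- `c` each.
  have key := pi_correction P ν W hWm G 0 (ENNReal.ofReal c) (fun w hw e => by
      obtain ⟨l, hl, hgl⟩ := hg2 w hw (D e) e
      rw [Metric.closedBall_zero, show G w e = u + l by simp only [G, dif_pos hw]; exact hgl]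
      exact hc e l hl) {x | ∀ b, ∑ e with D e = b, x e = s b} ?_ fun x hxW hx b => ?_
  · refine le_trans ?_ key
    exact mul_le_mul' hPW (pow_le_pow_right_of_le_one'
      (by simpa using ENNReal.ofReal_le_ofReal hc1) hcardQ)
  · have : {x : ι → ℝ | ∀ b, ∑ e with D e = b, x e = s b} =
        ⋂ b, {x | ∑ e with D e = b, x e = s b} := by
      ext x
      simp
    rw [this]
    exact MeasurableSet.iInter fun b => measurableSet_eq_fun (by fun_prop) measurable_const
  · have h1 : ∀ e ∈ Q b, x e = g _ hxW b e := by
      intro e he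
      have hDe := hQD b e he
      have hPe : ¬ P e := by simpa [P, hDe] using he
      have h2 := abs_nonpos_iff.1 (hx ⟨e, hPe⟩)
      simp only [G, dif_pos hxW, hDe] at h2
      exact sub_eq_zero.1 h2
    rw [← Finset.sum_sdiff (hQs b), ← hfree b x, Finset.sum_congr rfl h1, hg1]
    ring

end fast

/-! ### Lower bounds of order `exp (-O(k log k))`: counting measure -/

section fast
variable {m₀ n₀ : ℕ}

theorem intCount_Icc_le {D : ℝ} (hD : 0 ≤ D) :
    intCount (Set.Icc 0 D) ≤ ENNReal.ofReal (D + 1) := by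
  rw [intCount_apply, Int.preimage_Icc, Int.ceil_zero, ← Finset.coe_Icc, Measure.count_apply_finset,
    Int.card_Icc, sub_zero, ← ENNReal.ofReal_natCast]
  refine ENNReal.ofReal_le_ofReal ?_
  have h1 : 0 ≤ ⌊D⌋ + 1 := by have := Int.floor_nonneg.2 hD; omega
  have h2 : (((⌊D⌋ + 1).toNat : ℤ) : ℝ) = ⌊D⌋ + 1 := by rw [Int.toNat_of_nonneg h1]; push_cast; rfl
  have h3 := Int.floor_le D
  push_cast at h2
  linarith

/-- The means are rounded to an integer table `s` of block sums with the same line sums as `k ^ 2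
z`. On the event that the block sums are exactly `s`, the block-averaged margin is exactly the
target margin, so no comparison between different margins is needed. Only `O(k)` cells per block
have to be prescribed, hence the event has probability `exp (-O(k))`. -/
theorem exists_fast_lower_bound_intCount {μ : Measure ℝ} [NeZero μ] {p : ℝ → ℝ≥0∞}
    (hp : Measurable p) (hpI : IntervalWt p) (hp0 : ∀ x, p x ≠ 0 → 0 ≤ x)
    (hμ : intCount.withDensity p = μ) (hm : 0 < m₀) (hn : 0 < n₀)
    {α : Fin m₀ → ℝ} {β : Fin n₀ → ℝ} (hdom : ∀ a b, α a + β b ∈ tiltDomain μ) {u : ℤ} {c η : ℝ}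
    {B : ℕ} (hη : 0 < η) (hc : 0 < c) (hc1 : c ≤ 1)
    (hz : ∀ a b, u + η ≤ tiltMean μ (α a + β b) ∧ tiltMean μ (α a + β b) ≤ u + B - η)
    (hz0 : ∀ a b, 0 ≤ tiltMean μ (α a + β b))
    (hcE : ∀ a b, ∀ l : ℕ, l ≤ B → ENNReal.ofReal c ≤ tiltDens μ p (α a + β b) (u + l)) :
    ∃ C' > 0, ∀ᶠ k : ℕ in atTop, ∀ (N N' : ℕ) (d : Fin N → Fin m₀) (d' : Fin N' → Fin n₀),
      (∀ a, (Finset.univ.filter fun i => d i = a).card = k) →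
      (∀ b, (Finset.univ.filter fun j => d' j = b).card = k) →
      (∀ a, (k : ℝ) * ∑ b, tiltMean μ (α a + β b) ∈ intSubgroup) →
      (∀ b, (k : ℝ) * ∑ a, tiltMean μ (α a + β b) ∈ intSubgroup) →
      ENNReal.ofReal (Real.exp (-(C' * (k * Real.log k)))) ≤
        fibInt intCount (prodWt fun i j => tiltDens μ p (α (d i) + β (d' j)))
          (fun i => k * ∑ b, tiltMean μ (α (d i) + β b))
          (fun j => k * ∑ a, tiltMean μ (α a + β (d' j))) := by
  set z : Fin m₀ → Fin n₀ → ℝ := fun a b => tiltMean μ (α a + β b) with hzdef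
  obtain ⟨C, hC, s₀, hs₀, hsub⟩ := exists_subGaussNear_tilt hdom
  set B' : ℝ := C + 4 * (Fintype.card (Fin m₀ × Fin n₀) : ℕ) with hB'
  have hB'0 : 0 < B' := by positivity
  set V : ℝ := m₀ + n₀ with hV
  -- `L₀ k` reserved cells per block absorb the rounding error, at most `m₀ n₀`, together with the
  -- fluctuation `B' k` of the free block sum.
  set L₀ : ℕ := ⌈((m₀ * n₀ : ℝ) + B') / η⌉₊ with hL₀
  have hL₀0 : 0 < L₀ := Nat.ceil_pos.2 (by positivity)
  set H : ℝ := 1 + Fintype.card (Fin m₀ × Fin n₀) * L₀ * -Real.log c with hH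
  have hlogc : 0 ≤ -Real.log c := neg_nonneg.2 (Real.log_nonpos hc.le hc1)
  have hH0 : 0 < H := by positivity
  set D₀ : ℝ := ∑ e : Fin m₀ × Fin n₀, z e.1 e.2 + 1 with hD₀
  have hsum0 : 0 ≤ ∑ e : Fin m₀ × Fin n₀, z e.1 e.2 := Finset.sum_nonneg fun e _ => hz0 _ _
  have hD₀1 : 1 ≤ D₀ := by linarith
  refine ⟨H + V * (2 + Real.log D₀), by
    have := Real.log_nonneg hD₀1
    positivity, ?_⟩
  filter_upwards [eventually_ge_atTop 2, eventually_log_ge 1, eventually_natCast_ge (1 / s₀),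
    eventually_ge_atTop L₀] with k hk hlog hks hkL N N' d d' hd hd' hrΓ hcΓ
  have hk1 : (1 : ℝ) ≤ k := by exact_mod_cast (show 1 ≤ k by omega)
  have hk0 : (0 : ℝ) < k := by linarith
  have hNk := card_cloning hd
  have hNk' := card_cloning hd'
  obtain ⟨m, rfl⟩ : ∃ m, N = m + 2 := ⟨N - 2, by
    have := Nat.mul_le_mul hm hk
    omega⟩
  obtain ⟨n, rfl⟩ : ∃ n, N' = n + 2 := ⟨N' - 2, by
    have := Nat.mul_le_mul hn hk
    omega⟩
  have hE : ((m + 1 + (n + 2) : ℕ) : ℝ) ≤ V * k := by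
    have h1 : ((m + 2 : ℕ) : ℝ) + (n + 2 : ℕ) = V * k := by rw [hNk, hNk', hV]; push_cast; ring
    rw [← h1]
    push_cast
    linarith
  refine le_of_le_mul_pow hH0.le hD₀1 (by omega) hlog hE ?_
  set Φ := fibInt intCount (prodWt fun i j => tiltDens μ p (α (d i) + β (d' j)))
          (fun i => k * ∑ b, tiltMean μ (α (d i) + β b))
          (fun j => k * ∑ a, tiltMean μ (α a + β (d' j))) with hΦ
  have hrc : ∑ i, (k : ℝ) * ∑ b, z (d i) b = ∑ j, (k : ℝ) * ∑ a, z a (d' j) := by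
    rw [sum_comp_cloning hd fun a => (k : ℝ) * ∑ b, z a b,
      sum_comp_cloning hd' fun b => (k : ℝ) * ∑ a, z a b, ← Finset.mul_sum, ← Finset.mul_sum,
      Finset.sum_comm]
  have hprob : ∀ a b, IsProbabilityMeasure (intCount.withDensity
      (tiltDens μ p (α a + β b))) := fun a b => by
    rw [withDensity_tiltDens hp hμ (hdom a b)]
    exact isProbabilityMeasure_tilt (hdom a b)
  have hmul : ∀ y : ℝ, (k : ℝ) * y ∈ intSubgroup → (k : ℝ) ^ 2 * y ∈ intSubgroup := fun y hy => by
    have := intSubgroup.nsmul_mem hy k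
    rwa [nsmul_eq_mul, ← mul_assoc, ← sq] at this
  obtain ⟨s, hsΓ, hsr, hsc, hsz⟩ := exists_int_table hm hn (fun a b => k ^ 2 * z a b)
    (fun a => by rw [← Finset.mul_sum]; exact hmul _ (hrΓ a))
    (fun b => by rw [← Finset.mul_sum]; exact hmul _ (hcΓ b))
  set D : Fin (m + 2) × Fin (n + 2) → Fin m₀ × Fin n₀ := fun e => (d e.1, d' e.2) with hDdef
  set A : Set (Fin (m + 2) → Fin (n + 2) → ℝ) :=
    {x | ∀ b, ∑ e with D e = b, x e.1 e.2 = s b.1 b.2} with hA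
  have hAm : MeasurableSet A := by
    have : A = ⋂ b, {x | ∑ e with D e = b, x e.1 e.2 = s b.1 b.2} := by
      ext x
      simp [hA]
    rw [this]
    exact MeasurableSet.iInter fun b => measurableSet_eq_fun (by fun_prop) measurable_const
  have hPA : 1 / 2 * ENNReal.ofReal c ^ (Fintype.card (Fin m₀ × Fin n₀) * (L₀ * k)) ≤
      (baseModel intCount (m + 2) (n + 2)).withDensity
      (prodWt fun i j => tiltDens μ p (α (d i) + β (d' j))) A := by
    have h1 := le_pi_block_sums (ν := fun e : Fin (m + 2) × Fin (n + 2) =>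
      intCount.withDensity (tiltDens μ p (α (d e.1) + β (d' e.2)))) D
      (z := fun b => z b.1 b.2) (s := fun b => s b.1 b.2) (k := k) (C := C) (s₀ := s₀) (η := η)
      (c := c) (M := m₀ * n₀) (u := u) (B := B) (K := k * k) (L := L₀ * k) (fun e => by
        rw [withDensity_tiltDens hp hμ (hdom _ _)]
        exact hsub _ _) hC.le hk0 (by
        rw [div_le_iff₀ hs₀] at hks
        rw [div_le_iff₀ hk0]
        linarith) (fun b => card_block hd hd' b) (by push_cast; rw [sq])
      (fun e => withDensity_absolutelyContinuous _ _ isLattice_intCount.ae_mem)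
      (fun b => hsΓ _ _) (fun b => hsz _ _) (fun b => hz _ _) (Nat.mul_pos hL₀0 (by omega))
      (Nat.mul_le_mul_right k hkL) (by
        have h2 : (m₀ * n₀ : ℝ) + B' ≤ L₀ * η := by
          rw [← div_le_iff₀ hη]
          exact Nat.le_ceil _
        push_cast at h2 hB' ⊢
        rw [← hB']
        have h3 : (m₀ * n₀ : ℝ) ≤ m₀ * n₀ * k := le_mul_of_one_le_right (by positivity) hk1
        nlinarith only [h2, h3, mul_le_mul_of_nonneg_right h2 hk0.le])
      (fun e l hl => by
        rw [withDensity_apply _ (measurableSet_singleton _), lintegral_singleton]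
        have h3 : intCount {(u : ℝ) + l} = 1 := by
          have := intCount_singleton (u + l)
          push_cast at this
          exact this
        rw [h3, mul_one]
        exact hcE _ _ l hl) hc1
    rw [← pi_pi_withDensity (fun i j => tiltDens μ p (α (d i) + β (d' j))) fun i j =>
      measurable_tiltDens hp, ← (measurePreserving_curry fun i j =>
      intCount.withDensity (tiltDens μ p (α (d i) + β (d' j)))).measure_preimage_equiv]
    exact h1
  have hRow : ∀ x ∈ A, ∀ a, ∑ i with d i = a, ∑ j, x i j = k ^ 2 * ∑ b, z a b := by
    intro x hx a
    rw [sum_block_row (d' := d') x, Finset.mul_sum, ← hsr]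
    exact Finset.sum_congr rfl fun b _ => hx (a, b)
  have hCol : ∀ x ∈ A, ∀ b, ∑ j with d' j = b, ∑ i, x i j = k ^ 2 * ∑ a, z a b := by
    intro x hx b
    rw [sum_block_col (d := d) x, Finset.mul_sum, ← hsc]
    exact Finset.sum_congr rfl fun a _ => hx (a, b)
  have hdiv : ∀ y : ℝ, (k : ℝ) ^ 2 * y / k = k * y := fun y => by field_simp
  have key := isLattice_intCount.withDensity_le_of_blocks (μ := μ) hp hpI hp0 (by omega) hd hd' α β
    hAm (D := (∑ e : Fin m₀ × Fin n₀, z e.1 e.2) * k ^ 2) (K := Φ) (fun x hx => ?_)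
    (fun x hx _ => ⟨fun a => ?_, fun b => ?_, ?_⟩)
  · have h0 : intCount (Set.Icc 0 ((∑ e : Fin m₀ × Fin n₀, z e.1 e.2) * (k : ℝ) ^ 2)) ≤
        ENNReal.ofReal (D₀ * k ^ 2) := by
      refine (intCount_Icc_le (by positivity)).trans (ENNReal.ofReal_le_ofReal ?_)
      rw [hD₀, add_mul, one_mul]
      nlinarith
    refine le_trans ?_ ((hPA.trans key).trans (mul_le_mul_right (pow_le_pow_left' h0 _) _))
    have h2 : ENNReal.ofReal (Real.exp (-k)) ≤ 1 / 2 := by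
      refine (ENNReal.ofReal_le_ofReal (exp_neg_le_half hk1)).trans (le_of_eq ?_)
      rw [ENNReal.ofReal_div_of_pos two_pos]
      simp
    refine le_trans (le_of_eq ?_) (mul_le_mul_left h2 _)
    rw [← ENNReal.ofReal_pow hc.le, ← ENNReal.ofReal_mul (Real.exp_pos _).le]
    congr 1
    have h5 : ∀ E : ℕ, c ^ E = Real.exp (E * Real.log c) := fun E => by
      rw [Real.exp_nat_mul, Real.exp_log hc]
    rw [h5, ← Real.exp_add]
    congr 1
    rw [hH]
    push_cast
    ring
  · rw [sum_block_total d d', Finset.sum_congr rfl fun e _ => hx e, Fintype.sum_prod_type,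
      Fintype.sum_prod_type]
    simp only [hsr, ← Finset.mul_sum]
    rw [mul_comm]
  · rw [hRow x hx, hdiv]
    exact hrΓ a
  · rw [hCol x hx, hdiv]
    exact hcΓ b
  · simp only [hRow x hx, hCol x hx, hdiv]
    have h12 : Φ = _ := fibInt_tiltDens (m := m + 1) (n := n + 1) μ hp (fun i => α (d i))
      (fun j => β (d' j)) hrc
    rw [h12, sum_comp_cloning hd fun a => (k * ∑ b, z a b) * α a,
      sum_comp_cloning hd' fun b => (k * ∑ a, z a b) * β b, Finset.mul_sum, Finset.mul_sum]
    have h15 : ∑ a, (k : ℝ) * ((k * ∑ b, z a b) * α a) = ∑ a, (k ^ 2 * ∑ b, z a b) * α a :=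
      Finset.sum_congr rfl fun a _ => by ring
    have h16 : ∑ b, (k : ℝ) * ((k * ∑ a, z a b) * β b) = ∑ b, (k ^ 2 * ∑ a, z a b) * β b :=
      Finset.sum_congr rfl fun b _ => by ring
    rw [h15, h16]

end fast

/-! ### The base measures with interval weights -/

section weights

/-- The interval `[0, b]`, or `[0, ∞)` if `b = ⊤`. -/
def intervalTo (b : ℕ∞) : Set ℝ := {x | 0 ≤ x ∧ ∀ n : ℕ, b = n → x ≤ n}

theorem measurableSet_intervalTo (b : ℕ∞) : MeasurableSet (intervalTo b) := by
  cases b with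
  | top =>
    have : intervalTo ⊤ = Set.Ici 0 := by
      ext x
      simp [intervalTo]
    exact this ▸ measurableSet_Ici
  | coe b =>
    have : intervalTo b = Set.Icc 0 (b : ℝ) := by
      ext x
      simp [intervalTo]
    exact this ▸ measurableSet_Icc

theorem intervalTo_top : intervalTo ⊤ = Set.Ici 0 := by
  ext x
  simp [intervalTo]

theorem intervalWt_indicator {S : Set ℝ}
    (h : ∀ D, ∃ R, ∀ x, (x ∈ S ∧ D - x ∈ S) ↔ x ∈ centeredIcc D R) : IntervalWt (S.indicator 1) := by
  classical
  intro D
  obtain ⟨R, hR⟩ := h D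
  refine ⟨R, fun x => ?_⟩
  simp only [Set.indicator_apply, ← hR x, Pi.one_apply]
  by_cases h1 : x ∈ S <;> by_cases h2 : D - x ∈ S <;> simp [h1, h2]

theorem intervalWt_intervalTo (b : ℕ∞) : IntervalWt ((intervalTo b).indicator 1) := by
  refine intervalWt_indicator fun D => ?_
  cases b with
  | top =>
    refine ⟨D, fun x => ?_⟩
    simp only [intervalTo_top, Set.mem_Ici, centeredIcc, Set.mem_ofPred_eq, abs_le]
    exact ⟨fun h => ⟨by linarith, by linarith⟩, fun h => ⟨by linarith, by linarith⟩⟩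
  | coe b =>
    -- Nonnegativity of `x` and `D - x` says `|2 x - D| ≤ D`, and both being at most `b` says `|2 x
    -- - D| ≤ 2 b - D`. A negative radius encodes the empty set.
    refine ⟨min D (2 * b - D), fun x => ?_⟩
    simp only [intervalTo, forall_eq', centeredIcc, Set.mem_ofPred_eq, abs_le,
      le_min_iff, neg_le, Nat.cast_inj]
    exact ⟨fun h => ⟨⟨by linarith, by linarith⟩, by linarith, by linarith⟩,
      fun h => ⟨⟨by linarith, by linarith⟩, by linarith, by linarith⟩⟩

theorem countUpTo_eq (b : ℕ∞) :
    intCount.withDensity ((intervalTo b).indicator 1) = countUpTo b := by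
  rw [withDensity_indicator_one (measurableSet_intervalTo b)]
  ext s hs
  rw [Measure.restrict_apply hs, intCount_apply, countUpTo,
    Measure.map_apply (by fun_prop) hs, Measure.restrict_apply (measurable_from_top hs),
    ← Measure.count_injective_image (Nat.cast_injective (R := ℤ))]
  congr 1
  ext z
  simp only [Set.mem_preimage, Set.mem_inter_iff, Set.mem_image, intervalTo, Set.mem_ofPred_eq]
  constructor
  · rintro ⟨h1, h2, h3⟩
    lift z to ℕ using by exact_mod_cast h2
    refine ⟨z, ⟨by simpa using h1, ?_⟩, rfl⟩
    cases b with
    | top => exact le_top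
    | coe b =>
      have := h3 b rfl
      exact_mod_cast this
  · rintro ⟨j, ⟨h1, h2⟩, rfl⟩
    refine ⟨by simpa using h1, by positivity, fun n hn => ?_⟩
    subst hn
    exact_mod_cast h2

theorem lebNonneg_eq :
    (volume : Measure ℝ).withDensity ((Set.Ici (0 : ℝ)).indicator 1) = lebNonneg :=
  withDensity_indicator_one measurableSet_Ici

instance (b : ℕ∞) : SigmaFinite (countUpTo b) := by
  rw [← countUpTo_eq, withDensity_indicator_one (measurableSet_intervalTo b)]
  infer_instance

instance : SigmaFinite lebNonneg := by
  unfold lebNonneg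
  infer_instance

theorem condLawEqFib_countUpTo (b : ℕ∞) :
    CondLawEqFib intCount intSubgroup (countUpTo b) ((intervalTo b).indicator 1) := by
  have : SigmaFinite (intCount.withDensity ((intervalTo b).indicator 1)) := by
    rw [countUpTo_eq]
    infer_instance
  have := condLawEqFib_intCount (p := (intervalTo b).indicator 1)
    (measurable_one.indicator (measurableSet_intervalTo b))
  rwa [countUpTo_eq] at this

theorem condLawEqFib_lebNonneg :
    CondLawEqFib volume ⊤ lebNonneg ((Set.Ici (0 : ℝ)).indicator 1) := by
  have : SigmaFinite ((volume : Measure ℝ).withDensity ((Set.Ici (0 : ℝ)).indicator 1)) := by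
    rw [lebNonneg_eq]
    infer_instance
  have := condLawEqFib_volume (p := (Set.Ici (0 : ℝ)).indicator 1)
    (measurable_one.indicator measurableSet_Ici)
  rwa [lebNonneg_eq] at this

theorem InTameRange.pos {μ : Measure ℝ} {δ z : ℝ} (hδ : 0 < δ) (h : InTameRange μ δ z)
    (hμ : μ (Set.Iio 0) = 0) : 0 < z := by
  obtain ⟨x, hx, hxz⟩ := h.exists_lt hδ
  by_contra! hz
  exact ((Measure.mem_support_iff_forall _).1 hx _ (Iio_mem_nhds (hxz.trans_le hz))).ne' hμ

theorem countUpTo_Iio (b : ℕ∞) : countUpTo b (Set.Iio 0) = 0 := by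
  rw [← countUpTo_eq, withDensity_indicator_one (measurableSet_intervalTo b),
    Measure.restrict_apply measurableSet_Iio]
  have : Set.Iio 0 ∩ intervalTo b = ∅ := by
    ext x
    simp only [intervalTo, Set.mem_inter_iff, Set.mem_Iio, Set.mem_ofPred_eq,
      Set.mem_empty_iff_false, iff_false]
    intro h
    linarith [h.2.1]
  rw [this, measure_empty]

theorem lebNonneg_Iio : lebNonneg (Set.Iio 0) = 0 := by
  rw [lebNonneg, Measure.restrict_apply measurableSet_Iio, Set.Iio_inter_Ici, Set.Ico_self,
    measure_empty]

theorem ae_tiltDens_le_one {μ : Measure ℝ} [NeZero μ] {p : ℝ → ℝ≥0∞} (hp : Measurable p)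
    (hμ : intCount.withDensity p = μ) {θ : ℝ} (hθ : θ ∈ tiltDomain μ) :
    ∀ᵐ x ∂intCount, tiltDens μ p θ x ≤ 1 := by
  filter_upwards [isLattice_intCount.ae_mem] with x hx
  obtain ⟨z, rfl⟩ := mem_intSubgroup.1 hx
  have := isProbabilityMeasure_tilt hθ
  have h1 := prob_le_one (μ := tilt μ θ) (s := {(z : ℝ)})
  rwa [← withDensity_tiltDens hp hμ hθ, withDensity_apply _ (measurableSet_singleton _),
    Measure.restrict_singleton, lintegral_smul_measure, lintegral_dirac, intCount_singleton,
    one_smul] at h1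

theorem neg_of_mem_tiltDomain_lebNonneg {θ : ℝ} (hθ : θ ∈ tiltDomain lebNonneg) : θ < 0 := by
  by_contra! h
  have h1 : IntegrableOn (fun x => Real.exp (θ * x)) (Set.Ici 0) := integrable_exp_of_mem hθ
  have h2 : IntegrableOn (fun _ => (1 : ℝ)) (Set.Ici (0 : ℝ)) := by
    refine Integrable.mono' h1 (by fun_prop) ?_
    filter_upwards [ae_restrict_mem measurableSet_Ici] with x hx
    rw [norm_one, Real.one_le_exp_iff]
    exact mul_nonneg h hx
  rw [integrableOn_const_iff] at h2
  simp at h2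

theorem tiltDens_lebNonneg_le {θ : ℝ} (hθ : θ < 0) (x : ℝ) :
    tiltDens lebNonneg ((Set.Ici (0 : ℝ)).indicator 1) θ x ≤
      (Real.exp (-logPartition lebNonneg θ)).toNNReal := by
  rw [tiltDens]
  by_cases hx : x ∈ Set.Ici (0 : ℝ)
  · rw [Set.indicator_of_mem hx, Pi.one_apply, mul_one]
    refine ENNReal.ofReal_le_ofReal (Real.exp_le_exp.2 ?_)
    have := mul_nonpos_of_nonpos_of_nonneg hθ.le hx
    linarith
  · simp [Set.indicator_of_notMem hx]

end weights

/-! ### Convergence at the fast rate -/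

section fastConverges
variable {m₀ n₀ : ℕ} {r₀ : Fin m₀ → ℝ} {c₀ : Fin n₀ → ℝ} {α : Fin m₀ → ℝ} {β : Fin n₀ → ℝ} {δ : ℝ}

theorem le_max_mul_log {k : ℕ} (C : ℝ) (hlog : 1 ≤ Real.log k) :
    (k : ℝ) ≤ max C 1 * (k * Real.log k) := by
  have h1 : (0 : ℝ) ≤ k := Nat.cast_nonneg k
  calc (k : ℝ) = 1 * (k * 1) := by ring
    _ ≤ _ := by gcongr; exact le_max_right _ _

theorem ofReal_exp_neg_max_le {k : ℕ} (C : ℝ) :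
    ENNReal.ofReal (Real.exp (-(max C 1 * (k * Real.log k)))) ≤
      ENNReal.ofReal (Real.exp (-(C * (k * Real.log k)))) := by
  have hlog : 0 ≤ Real.log k := Real.log_natCast_nonneg k
  refine ENNReal.ofReal_le_ofReal (Real.exp_le_exp.2 (neg_le_neg ?_))
  gcongr
  exact le_max_left _ _

theorem convergesTV_countUpTo (b : ℕ∞) (hm : 0 < m₀) (hn : 0 < n₀) (hδ : 0 < δ)
    (hMLE : IsMLE (countUpTo b) r₀ c₀ α β)
    (htame : ∀ i j, InTameRange (countUpTo b) δ (tiltMean (countUpTo b) (α i + β j))) :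
    ConvergesTV (cornerLaw (countUpTo b) r₀ c₀) (tilt (countUpTo b) (α ⟨0, hm⟩ + β ⟨0, hn⟩))
      (atTopIntegral r₀ c₀) fastRate := by
  have : NeZero (countUpTo b) := (htame ⟨0, hm⟩ ⟨0, hn⟩).neZero hδ
  have hp : Measurable ((intervalTo b).indicator (1 : ℝ → ℝ≥0∞)) :=
    measurable_one.indicator (measurableSet_intervalTo b)
  have hmem : ∀ x, (intervalTo b).indicator (1 : ℝ → ℝ≥0∞) x ≠ 0 ↔ x ∈ intervalTo b := fun x => by
    rw [← Function.mem_support, Set.support_indicator]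
    simp
  obtain ⟨u, c, η, B, hη, hc, hc1, hz, hcE⟩ := exists_grid_intCount (countUpTo_eq b)
    (fun u v w hu hv huw hwv => by
      rw [hmem] at hu hv ⊢
      refine ⟨hu.1.trans (by exact_mod_cast huw), fun n hn => le_trans ?_ (hv.2 n hn)⟩
      exact_mod_cast hwv) hm hn hδ htame
  obtain ⟨C, -, hev⟩ := exists_fast_lower_bound_intCount hp (intervalWt_intervalTo b)
    (fun x hx => ((hmem x).1 hx).1) (countUpTo_eq b) hm hn hMLE.1 hη hc hc1 hz
    (fun a b' => ((htame a b').pos hδ (countUpTo_Iio b)).le) hcE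
  simp only [hMLE.sum_row, hMLE.sum_col] at hev
  refine isLattice_intCount.convergesTV hp (countUpTo_eq b) (condLawEqFib_countUpTo b) hMLE hm hn
    ⟨1, fun a b' => ae_tiltDens_le_one hp (countUpTo_eq b) (hMLE.1 a b')⟩ atTopIntegral_le
    eventually_atTopIntegral (e := fun k => max C 1 * (k * Real.log k))
    (atTopIntegral_le <| (eventually_log_ge 1).mono fun k hk => le_max_mul_log C hk)
    (sqrt_fast_isBigO _) tendsto_fastRate ?_
  filter_upwards [atTopIntegral_le hev, eventually_atTopIntegral (r₀ := r₀) (c₀ := c₀)]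
    with k hk hΓk
  exact (ofReal_exp_neg_max_le C).trans
    (hk (m₀ * k) (n₀ * k) _ _ card_divNat card_divNat hΓk.1 hΓk.2)

theorem lebNonneg_props :
    Measurable ((Set.Ici (0 : ℝ)).indicator (1 : ℝ → ℝ≥0∞)) ∧
    IntervalWt ((Set.Ici (0 : ℝ)).indicator 1) ∧
    (∀ x, (Set.Ici (0 : ℝ)).indicator (1 : ℝ → ℝ≥0∞) x ≠ 0 → 0 ≤ x) ∧
    (∀ x t, 0 ≤ t → (Set.Ici (0 : ℝ)).indicator (1 : ℝ → ℝ≥0∞) x ≤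
      (Set.Ici (0 : ℝ)).indicator 1 (x + t)) ∧
    ∀ s x : ℝ, 0 < s → (Set.Ici (0 : ℝ)).indicator (1 : ℝ → ℝ≥0∞) (s * x) =
      (Set.Ici (0 : ℝ)).indicator 1 x := by
  classical
  refine ⟨measurable_one.indicator measurableSet_Ici,
    intervalTo_top ▸ intervalWt_intervalTo ⊤, fun x hx => ?_, fun x t ht => ?_, fun s x hs => ?_⟩
  · by_contra h
    exact hx (Set.indicator_of_notMem h _)
  · simp only [Set.indicator_apply, Set.mem_Ici, Pi.one_apply]
    split_ifs with h1 h2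
    · exact le_rfl
    · exact absurd (add_nonneg h1 ht) h2
    · exact zero_le
    · exact le_rfl
  · simp only [Set.indicator_apply, Set.mem_Ici, mul_nonneg_iff_of_pos_left hs,
      Pi.one_apply]

theorem exists_fast_lower_bound_lebNonneg [NeZero lebNonneg] (hm : 0 < m₀) (hn : 0 < n₀)
    (hdom : ∀ a b, α a + β b ∈ tiltDomain lebNonneg)
    (hz : ∀ a b, 0 < tiltMean lebNonneg (α a + β b)) :
    ∃ C' > 0, ∀ᶠ k : ℕ in atTop, ∀ (N N' : ℕ) (d : Fin N → Fin m₀) (d' : Fin N' → Fin n₀),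
      (∀ a, (Finset.univ.filter fun i => d i = a).card = k) →
      (∀ b, (Finset.univ.filter fun j => d' j = b).card = k) →
      ENNReal.ofReal (Real.exp (-(C' * (k * Real.log k)))) ≤
        fibInt volume (prodWt fun i j =>
            tiltDens lebNonneg ((Set.Ici (0 : ℝ)).indicator 1) (α (d i) + β (d' j)))
          (fun i => k * ∑ b, tiltMean lebNonneg (α (d i) + β b))
          (fun j => k * ∑ a, tiltMean lebNonneg (α a + β (d' j))) :=
  exists_fast_lower_bound_volume lebNonneg_props.1 lebNonneg_props.2.1 lebNonneg_props.2.2.1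
    lebNonneg_props.2.2.2.1 lebNonneg_props.2.2.2.2 lebNonneg_eq hm hn hdom hz

theorem exists_tiltDens_lebNonneg_le (hdom : ∀ a b, α a + β b ∈ tiltDomain lebNonneg) :
    ∃ M : ℝ≥0, ∀ a b, ∀ᵐ x,
      tiltDens lebNonneg ((Set.Ici (0 : ℝ)).indicator 1) (α a + β b) x ≤ M := by
  refine ⟨∑ a, ∑ b, (Real.exp (-logPartition lebNonneg (α a + β b))).toNNReal, fun a b =>
    ae_of_all _ fun x => (tiltDens_lebNonneg_le
      (neg_of_mem_tiltDomain_lebNonneg (hdom a b)) x).trans (ENNReal.coe_le_coe.2 ?_)⟩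
  exact (Finset.single_le_sum (f := fun b =>
      (Real.exp (-logPartition lebNonneg (α a + β b))).toNNReal) (fun _ _ => zero_le)
      (Finset.mem_univ b)).trans
    (Finset.single_le_sum (f := fun a =>
      ∑ b, (Real.exp (-logPartition lebNonneg (α a + β b))).toNNReal) (fun _ _ => zero_le)
      (Finset.mem_univ a))

theorem convergesTV_lebNonneg (hm : 0 < m₀) (hn : 0 < n₀) (hδ : 0 < δ)
    (hMLE : IsMLE lebNonneg r₀ c₀ α β)
    (htame : ∀ i j, InTameRange lebNonneg δ (tiltMean lebNonneg (α i + β j))) :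
    ConvergesTV (cornerLaw lebNonneg r₀ c₀) (tilt lebNonneg (α ⟨0, hm⟩ + β ⟨0, hn⟩))
      atTop fastRate := by
  have : NeZero lebNonneg := (htame ⟨0, hm⟩ ⟨0, hn⟩).neZero hδ
  obtain ⟨C, -, hev⟩ := exists_fast_lower_bound_lebNonneg hm hn hMLE.1
    fun a b => (htame a b).pos hδ lebNonneg_Iio
  simp only [hMLE.sum_row, hMLE.sum_col] at hev
  refine isLattice_volume.convergesTV lebNonneg_props.1 lebNonneg_eq condLawEqFib_lebNonneg hMLE hm
    hn (exists_tiltDens_lebNonneg_le hMLE.1) le_rfl (Eventually.of_forall fun k => by simp)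
    (e := fun k => max C 1 * (k * Real.log k))
    ((eventually_log_ge 1).mono fun k hk => le_max_mul_log C hk)
    (sqrt_fast_isBigO _) tendsto_fastRate ?_
  filter_upwards [hev] with k hk
  exact (ofReal_exp_neg_max_le C).trans (hk (m₀ * k) (n₀ * k) _ _ card_divNat card_divNat)

end fastConverges

/-! ### The tilts as Bernoulli, geometric and exponential laws -/

section laws

theorem countUpTo_top : countUpTo ⊤ = Measure.sum fun j : ℕ => Measure.dirac (j : ℝ) := by
  ext s hs
  have h : {j : ℕ | (j : ℕ∞) ≤ ⊤} = Set.univ := by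
    ext j
    simp
  rw [countUpTo, h, Measure.restrict_univ, Measure.map_apply (by fun_prop) hs, Measure.count,
    Measure.sum_apply _ (measurable_from_top hs), Measure.sum_apply _ hs]
  refine tsum_congr fun j => ?_
  rw [Measure.dirac_apply' _ (measurable_from_top hs), Measure.dirac_apply' _ hs]
  rfl

theorem countUpTo_one : countUpTo 1 = Measure.dirac 0 + Measure.dirac 1 := by
  classical
  ext s hs
  have h : {j : ℕ | (j : ℕ∞) ≤ 1} = {0, 1} := by
    ext j
    simp only [Set.mem_ofPred_eq, Set.mem_insert_iff, Set.mem_singleton_iff]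
    rw [← Nat.cast_one, Nat.cast_le]
    omega
  rw [countUpTo, h, Measure.map_apply (by fun_prop) hs,
    Measure.restrict_apply (measurable_from_top hs), Measure.count,
    Measure.sum_apply _ MeasurableSpace.measurableSet_top, tsum_eq_sum (s := Finset.range 2)]
  · rw [Finset.sum_range_succ, Finset.sum_range_one, Measure.add_apply, Measure.dirac_apply' _ hs,
      Measure.dirac_apply' _ hs]
    simp [Set.indicator_apply]
  · intro j hj
    have h2 : j ≠ 0 ∧ j ≠ 1 := by
      rw [Finset.mem_range] at hj
      omega
    simp [h2.1, h2.2]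

variable {θ : ℝ}

theorem tilt_countUpTo_one [NeZero (countUpTo 1)] (hθ : θ ∈ tiltDomain (countUpTo 1)) :
    tilt (countUpTo 1) θ = bernoulliLaw (tiltMean (countUpTo 1) θ) := by
  have hψ : ∀ θ ∈ tiltDomain (countUpTo 1),
      Real.exp (logPartition (countUpTo 1) θ) = 1 + Real.exp θ := fun θ hθ => by
    rw [exp_logPartition hθ, countUpTo_one, integral_add_measure (integrable_dirac (by simp))
      (integrable_dirac (by simp)), integral_dirac, integral_dirac, mul_zero, mul_one, Real.exp_zero]
  have hz : tiltMean (countUpTo 1) θ = Real.exp θ / (1 + Real.exp θ) := by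
    have h1 : HasDerivAt (fun θ => Real.log (1 + Real.exp θ)) (Real.exp θ / (1 + Real.exp θ)) θ :=
      ((Real.hasDerivAt_exp θ).const_add 1).log (by positivity)
    refine (h1.congr_of_eventuallyEq ?_).deriv
    filter_upwards [isOpen_tiltDomain.mem_nhds hθ] with t ht
    rw [← hψ t ht, Real.log_exp]
  have h1 : (0 : ℝ) < 1 + Real.exp θ := by positivity
  have hL := hψ θ hθ
  rw [tilt_eq_withDensity hθ, bernoulliLaw, hz]
  generalize logPartition (countUpTo 1) θ = L at hL ⊢
  rw [countUpTo_one, withDensity_add_measure, dirac_withDensity, dirac_withDensity]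
  simp only [Real.exp_sub, hL, mul_zero, mul_one, Real.exp_zero]
  congr 3
  field_simp
  ring

theorem tilt_countUpTo_top [NeZero (countUpTo ⊤)] (hθ : θ ∈ tiltDomain (countUpTo ⊤)) :
    tilt (countUpTo ⊤) θ = geometricLaw (tiltMean (countUpTo ⊤) θ) := by
  have hform : ∀ θ ∈ tiltDomain (countUpTo ⊤), tilt (countUpTo ⊤) θ =
      Measure.sum fun j : ℕ => ENNReal.ofReal
        (Real.exp (-logPartition (countUpTo ⊤) θ) * Real.exp θ ^ j) • Measure.dirac (j : ℝ) := by
    intro θ hθ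
    rw [tilt_eq_withDensity hθ]
    generalize logPartition (countUpTo ⊤) θ = L
    rw [countUpTo_top, withDensity_sum]
    congr 1
    ext1 j
    rw [dirac_withDensity]
    congr 2
    rw [← Real.exp_nat_mul, ← Real.exp_add]
    congr 1
    ring
  -- The tilt has total mass one, so its point masses form a convergent geometric series:
  -- convergence gives `exp θ < 1` and the value of the sum gives the normalizing constant.
  have hψ : ∀ θ ∈ tiltDomain (countUpTo ⊤), Real.exp θ < 1 ∧
      Real.exp (-logPartition (countUpTo ⊤) θ) = 1 - Real.exp θ := by
    intro θ hθ
    have := isProbabilityMeasure_tilt hθ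
    have h1 := measure_univ (μ := tilt (countUpTo ⊤) θ)
    rw [hform θ hθ, Measure.sum_apply _ MeasurableSet.univ] at h1
    simp only [Measure.smul_apply, measure_univ, smul_eq_mul, mul_one] at h1
    have h2 : Summable fun j : ℕ =>
        Real.exp (-logPartition (countUpTo ⊤) θ) * Real.exp θ ^ j := by
      have h3 := ENNReal.summable_toReal (h1 ▸ ENNReal.one_ne_top)
      refine h3.congr fun j => ENNReal.toReal_ofReal (by positivity)
    rw [← ENNReal.ofReal_tsum_of_nonneg (fun j => by positivity) h2, ENNReal.ofReal_eq_one,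
      tsum_mul_left] at h1
    have h3 : Real.exp θ < 1 := by
      have := (summable_mul_left_iff (Real.exp_ne_zero _)).1 h2
      rw [summable_geometric_iff_norm_lt_one, Real.norm_of_nonneg (Real.exp_pos θ).le] at this
      exact this
    rw [tsum_geometric_of_lt_one (Real.exp_pos θ).le h3] at h1
    exact ⟨h3, eq_of_mul_inv_eq_one h1⟩
  obtain ⟨hlt, hψθ⟩ := hψ θ hθ
  have h1 : 0 < 1 - Real.exp θ := by linarith
  have hz : tiltMean (countUpTo ⊤) θ = Real.exp θ / (1 - Real.exp θ) := by
    have h2 : HasDerivAt (fun θ => -Real.log (1 - Real.exp θ)) (Real.exp θ / (1 - Real.exp θ)) θ := by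
      have := (((Real.hasDerivAt_exp θ).const_sub 1).log h1.ne').neg
      rwa [neg_div, neg_neg] at this
    refine (h2.congr_of_eventuallyEq ?_).deriv
    filter_upwards [isOpen_tiltDomain.mem_nhds hθ] with t ht
    rw [← (hψ t ht).2, Real.log_exp, neg_neg]
  rw [hform θ hθ, geometricLaw, hz, hψθ]
  congr 1
  ext1 j
  have h2 : 1 + Real.exp θ / (1 - Real.exp θ) = (1 - Real.exp θ)⁻¹ := by
    field_simp
    ring
  rw [h2]
  congr 3
  · rw [one_div, inv_inv]
  · field_simp

instance : NeZero lebNonneg := ⟨fun h => by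
  have : lebNonneg Set.univ = 0 := by rw [h]; rfl
  simp [lebNonneg] at this⟩

theorem mem_tiltDomain_lebNonneg (hθ : θ < 0) : θ ∈ tiltDomain lebNonneg := by
  refine mem_interior.2 ⟨Set.Iio 0, fun t ht => ?_, isOpen_Iio, hθ⟩
  change IntegrableOn (fun x => Real.exp (t * x)) (Set.Ici 0) volume
  rw [integrableOn_Ici_iff_integrableOn_Ioi]
  exact integrableOn_exp_mul_Ioi ht 0

theorem exp_logPartition_lebNonneg (hθ : θ < 0) :
    Real.exp (logPartition lebNonneg θ) = (-θ)⁻¹ := by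
  rw [exp_logPartition (mem_tiltDomain_lebNonneg hθ), lebNonneg, integral_Ici_eq_integral_Ioi,
    integral_exp_mul_Ioi hθ, mul_zero, Real.exp_zero, neg_div, one_div, inv_neg]

theorem tiltMean_lebNonneg (hθ : θ < 0) : tiltMean lebNonneg θ = (-θ)⁻¹ := by
  have h2 : HasDerivAt (fun θ => -Real.log (-θ)) (-(-1 / -θ)) θ :=
    ((hasDerivAt_neg θ).log (by linarith)).neg
  rw [show (-θ)⁻¹ = -(-1 / -θ) by rw [neg_div, neg_neg, one_div]]
  refine (h2.congr_of_eventuallyEq ?_).deriv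
  filter_upwards [Iio_mem_nhds hθ] with t ht
  rw [← Real.log_inv, ← exp_logPartition_lebNonneg ht, Real.log_exp]

theorem tilt_lebNonneg_neg_one : tilt lebNonneg (-1) = expMeasure 1 := by
  classical
  rw [← withDensity_tiltDens lebNonneg_props.1 lebNonneg_eq (mem_tiltDomain_lebNonneg (by norm_num)),
    expMeasure, gammaMeasure]
  congr 1
  ext x
  have h0 : logPartition lebNonneg (-1) = 0 := by
    rw [← Real.exp_eq_one_iff, exp_logPartition_lebNonneg (by norm_num)]
    norm_num
  have h1 : gammaPDF 1 1 x = exponentialPDF 1 x := rfl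
  rw [h1, exponentialPDF_eq, tiltDens, h0, Set.indicator_apply]
  by_cases hx : 0 ≤ x <;> simp [hx]

end laws

/-! ### Scaling, and doubly stochastic matrices -/

section scaling
variable {m n : ℕ}

theorem measurable_corner : Measurable (corner : (Fin m → Fin n → ℝ) → ℝ) := by
  unfold corner
  split_ifs <;> fun_prop

theorem corner_smul (s : ℝ) (x : Fin m → Fin n → ℝ) : corner (s • x) = s * corner x := by
  unfold corner
  split_ifs <;> simp

/-- Scaling of the conditioned laws of a scale-invariant weight. -/
theorem map_smul_condLaw {p : ℝ → ℝ≥0∞} (hp : Measurable p)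
    [SigmaFinite ((volume : Measure ℝ).withDensity p)] {s : ℝ} (hs : 0 < s)
    (hps : ∀ x, p (s * x) = p x) {r : Fin (m + 2) → ℝ} {c : Fin (n + 2) → ℝ}
    (hrc : ∑ i, r i = ∑ j, c j) :
    (condLaw ((volume : Measure ℝ).withDensity p) r c).map (s • ·) =
      condLaw ((volume : Measure ℝ).withDensity p) (s • r) (s • c) := by
  have h : ∀ (_ : Fin (m + 2)) (_ : Fin (n + 2)),
      ((volume : Measure ℝ).withDensity p).rnDeriv volume =ᵐ[volume] p :=
    fun _ _ => Measure.rnDeriv_withDensity volume hp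
  have hlaw : ∀ (r : Fin (m + 2) → ℝ) (c : Fin (n + 2) → ℝ),
      condLaw ((volume : Measure ℝ).withDensity p) r c =
        (fibInt volume (prodWt fun _ _ => p) r c)⁻¹ • fib volume (prodWt fun _ _ => p) r c := by
    intro r c
    rw [condLaw_volume hp, isLattice_volume.fib_congr (fun _ => trivial) (fun _ => trivial) h,
      isLattice_volume.fibInt_congr (fun _ => trivial) (fun _ => trivial) h]
  have hF : Measurable (prodWt fun (_ : Fin (m + 2)) (_ : Fin (n + 2)) => p) :=
    measurable_prodWt fun _ _ => hp
  have hFs : ∀ x : Fin (m + 2) → Fin (n + 2) → ℝ,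
      prodWt (fun _ _ => p) (s • x) = prodWt (fun _ _ => p) x := fun x =>
    Finset.prod_congr rfl fun i _ => Finset.prod_congr rfl fun j _ => hps _
  have hms : Measurable fun x : Fin (m + 2) → Fin (n + 2) → ℝ => s • x := by fun_prop
  have ha : ENNReal.ofReal (s ^ ((m + 1) * (n + 1))) ≠ 0 := by
    rw [ENNReal.ofReal_ne_zero_iff]
    positivity
  ext E hE
  rw [Measure.map_apply hms hE, hlaw, hlaw, Measure.smul_apply, Measure.smul_apply,
    fib_apply hF (hms hE), fib_apply hF hE, fibInt_smul _ hrc hs, fibInt_smul _ hrc hs, smul_eq_mul,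
    smul_eq_mul]
  simp only [hFs]
  rw [ENNReal.mul_inv (Or.inl ha) (Or.inl ENNReal.ofReal_ne_top), mul_mul_mul_comm,
    ENNReal.inv_mul_cancel ha ENNReal.ofReal_ne_top, one_mul]
  rfl

/-- The weight of `[0, ∞)` is invariant under scaling, and `k` times a doubly stochastic `k × k`
matrix has the margin of the `k`-cloning of the `1 × 1` margin `(1)`. -/
theorem condLaw_lebNonneg_map_corner {k : ℕ} (hk : 2 ≤ k) :
    (condLaw lebNonneg (fun _ : Fin k => 1) (fun _ : Fin k => 1)).map (fun x => (k : ℝ) * corner x) =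
      (condLaw lebNonneg (fun _ : Fin k => (k : ℝ)) (fun _ : Fin k => (k : ℝ))).map corner := by
  obtain ⟨m, rfl⟩ : ∃ m, k = m + 2 := ⟨k - 2, by omega⟩
  have hk0 : (0 : ℝ) < (m + 2 : ℕ) := by positivity
  have : SigmaFinite ((volume : Measure ℝ).withDensity ((Set.Ici (0 : ℝ)).indicator 1)) := by
    rw [lebNonneg_eq]
    infer_instance
  have h := map_smul_condLaw (m := m) (n := m) lebNonneg_props.1 hk0
    (fun x => lebNonneg_props.2.2.2.2 _ x hk0) (r := fun _ => 1) (c := fun _ => 1) rfl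
  rw [lebNonneg_eq] at h
  have h1 : (fun _ : Fin (m + 2) => (((m + 2 : ℕ) : ℝ))) =
      ((m + 2 : ℕ) : ℝ) • fun _ : Fin (m + 2) => (1 : ℝ) := by
    ext
    simp
  rw [h1, ← h, Measure.map_map measurable_corner (by fun_prop)]
  exact congrArg (Measure.map · _) (funext fun x => (corner_smul _ x).symm)

/-- The rescaled entries of uniformly random doubly stochastic matrices. -/
theorem convergesTV_doublyStochastic :
    ConvergesTV
      (fun k => (condLaw lebNonneg (fun _ : Fin k => 1) (fun _ : Fin k => 1)).map
        fun x => (k : ℝ) * corner x)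
      (expMeasure 1) atTop fastRate := by
  -- The parameters of the `1 × 1` margin `(1)`: Lebesgue measure on the half-line tilted by `-1` is
  -- the exponential law, which has mean `1`.
  have hdom : ∀ a b : Fin 1, (fun _ : Fin 1 => (-1 : ℝ)) a + (fun _ : Fin 1 => (0 : ℝ)) b ∈
      tiltDomain lebNonneg := fun _ _ => mem_tiltDomain_lebNonneg (by norm_num)
  have hz : tiltMean lebNonneg (-1 + 0) = 1 := by
    rw [tiltMean_lebNonneg (by norm_num)]
    norm_num
  obtain ⟨C, -, hev⟩ := exists_fast_lower_bound_lebNonneg one_pos one_pos hdom fun _ _ => by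
    rw [hz]
    exact one_pos
  obtain ⟨M, hM⟩ := exists_tiltDens_lebNonneg_le hdom
  refine convergesTV_of_le le_rfl (e := fun k => max C 1 * (k * Real.log k)) (sqrt_fast_isBigO _)
    tendsto_fastRate
    (C := 4 * √(2 + ((1 : ℕ) + (1 : ℕ)) * Real.log (max M 1 : ℝ≥0)) + 2) ?_
  filter_upwards [hev, eventually_log_ge 1, eventually_ge_atTop 2] with k hk hlog hk2
  have hcard : ∀ a : Fin 1, (Finset.univ.filter fun i : Fin k => (0 : Fin 1) = a).card = k :=
    fun a => by simp [Subsingleton.elim a 0]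
  have h1 := hk k k (fun _ => 0) (fun _ => 0) hcard hcard
  have key := isLattice_volume.tv_corner_le (M := max M 1) lebNonneg_props.1 lebNonneg_eq
    condLawEqFib_lebNonneg hdom (r₀ := fun _ => 1) (c₀ := fun _ => 1) rfl (le_max_right _ _)
    (fun a b => (hM a b).mono fun x hx => hx.trans (by exact_mod_cast le_max_left _ _)) hk2
    (fun _ : Fin k => (0 : Fin 1)) (fun _ : Fin k => (0 : Fin 1)) (by omega) (by omega) hcard hcard
    (fun _ => trivial) (fun _ => trivial) (le_max_mul_log C hlog)
    ((ofReal_exp_neg_max_le C).trans (by simpa only [hz, Fin.sum_univ_one] using h1))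
  rw [condLaw_lebNonneg_map_corner hk2, ← tilt_lebNonneg_neg_one]
  simpa only [mul_one, add_zero] using key

end scaling

end MarginCond

theorem mainTheorem10 :
    (∀ (m₀ n₀ : ℕ) (hm : 0 < m₀) (hn : 0 < n₀) (μ : Measure ℝ) [SigmaFinite μ]
        (r₀ : Fin m₀ → ℝ) (c₀ : Fin n₀ → ℝ) (α₀ : Fin m₀ → ℝ) (β₀ : Fin n₀ → ℝ) (δ : ℝ),
      0 < δ → IsMLE μ r₀ c₀ α₀ β₀ →
      (∀ i j, InTameRange μ δ (tiltMean μ (α₀ i + β₀ j))) →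
      -- `condLaw` is a version of the conditional law given the margin
      ((μ ≪ intCount ∨ μ ≪ volume) → ∀ m n : ℕ, 0 < m → 0 < n →
        IsMarginDisintegration μ m n fun t => condLaw μ t.1 t.2) ∧
      -- general densities on `ℤ` and on `ℝ`
      (HasTameDensity μ intCount δ →
        ConvergesTV (cornerLaw μ r₀ c₀) (tilt μ (α₀ ⟨0, hm⟩ + β₀ ⟨0, hn⟩))
          (atTopIntegral r₀ c₀) slowRate) ∧
      (HasTameDensity μ volume δ →
        ConvergesTV (cornerLaw μ r₀ c₀) (tilt μ (α₀ ⟨0, hm⟩ + β₀ ⟨0, hn⟩)) atTop slowRate) ∧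
      -- counting measure on an integer interval, Lebesgue measure on the half-line
      ((∃ b : ℕ∞, μ = countUpTo b) →
        ConvergesTV (cornerLaw μ r₀ c₀) (tilt μ (α₀ ⟨0, hm⟩ + β₀ ⟨0, hn⟩))
          (atTopIntegral r₀ c₀) fastRate) ∧
      (μ = lebNonneg →
        ConvergesTV (cornerLaw μ r₀ c₀) (tilt μ (α₀ ⟨0, hm⟩ + β₀ ⟨0, hn⟩)) atTop fastRate) ∧
      -- Bernoulli and geometric limits for binary and for unbounded contingency tables
      (μ = countUpTo 1 → ∃ Z, IsTypicalTable μ r₀ c₀ Z ∧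
        (∀ Z', IsTypicalTable μ r₀ c₀ Z' → Z' = Z) ∧
        ConvergesTV (cornerLaw μ r₀ c₀) (bernoulliLaw (Z ⟨0, hm⟩ ⟨0, hn⟩))
          (atTopIntegral r₀ c₀) fastRate) ∧
      (μ = countUpTo ⊤ → ∃ Z, IsTypicalTable μ r₀ c₀ Z ∧
        (∀ Z', IsTypicalTable μ r₀ c₀ Z' → Z' = Z) ∧
        ConvergesTV (cornerLaw μ r₀ c₀) (geometricLaw (Z ⟨0, hm⟩ ⟨0, hn⟩))
          (atTopIntegral r₀ c₀) fastRate)) ∧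
    -- uniformly random doubly stochastic matrices
    ConvergesTV
      (fun k => (condLaw lebNonneg (fun _ : Fin k => 1) (fun _ : Fin k => 1)).map
        fun x => (k : ℝ) * corner x)
      (expMeasure 1) atTop fastRate := by
  refine ⟨fun m₀ n₀ hm hn μ _ r₀ c₀ α₀ β₀ δ hδ hMLE htame =>
    ⟨fun hμ m n hm' hn' => isMarginDisintegration_condLaw (hMLE.1 ⟨0, hm⟩ ⟨0, hn⟩) hμ hm' hn',
      fun h => h.convergesTV_intCount hm hn hδ hMLE htame,
      fun h => h.convergesTV_volume hm hn hδ hMLE htame, ?_, ?_, ?_, ?_⟩,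
    convergesTV_doublyStochastic⟩
  · rintro ⟨b, rfl⟩
    exact convergesTV_countUpTo b hm hn hδ hMLE htame
  · rintro rfl
    exact convergesTV_lebNonneg hm hn hδ hMLE htame
  · rintro rfl
    have : NeZero (countUpTo 1) := (htame ⟨0, hm⟩ ⟨0, hn⟩).neZero hδ
    refine ⟨_, hMLE.isTypicalTable.1, hMLE.isTypicalTable.2, ?_⟩
    rw [← tilt_countUpTo_one (hMLE.1 _ _)]
    exact convergesTV_countUpTo 1 hm hn hδ hMLE htame
  · rintro rfl
    have : NeZero (countUpTo ⊤) := (htame ⟨0, hm⟩ ⟨0, hn⟩).neZero hδ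
    refine ⟨_, hMLE.isTypicalTable.1, hMLE.isTypicalTable.2, ?_⟩
    rw [← tilt_countUpTo_top (hMLE.1 _ _)]
    exact convergesTV_countUpTo ⊤ hm hn hδ hMLE htame
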